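/- Let $X_1,X_2,\dots$ be i.i.d. $\mathbb Z$-valued random variables on a probability space with law $\mathbf P$, and $S_n=X_1+\dots+X_n$, $S_0=0$. Assume that $\mathbf E[X_1]=0$, that the walk is aperiodic (there are no integers $h\ge 2$ and $b$ with $\mathbf P(X_1\in b+h\mathbb Z)=1$), and that Cramér's condition holds: $\mathbf E[e^{tX_1}]<\infty$ for all $|t|<t_0$, for some $t_0>0$. **Model.** For $a\ge 0$, $\lambda>0$, $N\ge 1$, let $H_N=\sum_{n=1}^N \mathbf 1_{\{S_n=-\lfloor aN\rfloor\}}$ and $$\frac{d\mathbf P^a_{N,\lambda}}{d\mathbf P}=\frac{1}{Z^a_{N,\lambda}}\,\lambda^{H_N}\,\mathbf 1_{\{S_i\ge -\lfloor aN\rfloor,\ 1\le i\le N\}}\,\mathbf 1_{\{S_N=0\}},$$ where $Z^a_{N,\lambda}$ is the normalizing constant. Let $L_N$ and $R_N$ be the smallest and the largest $n\in\{0,\dots,N\}$ with $S_n=-\lfloor aN\rfloor$ (both $+\infty$ if there is none). Let $\mathrm f(\lambda,a)=\lim_{N\to\infty}\frac1N\log Z^a_{N,\lambda}$, $\mathrm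 f(\lambda)=\mathrm f(\lambda,0)$ and $\lambda_c(a)=\inf\{\lambda>0:\mathrm f(\lambda,a)>0\}\in[0,+\infty]$. **Rate functions.** For $t\ge0$ let $\Lambda_\pm(t)=\log\mathbf E[e^{\pm tX_1}]\in[0,+\infty]$, $t_0^\pm=\sup\{t\ge 0:\Lambda_\pm(t)<\infty\}$, $\mathrm I_\pm(x)=\sup_{t\ge0}\{tx-\Lambda_\pm(t)\}$, and let $\Lambda_\pm^{-1}(x)=\inf\{t\ge0:\Lambda_\pm(t)\ge x\}$ be the left-continuous inverse. Let $\lambda_\pm$ be the solution of $\mathrm f(\lambda_\pm)=\Lambda_\pm(t_0^\pm)$ if $t_0^\pm<\infty$ and $\Lambda_\pm(t_0^\pm)<\infty$, and $\lambda_\pm=+\infty$ otherwise. **Renewal law.** Let $f_n^+(0)=\mathbf P(S_1>0,\dots,S_{n-1}>0,S_n=0)$, $\kappa=\sum_{n\ge1}f_n^+(0)$ and $K(n)=f_n^+(0)/\kappa$. Let $m_\lambda$ and $\mathrm{Var}_\lambda$ be the mean and the variance of the law $n\mapsto \kappa\lambda K(n)e^{-n\mathrm f(\lambda)}$ on $\{1,2,\dots\}$.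 **Claim.** Let $a>0$ and $\lambda_c(a)\le\lambda<\min\{\lambda_+,\lambda_-\}$ (with $\lambda$ finite). Put $$u^*=\frac{a}{\Lambda_-'(\Lambda_-^{-1}(\mathrm f(\lambda)))},\qquad v^*=1-\frac{a}{\Lambda_+'(\Lambda_+^{-1}(\mathrm f(\lambda)))},$$ $$\sigma_1^2=\frac{(u^*)^3}{a^2\,\mathrm I_-''(a/u^*)},\qquad \sigma_2^2=\frac{(1-v^*)^3}{a^2\,\mathrm I_+''(a/(1-v^*))},\qquad \sigma_3^2=\frac{(v^*-u^*)\,\mathrm{Var}_\lambda}{m_\lambda^3}.$$ Then $0<u^*<v^*<1$, the constants $m_\lambda,\sigma_1,\sigma_2,\sigma_3$ are positive, the measure $\mathbf P^a_{N,\lambda}$ is well defined for $N$ large, and, as $N\to\infty$, the $\mathbf P^a_{N,\lambda}$-probability that there is no contact tends to $0$ and, in distribution under $\mathbf P^a_{N,\lambda}$, $$\Big(\frac{L_N-u^*N}{\sqrt N},\ \frac{R_N-v^*N}{\sqrt N},\ \frac{H_N-m_\lambda^{-1}(v^*-u^*)N}{\sqrt N}\Big)\longrightarrow(Z_1,Z_2,Z_3),$$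 where $(Z_1,Z_2,Z_3)$ is a Gaussian vector with density $$\frac{1}{(2\pi)^{3/2}\sigma_1\sigma_2\sigma_3}\,e^{-\frac12Q(z_1,z_2,z_3)},\qquad Q(z_1,z_2,z_3)=\frac{z_1^2}{\sigma_1^2}+\frac{z_2^2}{\sigma_2^2}+\frac{\big(z_3-m_\lambda^{-1}(z_2-z_1)\big)^2}{\sigma_3^2}.$$ In particular $Z_3$ is Gaussian (with positive variance), but it is not independent of $(Z_1,Z_2)$. Moreover, the following local version holds: for every $A>0$, as $N\to\infty$, $$\mathbf P^a_{N,\lambda}(L_N=\ell,R_N=r,H_N=k)=\frac{1+o(1)}{(2\pi N)^{3/2}\sigma_1\sigma_2\sigma_3}\exp\Big(-\tfrac12\,Q\Big(\tfrac{\ell-u^*N}{\sqrt N},\tfrac{r-v^*N}{\sqrt N},\tfrac{k-m_\lambda^{-1}(v^*-u^*)N}{\sqrt N}\Big)\Big),$$ with $o(1)$ uniform over integers $\ell,r,k\ge0$ such that $|\ell-u^*N|$, $|r-v^*N|$ and $|k-m_\lambda^{-1}(v^*-u^*)N|$ are all at most $A\sqrt N$. -/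

import Mathlib

open MeasureTheory ProbabilityTheory Filter Topology
open scoped ENNReal NNReal BoundedContinuousFunction

noncomputable section

namespace WettingWell

variable {Ω : Type*} [MeasurableSpace Ω]

/-! ### The random walk and its contacts with the bottom of the well -/

/-- The walk `S_n = X_1 + ⋯ + X_n`; the increment `X_{i+1}` of the mathematics is `X i`. -/
def walk (X : ℕ → Ω → ℤ) (n : ℕ) (ω : Ω) : ℤ := ∑ i ∈ Finset.range n, X i ω

/-- The depth `⌊a N⌋` of the well. -/
def depth (a : ℝ) (N : ℕ) : ℤ := ⌊a * (N : ℝ)⌋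

/-- The times `0 ≤ n ≤ N` at which the walk is at the bottom of the well. -/
def contactTimes (X : ℕ → Ω → ℤ) (a : ℝ) (N : ℕ) (ω : Ω) : Finset ℕ :=
  (Finset.range (N + 1)).filter fun n => walk X n ω = -depth a N

/-- The number of contacts `H_N`, over the times `1 ≤ n ≤ N`. -/
def numContacts (X : ℕ → Ω → ℤ) (a : ℝ) (N : ℕ) (ω : Ω) : ℕ :=
  ((Finset.Icc 1 N).filter fun n => walk X n ω = -depth a N).card

/-- The left-most contact `L_N`, equal to `⊤` if there is no contact. -/
def leftContact (X : ℕ → Ω → ℤ) (a : ℝ) (N : ℕ) (ω : Ω) : ℕ∞ :=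
  (contactTimes X a N ω).inf fun n => (n : ℕ∞)

open Classical in
/-- The right-most contact `R_N`, equal to `⊤` if there is no contact. -/
def rightContact (X : ℕ → Ω → ℤ) (a : ℝ) (N : ℕ) (ω : Ω) : ℕ∞ :=
  if (contactTimes X a N ω).Nonempty then (contactTimes X a N ω).sup fun n => (n : ℕ∞) else ⊤

/-! ### The Gibbs measure and the free energy -/

open Classical in
/-- The Gibbs weight `lam ^ H_N · 1{S_i ≥ -⌊aN⌋ for 1 ≤ i ≤ N} · 1{S_N = 0}`. -/
def weight (X : ℕ → Ω → ℤ) (a lam : ℝ) (N : ℕ) (ω : Ω) : ℝ≥0∞ :=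
  if (∀ i ∈ Finset.Icc 1 N, -depth a N ≤ walk X i ω) ∧ walk X N ω = 0
  then ENNReal.ofReal (lam ^ numContacts X a N ω) else 0

/-- The partition function `Z_{N,lam}^a`. -/
def partitionFn (P : Measure Ω) (X : ℕ → Ω → ℤ) (a lam : ℝ) (N : ℕ) : ℝ≥0∞ :=
  ∫⁻ ω, weight X a lam N ω ∂P

/-- The Gibbs measure `P_{N,lam}^a`. -/
def gibbs (P : Measure Ω) (X : ℕ → Ω → ℤ) (a lam : ℝ) (N : ℕ) : Measure Ω :=
  (partitionFn P X a lam N)⁻¹ • P.withDensity (weight X a lam N)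

/-- The free energy `f(lam, a) = lim N⁻¹ log Z_{N,lam}^a`. The free energy `f(lam)` of the standard
wetting model is `f(lam, 0)`. -/
def freeEnergy (P : Measure Ω) (X : ℕ → Ω → ℤ) (a lam : ℝ) : ℝ :=
  limUnder atTop fun N : ℕ => (1 / (N : ℝ)) * Real.log (partitionFn P X a lam N).toReal

/-- The critical point `lam_c(a) = inf {lam > 0 : f(lam, a) > 0}`, with `inf ∅ = +∞`. -/
def criticalPoint (P : Measure Ω) (X : ℕ → Ω → ℤ) (a : ℝ) : EReal :=
  sInf {x : EReal | ∃ lam : ℝ, x = (lam : EReal) ∧ 0 < lam ∧ 0 < freeEnergy P X a lam}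

/-! ### Log-moment generating functions and rate functions

The index `+` corresponds to `Y = X_1` and the index `-` to `Y = -X_1`. -/

/-- The increment `X_1`, as a real random variable. -/
def incPos (X : ℕ → Ω → ℤ) (ω : Ω) : ℝ := (X 0 ω : ℝ)

/-- The reflected increment `-X_1`, as a real random variable. -/
def incNeg (X : ℕ → Ω → ℤ) (ω : Ω) : ℝ := -(X 0 ω : ℝ)

open Classical in
/-- `Λ(t) = log E[exp (t Y)]`, with value `+∞` where the expectation is infinite. -/
def logMGF (P : Measure Ω) (Y : Ω → ℝ) (t : ℝ) : EReal :=
  if Integrable (fun ω => Real.exp (t * Y ω)) P then (cgf Y P t : EReal) else ⊤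

/-- The radius of convergence `t_0 = sup {t ≥ 0 : Λ(t) < +∞}`. -/
def radius (P : Measure Ω) (Y : Ω → ℝ) : EReal :=
  sSup {x : EReal | ∃ t : ℝ, x = (t : EReal) ∧ 0 ≤ t ∧ logMGF P Y t < ⊤}

/-- The left-continuous inverse of `Λ` on the half-line `t ≥ 0`. -/
def logMGFInv (P : Measure Ω) (Y : Ω → ℝ) (x : ℝ) : ℝ :=
  sInf {t : ℝ | 0 ≤ t ∧ (x : EReal) ≤ logMGF P Y t}

/-- The slope `Λ' ∘ Λ⁻¹`. -/
def slope (P : Measure Ω) (Y : Ω → ℝ) (x : ℝ) : ℝ :=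
  deriv (fun t => (logMGF P Y t).toReal) (logMGFInv P Y x)

/-- The rate function `I(x) = sup_{t ≥ 0} (t x - Λ(t))`. -/
def rateFn (P : Measure Ω) (Y : Ω → ℝ) (x : ℝ) : EReal :=
  ⨆ t : ℝ, ⨆ _ : 0 ≤ t, ((t * x : ℝ) : EReal) - logMGF P Y t

/-- The second derivative `I''(x)`. -/
def rateFnSecond (P : Measure Ω) (Y : Ω → ℝ) (x : ℝ) : ℝ :=
  deriv (deriv fun y => (rateFn P Y y).toReal) x

/-- The saturation point: the `lam` with `f(lam) = Λ(t_0)` if `t_0 ∈ (0, ∞)` and `Λ(t_0) < ∞`,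
and `+∞` (the infimum of the empty set) otherwise. -/
def saturationPoint (P : Measure Ω) (X : ℕ → Ω → ℤ) (Y : Ω → ℝ) : EReal :=
  sInf {x : EReal | ∃ lam : ℝ, x = (lam : EReal) ∧ 0 < lam ∧
    0 < radius P Y ∧ radius P Y < ⊤ ∧
    (freeEnergy P X 0 lam : EReal) = logMGF P Y (radius P Y).toReal}

/-! ### The renewal process of the localized standard wetting model -/

/-- `f_n^+(0) = P(S_1 > 0, …, S_{n-1} > 0, S_n = 0)`. -/
def excursionProb (P : Measure Ω) (X : ℕ → Ω → ℤ) (n : ℕ) : ℝ :=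
  P.real {ω | (∀ i ∈ Finset.Ico 1 n, 0 < walk X i ω) ∧ walk X n ω = 0}

/-- `κ = ∑_{n ≥ 1} f_n^+(0)`. -/
def kappa (P : Measure Ω) (X : ℕ → Ω → ℤ) : ℝ := ∑' n : ℕ, excursionProb P X (n + 1)

/-- `K(n) = f_n^+(0) / κ` for `n ≥ 1`. -/
def interArrival (P : Measure Ω) (X : ℕ → Ω → ℤ) (n : ℕ) : ℝ :=
  excursionProb P X n / kappa P X

/-- The tilted inter-arrival law `κ lam K(n) exp (-n f(lam))`, for `n ≥ 1`. -/
def tiltedLaw (P : Measure Ω) (X : ℕ → Ω → ℤ) (lam : ℝ) (n : ℕ) : ℝ :=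
  kappa P X * lam * interArrival P X n * Real.exp (-(n : ℝ) * freeEnergy P X 0 lam)

/-- The mean `m_lam` of the tilted law. -/
def tiltedMean (P : Measure Ω) (X : ℕ → Ω → ℤ) (lam : ℝ) : ℝ :=
  ∑' n : ℕ, ((n + 1 : ℕ) : ℝ) * tiltedLaw P X lam (n + 1)

/-- The variance of the tilted law. -/
def tiltedVar (P : Measure Ω) (X : ℕ → Ω → ℤ) (lam : ℝ) : ℝ :=
  ∑' n : ℕ, (((n + 1 : ℕ) : ℝ) - tiltedMean P X lam) ^ 2 * tiltedLaw P X lam (n + 1)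

/-! ### The constants of the limit theorem -/

/-- `u* = a / (Λ_-' ∘ Λ_-⁻¹)(f(lam))`. -/
def uStar (P : Measure Ω) (X : ℕ → Ω → ℤ) (a lam : ℝ) : ℝ :=
  a / slope P (incNeg X) (freeEnergy P X 0 lam)

/-- `v* = 1 - a / (Λ_+' ∘ Λ_+⁻¹)(f(lam))`. -/
def vStar (P : Measure Ω) (X : ℕ → Ω → ℤ) (a lam : ℝ) : ℝ :=
  1 - a / slope P (incPos X) (freeEnergy P X 0 lam)

/-- `σ_1`, with `σ_1² = (u*)³ / (a² I_-''(a / u*))`. -/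
def sigma1 (P : Measure Ω) (X : ℕ → Ω → ℤ) (a lam : ℝ) : ℝ :=
  Real.sqrt (uStar P X a lam ^ 3 /
    (a ^ 2 * rateFnSecond P (incNeg X) (a / uStar P X a lam)))

/-- `σ_2`, with `σ_2² = (1 - v*)³ / (a² I_+''(a / (1 - v*)))`. -/
def sigma2 (P : Measure Ω) (X : ℕ → Ω → ℤ) (a lam : ℝ) : ℝ :=
  Real.sqrt ((1 - vStar P X a lam) ^ 3 /
    (a ^ 2 * rateFnSecond P (incPos X) (a / (1 - vStar P X a lam))))

/-- `σ_3`, with `σ_3² = (v* - u*) Var / m_lam³`, where `Var` is the variance of the tilted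
inter-arrival law: by the renewal central limit theorem the number of renewals in an interval of
length `n` has variance equivalent to `n Var / m_lam³`. -/
def sigma3 (P : Measure Ω) (X : ℕ → Ω → ℤ) (a lam : ℝ) : ℝ :=
  Real.sqrt ((vStar P X a lam - uStar P X a lam) * tiltedVar P X lam / tiltedMean P X lam ^ 3)

/-- The quadratic form
`Q(z_1, z_2, z_3) = z_1²/σ_1² + z_2²/σ_2² + (z_3 - (z_2 - z_1)/m)²/σ_3²`. -/
def quadForm (s₁ s₂ s₃ m : ℝ) (z : ℝ × ℝ × ℝ) : ℝ :=
  z.1 ^ 2 / s₁ ^ 2 + z.2.1 ^ 2 / s₂ ^ 2 + (z.2.2 - m⁻¹ * (z.2.1 - z.1)) ^ 2 / s₃ ^ 2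

/-- The law on `ℝ³` with density `((2π)^{3/2} σ_1 σ_2 σ_3)⁻¹ exp (-Q/2)`. -/
def limitLaw (s₁ s₂ s₃ m : ℝ) : Measure (ℝ × ℝ × ℝ) :=
  volume.withDensity fun z => ENNReal.ofReal
    (1 / ((2 * Real.pi) ^ (3 / 2 : ℝ) * s₁ * s₂ * s₃) *
      Real.exp (-(1 / 2) * quadForm s₁ s₂ s₃ m z))

/-- Centering by `(u, v, c) N` and scaling by `√N`. -/
def rescale (u v c : ℝ) (N : ℕ) (l r k : ℕ) : ℝ × ℝ × ℝ :=
  (((l : ℝ) - u * N) / Real.sqrt N, ((r : ℝ) - v * N) / Real.sqrt N,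
    ((k : ℝ) - c * N) / Real.sqrt N)

/-- The centered and rescaled vector built from `(L_N, R_N, H_N)`. If there is no contact, the
infinite `L_N, R_N` are replaced by `0`; this has no effect on convergence in distribution, as soon
as the probability of having no contact tends to `0`. -/
def rescaledVector (X : ℕ → Ω → ℤ) (a u v c : ℝ) (N : ℕ) (ω : Ω) : ℝ × ℝ × ℝ :=
  rescale u v c N (leftContact X a N ω).toNat (rightContact X a N ω).toNat (numContacts X a N ω)

end WettingWell

end

noncomputable section

set_option linter.unusedSectionVars false

namespace WettingWell

/-! ### Paths with independent identically distributed steps -/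

/-! Put `d = ⌊aN⌋`. A path that contributes to the partition function and touches `-d` is cut at its
first contact `l` and its last contact `r`. This leaves three independent pieces: a first passage to
`-d` at time `l`, a bridge of length `r - l` above `-d` made of `k - 1` excursions, and a walk of
length `N - r` that stays strictly above `-d` and climbs by `d` (`isWell_iff`, `wellProb_eq`).

The free energy `F = f(λ)` is the positive root of `λ ∑ f_n^+(0) e^{-nF} = 1` (`Localized`,
`Localized.freeEnergy_eq`), so the weights `λ f_n^+(0) e^{-nF}` form a renewal law `Q` for the
middle piece. The outer pieces are tilted exponentially with parameters `tm`, `tp` such that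
`Λ_-(tm) = Λ_+(tp) = F`. A unit of time then contributes the same factor `e^F` in every piece, and
the weight of `(l, r, k)` is `λ exp(NF - (tm + tp) d)`, which does not depend on the triple, times a
product of three probabilities (`WellTilt.tripleWeight_eq`).

Under the tilted laws the outer walks have drift `Λ'(t) > 0` and variance `Λ''(t)`. The Fourier
local limit theorem `tendsto_sqrt_mul_prob`, and its version `PosDrift.tendsto_sqrt_mul_stayPos` for
walks kept positive, give a Gaussian factor for each piece (`Pieces.localLimit`). Since the `k - 1`
renewals must cover exactly the length `r - l`, the third factor is centered at `(z_2 - z_1) / m`;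
this is the origin of the correlation. The duality `I''(Λ'(t)) = 1 / Λ''(t)` turns the variances
into the stated constants.

Local limits become convergence in law by Riemann sums (`LocalLimit.tendsto_sum`), once no mass
escapes at scale `√N` (`Pieces.tight`). Tightness is Chebyshev's inequality: the events attached to
different passage times, or to different numbers of renewals, are disjoint, so their sums are single
probabilities. The same summation gives the asymptotics of the partition function.

The assumptions on `λ` enter as follows. Below the saturation points the roots `tm`, `tp` exist in
the interior of the domain (`Localized.exists_cgf_eq`). Above `λ_c(a)` the root `F` exists and `a
(tm + tp) ≤ F` (`WellTilt.mul_le_of_criticalPoint_le`), since otherwise the free energy in the well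
would still vanish at some larger parameter. Hence the prefactor is bounded below, even at `λ =
λ_c(a)`, whereas the weight of the paths without contact tends to zero. Strict convexity, in the
form `Λ(t) < t Λ'(t)`, converts the same inequality into `u* < v*` (`WellTilt.lt`). -/

/-- The law of a sequence of independent steps with law `ν`. -/
def pathMeasure (ν : Measure ℤ) : Measure (ℕ → ℤ) := Measure.infinitePi fun _ => ν

instance (ν : Measure ℤ) [IsProbabilityMeasure ν] : IsProbabilityMeasure (pathMeasure ν) := by
  unfold pathMeasure; infer_instance

/-- The partial sums of a sequence of steps. -/
def psum (n : ℕ) (x : ℕ → ℤ) : ℤ := ∑ i ∈ Finset.range n, x i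

/-- The sequence of steps after time `m`. -/
def shift (m : ℕ) (x : ℕ → ℤ) : ℕ → ℤ := fun i => x (m + i)

@[simp] lemma psum_zero (x : ℕ → ℤ) : psum 0 x = 0 := by simp [psum]

lemma psum_succ (n : ℕ) (x : ℕ → ℤ) : psum (n + 1) x = psum n x + x n := by
  simp [psum, Finset.sum_range_succ]

lemma psum_add (m n : ℕ) (x : ℕ → ℤ) : psum (m + n) x = psum m x + psum n (shift m x) := by
  simp [psum, shift, Finset.sum_range_add]

lemma psum_shift (m n : ℕ) (x : ℕ → ℤ) : psum n (shift m x) = psum (m + n) x - psum m x := by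
  rw [psum_add]; ring

lemma psum_congr {n i : ℕ} {x y : ℕ → ℤ} (h : ∀ j < n, x j = y j) (hi : i ≤ n) :
    psum i x = psum i y :=
  Finset.sum_congr rfl fun j hj => h j (lt_of_lt_of_le (Finset.mem_range.1 hj) hi)

/-- The event `A` only depends on the first `n` steps. -/
def FinDep (n : ℕ) (A : (ℕ → ℤ) → Prop) : Prop :=
  ∀ x y, (∀ j < n, x j = y j) → A x → A y

lemma FinDep.of_psum {n : ℕ} {A : (ℕ → ℤ) → Prop}
    (h : ∀ x y, (∀ j ≤ n, psum j x = psum j y) → A x → A y) : FinDep n A :=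
  fun x y hxy => h x y fun _ hj => psum_congr hxy hj

lemma FinDep.and {n : ℕ} {A B : (ℕ → ℤ) → Prop} (hA : FinDep n A) (hB : FinDep n B) :
    FinDep n fun x => A x ∧ B x :=
  fun x y hxy h => ⟨hA x y hxy h.1, hB x y hxy h.2⟩

lemma FinDep.mono {n m : ℕ} (hnm : n ≤ m) {A : (ℕ → ℤ) → Prop} (hA : FinDep n A) : FinDep m A :=
  fun x y hxy => hA x y fun j hj => hxy j (hj.trans_le hnm)

lemma FinDep.shift {n : ℕ} (m : ℕ) {A : (ℕ → ℤ) → Prop} (hA : FinDep n A) :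
    FinDep (m + n) fun x => A (shift m x) :=
  fun _ _ hxy => hA _ _ fun _ hj => hxy _ (by omega)

/-- The extension by zero of a finite family of steps. -/
def extendZero (I : Finset ℕ) (z : I → ℤ) (i : ℕ) : ℤ := if h : i ∈ I then z ⟨i, h⟩ else 0

lemma FinDep.setOf_eq {n : ℕ} {A : (ℕ → ℤ) → Prop} (hA : FinDep n A) :
    {x | A x} = (Finset.range n).restrict ⁻¹' {z | A (extendZero _ z)} := by
  ext x
  have h : ∀ j < n, x j = extendZero (Finset.range n) ((Finset.range n).restrict x) j := by
    intro j hj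
    simp [extendZero, hj]
  exact ⟨fun hx => hA _ _ h hx, fun hx => hA _ _ (fun j hj => (h j hj).symm) hx⟩

lemma FinDep.measurableSet {n : ℕ} {A : (ℕ → ℤ) → Prop} (hA : FinDep n A) :
    MeasurableSet {x | A x} := by
  rw [hA.setOf_eq]
  exact Finset.measurable_restrict _ (MeasurableSet.of_discrete)

@[fun_prop]
lemma measurable_psum (n : ℕ) : Measurable (psum n) := by
  unfold psum; fun_prop

section

variable (ν : Measure ℤ) [IsProbabilityMeasure ν]

lemma pathMeasure_finDep {n : ℕ} {A : (ℕ → ℤ) → Prop} (hA : FinDep n A) :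
    pathMeasure ν {x | A x} = Measure.pi (fun _ : Finset.range n => ν)
      {z | A (extendZero (Finset.range n) z)} := by
  rw [hA.setOf_eq, pathMeasure, ← Measure.map_apply (Finset.measurable_restrict _)
    MeasurableSet.of_discrete, Measure.infinitePi_map_restrict]

/-- An i.i.d. sequence is invariant under injective relabelling of its indices. The two relabellings
used are the shift by `m` and the reversal `flip` of the first `n` steps. -/
lemma pathMeasure_comp {n : ℕ} {A : (ℕ → ℤ) → Prop} (hA : FinDep n A) {f : ℕ → ℕ}
    (hf : f.Injective) :
    pathMeasure ν {x | A fun i => x (f i)} = pathMeasure ν {x | A x} := by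
  have h := Measure.map_infinitePi_infinitePi_of_inj (P := fun _ : ℕ => ν) hf
  unfold pathMeasure
  nth_rewrite 2 [← h]
  rw [Measure.map_apply (by fun_prop) hA.measurableSet]
  rfl

lemma pathMeasure_shift {n : ℕ} (m : ℕ) {A : (ℕ → ℤ) → Prop} (hA : FinDep n A) :
    pathMeasure ν {x | A (shift m x)} = pathMeasure ν {x | A x} :=
  pathMeasure_comp ν hA (f := fun i => m + i) (add_right_injective m)

lemma iIndepFun_pathMeasure : iIndepFun (fun (i : ℕ) (x : ℕ → ℤ) => x i) (pathMeasure ν) :=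
  iIndepFun_infinitePi (P := fun _ : ℕ => ν) (X := fun _ x => x) fun _ => measurable_id

lemma pathMeasure_map_eval (i : ℕ) : (pathMeasure ν).map (fun x => x i) = ν :=
  Measure.infinitePi_map_eval (fun _ : ℕ => ν) i

/-- The Markov property at a deterministic time. -/
lemma pathMeasure_and_shift {m n : ℕ} {A B : (ℕ → ℤ) → Prop} (hA : FinDep m A)
    (hB : FinDep n B) :
    pathMeasure ν {x | A x ∧ B (shift m x)} =
      pathMeasure ν {x | A x} * pathMeasure ν {x | B x} := by
  have hd : Disjoint (Finset.range m) (Finset.Ico m (m + n)) :=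
    Finset.disjoint_left.2 fun i hi hi' => by
      rw [Finset.mem_range] at hi; rw [Finset.mem_Ico] at hi'; omega
  have hi := (iIndepFun_pathMeasure ν).indepFun_finset _ _ hd fun i => measurable_pi_apply i
  have h1 := hi.measure_inter_preimage_eq_mul {z | A (extendZero _ z)}
    {z | B (shift m (extendZero _ z))} MeasurableSet.of_discrete MeasurableSet.of_discrete
  have hB' : {x : ℕ → ℤ | B (shift m x)} = (fun (a : ℕ → ℤ) (i : Finset.Ico m (m + n)) => a i) ⁻¹'
      {z | B (shift m (extendZero _ z))} := by
    ext x
    have h : ∀ j < n, shift m x j = shift m (extendZero (Finset.Ico m (m + n)) fun i => x i) j := by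
      intro j hj
      simp [extendZero, shift, hj]
    exact ⟨fun hx => hB _ _ h hx, fun hx => hB _ _ (fun j hj => (h j hj).symm) hx⟩
  rw [← pathMeasure_shift ν m hB, hB', Set.ofPred_and, hB']
  have hA' := hA.setOf_eq
  rw [hA']
  exact h1

lemma pathMeasureReal_and_shift {m n : ℕ} {A B : (ℕ → ℤ) → Prop} (hA : FinDep m A)
    (hB : FinDep n B) :
    (pathMeasure ν).real {x | A x ∧ B (shift m x)} =
      (pathMeasure ν).real {x | A x} * (pathMeasure ν).real {x | B x} := by
  simp only [measureReal_def, pathMeasure_and_shift ν hA hB, ENNReal.toReal_mul]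

/-- The reversal of the first `n` steps. -/
def flip (n i : ℕ) : ℕ := if i < n then n - 1 - i else i

lemma flip_injective (n : ℕ) : (flip n).Injective := by
  intro i j h
  unfold flip at h
  split_ifs at h <;> omega

lemma psum_flip {n i : ℕ} (hi : i ≤ n) (x : ℕ → ℤ) :
    psum i (fun j => x (flip n j)) = psum n x - psum (n - i) x := by
  induction i with
  | zero => simp
  | succ i ih =>
    rw [psum_succ, ih (by omega)]
    have h1 : n - i = n - (i + 1) + 1 := by omega
    have h2 : flip n i = n - (i + 1) := by unfold flip; split_ifs <;> omega
    rw [h1, psum_succ, h2]; ring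

/-- Exponential change of measure on events depending on finitely many steps. -/
lemma pathMeasure_tilt {ν' : Measure ℤ} [IsProbabilityMeasure ν'] {t L : ℝ}
    (h : ∀ y, ν' {y} = ENNReal.ofReal (Real.exp (t * y - L)) * ν {y}) {n : ℕ}
    {A : (ℕ → ℤ) → Prop} (hA : FinDep n A) {s : ℤ} (hs : ∀ x, A x → psum n x = s) :
    pathMeasure ν' {x | A x} =
      ENNReal.ofReal (Real.exp (t * s - n * L)) * pathMeasure ν {x | A x} := by
  -- The density of a product of tilted laws depends on the steps only through their sum. On `A`
  -- this sum equals `s`, so the density is constant there; the space of finite families of integers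
  -- being countable, measures can be compared atom by atom.
  have key : ∀ z : Finset.range n → ℤ, Measure.pi (fun _ : Finset.range n => ν') {z} =
      ENNReal.ofReal (Real.exp (t * psum n (extendZero _ z) - n * L)) *
        Measure.pi (fun _ : Finset.range n => ν) {z} := by
    intro z
    rw [Measure.pi_singleton, Measure.pi_singleton]
    simp_rw [h]
    rw [Finset.prod_mul_distrib, ← ENNReal.ofReal_prod_of_nonneg fun _ _ => (Real.exp_pos _).le,
      ← Real.exp_sum]
    congr 4
    rw [Finset.sum_sub_distrib, ← Finset.mul_sum]
    have : psum n (extendZero (Finset.range n) z) = ∑ i : Finset.range n, z i := by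
      rw [psum, ← Finset.sum_coe_sort]
      exact Finset.sum_congr rfl fun i _ => by simp [extendZero]
    rw [this]
    simp
  rw [pathMeasure_finDep ν' hA, pathMeasure_finDep ν hA,
    ← Measure.tsum_indicator_apply_singleton _ _ MeasurableSet.of_discrete,
    ← Measure.tsum_indicator_apply_singleton _ _ MeasurableSet.of_discrete,
    ← ENNReal.tsum_mul_left]
  refine tsum_congr fun z => ?_
  by_cases hz : A (extendZero _ z)
  · have hz' : z ∈ {z : Finset.range n → ℤ | A (extendZero _ z)} := hz
    rw [Set.indicator_of_mem hz', Set.indicator_of_mem hz', key, hs _ hz]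
  · have hz' : z ∉ {z : Finset.range n → ℤ | A (extendZero _ z)} := hz
    rw [Set.indicator_of_notMem hz', Set.indicator_of_notMem hz', mul_zero]

lemma pathMeasureReal_tilt {ν' : Measure ℤ} [IsProbabilityMeasure ν'] {t L : ℝ}
    (h : ∀ y, ν' {y} = ENNReal.ofReal (Real.exp (t * y - L)) * ν {y}) {n : ℕ}
    {A : (ℕ → ℤ) → Prop} (hA : FinDep n A) {s : ℤ} (hs : ∀ x, A x → psum n x = s) :
    (pathMeasure ν).real {x | A x} =
      Real.exp (n * L - t * s) * (pathMeasure ν').real {x | A x} := by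
  rw [measureReal_def, measureReal_def, pathMeasure_tilt ν h hA hs, ENNReal.toReal_mul,
    ENNReal.toReal_ofReal (Real.exp_pos _).le, ← mul_assoc, ← Real.exp_add]
  simp

/-- The law of the steps of the walk. -/
lemma map_steps_eq_pathMeasure {Ω : Type*} [MeasurableSpace Ω] {P : Measure Ω}
    [IsProbabilityMeasure P] {X : ℕ → Ω → ℤ} (hmeas : ∀ i, Measurable (X i))
    (hindep : iIndepFun X P) (hident : ∀ i, IdentDistrib (X i) (X 0) P P) :
    P.map (fun ω i => X i ω) = pathMeasure (P.map (X 0)) := by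
  rw [(iIndepFun_iff_map_fun_eq_infinitePi_map hmeas).1 hindep, pathMeasure]
  congr 1
  funext i
  exact (hident i).map_eq

/-- Descending to `-d` is ascending to `d` for the reflected steps, so that the piece before the
first contact is treated by the same results as the piece after the last one. -/
lemma pathMeasureReal_neg {n : ℕ} {A : (ℕ → ℤ) → Prop} (hA : FinDep n A) :
    (pathMeasure (ν.map Neg.neg)).real {x | A x} =
      (pathMeasure ν).real {x | A fun i => -x i} := by
  have h := Measure.infinitePi_map_pi (fun _ : ℕ => ν) (f := fun _ => (Neg.neg : ℤ → ℤ))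
    fun _ => measurable_neg
  rw [measureReal_def, pathMeasure, ← h, Measure.map_apply (by fun_prop) hA.measurableSet]
  rfl

end

lemma psum_neg (n : ℕ) (x : ℕ → ℤ) : psum n (fun i => -x i) = -psum n x := by
  simp [psum]

/-! ### The local limit theorem for lattice random walks -/

/-- The law `ν` is not carried by a coset of a proper subgroup of `ℤ`. -/
def Aperiodic (ν : Measure ℤ) : Prop := ∀ h : ℕ, 2 ≤ h → ∀ b : ℤ, ¬ ∀ᵐ x ∂ν, (h : ℤ) ∣ x - b

/-- The mean of a law on `ℤ`. -/
def mean (ν : Measure ℤ) : ℝ := ∫ y, (y : ℝ) ∂ν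

/-- The variance of a law on `ℤ`. -/
def vari (ν : Measure ℤ) : ℝ := Var[fun y : ℤ => (y : ℝ); ν]

/-- The centered Gaussian density with variance `v`. -/
def gaussDens (v z : ℝ) : ℝ := (Real.sqrt (2 * Real.pi * v))⁻¹ * Real.exp (-z ^ 2 / (2 * v))

/-- The characteristic function of a law on `ℤ`. -/
def chf (ν : Measure ℤ) (θ : ℝ) : ℂ := ∫ y, Complex.exp (θ * (y : ℝ) * Complex.I) ∂ν

lemma chf_eq_charFun (ν : Measure ℤ) (θ : ℝ) :
    chf ν θ = charFun (ν.map fun y : ℤ => (y : ℝ)) θ := by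
  rw [charFun_apply_real, integral_map (by fun_prop) (by fun_prop), chf]

lemma integral_exp_int (k : ℤ) :
    ∫ θ in (-Real.pi)..Real.pi, Complex.exp (θ * k * Complex.I) =
      if k = 0 then 2 * (Real.pi : ℂ) else 0 := by
  split_ifs with h
  · subst h; simp; ring
  · have hk : (k : ℂ) * Complex.I ≠ 0 := by simp [h]
    have : ∀ θ : ℝ, Complex.exp (θ * k * Complex.I) = Complex.exp (k * Complex.I * θ) := by
      intro θ; congr 1; ring
    simp_rw [this]
    rw [integral_exp_mul_complex hk]
    have h2 : Complex.exp (k * Complex.I * Real.pi) =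
        Complex.exp (k * Complex.I * ((-Real.pi : ℝ) : ℂ)) := by
      rw [Complex.exp_eq_exp_iff_exists_int]
      exact ⟨k, by push_cast; ring⟩
    rw [h2, sub_self, zero_div]

/-- Fourier inversion for an integer valued random variable. -/
lemma fourier_inversion {Ω : Type*} [MeasurableSpace Ω] (μ : Measure Ω) [IsFiniteMeasure μ]
    {S : Ω → ℤ} (hS : Measurable S) (x : ℤ) :
    ((2 * Real.pi * μ.real {ω | S ω = x} : ℝ) : ℂ) =
      ∫ θ in (-Real.pi)..Real.pi, Complex.exp (-(θ * x * Complex.I)) *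
        ∫ ω, Complex.exp (θ * (S ω : ℝ) * Complex.I) ∂μ := by
  have hπ : -Real.pi ≤ Real.pi := by linarith [Real.pi_pos]
  have h1 : ∀ θ : ℝ, Complex.exp (-(θ * x * Complex.I)) *
      ∫ ω, Complex.exp (θ * (S ω : ℝ) * Complex.I) ∂μ =
      ∫ ω, Complex.exp (θ * ((S ω - x : ℤ) : ℂ) * Complex.I) ∂μ := by
    intro θ
    rw [← integral_const_mul]
    congr 1; ext ω
    rw [← Complex.exp_add]; congr 1; push_cast; ring
  simp_rw [h1]
  rw [intervalIntegral.integral_of_le hπ, integral_integral_swap]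
  · have h2 : ∀ ω, ∫ θ in Set.Ioc (-Real.pi) Real.pi,
        Complex.exp (θ * ((S ω - x : ℤ) : ℂ) * Complex.I) =
        Set.indicator {ω | S ω = x} (fun _ => 2 * (Real.pi : ℂ)) ω := by
      intro ω
      rw [← intervalIntegral.integral_of_le hπ, integral_exp_int]
      by_cases h : S ω = x
      · have h' : ω ∈ {ω | S ω = x} := h
        rw [Set.indicator_of_mem h', if_pos (by omega)]
      · have h' : ω ∉ {ω | S ω = x} := h
        rw [Set.indicator_of_notMem h', if_neg (by omega)]
    simp_rw [h2]
    rw [integral_indicator (show MeasurableSet {ω | S ω = x} from hS (measurableSet_singleton x)),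
      integral_const]
    simp only [measureReal_restrict_apply_univ, Complex.real_smul]
    push_cast; ring
  · refine Integrable.mono' (g := fun _ => (1 : ℝ)) (integrable_const _) ?_ ?_
    · refine Measurable.aestronglyMeasurable ?_
      have : Measurable fun p : ℝ × Ω => ((S p.2 - x : ℤ) : ℂ) :=
        (measurable_from_top (f := fun k : ℤ => (k : ℂ))).comp
          ((hS.comp measurable_snd).sub_const x)
      unfold Function.uncurry
      fun_prop
    · refine ae_of_all _ fun p => ?_
      have : ((p.1 : ℂ) * ((S p.2 - x : ℤ) : ℂ) * Complex.I) =
        (((p.1 * (S p.2 - x : ℤ) : ℝ) : ℂ)) * Complex.I := by push_cast; ring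
      simp only [Function.uncurry]
      rw [this, Complex.norm_exp_ofReal_mul_I]

section

variable (ν : Measure ℤ) [IsProbabilityMeasure ν]

lemma integral_finDep_mul {n : ℕ} {F : (ℕ → ℤ) → ℂ} (hF : ∀ x y, (∀ j < n, x j = y j) → F x = F y)
    (G : ℤ → ℂ) :
    ∫ x, F x * G (x n) ∂pathMeasure ν = (∫ x, F x ∂pathMeasure ν) * ∫ y, G y ∂ν := by
  have hd : Disjoint (Finset.range n) {n} := by simp
  have hi := (iIndepFun_pathMeasure ν).indepFun_finset _ _ hd fun i => measurable_pi_apply i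
  have h2 := hi.comp (φ := fun z => F (extendZero _ z)) (ψ := fun z => G (extendZero _ z n))
    (Measurable.of_discrete) (Measurable.of_discrete)
  have e1 : ((fun z => F (extendZero (Finset.range n) z)) ∘
      fun (a : ℕ → ℤ) (i : Finset.range n) => a i) = F := by
    ext x
    exact hF _ _ fun j hj => by simp [extendZero, hj]
  have e2 : ((fun z => G (extendZero {n} z n)) ∘
      fun (a : ℕ → ℤ) (i : ({n} : Finset ℕ)) => a i) = fun x => G (x n) := by
    ext x
    simp [extendZero]
  rw [e1, e2] at h2
  have hFm : Measurable F := by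
    rw [← e1]
    exact Measurable.of_discrete.comp (measurable_pi_lambda _ fun i => measurable_pi_apply _)
  have hGm : Measurable fun x : ℕ → ℤ => G (x n) :=
    (Measurable.of_discrete (f := G)).comp (measurable_pi_apply n)
  rw [h2.integral_fun_mul_eq_mul_integral hFm.aestronglyMeasurable hGm.aestronglyMeasurable]
  congr 1
  conv_rhs => rw [← pathMeasure_map_eval ν n]
  rw [integral_map (measurable_pi_apply n).aemeasurable Measurable.of_discrete.aestronglyMeasurable]

/-- Only the first `M` steps feel the constraint `A`; the other steps are independent of it and
contribute powers of the characteristic function. This is what lets the local limit theorem carry an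
initial constraint. -/
lemma setIntegral_exp_psum {M : ℕ} {A : (ℕ → ℤ) → Prop} (hA : FinDep M A) (θ : ℝ) (n : ℕ) :
    ∫ x in {x | A x}, Complex.exp (θ * (psum (M + n) x : ℝ) * Complex.I) ∂pathMeasure ν =
      (∫ x in {x | A x}, Complex.exp (θ * (psum M x : ℝ) * Complex.I) ∂pathMeasure ν) *
        chf ν θ ^ n := by
  induction n with
  | zero => simp
  | succ n ih =>
    rw [pow_succ, ← mul_assoc, ← ih, ← integral_indicator hA.measurableSet,
      ← integral_indicator hA.measurableSet, chf]
    rw [← integral_finDep_mul ν (n := M + n)]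
    · congr 1; ext x
      by_cases hx : A x
      · have hx' : x ∈ {x | A x} := hx
        rw [Set.indicator_of_mem hx', Set.indicator_of_mem hx', ← Complex.exp_add, ← add_assoc,
          psum_succ]
        congr 1; push_cast; ring
      · have hx' : x ∉ {x | A x} := hx
        rw [Set.indicator_of_notMem hx', Set.indicator_of_notMem hx', zero_mul]
    · intro x y hxy
      by_cases hx : A x
      · have hx' : x ∈ {x | A x} := hx
        have hy' : y ∈ {x | A x} := hA.mono (Nat.le_add_right M n) x y hxy hx
        rw [Set.indicator_of_mem hx', Set.indicator_of_mem hy', psum_congr hxy le_rfl]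
      · have hx' : x ∉ {x | A x} := hx
        have hy' : y ∉ {x | A x} := fun hy =>
          hx (hA.mono (Nat.le_add_right M n) y x (fun j hj => (hxy j hj).symm) hy)
        rw [Set.indicator_of_notMem hx', Set.indicator_of_notMem hy']

lemma continuous_chf : Continuous (chf ν) := by
  have : IsProbabilityMeasure (ν.map fun y : ℤ => (y : ℝ)) :=
    Measure.isProbabilityMeasure_map (by fun_prop)
  rw [show chf ν = charFun (ν.map fun y : ℤ => (y : ℝ)) from funext (chf_eq_charFun ν)]
  exact continuous_charFun

lemma norm_chf_le_one (θ : ℝ) : ‖chf ν θ‖ ≤ 1 := by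
  have : IsProbabilityMeasure (ν.map fun y : ℤ => (y : ℝ)) :=
    Measure.isProbabilityMeasure_map (by fun_prop)
  rw [chf_eq_charFun]
  exact norm_charFun_le_one θ

variable {ν}

/-- Equality in the triangle inequality for the characteristic function of an aperiodic law. -/
lemma Aperiodic.norm_chf_lt_one (hν : Aperiodic ν) {θ : ℝ} (h0 : θ ≠ 0) (h1 : |θ| ≤ Real.pi) :
    ‖chf ν θ‖ < 1 := by
  refine lt_of_le_of_ne (norm_chf_le_one ν θ) fun heq => ?_
  obtain ⟨α, hα⟩ : ∃ α : ℝ, chf ν θ = Complex.exp (α * Complex.I) :=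
    ⟨(chf ν θ).arg, by
      have := Complex.norm_mul_exp_arg_mul_I (chf ν θ)
      rw [heq] at this; simpa using this.symm⟩
  have hexp : ∀ y : ℤ, (θ : ℂ) * ((y : ℝ) : ℂ) * Complex.I - α * Complex.I =
      ((θ * y - α : ℝ) : ℂ) * Complex.I := by
    intro y; push_cast; ring
  -- the real part of `exp (i (θ y - α))` has mean one
  have hint : Integrable (fun y : ℤ => Complex.exp (((θ * y - α : ℝ) : ℂ) * Complex.I)) ν := by
    refine Integrable.mono' (g := fun _ => (1 : ℝ)) (integrable_const _)
      Measurable.of_discrete.aestronglyMeasurable (ae_of_all _ fun y => ?_)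
    rw [Complex.norm_exp_ofReal_mul_I]
  have h2 : ∫ y : ℤ, Complex.exp (((θ * y - α : ℝ) : ℂ) * Complex.I) ∂ν = 1 := by
    have : ∀ y : ℤ, Complex.exp (((θ * y - α : ℝ) : ℂ) * Complex.I) =
        Complex.exp (θ * (y : ℝ) * Complex.I) * Complex.exp (-(α * Complex.I)) := by
      intro y; rw [← Complex.exp_add, ← hexp]; ring_nf
    simp_rw [this]
    rw [integral_mul_const, ← chf, hα, ← Complex.exp_add]
    simp
  have h3 : ∫ y : ℤ, (1 - Real.cos (θ * y - α)) ∂ν = 0 := by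
    have hre := integral_re hint
    rw [h2] at hre
    have : ∀ y : ℤ, RCLike.re (Complex.exp (((θ * y - α : ℝ) : ℂ) * Complex.I)) =
        Real.cos (θ * y - α) := fun y => Complex.exp_ofReal_mul_I_re _
    simp_rw [this] at hre
    rw [integral_sub (integrable_const _)]
    · rw [hre]; simp
    · have := hint.re
      simp_rw [‹∀ y : ℤ, RCLike.re _ = _›] at this
      exact this
  have hcos : Integrable (fun y : ℤ => 1 - Real.cos (θ * y - α)) ν := by
    refine Integrable.mono' (g := fun _ => (2 : ℝ)) (integrable_const _)
      Measurable.of_discrete.aestronglyMeasurable (ae_of_all _ fun y => ?_)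
    rw [Real.norm_eq_abs, abs_le]
    constructor <;> linarith [Real.neg_one_le_cos (θ * y - α), Real.cos_le_one (θ * y - α)]
  have h4 := (integral_eq_zero_iff_of_nonneg (μ := ν)
    (f := fun y : ℤ => 1 - Real.cos (θ * y - α)) (fun y => sub_nonneg.2 (Real.cos_le_one _)) hcos).1 h3
  have h5 : ∀ᵐ (y : ℤ) ∂ν, ∃ k : ℤ, (k : ℝ) * (2 * Real.pi) = θ * y - α := by
    filter_upwards [h4] with y hy
    have : Real.cos (θ * y - α) = 1 := by
      have h6 : 1 - Real.cos (θ * y - α) = 0 := hy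
      linarith
    exact (Real.cos_eq_one_iff _).1 this
  obtain ⟨b, kb, hb⟩ := h5.exists
  -- Equality in the triangle inequality makes `θ y - α` a multiple of `2π` almost surely, so the
  -- differences of values of the step lie in the subgroup of the `z` with `θ z ∈ 2πℤ`. It is
  -- cyclic, with generator `g`.
  let H : AddSubgroup ℤ :=
    { carrier := {z | ∃ k : ℤ, (k : ℝ) * (2 * Real.pi) = θ * z}
      zero_mem' := ⟨0, by simp⟩
      add_mem' := by
        rintro x y ⟨k, hk⟩ ⟨l, hl⟩
        exact ⟨k + l, by push_cast; rw [add_mul, hk, hl]; ring⟩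
      neg_mem' := by
        rintro x ⟨k, hk⟩
        exact ⟨-k, by push_cast; rw [neg_mul, hk]; ring⟩ }
  obtain ⟨g, hg⟩ := Int.subgroup_cyclic H
  have hmem : ∀ᵐ y ∂ν, y - b ∈ H := by
    filter_upwards [h5] with y ⟨k, hk⟩
    exact ⟨k - kb, by push_cast; rw [sub_mul, hk, hb]; ring⟩
  have hdvd : ∀ z ∈ H, g ∣ z := by
    intro z hz
    rw [hg, AddSubgroup.mem_closure_singleton] at hz
    obtain ⟨n, rfl⟩ := hz
    exact ⟨n, by simp [mul_comm]⟩
  -- If `1 ∈ H` then `θ` is a multiple of `2π`, which is impossible for `0 < |θ| ≤ π`.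
  have hg1 : g.natAbs ≠ 1 := by
    intro h
    have : (1 : ℤ) ∈ H := by
      rw [hg, AddSubgroup.mem_closure_singleton]
      rcases Int.natAbs_eq_iff.1 h with h | h
      · exact ⟨1, by simp [h]⟩
      · exact ⟨-1, by simp [h]⟩
    obtain ⟨k, hk⟩ := this
    have hπ := Real.pi_pos
    rw [Int.cast_one, mul_one] at hk
    have : |(k : ℝ)| < 1 := by
      rw [← hk, abs_mul, abs_of_pos (by positivity : (0 : ℝ) < 2 * Real.pi)] at h1
      nlinarith
    have hk0 : k = 0 := by
      have h' : |k| < 1 := by exact_mod_cast this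
      exact Int.abs_lt_one_iff.1 h'
    apply h0
    rw [← hk, hk0]; simp
  -- Either `g = 0`, the law is a point mass and already the modulus `2` contradicts aperiodicity,
  -- or `|g| ≥ 2` is itself a forbidden modulus.
  rcases Nat.lt_or_ge g.natAbs 2 with hlt | hge
  · have hg0 : g = 0 := by
      have : g.natAbs = 0 := by omega
      exact Int.natAbs_eq_zero.1 this
    refine hν 2 le_rfl b ?_
    filter_upwards [hmem] with y hy
    have := hdvd _ hy
    rw [hg0, zero_dvd_iff] at this
    rw [this]; exact dvd_zero _
  · refine hν g.natAbs hge b ?_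
    filter_upwards [hmem] with y hy
    exact Int.natAbs_dvd.2 (hdvd _ hy)

end

section

variable {ν : Measure ℤ} [IsProbabilityMeasure ν]

omit [IsProbabilityMeasure ν] in
/-- The centered and normalized characteristic function. -/
lemma chf_eq_standardized (hσ : 0 < vari ν) (θ : ℝ) :
    Complex.exp (-(θ * mean ν * Complex.I)) * chf ν θ =
      charFun (ν.map fun y : ℤ => ((y : ℝ) - mean ν) / Real.sqrt (vari ν))
        (Real.sqrt (vari ν) * θ) := by
  rw [charFun_apply_real, integral_map (by fun_prop) (by fun_prop), chf, ← integral_const_mul]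
  congr 1; ext y
  rw [← Complex.exp_add]
  have h : (Real.sqrt (vari ν) : ℂ) ≠ 0 := by
    exact_mod_cast (Real.sqrt_pos.2 hσ).ne'
  congr 1; push_cast; field_simp; ring

lemma mean_standardized (h2 : MemLp (fun y : ℤ => (y : ℝ)) 2 ν) :
    ν[fun y : ℤ => ((y : ℝ) - mean ν) / Real.sqrt (vari ν)] = 0 := by
  have hi : Integrable (fun y : ℤ => (y : ℝ)) ν := h2.integrable (by norm_num)
  rw [integral_div, integral_sub hi (integrable_const _)]
  simp [mean]

omit [IsProbabilityMeasure ν] in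
lemma variance_standardized (hσ : 0 < vari ν) :
    ν[(fun y : ℤ => ((y : ℝ) - mean ν) / Real.sqrt (vari ν)) ^ 2] = 1 := by
  simp only [Pi.pow_apply, div_pow]
  rw [integral_div, Real.sq_sqrt hσ.le]
  have : ∫ y : ℤ, ((y : ℝ) - mean ν) ^ 2 ∂ν = vari ν := by
    rw [vari, variance_eq_integral (by fun_prop)]; rfl
  rw [this, div_self hσ.ne']

omit [IsProbabilityMeasure ν] in
lemma norm_chf_eq_standardized (hσ : 0 < vari ν) (θ : ℝ) :
    ‖chf ν θ‖ = ‖charFun (ν.map fun y : ℤ => ((y : ℝ) - mean ν) / Real.sqrt (vari ν))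
        (Real.sqrt (vari ν) * θ)‖ := by
  rw [← chf_eq_standardized hσ, norm_mul]
  have : -((θ : ℂ) * mean ν * Complex.I) = ((-(θ * mean ν) : ℝ) : ℂ) * Complex.I := by
    push_cast; ring
  rw [this, Complex.norm_exp_ofReal_mul_I, one_mul]

/-- Second order Taylor expansion of the standardized characteristic function. An error of at most
`w² / 4`, half of the main term, leaves `1 - w² / 4 ≤ exp(-w² / 4)`; the restriction `w² < 2` makes
`1 - w² / 2` equal to its norm. -/
lemma exists_norm_chf_le_near_zero (hσ : 0 < vari ν)
    (h2 : MemLp (fun y : ℤ => (y : ℝ)) 2 ν) :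
    ∃ δ > 0, ∀ θ : ℝ, |θ| < δ → ‖chf ν θ‖ ≤ Real.exp (-(vari ν / 4) * θ ^ 2) := by
  have ht := taylor_charFun_two (X := fun y : ℤ => ((y : ℝ) - mean ν) / Real.sqrt (vari ν))
    (P := ν) (by fun_prop) (mean_standardized h2) (variance_standardized hσ)
  have ht' := ht.def (show (0 : ℝ) < 1 / 4 by norm_num)
  have hc : Tendsto (fun θ : ℝ => Real.sqrt (vari ν) * θ) (𝓝 0) (𝓝 0) := by
    have : Continuous fun θ : ℝ => Real.sqrt (vari ν) * θ := by fun_prop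
    simpa using this.tendsto 0
  have hs : ∀ᶠ θ : ℝ in 𝓝 0, (Real.sqrt (vari ν) * θ) ^ 2 < 2 := by
    have : Tendsto (fun θ : ℝ => (Real.sqrt (vari ν) * θ) ^ 2) (𝓝 0) (𝓝 (0 ^ 2)) := hc.pow 2
    exact this.eventually (gt_mem_nhds (by norm_num))
  obtain ⟨δ, hδ, h⟩ := Metric.eventually_nhds_iff.1 ((hc.eventually ht').and hs)
  refine ⟨δ, hδ, fun θ hθ => ?_⟩
  obtain ⟨h3, h4⟩ := h (show dist θ 0 < δ by simpa [Real.dist_eq] using hθ)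
  rw [norm_chf_eq_standardized hσ]
  set w := Real.sqrt (vari ν) * θ with hw
  set c := charFun (ν.map fun y : ℤ => ((y : ℝ) - mean ν) / Real.sqrt (vari ν)) w
  have hw2 : w ^ 2 = vari ν * θ ^ 2 := by rw [hw, mul_pow, Real.sq_sqrt hσ.le]
  have e1 : ‖c‖ ≤ ‖c - (1 - (w : ℂ) ^ 2 / 2)‖ + ‖1 - (w : ℂ) ^ 2 / 2‖ := by
    have := norm_add_le (c - (1 - (w : ℂ) ^ 2 / 2)) (1 - (w : ℂ) ^ 2 / 2)
    rwa [sub_add_cancel] at this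
  have e2 : ‖1 - (w : ℂ) ^ 2 / 2‖ = 1 - w ^ 2 / 2 := by
    rw [show (1 - (w : ℂ) ^ 2 / 2) = ((1 - w ^ 2 / 2 : ℝ) : ℂ) by push_cast; ring,
      Complex.norm_real, Real.norm_of_nonneg (by linarith)]
  have e3 : ‖w ^ 2‖ = w ^ 2 := Real.norm_of_nonneg (sq_nonneg _)
  rw [e3] at h3
  calc ‖c‖ ≤ 1 - w ^ 2 / 4 := by linarith
    _ ≤ Real.exp (-(vari ν / 4) * θ ^ 2) := by
      have := Real.add_one_le_exp (-(vari ν / 4) * θ ^ 2)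
      rw [hw2]; linarith

/-- Gaussian decay of the characteristic function of an aperiodic law on `[-π, π]`. -/
lemma exists_norm_chf_le (hν : Aperiodic ν) (hσ : 0 < vari ν)
    (h2 : MemLp (fun y : ℤ => (y : ℝ)) 2 ν) :
    ∃ c > 0, ∀ θ : ℝ, |θ| ≤ Real.pi → ‖chf ν θ‖ ≤ Real.exp (-c * θ ^ 2) := by
  obtain ⟨δ, hδ, h⟩ := exists_norm_chf_le_near_zero hσ h2
  set K : Set ℝ := Set.Icc (-Real.pi) Real.pi \ Metric.ball 0 δ
  have hK : IsCompact K := isCompact_Icc.diff Metric.isOpen_ball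
  obtain ⟨η, hη, hη'⟩ : ∃ η > 0, ∀ θ ∈ K, ‖chf ν θ‖ ≤ Real.exp (-η) := by
    rcases K.eq_empty_or_nonempty with he | hne
    · exact ⟨1, one_pos, fun θ hθ => by simp [he] at hθ⟩
    obtain ⟨θ₀, hθ₀, hmax⟩ := hK.exists_isMaxOn hne (continuous_chf ν).norm.continuousOn
    have hlt : ‖chf ν θ₀‖ < 1 := by
      refine hν.norm_chf_lt_one ?_ (abs_le.2 ⟨hθ₀.1.1, hθ₀.1.2⟩)
      rintro rfl
      exact hθ₀.2 (Metric.mem_ball_self hδ)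
    refine ⟨1 - ‖chf ν θ₀‖, by linarith, fun θ hθ => (hmax hθ).trans ?_⟩
    have := Real.add_one_le_exp (-(1 - ‖chf ν θ₀‖))
    linarith
  have hπ := Real.pi_pos
  -- Away from zero the bound is a constant `exp(-η)` by compactness; as `θ² ≤ π²`, it is at most
  -- `exp(-(η / π²) θ²)`.
  refine ⟨min (vari ν / 4) (η / Real.pi ^ 2), by positivity, fun θ hθ => ?_⟩
  by_cases hd : |θ| < δ
  · refine (h θ hd).trans (Real.exp_le_exp.2 ?_)
    have := min_le_left (vari ν / 4) (η / Real.pi ^ 2)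
    nlinarith [sq_nonneg θ]
  · refine (hη' θ ⟨⟨(abs_le.1 hθ).1, (abs_le.1 hθ).2⟩, by simpa using hd⟩).trans
      (Real.exp_le_exp.2 ?_)
    have h3 := min_le_right (vari ν / 4) (η / Real.pi ^ 2)
    have h4 : θ ^ 2 ≤ Real.pi ^ 2 := sq_le_sq' (abs_le.1 hθ).1 (abs_le.1 hθ).2
    have h5 : min (vari ν / 4) (η / Real.pi ^ 2) * θ ^ 2 ≤ η / Real.pi ^ 2 * Real.pi ^ 2 := by
      gcongr
    rw [div_mul_cancel₀ _ (by positivity)] at h5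
    linarith

/-- The local probabilities are of order at most `1 / √n`. -/
lemma exists_sqrt_mul_prob_le (hν : Aperiodic ν) (hσ : 0 < vari ν)
    (h2 : MemLp (fun y : ℤ => (y : ℝ)) 2 ν) :
    ∃ K > 0, ∀ (n : ℕ) (x : ℤ),
      Real.sqrt n * (pathMeasure ν).real {ω | psum n ω = x} ≤ K := by
  obtain ⟨c, hc, h⟩ := exists_norm_chf_le hν hσ h2
  refine ⟨(2 * Real.pi)⁻¹ * Real.sqrt (Real.pi / c), by positivity, fun n x => ?_⟩
  rcases Nat.eq_zero_or_pos n with rfl | hn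
  · simp; positivity
  have hn' : (0 : ℝ) < n := by exact_mod_cast hn
  have hπ : -Real.pi ≤ Real.pi := by linarith [Real.pi_pos]
  have hinv := fourier_inversion (pathMeasure ν) (measurable_psum n) x
  have hG : ∀ θ : ℝ, ∫ ω, Complex.exp (θ * (psum n ω : ℝ) * Complex.I) ∂pathMeasure ν =
      chf ν θ ^ n := by
    intro θ
    have := setIntegral_exp_psum ν (M := 0) (A := fun _ => True) (fun _ _ _ h => h) θ n
    simpa [Set.ofPred_true] using this
  simp_rw [hG] at hinv
  have hle : 2 * Real.pi * (pathMeasure ν).real {ω | psum n ω = x} ≤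
      ∫ θ in (-Real.pi)..Real.pi, Real.exp (-(c * n) * θ ^ 2) := by
    calc 2 * Real.pi * (pathMeasure ν).real {ω | psum n ω = x}
        = ‖((2 * Real.pi * (pathMeasure ν).real {ω | psum n ω = x} : ℝ) : ℂ)‖ := by
          rw [Complex.norm_real, Real.norm_of_nonneg (by positivity)]
      _ ≤ ∫ θ in (-Real.pi)..Real.pi, ‖Complex.exp (-(θ * x * Complex.I)) * chf ν θ ^ n‖ := by
          rw [hinv]
          exact intervalIntegral.norm_integral_le_integral_norm hπ
      _ ≤ _ := by
          refine intervalIntegral.integral_mono_on hπ ?_ ?_ fun θ hθ => ?_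
          · refine Continuous.intervalIntegrable ?_ _ _
            have := continuous_chf ν
            fun_prop
          · exact Continuous.intervalIntegrable (by fun_prop) _ _
          · have e : -((θ : ℂ) * x * Complex.I) = ((-(θ * x) : ℝ) : ℂ) * Complex.I := by
              push_cast; ring
            rw [norm_mul, e, Complex.norm_exp_ofReal_mul_I, one_mul, norm_pow]
            calc ‖chf ν θ‖ ^ n ≤ Real.exp (-c * θ ^ 2) ^ n := by
                  gcongr; exact h θ (abs_le.2 ⟨hθ.1, hθ.2⟩)
              _ = _ := by rw [← Real.exp_nat_mul]; congr 1; ring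
  have hle2 : ∫ θ in (-Real.pi)..Real.pi, Real.exp (-(c * n) * θ ^ 2) ≤
      Real.sqrt (Real.pi / (c * n)) := by
    rw [← integral_gaussian, intervalIntegral.integral_of_le hπ]
    exact setIntegral_le_integral (integrable_exp_neg_mul_sq (by positivity))
      (ae_of_all _ fun _ => (Real.exp_pos _).le)
  have h3 : Real.sqrt (Real.pi / (c * n)) = Real.sqrt (Real.pi / c) / Real.sqrt n := by
    rw [← div_div, Real.sqrt_div (by positivity)]
  have hs : 0 < Real.sqrt n := Real.sqrt_pos.2 hn'
  rw [h3] at hle2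
  have h4 := hle.trans hle2
  rw [le_div_iff₀ hs] at h4
  have hp := Real.pi_pos
  rw [inv_mul_eq_div, le_div_iff₀ (by positivity)]
  linarith

lemma tendsto_chf_pow (hσ : 0 < vari ν) (h2 : MemLp (fun y : ℤ => (y : ℝ)) 2 ν) (s : ℝ) :
    Tendsto (fun n : ℕ => (Complex.exp (-((s / Real.sqrt n : ℝ) * mean ν * Complex.I)) *
      chf ν (s / Real.sqrt n)) ^ n) atTop (𝓝 (Real.exp (-(vari ν) * s ^ 2 / 2) : ℂ)) := by
  have h := tendsto_charFun_inv_sqrt_mul_pow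
    (X := fun y : ℤ => ((y : ℝ) - mean ν) / Real.sqrt (vari ν))
    (P := ν) (by fun_prop) (mean_standardized h2) (variance_standardized hσ) (Real.sqrt (vari ν) * s)
  have e : -((Real.sqrt (vari ν) * s : ℝ) : ℂ) ^ 2 / 2 = ((-(vari ν) * s ^ 2 / 2 : ℝ) : ℂ) := by
    rw [← Complex.ofReal_pow, mul_pow, Real.sq_sqrt hσ.le]; push_cast; ring
  rw [e, ← Complex.ofReal_exp] at h
  refine h.congr fun n => ?_
  rw [chf_eq_standardized hσ]
  congr 2; ring

lemma integral_gaussDens_fourier {v : ℝ} (hv : 0 < v) (z : ℝ) :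
    ∫ s : ℝ, Complex.exp (-(s * z * Complex.I)) * (Real.exp (-v * s ^ 2 / 2) : ℂ) =
      ((2 * Real.pi * gaussDens v z : ℝ) : ℂ) := by
  have h := fourierIntegral_gaussian (b := (v / 2 : ℝ)) (by simpa using hv) (-z : ℂ)
  have e : ∀ s : ℝ, Complex.exp (-(s * z * Complex.I)) * (Real.exp (-v * s ^ 2 / 2) : ℂ) =
      Complex.exp (Complex.I * (-z : ℂ) * s) * Complex.exp (-((v / 2 : ℝ) : ℂ) * (s : ℂ) ^ 2) := by
    intro s
    rw [Complex.ofReal_exp]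
    congr 2 <;> push_cast <;> ring
  simp_rw [e]
  rw [h]
  have e2 : -(-(z : ℂ)) ^ 2 / (4 * ((v / 2 : ℝ) : ℂ)) = ((-z ^ 2 / (2 * v) : ℝ) : ℂ) := by
    push_cast; ring
  have e3 : ((Real.pi : ℂ) / ((v / 2 : ℝ) : ℂ)) ^ (1 / 2 : ℂ) =
      ((Real.sqrt (Real.pi / (v / 2)) : ℝ) : ℂ) := by
    rw [Real.sqrt_eq_rpow, Complex.ofReal_cpow (by positivity)]
    push_cast; rfl
  rw [e2, e3, ← Complex.ofReal_exp, ← Complex.ofReal_mul]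
  congr 1
  have hp := Real.pi_pos
  have e4 : Real.sqrt (Real.pi / (v / 2)) = 2 * Real.pi * (Real.sqrt (2 * Real.pi * v))⁻¹ := by
    rw [Real.sqrt_eq_iff_mul_self_eq (by positivity) (by positivity)]
    have h5 : (Real.sqrt (2 * Real.pi * v))⁻¹ * (Real.sqrt (2 * Real.pi * v))⁻¹ =
        (2 * Real.pi * v)⁻¹ := by
      rw [← mul_inv, Real.mul_self_sqrt (by positivity)]
    symm
    calc _ = 4 * Real.pi ^ 2 * ((Real.sqrt (2 * Real.pi * v))⁻¹ * (Real.sqrt (2 * Real.pi * v))⁻¹) := by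
          ring
      _ = _ := by rw [h5]; field_simp; norm_num
  rw [e4, gaussDens]; ring

lemma tendsto_setIntegral_exp_psum {M : ℕ} {A : (ℕ → ℤ) → Prop} :
    Tendsto (fun θ : ℝ => ∫ x in {x | A x}, Complex.exp (θ * (psum M x : ℝ) * Complex.I)
      ∂pathMeasure ν) (𝓝 0) (𝓝 ((pathMeasure ν).real {x | A x} : ℂ)) := by
  have h : ∀ θ : ℝ, ∫ x in {x | A x}, Complex.exp (θ * (psum M x : ℝ) * Complex.I)
      ∂pathMeasure ν = charFun (((pathMeasure ν).restrict {x | A x}).map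
        fun x => (psum M x : ℝ)) θ := by
    intro θ
    rw [charFun_apply_real, integral_map (by fun_prop) (by fun_prop)]
  have : IsFiniteMeasure (((pathMeasure ν).restrict {x | A x}).map fun x => (psum M x : ℝ)) :=
    Measure.isFiniteMeasure_map _ _
  simp_rw [h]
  have hc := (continuous_charFun (μ := ((pathMeasure ν).restrict {x | A x}).map
    fun x => (psum M x : ℝ))).tendsto 0
  rw [charFun_zero] at hc
  rw [map_measureReal_apply (by fun_prop) MeasurableSet.univ] at hc
  simpa using hc

/-- **Local limit theorem**, along arbitrary sequences and with a constraint on finitely many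
initial steps. -/
theorem tendsto_sqrt_mul_prob (hν : Aperiodic ν) (hσ : 0 < vari ν)
    (h2 : MemLp (fun y : ℤ => (y : ℝ)) 2 ν) {M : ℕ} {A : (ℕ → ℤ) → Prop} (hA : FinDep M A)
    {ι : Type*} {l : Filter ι} [l.IsCountablyGenerated] {n : ι → ℕ} (hn : Tendsto n l atTop)
    {x : ι → ℤ} {z : ℝ}
    (hx : Tendsto (fun i => ((x i : ℝ) - n i * mean ν) / Real.sqrt (n i)) l (𝓝 z)) :
    Tendsto (fun i => Real.sqrt (n i) * (pathMeasure ν).real {ω | A ω ∧ psum (n i) ω = x i}) l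
      (𝓝 ((pathMeasure ν).real {ω | A ω} * gaussDens (vari ν) z)) := by
  obtain ⟨c, hc, hdec⟩ := exists_norm_chf_le hν hσ h2
  have hp := Real.pi_pos
  set μA := (pathMeasure ν).restrict {ω | A ω} with hμA
  set ψ : ℝ → ℂ := fun θ => ∫ x in {x | A x}, Complex.exp (θ * (psum M x : ℝ) * Complex.I)
    ∂pathMeasure ν with hψ
  have hψ1 : ∀ θ, ‖ψ θ‖ ≤ 1 := by
    intro θ
    refine (norm_integral_le_integral_norm _).trans ?_
    have : ∀ x : ℕ → ℤ, ‖Complex.exp (θ * (psum M x : ℝ) * Complex.I)‖ = 1 := by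
      intro x
      rw [← Complex.ofReal_mul, Complex.norm_exp_ofReal_mul_I]
    simp_rw [this]
    simp only [integral_const, smul_eq_mul, mul_one, measureReal_restrict_apply_univ]
    exact measureReal_le_one
  set φ : ℝ → ℂ := fun θ => Complex.exp (-(θ * mean ν * Complex.I)) * chf ν θ with hφ
  have hφn : ∀ θ, ‖φ θ‖ = ‖chf ν θ‖ := by
    intro θ
    rw [hφ]
    simp only [norm_mul]
    rw [show -((θ : ℂ) * mean ν * Complex.I) = ((-(θ * mean ν) : ℝ) : ℂ) * Complex.I by
      push_cast; ring, Complex.norm_exp_ofReal_mul_I, one_mul]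
  have hφc : Continuous φ := by
    have := continuous_chf ν
    rw [hφ]; fun_prop
  have hφ0 : φ 0 = 1 := by
    simp [hφ, chf]
  -- the rescaled integrand
  set F : ι → ℝ → ℂ := fun i s => Set.indicator
    (Set.Ioc (-(Real.pi * Real.sqrt (n i))) (Real.pi * Real.sqrt (n i)))
    (fun s => Complex.exp (-(s * (((x i : ℝ) - n i * mean ν) / Real.sqrt (n i) : ℝ) * Complex.I)) *
      (ψ (s / Real.sqrt (n i)) * Complex.exp (-((s / Real.sqrt (n i) : ℝ) * (M * mean ν : ℝ) *
        Complex.I)) * φ (s / Real.sqrt (n i)) ^ (n i - M))) s with hF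
  have hnat : Tendsto (fun i => (n i : ℝ)) l atTop := tendsto_natCast_atTop_atTop.comp hn
  have hsq : Tendsto (fun i => Real.sqrt (n i)) l atTop := Real.tendsto_sqrt_atTop.comp hnat
  have hid : ∀ i, 1 ≤ n i → M ≤ n i →
      ((2 * Real.pi * (Real.sqrt (n i) * (pathMeasure ν).real {ω | A ω ∧ psum (n i) ω = x i}) : ℝ)
        : ℂ) = ∫ s, F i s := by
    intro i h1 hM
    have hs : 0 < Real.sqrt (n i) := Real.sqrt_pos.2 (by exact_mod_cast h1)
    have hinv := fourier_inversion μA (measurable_psum (n i)) (x i)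
    have hreal : μA.real {ω | psum (n i) ω = x i} =
        (pathMeasure ν).real {ω | A ω ∧ psum (n i) ω = x i} := by
      rw [hμA, measureReal_restrict_apply (show MeasurableSet {ω | psum (n i) ω = x i} from
        measurable_psum _ (measurableSet_singleton _))]
      congr 1; ext ω; exact and_comm
    have hG : ∀ θ : ℝ, ∫ ω, Complex.exp (θ * (psum (n i) ω : ℝ) * Complex.I) ∂μA =
        ψ θ * chf ν θ ^ (n i - M) := by
      intro θ
      have := setIntegral_exp_psum ν hA θ (n i - M)
      rwa [Nat.add_sub_cancel' hM] at this
    simp_rw [hG, hreal] at hinv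
    have hsub := intervalIntegral.integral_comp_div (a := -(Real.pi * Real.sqrt (n i)))
      (b := Real.pi * Real.sqrt (n i)) (fun θ : ℝ => Complex.exp (-(θ * x i * Complex.I)) *
        (ψ θ * chf ν θ ^ (n i - M))) hs.ne'
    rw [neg_div, mul_div_cancel_right₀ _ hs.ne', ← hinv] at hsub
    rw [hF, integral_indicator measurableSet_Ioc, ← intervalIntegral.integral_of_le (by nlinarith)]
    have e1 : ((2 * Real.pi * (Real.sqrt (n i) *
        (pathMeasure ν).real {ω | A ω ∧ psum (n i) ω = x i}) : ℝ) : ℂ) =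
        Real.sqrt (n i) • ((2 * Real.pi * (pathMeasure ν).real
          {ω | A ω ∧ psum (n i) ω = x i} : ℝ) : ℂ) := by
      rw [Complex.real_smul]; push_cast; ring
    rw [e1, ← hsub]
    refine intervalIntegral.integral_congr fun s _ => ?_
    simp only [hφ, mul_pow]
    rw [← Complex.exp_nat_mul]
    have e2 : Complex.exp (-(((s / Real.sqrt (n i) : ℝ) : ℂ) * x i * Complex.I)) =
        Complex.exp (-(s * (((x i : ℝ) - n i * mean ν) / Real.sqrt (n i) : ℝ) * Complex.I)) *
        (Complex.exp (-((s / Real.sqrt (n i) : ℝ) * (M * mean ν : ℝ) * Complex.I)) *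
          Complex.exp (((n i - M : ℕ) : ℂ) *
            (-(((s / Real.sqrt (n i) : ℝ) : ℂ) * mean ν * Complex.I)))) := by
      rw [← Complex.exp_add, ← Complex.exp_add]
      congr 1
      push_cast [Nat.cast_sub hM]
      ring
    rw [e2]; ring
  have hlim : Tendsto (fun i => ∫ s, F i s) l (𝓝 (∫ s : ℝ, Complex.exp (-(s * z * Complex.I)) *
      (((pathMeasure ν).real {ω | A ω} : ℂ) * (Real.exp (-(vari ν) * s ^ 2 / 2) : ℂ)))) := by
    refine tendsto_integral_filter_of_dominated_convergence
      (fun s => Real.exp (-(c / 2) * s ^ 2)) ?_ ?_ ?_ ?_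
    · refine Eventually.of_forall fun i => ?_
      refine Measurable.aestronglyMeasurable (Measurable.indicator ?_ measurableSet_Ioc)
      have hψm : Measurable ψ := by
        have : StronglyMeasurable ψ := by
          refine StronglyMeasurable.integral_prod_right (f := fun (θ : ℝ) (x : ℕ → ℤ) =>
            Complex.exp (θ * (psum M x : ℝ) * Complex.I)) ?_
          refine Measurable.stronglyMeasurable ?_
          have : Measurable fun p : ℝ × (ℕ → ℤ) => ((psum M p.2 : ℝ)) := by fun_prop
          unfold Function.uncurry
          fun_prop
        exact this.measurable
      have hφm := hφc.measurable
      fun_prop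
    -- For `n ≥ 2M` the exponent `n - M` is at least `n / 2`, so halving the constant `c` gives a
    -- Gaussian dominating function independent of `n`.
    · filter_upwards [hn.eventually_ge_atTop (2 * M), hn.eventually_ge_atTop 1] with i hi h1
      refine ae_of_all _ fun s => ?_
      rw [hF]
      simp only
      by_cases hs : s ∈ Set.Ioc (-(Real.pi * Real.sqrt (n i))) (Real.pi * Real.sqrt (n i))
      · rw [Set.indicator_of_mem hs]
        have hn0 : (0 : ℝ) < n i := by exact_mod_cast h1
        have hs0 : 0 < Real.sqrt (n i) := Real.sqrt_pos.2 hn0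
        have hθ : |s / Real.sqrt (n i)| ≤ Real.pi := by
          rw [abs_div, abs_of_pos hs0, div_le_iff₀ hs0]
          exact abs_le.2 ⟨hs.1.le, hs.2⟩
        rw [norm_mul, norm_mul, norm_mul, norm_pow]
        rw [show -((s : ℂ) * (((x i : ℝ) - n i * mean ν) / Real.sqrt (n i) : ℝ) * Complex.I) =
          ((-(s * (((x i : ℝ) - n i * mean ν) / Real.sqrt (n i))) : ℝ) : ℂ) * Complex.I by
            push_cast; ring, Complex.norm_exp_ofReal_mul_I]
        rw [show -(((s / Real.sqrt (n i) : ℝ) : ℂ) * (M * mean ν : ℝ) * Complex.I) =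
          ((-((s / Real.sqrt (n i)) * (M * mean ν)) : ℝ) : ℂ) * Complex.I by
            push_cast; ring, Complex.norm_exp_ofReal_mul_I, one_mul, mul_one, hφn]
        calc ‖ψ (s / Real.sqrt (n i))‖ * ‖chf ν (s / Real.sqrt (n i))‖ ^ (n i - M)
            ≤ 1 * Real.exp (-c * (s / Real.sqrt (n i)) ^ 2) ^ (n i - M) := by
              gcongr
              · exact hψ1 _
              · exact hdec _ hθ
          _ = Real.exp (-(c * (s ^ 2 * ((n i - M : ℕ) / n i)))) := by
              rw [one_mul, ← Real.exp_nat_mul]; congr 1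
              rw [div_pow, Real.sq_sqrt hn0.le]; ring
          _ ≤ Real.exp (-(c / 2) * s ^ 2) := by
              refine Real.exp_le_exp.2 ?_
              have h3 : (1 : ℝ) / 2 ≤ ((n i - M : ℕ) : ℝ) / n i := by
                rw [le_div_iff₀ hn0, Nat.cast_sub (by omega)]
                have : ((2 * M : ℕ) : ℝ) ≤ n i := by exact_mod_cast hi
                push_cast at this
                linarith
              have h4 : s ^ 2 * (1 / 2) ≤ s ^ 2 * (((n i - M : ℕ) : ℝ) / n i) := by gcongr
              nlinarith
      · rw [Set.indicator_of_notMem hs, norm_zero]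
        positivity
    · exact integrable_exp_neg_mul_sq (by positivity)
    · refine ae_of_all _ fun s => ?_
      have hs0 : Tendsto (fun i => s / Real.sqrt (n i)) l (𝓝 0) := hsq.const_div_atTop s
      have t1 : Tendsto (fun i => Complex.exp (-(s * (((x i : ℝ) - n i * mean ν) /
          Real.sqrt (n i) : ℝ) * Complex.I))) l (𝓝 (Complex.exp (-(s * z * Complex.I)))) := by
        have : Continuous fun w : ℝ => Complex.exp (-(s * w * Complex.I)) := by fun_prop
        exact (this.tendsto z).comp hx
      have t2 : Tendsto (fun i => ψ (s / Real.sqrt (n i))) l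
          (𝓝 ((pathMeasure ν).real {x | A x} : ℂ)) := tendsto_setIntegral_exp_psum.comp hs0
      have t3 : Tendsto (fun i => Complex.exp (-((s / Real.sqrt (n i) : ℝ) * (M * mean ν : ℝ) *
          Complex.I))) l (𝓝 1) := by
        have : Continuous fun w : ℝ => Complex.exp (-(w * (M * mean ν : ℝ) * Complex.I)) := by
          fun_prop
        have h := (this.tendsto 0).comp hs0
        rw [show Complex.exp (-(((0 : ℝ) : ℂ) * (M * mean ν : ℝ) * Complex.I)) = 1 by simp] at h
        exact h
      have t4 : Tendsto (fun i => φ (s / Real.sqrt (n i)) ^ M) l (𝓝 1) := by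
        have h := ((hφc.tendsto 0).comp hs0).pow M
        simpa [hφ0] using h
      have t5 : Tendsto (fun i => φ (s / Real.sqrt (n i)) ^ (n i)) l
          (𝓝 (Real.exp (-(vari ν) * s ^ 2 / 2) : ℂ)) := (tendsto_chf_pow hσ h2 s).comp hn
      -- The power `n - M` is obtained by dividing the power `n` by the power `M`, which tends to
      -- `1` because `M` is fixed.
      have t6 : Tendsto (fun i => φ (s / Real.sqrt (n i)) ^ (n i - M)) l
          (𝓝 (Real.exp (-(vari ν) * s ^ 2 / 2) : ℂ)) := by
        have h := t5.div t4 one_ne_zero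
        rw [div_one] at h
        refine h.congr' ?_
        filter_upwards [t4.eventually_ne one_ne_zero, hn.eventually_ge_atTop M] with i h0 hM
        simp only [Pi.div_apply]
        rw [div_eq_iff h0, ← pow_add, Nat.sub_add_cancel hM]
      have h := t1.mul ((t2.mul t3).mul t6)
      rw [mul_one] at h
      refine h.congr' ?_
      have hbig : Tendsto (fun i => Real.pi * Real.sqrt (n i)) l atTop :=
        hsq.const_mul_atTop hp
      filter_upwards [hbig.eventually_gt_atTop |s|] with i hi
      have hs : s ∈ Set.Ioc (-(Real.pi * Real.sqrt (n i))) (Real.pi * Real.sqrt (n i)) :=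
        ⟨(abs_lt.1 hi).1, (abs_lt.1 hi).2.le⟩
      rw [hF]
      simp only
      rw [Set.indicator_of_mem hs]
  have e : ∫ s : ℝ, Complex.exp (-(s * z * Complex.I)) *
      (((pathMeasure ν).real {ω | A ω} : ℂ) * (Real.exp (-(vari ν) * s ^ 2 / 2) : ℂ)) =
      ((2 * Real.pi * ((pathMeasure ν).real {ω | A ω} * gaussDens (vari ν) z) : ℝ) : ℂ) := by
    have : ∀ s : ℝ, Complex.exp (-(s * z * Complex.I)) *
      (((pathMeasure ν).real {ω | A ω} : ℂ) * (Real.exp (-(vari ν) * s ^ 2 / 2) : ℂ)) =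
      ((pathMeasure ν).real {ω | A ω} : ℂ) * (Complex.exp (-(s * z * Complex.I)) *
        (Real.exp (-(vari ν) * s ^ 2 / 2) : ℂ)) := fun s => by ring
    simp_rw [this]
    rw [integral_const_mul, integral_gaussDens_fourier hσ]
    push_cast; ring
  rw [e] at hlim
  have hlim' : Tendsto (fun i => ((2 * Real.pi * (Real.sqrt (n i) * (pathMeasure ν).real
      {ω | A ω ∧ psum (n i) ω = x i}) : ℝ) : ℂ)) l
      (𝓝 ((2 * Real.pi * ((pathMeasure ν).real {ω | A ω} * gaussDens (vari ν) z) : ℝ) : ℂ)) := by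
    refine hlim.congr' ?_
    filter_upwards [hn.eventually_ge_atTop 1, hn.eventually_ge_atTop M] with i h1 h3
    exact (hid i h1 h3).symm
  have h3 := (Complex.continuous_re.tendsto _).comp hlim'
  simp only [Function.comp_def, Complex.ofReal_re] at h3
  have h4 := h3.const_mul (2 * Real.pi)⁻¹
  have hp' : 2 * Real.pi ≠ 0 := by positivity
  simpa only [inv_mul_cancel_left₀ hp'] using h4

end

/-! ### Walks with positive drift: staying positive and first passage -/

section

variable (ν : Measure ℤ) [IsProbabilityMeasure ν]

lemma mgf_eval (t : ℝ) (i : ℕ) :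
    mgf (fun x : ℕ → ℤ => (x i : ℝ)) (pathMeasure ν) t = mgf (fun y : ℤ => (y : ℝ)) ν t := by
  conv_rhs => rw [← pathMeasure_map_eval ν i]
  have hm : AEMeasurable (fun x : ℕ → ℤ => x i) (pathMeasure ν) :=
    (measurable_pi_apply i).aemeasurable
  rw [mgf_map hm (by fun_prop)]
  rfl

lemma iIndepFun_cast : iIndepFun (fun (i : ℕ) (x : ℕ → ℤ) => (x i : ℝ)) (pathMeasure ν) :=
  (iIndepFun_pathMeasure ν).comp (fun _ (y : ℤ) => (y : ℝ)) fun _ => Measurable.of_discrete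

lemma measurable_eval_cast (i : ℕ) : Measurable fun x : ℕ → ℤ => (x i : ℝ) :=
  (Measurable.of_discrete (f := fun y : ℤ => (y : ℝ))).comp (measurable_pi_apply i)

lemma cast_psum_eq (n : ℕ) : (fun x : ℕ → ℤ => (psum n x : ℝ)) =
    ∑ i ∈ Finset.range n, fun x : ℕ → ℤ => (x i : ℝ) := by
  ext x; simp [psum]

lemma mgf_psum (t : ℝ) (n : ℕ) :
    mgf (fun x => (psum n x : ℝ)) (pathMeasure ν) t = mgf (fun y : ℤ => (y : ℝ)) ν t ^ n := by
  rw [cast_psum_eq, (iIndepFun_cast ν).mgf_sum measurable_eval_cast]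
  simp [mgf_eval]

lemma integrable_comp_eval {E : Type*} [NormedAddCommGroup E] {g : ℤ → E} (hg : Integrable g ν)
    (i : ℕ) : Integrable (fun x : ℕ → ℤ => g (x i)) (pathMeasure ν) := by
  rw [← pathMeasure_map_eval ν i] at hg
  exact hg.comp_measurable (measurable_pi_apply i)

lemma integrable_exp_psum {t : ℝ} (ht : Integrable (fun y : ℤ => Real.exp (t * y)) ν) (n : ℕ) :
    Integrable (fun x => Real.exp (t * (psum n x : ℝ))) (pathMeasure ν) := by
  have := (iIndepFun_cast ν).integrable_exp_mul_sum (t := t) (s := Finset.range n)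
    measurable_eval_cast fun i _ => integrable_comp_eval ν ht i
  rw [← cast_psum_eq] at this
  exact this

lemma prob_psum_le_le {s : ℝ} (hs : 0 ≤ s) (hi : Integrable (fun y : ℤ => Real.exp (-s * y)) ν)
    (n : ℕ) (y : ℝ) :
    (pathMeasure ν).real {ω | (psum n ω : ℝ) ≤ y} ≤
      Real.exp (s * y) * mgf (fun y : ℤ => (y : ℝ)) ν (-s) ^ n := by
  have := measure_le_le_exp_mul_mgf (X := fun x => (psum n x : ℝ)) (μ := pathMeasure ν) (t := -s) y
    (by linarith) (integrable_exp_psum ν hi n)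
  rwa [mgf_psum, neg_neg] at this

lemma memLp_eval (h2 : MemLp (fun y : ℤ => (y : ℝ)) 2 ν) (i : ℕ) :
    MemLp (fun x : ℕ → ℤ => (x i : ℝ)) 2 (pathMeasure ν) := by
  rw [← pathMeasure_map_eval ν i] at h2
  exact (memLp_map_measure_iff Measurable.of_discrete.aestronglyMeasurable
    (measurable_pi_apply i).aemeasurable).1 h2

lemma memLp_psum (h2 : MemLp (fun y : ℤ => (y : ℝ)) 2 ν) (n : ℕ) :
    MemLp (fun x => (psum n x : ℝ)) 2 (pathMeasure ν) := by
  rw [cast_psum_eq]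
  exact memLp_finsetSum' _ fun i _ => memLp_eval ν h2 i

lemma variance_psum (h2 : MemLp (fun y : ℤ => (y : ℝ)) 2 ν) (n : ℕ) :
    Var[fun x => (psum n x : ℝ); pathMeasure ν] = n * vari ν := by
  rw [cast_psum_eq, IndepFun.variance_sum (fun i _ => memLp_eval ν h2 i)
    fun i _ j _ hij => (iIndepFun_cast ν).indepFun hij]
  have : ∀ i : ℕ, Var[fun x : ℕ → ℤ => (x i : ℝ); pathMeasure ν] = vari ν := by
    intro i
    rw [vari]
    conv_rhs => rw [← pathMeasure_map_eval ν i]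
    have hm : AEMeasurable (fun x : ℕ → ℤ => x i) (pathMeasure ν) :=
      (measurable_pi_apply i).aemeasurable
    rw [variance_map (by fun_prop) hm]
    rfl
  simp [this]

lemma integral_psum (h2 : MemLp (fun y : ℤ => (y : ℝ)) 2 ν) (n : ℕ) :
    ∫ x, (psum n x : ℝ) ∂pathMeasure ν = n * mean ν := by
  have : ∀ i : ℕ, ∫ x : ℕ → ℤ, (x i : ℝ) ∂pathMeasure ν = mean ν := by
    intro i
    rw [mean]
    conv_rhs => rw [← pathMeasure_map_eval ν i]
    rw [integral_map (measurable_pi_apply i).aemeasurable (by fun_prop)]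
  simp only [psum, Int.cast_sum]
  rw [integral_finsetSum _ fun i _ => (memLp_eval ν h2 i).integrable (by norm_num)]
  simp [this]

/-- Chebyshev's inequality for the walk. -/
lemma prob_abs_psum_sub_le (h2 : MemLp (fun y : ℤ => (y : ℝ)) 2 ν) (n : ℕ) {c : ℝ} (hc : 0 < c) :
    (pathMeasure ν).real {ω | c ≤ |(psum n ω : ℝ) - n * mean ν|} ≤ n * vari ν / c ^ 2 := by
  have h := meas_ge_le_variance_div_sq (memLp_psum ν h2 n) hc
  rw [variance_psum ν h2, integral_psum ν h2] at h
  refine ENNReal.toReal_le_of_le_ofReal ?_ h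
  have : 0 ≤ vari ν := variance_nonneg _ _
  positivity

end

lemma measure_eq_tsum_fiber {Ω : Type*} [MeasurableSpace Ω] (μ : Measure Ω) {S : Ω → ℤ}
    (hS : Measurable S) {A : Set Ω} (hA : MeasurableSet A) :
    μ A = ∑' y, μ {ω | ω ∈ A ∧ S ω = y} := by
  rw [← measure_iUnion]
  · congr 1; ext ω
    rw [Set.mem_iUnion]
    exact ⟨fun h => ⟨S ω, h, rfl⟩, fun ⟨_, h, _⟩ => h⟩
  · intro i j hij
    exact Set.disjoint_left.2 fun ω h h' => hij (h.2.symm.trans h'.2)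
  · exact fun y => hA.inter (hS (measurableSet_singleton y))

/-- The probability that the walk stays positive up to time `n` and is at `x` at time `n`. -/
def stayPos (ν : Measure ℤ) (n : ℕ) (x : ℤ) : ℝ :=
  (pathMeasure ν).real {ω | (∀ i, 1 ≤ i → i ≤ n → 0 < psum i ω) ∧ psum n ω = x}

/-- The probability that the walk first exceeds `d - 1` at time `n`, with value `d`. -/
def firstHit (ν : Measure ℤ) (n : ℕ) (d : ℤ) : ℝ :=
  (pathMeasure ν).real {ω | (∀ i < n, psum i ω < d) ∧ psum n ω = d}

lemma finDep_psum_eq (n : ℕ) (x : ℤ) : FinDep n fun ω => psum n ω = x :=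
  FinDep.of_psum fun a b h ha => by rw [← h n le_rfl]; exact ha

lemma finDep_pos (n : ℕ) : FinDep n fun ω => ∀ i, 1 ≤ i → i ≤ n → 0 < psum i ω :=
  FinDep.of_psum fun a b h ha i h1 h2 => by rw [← h i h2]; exact ha i h1 h2

lemma finDep_stayPos (n : ℕ) (x : ℤ) :
    FinDep n fun ω => (∀ i, 1 ≤ i → i ≤ n → 0 < psum i ω) ∧ psum n ω = x :=
  (finDep_pos n).and (finDep_psum_eq n x)

lemma finDep_firstHit (n : ℕ) (d : ℤ) :
    FinDep n fun ω => (∀ i < n, psum i ω < d) ∧ psum n ω = d :=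
  FinDep.and (FinDep.of_psum fun a b h ha i hi => by rw [← h i hi.le]; exact ha i hi)
    (finDep_psum_eq n d)

section

variable (ν : Measure ℤ) [IsProbabilityMeasure ν]

/-- Time reversal: read backwards from its end, a path reaching a new strict maximum `d` at time `n`
is a path that stays positive and ends at `d`. Thus one local limit theorem serves both outer
pieces, and the disjointness of first passages also controls sums of `stayPos` over time. -/
lemma firstHit_eq_stayPos (n : ℕ) (d : ℤ) : firstHit ν n d = stayPos ν n d := by
  unfold firstHit stayPos
  rw [measureReal_def, measureReal_def, ← pathMeasure_comp ν (finDep_stayPos n d) (flip_injective n)]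
  congr 2; ext ω
  simp only [Set.mem_ofPred_eq]
  rw [psum_flip le_rfl, Nat.sub_self, psum_zero, sub_zero]
  refine and_congr_left fun hd => ⟨fun h i h1 h2 => ?_, fun h i hi => ?_⟩
  · rw [psum_flip h2, hd]
    linarith [h (n - i) (by omega)]
  · have := h (n - i) (by omega) (by omega)
    rw [psum_flip (by omega), hd, show n - (n - i) = i by omega] at this
    linarith

/-- The probability that the walk stays positive up to time `n`. -/
def survival (ν : Measure ℤ) (n : ℕ) : ℝ :=
  (pathMeasure ν).real {ω | ∀ i, 1 ≤ i → i ≤ n → 0 < psum i ω}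

/-- The probability that the walk stays positive forever. -/
def escape (ν : Measure ℤ) : ℝ := ⨅ n, survival ν n

lemma survival_antitone : Antitone (survival ν) := fun m n hmn =>
  measureReal_mono fun ω h i h1 h2 => h i h1 (h2.trans hmn)

omit [IsProbabilityMeasure ν] in
lemma bddBelow_survival : BddBelow (Set.range (survival ν)) :=
  ⟨0, by rintro _ ⟨n, rfl⟩; exact measureReal_nonneg⟩

omit [IsProbabilityMeasure ν] in
lemma escape_le (n : ℕ) : escape ν ≤ survival ν n := ciInf_le (bddBelow_survival ν) n

lemma tendsto_survival : Tendsto (survival ν) atTop (𝓝 (escape ν)) :=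
  tendsto_atTop_ciInf (survival_antitone ν) (bddBelow_survival ν)

/-- Conditioning on the position at time `i`: whatever it is, the last `m` steps hit the required
increment with probability at most `C`. -/
lemma prob_and_psum_le {i m : ℕ} {A : (ℕ → ℤ) → Prop} (hA : FinDep i A) (x : ℤ) {C : ℝ}
    (hC : ∀ y, (pathMeasure ν).real {ω | psum m ω = y} ≤ C) :
    (pathMeasure ν).real {ω | A ω ∧ psum (i + m) ω = x} ≤ (pathMeasure ν).real {ω | A ω} * C := by
  have hC0 : 0 ≤ C := measureReal_nonneg.trans (hC 0)
  have hm : MeasurableSet {ω | A ω ∧ psum (i + m) ω = x} :=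
    ((hA.mono (Nat.le_add_right i m)).and (finDep_psum_eq _ _)).measurableSet
  have h1 : pathMeasure ν {ω | A ω ∧ psum (i + m) ω = x} ≤
      pathMeasure ν {ω | A ω} * ENNReal.ofReal C := by
    rw [measure_eq_tsum_fiber _ (measurable_psum i) hm,
      measure_eq_tsum_fiber _ (measurable_psum i) hA.measurableSet, ← ENNReal.tsum_mul_right]
    refine ENNReal.tsum_le_tsum fun y => ?_
    have hAy : FinDep i fun ω => A ω ∧ psum i ω = y := hA.and (finDep_psum_eq _ _)
    have h2 := pathMeasure_and_shift ν hAy (finDep_psum_eq m (x - y))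
    have e : {ω | ω ∈ {ω | A ω ∧ psum (i + m) ω = x} ∧ psum i ω = y} =
        {ω | (A ω ∧ psum i ω = y) ∧ psum m (shift i ω) = x - y} := by
      ext ω
      simp only [Set.mem_ofPred_eq]
      rw [psum_shift]
      constructor
      · rintro ⟨⟨h1, h2⟩, h3⟩; exact ⟨⟨h1, h3⟩, by omega⟩
      · rintro ⟨⟨h1, h2⟩, h3⟩; exact ⟨⟨h1, by omega⟩, h2⟩
    rw [e, h2]
    refine mul_le_mul_right ?_ _
    rw [← ENNReal.ofReal_toReal (measure_ne_top (pathMeasure ν) {ω | psum m ω = x - y})]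
    exact ENNReal.ofReal_le_ofReal (hC _)
  have h3 := ENNReal.toReal_mono (by finiteness) h1
  rwa [ENNReal.toReal_mul, ENNReal.toReal_ofReal hC0] at h3

/-- A lattice law with positive drift and an exponential moment on the negative side. -/
structure PosDrift (ν : Measure ℤ) : Prop where
  aperiodic : Aperiodic ν
  vari_pos : 0 < vari ν
  memLp : MemLp (fun y : ℤ => (y : ℝ)) 2 ν
  mean_pos : 0 < mean ν
  exists_mgf_lt : ∃ s > 0, Integrable (fun y : ℤ => Real.exp (-s * y)) ν ∧
    mgf (fun y : ℤ => (y : ℝ)) ν (-s) < 1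

variable {ν}

/-- The walk is forced to start with `j` steps equal to a positive atom `p`. From the height `j p`,
Chernoff bounds summed over all times make a return to the nonpositive half-line have probability at
most `exp(-s j p) / (1 - r)`, which is less than one for `j` large. -/
lemma PosDrift.escape_pos (h : PosDrift ν) : 0 < escape ν := by
  obtain ⟨s, hs, hi, hr⟩ := h.exists_mgf_lt
  set r := mgf (fun y : ℤ => (y : ℝ)) ν (-s) with hrdef
  have hr0 : 0 ≤ r := mgf_nonneg
  -- a positive atom
  obtain ⟨p, hp, hνp⟩ : ∃ p : ℤ, 0 < p ∧ ν {p} ≠ 0 := by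
    by_contra! hcon
    have hae : ∀ᵐ y : ℤ ∂ν, (y : ℝ) ≤ 0 := by
      rw [ae_iff_of_countable]
      intro y hy
      by_contra! hlt
      exact hy (hcon y (by exact_mod_cast hlt))
    exact absurd (integral_nonpos_of_ae hae) (not_le.2 h.mean_pos)
  have hp' : (0 : ℝ) < p := by exact_mod_cast hp
  obtain ⟨j, hj⟩ : ∃ j : ℕ, Real.exp (s * -(j * p)) * (1 - r)⁻¹ < 1 := by
    have : Tendsto (fun j : ℕ => Real.exp (s * -(j * p)) * (1 - r)⁻¹) atTop (𝓝 (0 * (1 - r)⁻¹)) := by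
      refine Tendsto.mul_const _ (Real.tendsto_exp_atBot.comp ?_)
      have h1 : Tendsto (fun j : ℕ => (j : ℝ) * (s * p)) atTop atTop :=
        tendsto_natCast_atTop_atTop.atTop_mul_const (by positivity)
      refine (tendsto_neg_atTop_atBot.comp h1).congr fun j => ?_
      simp only [Function.comp]; ring
    rw [zero_mul] at this
    exact (this.eventually (gt_mem_nhds one_pos)).exists
  set A : (ℕ → ℤ) → Prop := fun ω => ∀ i < j, ω i = p with hAdef
  have hA : FinDep j A := fun x y hxy hx i hi => by rw [← hxy i hi]; exact hx i hi
  have hApos : 0 < (pathMeasure ν).real {ω | A ω} := by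
    rw [measureReal_def]
    refine ENNReal.toReal_pos ?_ (measure_ne_top _ _)
    have : {ω : ℕ → ℤ | A ω} = Set.pi (Finset.range j : Set ℕ) fun _ => {p} := by
      ext ω; simp [hAdef]
    rw [this, pathMeasure, Measure.infinitePi_pi _ fun _ _ => measurableSet_singleton _]
    exact Finset.prod_ne_zero_iff.2 fun _ _ => hνp
  have hApsum : ∀ ω, A ω → ∀ i ≤ j, psum i ω = i * p := by
    intro ω hω i hi
    rw [psum, Finset.sum_congr rfl fun k hk => hω k ((Finset.mem_range.1 hk).trans_le hi)]
    simp
  set q := 1 - Real.exp (s * -(j * p)) * (1 - r)⁻¹ with hq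
  have hBq : ∀ n, q ≤ (pathMeasure ν).real {ω | ∀ i, 1 ≤ i → i ≤ n → -(j * p : ℤ) < psum i ω} := by
    intro n
    have hB : FinDep n fun ω => ∀ i, 1 ≤ i → i ≤ n → -(j * p : ℤ) < psum i ω :=
      FinDep.of_psum fun a b h ha i h1 h2 => by rw [← h i h2]; exact ha i h1 h2
    have hc := probReal_compl_eq_one_sub (μ := pathMeasure ν) hB.measurableSet
    have hsub : {ω | ∀ i, 1 ≤ i → i ≤ n → -(j * p : ℤ) < psum i ω}ᶜ ⊆
        ⋃ i ∈ Finset.range (n + 1), {ω : ℕ → ℤ | (psum i ω : ℝ) ≤ -(j * p)} := by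
      intro ω hω
      have hω' : ¬ ∀ i, 1 ≤ i → i ≤ n → -(j * p : ℤ) < psum i ω := hω
      push Not at hω'
      obtain ⟨i, -, h2, h3⟩ := hω'
      refine Set.mem_biUnion (Finset.mem_coe.2 (Finset.mem_range.2 (by omega : i < n + 1))) ?_
      show (psum i ω : ℝ) ≤ -(j * p)
      exact_mod_cast h3
    have hle := (measureReal_mono hsub (measure_ne_top _ _)).trans
      (measureReal_biUnion_finset_le (μ := pathMeasure ν) _ _)
    have hsum : ∑ i ∈ Finset.range (n + 1), (pathMeasure ν).real
        {ω : ℕ → ℤ | (psum i ω : ℝ) ≤ -(j * p)} ≤ Real.exp (s * -(j * p)) * (1 - r)⁻¹ := by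
      calc _ ≤ ∑ i ∈ Finset.range (n + 1), Real.exp (s * -(j * p)) * r ^ i :=
            Finset.sum_le_sum fun i _ => prob_psum_le_le ν hs.le hi i _
        _ ≤ _ := by
            rw [← Finset.mul_sum]
            gcongr
            exact (Summable.sum_le_tsum _ (fun i _ => by positivity)
              (summable_geometric_of_lt_one hr0 hr)).trans_eq (tsum_geometric_of_lt_one hr0 hr)
    rw [hc] at hle
    linarith
  have hlow : ∀ n, (pathMeasure ν).real {ω | A ω} * q ≤ survival ν n := by
    intro n
    have hB : FinDep n fun ω => ∀ i, 1 ≤ i → i ≤ n → -(j * p : ℤ) < psum i ω :=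
      FinDep.of_psum fun a b h ha i h1 h2 => by rw [← h i h2]; exact ha i h1 h2
    calc _ ≤ (pathMeasure ν).real {ω | A ω} *
          (pathMeasure ν).real {ω | ∀ i, 1 ≤ i → i ≤ n → -(j * p : ℤ) < psum i ω} := by
          gcongr; exact hBq n
      _ = _ := (pathMeasureReal_and_shift ν hA hB).symm
      _ ≤ survival ν n := by
          refine measureReal_mono ?_
          rintro ω ⟨h1, h2⟩ i hi1 hi2
          rcases le_or_gt i j with hij | hij
          · rw [hApsum ω h1 i hij]
            have : (0 : ℤ) < i := by exact_mod_cast hi1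
            positivity
          · have h3 := h2 (i - j) (by omega) (by omega)
            rw [psum_shift, hApsum ω h1 j le_rfl, Nat.add_sub_cancel' hij.le] at h3
            linarith
  have hq0 : 0 < q := by rw [hq]; linarith
  exact (mul_pos hApos hq0).trans_le (le_ciInf hlow)

/-- **Local limit theorem for the walk conditioned to stay positive**, along arbitrary
sequences. -/
theorem PosDrift.tendsto_sqrt_mul_stayPos (h : PosDrift ν) {ι : Type*} {l : Filter ι}
    [l.IsCountablyGenerated] {n : ι → ℕ} (hn : Tendsto n l atTop) {x : ι → ℤ} {z : ℝ}
    (hx : Tendsto (fun i => ((x i : ℝ) - n i * mean ν) / Real.sqrt (n i)) l (𝓝 z)) :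
    Tendsto (fun i => Real.sqrt (n i) * stayPos ν (n i) (x i)) l
      (𝓝 (escape ν * gaussDens (vari ν) z)) := by
  obtain ⟨s, hs, hi, hr⟩ := h.exists_mgf_lt
  set r := mgf (fun y : ℤ => (y : ℝ)) ν (-s) with hrdef
  have hr0 : 0 ≤ r := mgf_nonneg
  obtain ⟨K, hK, hKb⟩ := exists_sqrt_mul_prob_le h.aperiodic h.vari_pos h.memLp
  have hsumm : Summable fun i : ℕ => ((i : ℝ) + 1) * r ^ i := by
    have h1 := summable_pow_mul_geometric_of_norm_lt_one 1
      (show ‖r‖ < 1 by rwa [Real.norm_of_nonneg hr0])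
    have h2 := summable_geometric_of_lt_one hr0 hr
    refine (h1.add h2).congr fun i => ?_
    simp; ring
  -- A bound on `√m` times the probability to end at a given point after visiting the nonpositive
  -- half-line at some time later than `M`. The constant `K` covers visits before the final time and
  -- the summand `1` covers a visit at the final time.
  set τ : ℕ → ℝ := fun M => (K + 1) * ∑' i : ℕ, (((i + M : ℕ) : ℝ) + 1) * r ^ (i + M) with hτ
  have hτ0 : Tendsto τ atTop (𝓝 0) := by
    have := (tendsto_sum_nat_add fun i : ℕ => ((i : ℝ) + 1) * r ^ i).const_mul (K + 1)
    simpa [hτ] using this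
  have hleft : ∀ (M m : ℕ) (y : ℤ), M ≤ m → stayPos ν m y ≤ (pathMeasure ν).real
      {ω | (∀ i, 1 ≤ i → i ≤ M → 0 < psum i ω) ∧ psum m ω = y} := by
    intro M m y hM
    exact measureReal_mono fun ω h => ⟨fun i h1 h2 => h.1 i h1 (h2.trans hM), h.2⟩
  have hterm : ∀ (m i : ℕ) (y : ℤ), 1 ≤ i → i ≤ m → Real.sqrt m * (pathMeasure ν).real
      {ω | psum i ω ≤ 0 ∧ psum m ω = y} ≤ (K + 1) * (((i : ℝ) + 1) * r ^ i) := by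
    intro m i y h1 him
    have hA : FinDep i fun ω => psum i ω ≤ 0 :=
      FinDep.of_psum fun a b h ha => by rw [← h i le_rfl]; exact ha
    have hPi : (pathMeasure ν).real {ω | psum i ω ≤ 0} ≤ r ^ i := by
      have := prob_psum_le_le ν hs.le hi i 0
      rw [mul_zero, Real.exp_zero, one_mul] at this
      convert this using 3
      norm_cast
    rcases him.lt_or_eq with hlt | rfl
    · have hmi : (1 : ℝ) ≤ (m - i : ℕ) := by exact_mod_cast (by omega : 1 ≤ m - i)
      have hs0 : 0 < Real.sqrt (m - i : ℕ) := Real.sqrt_pos.2 (by linarith)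
      have hb := prob_and_psum_le ν (m := m - i) hA y (C := K / Real.sqrt (m - i : ℕ)) fun y' => by
        rw [le_div_iff₀ hs0, mul_comm]; exact hKb _ _
      rw [Nat.add_sub_cancel' him] at hb
      -- Since `m - i ≥ 1`, one has `m = i + (m - i) ≤ (i + 1)² (m - i)`. The polynomial loss `i +
      -- 1` is absorbed by the geometric factor `r ^ i`.
      have hsq : Real.sqrt m ≤ (i + 1) * Real.sqrt (m - i : ℕ) := by
        have e : Real.sqrt m ≤ Real.sqrt ((i + 1) ^ 2 * (m - i : ℕ)) := by
          refine Real.sqrt_le_sqrt ?_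
          have e1 : (m : ℝ) = i + (m - i : ℕ) := by
            rw [Nat.cast_sub him]; ring
          rw [e1]
          have : (0 : ℝ) ≤ i := Nat.cast_nonneg i
          nlinarith [mul_nonneg this (sub_nonneg.2 hmi),
            mul_nonneg (mul_nonneg this this) (zero_le_one.trans hmi)]
        rwa [Real.sqrt_mul (by positivity), Real.sqrt_sq (by positivity)] at e
      calc _ ≤ ((i + 1) * Real.sqrt (m - i : ℕ)) * (r ^ i * (K / Real.sqrt (m - i : ℕ))) := by
            gcongr
            refine hb.trans ?_
            gcongr
        _ = K * ((i + 1) * r ^ i) := by field_simp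
        _ ≤ _ := by
            have : 0 ≤ ((i : ℝ) + 1) * r ^ i := by positivity
            nlinarith
    · have h3 : (pathMeasure ν).real {ω | psum i ω ≤ 0 ∧ psum i ω = y} ≤ r ^ i :=
        (measureReal_mono fun ω h => h.1).trans hPi
      have h4 : Real.sqrt i ≤ i + 1 := by
        rw [Real.sqrt_le_left (by positivity)]
        have : (0 : ℝ) ≤ i := Nat.cast_nonneg i
        nlinarith
      calc _ ≤ ((i : ℝ) + 1) * r ^ i := by gcongr
        _ ≤ _ := by
            have : 0 ≤ ((i : ℝ) + 1) * r ^ i := by positivity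
            nlinarith
  have hright : ∀ (M m : ℕ) (y : ℤ), M ≤ m → Real.sqrt m * (pathMeasure ν).real
      {ω | (∀ i, 1 ≤ i → i ≤ M → 0 < psum i ω) ∧ psum m ω = y} ≤
        Real.sqrt m * stayPos ν m y + τ M := by
    intro M m y hM
    have hsub : {ω | (∀ i, 1 ≤ i → i ≤ M → 0 < psum i ω) ∧ psum m ω = y} ⊆
        {ω | (∀ i, 1 ≤ i → i ≤ m → 0 < psum i ω) ∧ psum m ω = y} ∪
          ⋃ i ∈ Finset.Ico (M + 1) (m + 1), {ω | psum i ω ≤ 0 ∧ psum m ω = y} := by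
      rintro ω ⟨h1, h2⟩
      by_cases hc : ∀ i, 1 ≤ i → i ≤ m → 0 < psum i ω
      · exact Or.inl ⟨hc, h2⟩
      · push Not at hc
        obtain ⟨i, hi1, hi2, hi3⟩ := hc
        have : M < i := by
          by_contra hcon
          exact absurd (h1 i hi1 (by omega)) (not_lt.2 hi3)
        exact Or.inr (Set.mem_biUnion (Finset.mem_coe.2 (Finset.mem_Ico.2 ⟨this, by omega⟩))
          ⟨hi3, h2⟩)
    have hle := (measureReal_mono (μ := pathMeasure ν) hsub).trans ((measureReal_union_le _ _).trans
      (add_le_add_right (measureReal_biUnion_finset_le (μ := pathMeasure ν) _ _) _))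
    have hsum : Real.sqrt m * ∑ i ∈ Finset.Ico (M + 1) (m + 1),
        (pathMeasure ν).real {ω | psum i ω ≤ 0 ∧ psum m ω = y} ≤ τ M := by
      rw [Finset.mul_sum]
      calc _ ≤ ∑ i ∈ Finset.Ico (M + 1) (m + 1), (K + 1) * (((i : ℝ) + 1) * r ^ i) := by
            refine Finset.sum_le_sum fun i hi => ?_
            rw [Finset.mem_Ico] at hi
            exact hterm m i y (by omega) (by omega)
        _ ≤ ∑ i ∈ Finset.Ico M (m + 1), (K + 1) * (((i : ℝ) + 1) * r ^ i) := by
            refine Finset.sum_le_sum_of_subset_of_nonneg (Finset.Ico_subset_Ico_left (by omega)) ?_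
            intro i _ _
            positivity
        _ ≤ τ M := by
            rw [← Finset.mul_sum, Finset.sum_Ico_eq_sum_range, hτ]
            refine mul_le_mul_of_nonneg_left ?_ (by positivity)
            have hs' := (summable_nat_add_iff M).2 hsumm
            refine le_trans (le_of_eq ?_) (hs'.sum_le_tsum (Finset.range (m + 1 - M))
              fun i _ => by positivity)
            exact Finset.sum_congr rfl fun i _ => by rw [add_comm M i]
    calc _ ≤ Real.sqrt m * (stayPos ν m y + ∑ i ∈ Finset.Ico (M + 1) (m + 1),
          (pathMeasure ν).real {ω | psum i ω ≤ 0 ∧ psum m ω = y}) := by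
          gcongr; exact hle
      _ ≤ _ := by rw [mul_add]; linarith
  -- conclusion
  have hlimM : Tendsto (fun M => survival ν M * gaussDens (vari ν) z) atTop
      (𝓝 (escape ν * gaussDens (vari ν) z)) := (tendsto_survival ν).mul_const _
  rw [Metric.tendsto_nhds]
  intro ε hε
  have hε3 : 0 < ε / 3 := by positivity
  -- The constraint is truncated at a fixed time `M`, for which the local limit theorem with initial
  -- constraint applies; `M` is chosen before the length goes to infinity.
  obtain ⟨M, hM1, hM2⟩ := ((hτ0.eventually (gt_mem_nhds hε3)).and
    (Metric.tendsto_nhds.1 hlimM _ hε3)).exists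
  have hb := tendsto_sqrt_mul_prob h.aperiodic h.vari_pos h.memLp (finDep_pos M) hn hx
  filter_upwards [Metric.tendsto_nhds.1 hb _ hε3, hn.eventually_ge_atTop M] with i hi1 hi2
  have h1 := hright M (n i) (x i) hi2
  have h2 := mul_le_mul_of_nonneg_left (hleft M (n i) (x i) hi2) (Real.sqrt_nonneg (n i))
  rw [Real.dist_eq, abs_lt] at *
  unfold survival at hM2
  constructor <;> linarith [hM2.1, hM2.2, hi1.1, hi1.2]

end

/-! ### Concentration of first passage times -/

section

variable (ν : Measure ℤ) [IsProbabilityMeasure ν]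

lemma pairwiseDisjoint_firstHit (B : Finset ℕ) (d : ℤ) :
    (B : Set ℕ).PairwiseDisjoint fun l => {ω : ℕ → ℤ | (∀ i < l, psum i ω < d) ∧ psum l ω = d} := by
  intro i _ j _ hij
  refine Set.disjoint_left.2 fun ω h h' => ?_
  rcases lt_or_gt_of_ne hij with hlt | hlt
  · exact absurd h.2 (h'.1 i hlt).ne
  · exact absurd h'.2 (h.1 j hlt).ne

lemma sum_firstHit_eq (B : Finset ℕ) (d : ℤ) :
    ∑ l ∈ B, firstHit ν l d = (pathMeasure ν).real
      (⋃ l ∈ B, {ω : ℕ → ℤ | (∀ i < l, psum i ω < d) ∧ psum l ω = d}) :=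
  (measureReal_biUnion_finset (pairwiseDisjoint_firstHit B d)
    fun l _ => (finDep_firstHit l d).measurableSet).symm

lemma sum_firstHit_le_one (B : Finset ℕ) (d : ℤ) : ∑ l ∈ B, firstHit ν l d ≤ 1 := by
  rw [sum_firstHit_eq]; exact measureReal_le_one

/-- Late first passages are unlikely. -/
lemma sum_firstHit_late_le (h2 : MemLp (fun y : ℤ => (y : ℝ)) 2 ν) {n : ℕ} {d : ℤ}
    (hd : (d : ℝ) < n * mean ν) (B : Finset ℕ) (hB : ∀ l ∈ B, n < l) :
    ∑ l ∈ B, firstHit ν l d ≤ n * vari ν / (n * mean ν - d) ^ 2 := by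
  rw [sum_firstHit_eq]
  refine (measureReal_mono ?_).trans (prob_abs_psum_sub_le ν h2 n (sub_pos.2 hd))
  refine Set.iUnion₂_subset fun l hl ω hω => ?_
  have h : ((psum n ω : ℤ) : ℝ) < d := by exact_mod_cast hω.1 n (hB l hl)
  show n * mean ν - d ≤ |(psum n ω : ℝ) - n * mean ν|
  rw [abs_sub_comm]
  exact (by linarith : _ ≤ n * mean ν - psum n ω).trans (le_abs_self _)

/-- Early first passages are unlikely. -/
lemma sum_firstHit_early_le (h2 : MemLp (fun y : ℤ => (y : ℝ)) 2 ν) {n : ℕ} {d : ℤ}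
    (hd : n * mean ν < d) (B : Finset ℕ) (hB : ∀ l ∈ B, l ≤ n) :
    escape ν * ∑ l ∈ B, firstHit ν l d ≤ n * vari ν / (d - n * mean ν) ^ 2 := by
  -- After the passage at time `l ≤ n` an independent walk stays positive with probability at least
  -- `escape ν`, and then the position at time `n` is at least `d`. This replaces a maximal
  -- inequality, at the price of the factor `escape ν`.
  have h1 : ∀ l ∈ B, escape ν * firstHit ν l d ≤ (pathMeasure ν).real
      {ω | ((∀ i < l, psum i ω < d) ∧ psum l ω = d) ∧
        ∀ i, 1 ≤ i → i ≤ n - l → 0 < psum i (shift l ω)} := by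
    intro l _
    rw [pathMeasureReal_and_shift ν (finDep_firstHit l d) (finDep_pos (n - l)), mul_comm]
    exact mul_le_mul_of_nonneg_left (escape_le ν _) measureReal_nonneg
  rw [Finset.mul_sum]
  refine (Finset.sum_le_sum h1).trans ?_
  rw [← measureReal_biUnion_finset]
  · refine (measureReal_mono ?_).trans (prob_abs_psum_sub_le ν h2 n (sub_pos.2 hd))
    refine Set.iUnion₂_subset fun l hl ω hω => ?_
    have h : d ≤ psum n ω := by
      have hln := hB l hl
      rcases hln.lt_or_eq with hlt | rfl
      · have := hω.2 (n - l) (by omega) le_rfl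
        rw [psum_shift, Nat.add_sub_cancel' hln, hω.1.2] at this
        linarith
      · exact hω.1.2.ge
    have h' : (d : ℝ) ≤ psum n ω := by exact_mod_cast h
    show d - n * mean ν ≤ |(psum n ω : ℝ) - n * mean ν|
    exact (by linarith : _ ≤ (psum n ω : ℝ) - n * mean ν).trans (le_abs_self _)
  · intro i hi j hj hij
    exact (pairwiseDisjoint_firstHit B d hi hj hij).mono (fun ω h => h.1) fun ω h => h.1
  · exact fun l _ => (((finDep_firstHit l d).mono (Nat.le_add_right l (n - l))).and
      ((finDep_pos (n - l)).shift l)).measurableSet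

end

/-! ### Excursions above zero and renewals -/

/-- The number of visits to `c` at the times `1, …, n`. -/
def visits (c : ℤ) (n : ℕ) (ω : ℕ → ℤ) : ℕ :=
  ∑ k ∈ Finset.range n, if psum (k + 1) ω = c then 1 else 0

@[simp] lemma visits_zero (c : ℤ) (ω : ℕ → ℤ) : visits c 0 ω = 0 := by simp [visits]

lemma visits_add (c : ℤ) (m n : ℕ) (ω : ℕ → ℤ) :
    visits c (m + n) ω = visits c m ω + visits (c - psum m ω) n (shift m ω) := by
  rw [visits, Finset.sum_range_add]
  congr 1
  refine Finset.sum_congr rfl fun k _ => ?_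
  rw [psum_shift, add_assoc]
  refine if_congr ?_ rfl rfl
  omega

lemma visits_le (c : ℤ) (n : ℕ) (ω : ℕ → ℤ) : visits c n ω ≤ n := by
  unfold visits
  calc _ ≤ ∑ _k ∈ Finset.range n, 1 := Finset.sum_le_sum fun k _ => by split_ifs <;> simp
    _ = n := by simp

lemma visits_eq_zero {c : ℤ} {n : ℕ} {ω : ℕ → ℤ} (h : ∀ i, 1 ≤ i → i ≤ n → psum i ω ≠ c) :
    visits c n ω = 0 :=
  Finset.sum_eq_zero fun k hk =>
    if_neg (h (k + 1) (by omega) (by rw [Finset.mem_range] at hk; omega))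

lemma visits_succ (c : ℤ) (n : ℕ) (ω : ℕ → ℤ) :
    visits c (n + 1) ω = visits c n ω + if psum (n + 1) ω = c then 1 else 0 := by
  rw [visits, Finset.sum_range_succ]; rfl

lemma visits_eq_one {c : ℤ} {n : ℕ} {ω : ℕ → ℤ} (hn : 1 ≤ n)
    (h : ∀ i, 1 ≤ i → i < n → psum i ω ≠ c) (hc : psum n ω = c) : visits c n ω = 1 := by
  obtain ⟨m, rfl⟩ : ∃ m, n = m + 1 := ⟨n - 1, by omega⟩
  rw [visits_succ, visits_eq_zero fun i h1 h2 => h i h1 (by omega), if_pos hc]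

lemma visits_congr {c : ℤ} {n : ℕ} {x y : ℕ → ℤ} (h : ∀ j ≤ n, psum j x = psum j y) :
    visits c n x = visits c n y :=
  Finset.sum_congr rfl fun k hk => by rw [h (k + 1) (Finset.mem_range.1 hk)]

/-- The event of an excursion of length `n` above zero. -/
def IsExcursion (n : ℕ) (ω : ℕ → ℤ) : Prop := (∀ i, 1 ≤ i → i < n → 0 < psum i ω) ∧ psum n ω = 0

/-- The event that the walk is nonnegative up to time `n`, and returns to `0` for the `j`-th time
at time `n`. -/
def IsReturn (j n : ℕ) (ω : ℕ → ℤ) : Prop :=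
  (∀ i ≤ n, 0 ≤ psum i ω) ∧ psum n ω = 0 ∧ visits 0 n ω = j

lemma finDep_isExcursion (n : ℕ) : FinDep n (IsExcursion n) :=
  FinDep.of_psum fun a b h ha =>
    ⟨fun i h1 h2 => by rw [← h i h2.le]; exact ha.1 i h1 h2, by rw [← h n le_rfl]; exact ha.2⟩

lemma finDep_isReturn (j n : ℕ) : FinDep n (IsReturn j n) :=
  FinDep.of_psum fun a b h ha =>
    ⟨fun i h2 => by rw [← h i h2]; exact ha.1 i h2, by rw [← h n le_rfl]; exact ha.2.1,
      by rw [← visits_congr h]; exact ha.2.2⟩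

/-- The probability of an excursion of length `n`. -/
def exc (ν : Measure ℤ) (n : ℕ) : ℝ := (pathMeasure ν).real {ω | IsExcursion n ω}

/-- The probability of a `j`-th return at time `n`. -/
def returnProb (ν : Measure ℤ) (j n : ℕ) : ℝ := (pathMeasure ν).real {ω | IsReturn j n ω}

/-- Decomposition at the first return to zero: nonnegativity together with the absence of earlier
zeros makes the path strictly positive before it. -/
lemma isReturn_succ_iff (j n : ℕ) (ω : ℕ → ℤ) :
    IsReturn (j + 1) n ω ↔
      ∃ i ∈ Finset.Icc 1 n, IsExcursion i ω ∧ IsReturn j (n - i) (shift i ω) := by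
  constructor
  · rintro ⟨h1, h2, h3⟩
    have hn : 1 ≤ n := by
      by_contra hn
      obtain rfl : n = 0 := by omega
      simp at h3
    have hex : ∃ i, 1 ≤ i ∧ psum i ω = 0 := ⟨n, hn, h2⟩
    classical
    set i := Nat.find hex with hi
    have hi1 := Nat.find_spec hex
    have hin : i ≤ n := Nat.find_min' hex ⟨hn, h2⟩
    have hexc : ∀ k, 1 ≤ k → k < i → 0 < psum k ω := by
      intro k hk1 hk2
      have := Nat.find_min hex hk2
      have h0 : psum k ω ≠ 0 := fun h => this ⟨hk1, h⟩
      exact lt_of_le_of_ne (h1 k (by omega)) (Ne.symm h0)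
    refine ⟨i, Finset.mem_Icc.2 ⟨hi1.1, hin⟩, ⟨hexc, hi1.2⟩, fun k hk => ?_, ?_, ?_⟩
    · rw [psum_shift, hi1.2, sub_zero]; exact h1 _ (by omega)
    · rw [psum_shift, hi1.2, sub_zero, Nat.add_sub_cancel' hin, h2]
    · have h4 := visits_add 0 i (n - i) ω
      rw [Nat.add_sub_cancel' hin, h3, visits_eq_one hi1.1 (fun k hk1 hk2 => (hexc k hk1 hk2).ne')
        hi1.2, hi1.2, sub_zero] at h4
      omega
  · rintro ⟨i, hi, ⟨h1, h2⟩, h3, h4, h5⟩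
    rw [Finset.mem_Icc] at hi
    have key : ∀ k, i ≤ k → psum k ω = psum (k - i) (shift i ω) := fun k hk => by
      rw [psum_shift, h2, sub_zero, Nat.add_sub_cancel' hk]
    refine ⟨fun k hk => ?_, ?_, ?_⟩
    · rcases lt_or_ge k i with hlt | hge
      · rcases Nat.eq_zero_or_pos k with rfl | hpos
        · simp
        · exact (h1 k hpos hlt).le
      · rw [key k hge]; exact h3 _ (by omega)
    · rw [key n hi.2, h4]
    · have h6 := visits_add 0 i (n - i) ω
      rw [Nat.add_sub_cancel' hi.2, visits_eq_one hi.1 (fun k hk1 hk2 => (h1 k hk1 hk2).ne')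
        h2, h2, sub_zero, h5] at h6
      omega

section

variable (ν : Measure ℤ) [IsProbabilityMeasure ν]

lemma exc_nonneg (n : ℕ) : 0 ≤ exc ν n := measureReal_nonneg

lemma returnProb_nonneg (j n : ℕ) : 0 ≤ returnProb ν j n := measureReal_nonneg

/-- The renewal equation for the return probabilities. -/
lemma returnProb_succ (j n : ℕ) :
    returnProb ν (j + 1) n = ∑ i ∈ Finset.Icc 1 n, exc ν i * returnProb ν j (n - i) := by
  have h : {ω | IsReturn (j + 1) n ω} =
      ⋃ i ∈ Finset.Icc 1 n, {ω | IsExcursion i ω ∧ IsReturn j (n - i) (shift i ω)} := by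
    ext ω
    simp only [Set.mem_iUnion, exists_prop]
    exact isReturn_succ_iff j n ω
  rw [returnProb, h, measureReal_biUnion_finset]
  · exact Finset.sum_congr rfl fun i _ =>
      pathMeasureReal_and_shift ν (finDep_isExcursion i) (finDep_isReturn j (n - i))
  · intro i hi k hk hik
    rw [Finset.mem_coe, Finset.mem_Icc] at hi hk
    refine Set.disjoint_left.2 fun ω h h' => ?_
    rcases lt_or_gt_of_ne hik with hlt | hlt
    · exact absurd h.1.2 (h'.1.1 i hi.1 hlt).ne'
    · exact absurd h'.1.2 (h.1.1 k hk.1 hlt).ne'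
  · exact fun i _ => (((finDep_isExcursion i).mono (Nat.le_add_right i (n - i))).and
      ((finDep_isReturn j (n - i)).shift i)).measurableSet

lemma returnProb_zero_zero : returnProb ν 0 0 = 1 := by
  have : {ω | IsReturn 0 0 ω} = Set.univ := by
    ext ω; simp [IsReturn]
  rw [returnProb, this]; simp

lemma returnProb_eq_zero_of_lt {j n : ℕ} (h : n < j) : returnProb ν j n = 0 := by
  have : {ω | IsReturn j n ω} = ∅ := by
    refine Set.eq_empty_of_forall_notMem fun ω hω => ?_
    have := visits_le 0 n ω
    rw [hω.2.2] at this
    omega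
  rw [returnProb, this]; simp

lemma returnProb_zero_of_pos {n : ℕ} (h : 1 ≤ n) : returnProb ν 0 n = 0 := by
  have : {ω | IsReturn 0 n ω} = ∅ := by
    refine Set.eq_empty_of_forall_notMem fun ω hω => ?_
    obtain ⟨m, rfl⟩ : ∃ m, n = m + 1 := ⟨n - 1, by omega⟩
    have := hω.2.2
    rw [visits_succ, if_pos hω.2.1] at this
    omega
  rw [returnProb, this]; simp

/-- The tilted return weights are bounded by one when the tilted excursion law is a
sub-probability. -/
lemma sum_returnProb_le_one {lam F : ℝ} (hlam : 0 ≤ lam)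
    (hq : ∀ n, ∑ i ∈ Finset.Icc 1 n, lam * exc ν i * Real.exp (-(i * F)) ≤ 1) (n : ℕ) :
    ∑ k ∈ Finset.range (n + 1), lam ^ k * returnProb ν k n * Real.exp (-(n * F)) ≤ 1 := by
  induction n using Nat.strong_induction_on with
  | _ n ih =>
    rcases Nat.eq_zero_or_pos n with rfl | hn
    · simp [returnProb_zero_zero]
    rw [Finset.sum_range_succ', returnProb_zero_of_pos ν hn]
    simp only [mul_zero, zero_mul, add_zero]
    calc ∑ k ∈ Finset.range n, lam ^ (k + 1) * returnProb ν (k + 1) n * Real.exp (-(n * F))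
        = ∑ i ∈ Finset.Icc 1 n, lam * exc ν i * Real.exp (-(i * F)) *
          ∑ k ∈ Finset.range n, lam ^ k * returnProb ν k (n - i) *
            Real.exp (-((n - i : ℕ) * F)) := by
          simp_rw [returnProb_succ, Finset.mul_sum, Finset.sum_mul]
          rw [Finset.sum_comm]
          refine Finset.sum_congr rfl fun i hi => Finset.sum_congr rfl fun k _ => ?_
          rw [Finset.mem_Icc] at hi
          have : Real.exp (-(n * F)) = Real.exp (-(i * F)) * Real.exp (-((n - i : ℕ) * F)) := by
            rw [← Real.exp_add, Nat.cast_sub hi.2]; congr 1; ring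
          rw [this]; ring
      _ ≤ ∑ i ∈ Finset.Icc 1 n, lam * exc ν i * Real.exp (-(i * F)) * 1 := by
          refine Finset.sum_le_sum fun i hi => ?_
          have h0 := exc_nonneg ν i
          refine mul_le_mul_of_nonneg_left ?_ (by positivity)
          rw [Finset.mem_Icc] at hi
          -- The sum over `k` may stop at `n - i`, because each return takes at least one unit of
          -- time.
          refine le_trans (le_of_eq ?_) (ih (n - i) (by omega))
          symm
          refine Finset.sum_subset (fun k hk => ?_) fun k _ hk => ?_
          · rw [Finset.mem_range] at hk ⊢; omega
          · rw [Finset.mem_range] at hk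
            rw [returnProb_eq_zero_of_lt ν (by omega)]; ring
      _ ≤ 1 := by simpa using hq n

end

/-! ### The renewal law -/

/-- A point mass at `b` is carried by `b + 2ℤ`, so the definition of aperiodicity excludes it. -/
lemma Aperiodic.exists_ne {ν : Measure ℤ} (h : Aperiodic ν) (b : ℤ) : ∃ y ≠ b, ν {y} ≠ 0 := by
  by_contra! hcon
  refine h 2 le_rfl b ?_
  rw [ae_iff_of_countable]
  intro y hy
  by_cases hyb : y = b
  · rw [hyb, sub_self]; exact dvd_zero _
  · exact absurd (hcon y hyb) hy

lemma Aperiodic.vari_pos {ν : Measure ℤ} [IsProbabilityMeasure ν] (h : Aperiodic ν)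
    (h2 : MemLp (fun y : ℤ => (y : ℝ)) 2 ν) : 0 < vari ν := by
  refine lt_of_le_of_ne (variance_nonneg _ _) fun h0 => ?_
  have hev : evariance (fun y : ℤ => (y : ℝ)) ν = 0 := by
    have h3 := (evariance_lt_top h2).ne
    have h4 : (evariance (fun y : ℤ => (y : ℝ)) ν).toReal = 0 := h0.symm
    exact (ENNReal.toReal_eq_zero_iff _).1 h4 |>.resolve_right h3
  rw [evariance_eq_zero_iff (by fun_prop)] at hev
  obtain ⟨b, hb⟩ := hev.exists
  obtain ⟨y, hy, hνy⟩ := h.exists_ne b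
  rw [Filter.EventuallyEq, ae_iff_of_countable] at hev
  have h5 : (y : ℝ) = b := (hev y hνy).trans hb.symm
  exact hy (by exact_mod_cast h5)

/-- A centered aperiodic law charges both half-lines. -/
lemma Aperiodic.exists_pos_neg {ν : Measure ℤ} [IsProbabilityMeasure ν] (h : Aperiodic ν)
    (hi : Integrable (fun y : ℤ => (y : ℝ)) ν) (hm : mean ν = 0) :
    (∃ p : ℕ, 1 ≤ p ∧ ν {(p : ℤ)} ≠ 0) ∧ ∃ q : ℕ, 1 ≤ q ∧ ν {-(q : ℤ)} ≠ 0 := by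
  obtain ⟨y, hy, hνy⟩ := h.exists_ne 0
  constructor
  · by_contra! hcon
    have hle : ∀ᵐ z : ℤ ∂ν, (0 : ℝ) ≤ -z := by
      rw [ae_iff_of_countable]
      intro z hz
      by_contra! hlt
      have hz0 : 0 < z := by
        have : (0 : ℝ) < z := by linarith
        exact_mod_cast this
      have := hcon z.toNat (by omega)
      rw [Int.toNat_of_nonneg hz0.le] at this
      exact hz this
    have h0 : ∫ z : ℤ, -(z : ℝ) ∂ν = 0 := by rw [integral_neg]; simpa [mean] using hm
    have h1 := (integral_eq_zero_iff_of_nonneg_ae hle hi.neg).1 h0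
    rw [Filter.EventuallyEq, ae_iff_of_countable] at h1
    have := h1 y hνy
    exact hy (by simpa using this)
  · by_contra! hcon
    have hle : ∀ᵐ z : ℤ ∂ν, (0 : ℝ) ≤ z := by
      rw [ae_iff_of_countable]
      intro z hz
      by_contra! hlt
      have hz0 : z < 0 := by exact_mod_cast hlt
      have := hcon (-z).toNat (by omega)
      rw [Int.toNat_of_nonneg (by omega), neg_neg] at this
      exact hz this
    have h1 := (integral_eq_zero_iff_of_nonneg_ae hle hi).1 hm
    rw [Filter.EventuallyEq, ae_iff_of_countable] at h1
    have := h1 y hνy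
    exact hy (by simpa using this)

section

variable (ν : Measure ℤ) [IsProbabilityMeasure ν]

lemma prob_cylinder_pos {n : ℕ} {z : ℕ → ℤ} (hz : ∀ i < n, ν {z i} ≠ 0) :
    0 < (pathMeasure ν).real {ω | ∀ i < n, ω i = z i} := by
  rw [measureReal_def]
  refine ENNReal.toReal_pos ?_ (measure_ne_top _ _)
  have : {ω : ℕ → ℤ | ∀ i < n, ω i = z i} = Set.pi (Finset.range n : Set ℕ) fun i => {z i} := by
    ext ω; simp
  rw [this, pathMeasure, Measure.infinitePi_pi _ fun _ _ => measurableSet_singleton _]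
  exact Finset.prod_ne_zero_iff.2 fun i hi => hz i (Finset.mem_range.1 hi)

lemma exc_one_pos (h : ν {0} ≠ 0) : 0 < exc ν 1 := by
  refine (prob_cylinder_pos ν (n := 1) (z := fun _ => 0) fun _ _ => h).trans_le
    (measureReal_mono fun ω hω => ⟨fun i h1 h2 => by omega, ?_⟩)
  have := hω 0 one_pos
  simpa [psum] using this

/-- An explicit excursion: `c q` upward steps of size `p` followed by `c p` downward steps of size
`q`. The freedom in `c` and in the atoms is what determines the period of the excursion lengths. -/
lemma exc_pos {p q : ℕ} (hp : 1 ≤ p) (hq : 1 ≤ q) (hνp : ν {(p : ℤ)} ≠ 0)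
    (hνq : ν {-(q : ℤ)} ≠ 0) {c : ℕ} (hc : 1 ≤ c) : 0 < exc ν (c * (p + q)) := by
  refine (prob_cylinder_pos ν (n := c * (p + q))
    (z := fun i => if i < c * q then (p : ℤ) else -q) fun i _ => ?_).trans_le
    (measureReal_mono fun ω hω => ?_)
  · split_ifs <;> assumption
  have e : c * (p + q) = c * q + c * p := by ring
  have hcq : 1 ≤ c * q := Nat.mul_pos hc hq
  have hcp : 1 ≤ c * p := Nat.mul_pos hc hp
  have h1 : ∀ i ≤ c * q, psum i ω = i * p := by
    intro i hi
    rw [psum, Finset.sum_congr rfl fun k hk => (hω k (by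
      rw [Finset.mem_range] at hk; omega)).trans
      (if_pos (by rw [Finset.mem_range] at hk; omega))]
    simp
  have h2 : ∀ i ≤ c * p, psum (c * q + i) ω = q * (c * p - i) := by
    intro i hi
    have h3 : ∀ k ∈ Finset.range i, shift (c * q) ω k = -(q : ℤ) := fun k hk =>
      (hω (c * q + k) (by rw [Finset.mem_range] at hk; omega)).trans (if_neg (by omega))
    rw [psum_add, h1 _ le_rfl, psum, Finset.sum_congr rfl h3]
    simp only [Finset.sum_const, Finset.card_range]
    push_cast; simp only [nsmul_eq_mul]; ring
  refine ⟨fun i hi1 hi2 => ?_, ?_⟩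
  · rcases le_or_gt i (c * q) with hle | hlt
    · rw [h1 i hle]; positivity
    · have h3 := h2 (i - c * q) (by omega)
      rw [Nat.add_sub_cancel' hlt.le] at h3
      rw [h3]
      have : (0 : ℤ) < c * p - (i - c * q : ℕ) := by
        have : i - c * q < c * p := by omega
        zify at this; linarith
      positivity
  · rw [e, h2 _ le_rfl]; push_cast; ring

/-- The tilted law of the excursion lengths. -/
def renewalLaw (lam F : ℝ) : Measure ℤ :=
  Measure.sum fun n : ℕ => ENNReal.ofReal (lam * exc ν (n + 1) * Real.exp (-((n + 1 : ℕ) * F))) •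
    Measure.dirac ((n + 1 : ℕ) : ℤ)

variable {ν} {lam F : ℝ} (hlam : 0 < lam)
  (hsum : HasSum (fun n : ℕ => lam * exc ν (n + 1) * Real.exp (-((n + 1 : ℕ) * F))) 1)

lemma weight_nonneg (hlam : 0 < lam) (n : ℕ) :
    0 ≤ lam * exc ν n * Real.exp (-(n * F)) := by
  have := exc_nonneg ν n
  positivity

include hlam hsum in
lemma isProbabilityMeasure_renewalLaw : IsProbabilityMeasure (renewalLaw ν lam F) := by
  constructor
  rw [renewalLaw, Measure.sum_apply _ MeasurableSet.univ]
  simp only [Measure.smul_apply, measure_univ, smul_eq_mul, mul_one]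
  rw [← ENNReal.ofReal_tsum_of_nonneg (fun n => weight_nonneg hlam (n + 1)) hsum.summable,
    hsum.tsum_eq, ENNReal.ofReal_one]

lemma renewalLaw_singleton {n : ℕ} (hn : 1 ≤ n) : renewalLaw ν lam F {(n : ℤ)} =
    ENNReal.ofReal (lam * exc ν n * Real.exp (-(n * F))) := by
  rw [renewalLaw, Measure.sum_apply _ (measurableSet_singleton _), tsum_eq_single (n - 1)]
  · rw [Measure.smul_apply, Nat.sub_add_cancel hn, Measure.dirac_apply_of_mem (Set.mem_singleton _),
      smul_eq_mul, mul_one]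
  · intro k hk
    rw [Measure.smul_apply, Measure.dirac_apply' _ (measurableSet_singleton _),
      Set.indicator_of_notMem, smul_zero]
    rw [Set.mem_singleton_iff]
    omega

lemma renewalLaw_singleton_of_nonpos {y : ℤ} (hy : y ≤ 0) : renewalLaw ν lam F {y} = 0 := by
  rw [renewalLaw, Measure.sum_apply _ (measurableSet_singleton _), ENNReal.tsum_eq_zero]
  intro k
  rw [Measure.smul_apply, Measure.dirac_apply' _ (measurableSet_singleton _),
    Set.indicator_of_notMem, smul_zero]
  rw [Set.mem_singleton_iff]
  omega

lemma ae_one_le_renewalLaw : ∀ᵐ y ∂renewalLaw ν lam F, 1 ≤ y := by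
  rw [ae_iff_of_countable]
  intro y hy
  by_contra! hlt
  exact hy (renewalLaw_singleton_of_nonpos (by omega))

lemma exc_le_one (n : ℕ) : exc ν n ≤ 1 := measureReal_le_one

-- Since `F > 0`, the tilt makes the excursion lengths decay exponentially, so all their moments are
-- finite even though the untilted lengths are only known to be summable.
include hlam in
lemma summable_pow_mul_weight (hF : 0 < F) (k : ℕ) : Summable fun n : ℕ =>
    ((n + 1 : ℕ) : ℝ) ^ k * (lam * exc ν (n + 1) * Real.exp (-((n + 1 : ℕ) * F))) := by
  have h := summable_pow_mul_geometric_of_norm_lt_one k (r := Real.exp (-F))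
    (by rw [Real.norm_of_nonneg (Real.exp_pos _).le]; exact Real.exp_lt_one_iff.2 (by linarith))
  have h1 := ((summable_nat_add_iff 1).2 h).mul_left lam
  refine Summable.of_nonneg_of_le (fun n => mul_nonneg (by positivity) (weight_nonneg hlam _)) ?_ h1
  intro n
  have e : Real.exp (-((n + 1 : ℕ) * F)) = Real.exp (-F) ^ (n + 1) := by
    rw [← Real.exp_nat_mul]; congr 1; ring
  rw [e]
  have := exc_le_one (ν := ν) (n + 1)
  have h0 := exc_nonneg ν (n + 1)
  calc _ ≤ ((n + 1 : ℕ) : ℝ) ^ k * (lam * 1 * Real.exp (-F) ^ (n + 1)) := by gcongr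
    _ = _ := by ring

include hlam in
lemma lintegral_renewalLaw (g : ℤ → ℝ≥0∞) : ∫⁻ y, g y ∂renewalLaw ν lam F =
    ∑' n : ℕ, ENNReal.ofReal (lam * exc ν (n + 1) * Real.exp (-((n + 1 : ℕ) * F))) *
      g (n + 1 : ℕ) := by
  rw [renewalLaw, lintegral_sum_measure]
  simp [lintegral_smul_measure, lintegral_dirac]

include hlam in
lemma integral_renewalLaw {g : ℤ → ℝ} (hg : Integrable g (renewalLaw ν lam F)) :
    ∫ y, g y ∂renewalLaw ν lam F =
      ∑' n : ℕ, g (n + 1 : ℕ) * (lam * exc ν (n + 1) * Real.exp (-((n + 1 : ℕ) * F))) := by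
  unfold renewalLaw at hg ⊢
  rw [integral_sum_measure hg]
  refine tsum_congr fun n => ?_
  rw [integral_smul_measure, integral_dirac, ENNReal.toReal_ofReal (weight_nonneg hlam _),
    smul_eq_mul, mul_comm]

include hlam hsum in
lemma memLp_renewalLaw (hF : 0 < F) : MemLp (fun y : ℤ => (y : ℝ)) 2 (renewalLaw ν lam F) := by
  rw [memLp_two_iff_integrable_sq Measurable.of_discrete.aestronglyMeasurable]
  refine ⟨Measurable.of_discrete.aestronglyMeasurable, ?_⟩
  rw [hasFiniteIntegral_iff_ofReal (ae_of_all _ fun y => sq_nonneg _), lintegral_renewalLaw hlam]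
  have h := summable_pow_mul_weight (ν := ν) hlam hF 2
  have e : ∀ n : ℕ, ENNReal.ofReal (lam * exc ν (n + 1) * Real.exp (-((n + 1 : ℕ) * F))) *
      ENNReal.ofReal ((((n + 1 : ℕ) : ℤ) : ℝ) ^ 2) = ENNReal.ofReal (((n + 1 : ℕ) : ℝ) ^ 2 *
        (lam * exc ν (n + 1) * Real.exp (-((n + 1 : ℕ) * F)))) := by
    intro n
    rw [← ENNReal.ofReal_mul (weight_nonneg hlam _), mul_comm]
    simp
  simp_rw [e]
  rw [← ENNReal.ofReal_tsum_of_nonneg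
    (fun n => mul_nonneg (by positivity) (weight_nonneg hlam _)) h]
  exact ENNReal.ofReal_lt_top

-- If the possible excursion lengths all lie in `b + hℤ`, the lengths `p + q` and `2(p + q)` give `h
-- ∣ p + q` and then `h ∣ b`. Replacing `p` or `q` by any other atom `x` of the step law yields `h ∣
-- x + q`; an atom at `0` would give an excursion of length one and is excluded. So the step law
-- would be carried by `-q + hℤ`.
include hlam in
lemma aperiodic_renewalLaw (hν : Aperiodic ν) (hi : Integrable (fun y : ℤ => (y : ℝ)) ν)
    (hm : mean ν = 0) : Aperiodic (renewalLaw ν lam F) := by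
  intro h hh b hb
  rw [ae_iff_of_countable] at hb
  have key : ∀ n : ℕ, 1 ≤ n → 0 < exc ν n → (h : ℤ) ∣ n - b := by
    intro n hn he
    refine hb n ?_
    rw [renewalLaw_singleton hn, ne_eq, ENNReal.ofReal_eq_zero, not_le]
    positivity
  obtain ⟨⟨p, hp, hνp⟩, q, hq, hνq⟩ := hν.exists_pos_neg hi hm
  have h1 := key _ (by nlinarith) (exc_pos ν hp hq hνp hνq (c := 1) le_rfl)
  have h2 := key _ (by nlinarith) (exc_pos ν hp hq hνp hνq (c := 2) (by norm_num))
  have hpq : (h : ℤ) ∣ p + q := by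
    have := dvd_sub h2 h1
    push_cast at this
    ring_nf at this ⊢
    exact this
  have hb0 : (h : ℤ) ∣ b := by
    have := dvd_sub hpq h1
    push_cast at this
    ring_nf at this
    exact this
  refine hν h hh (-q) ?_
  rw [ae_iff_of_countable]
  intro x hx
  rcases lt_trichotomy x 0 with hneg | rfl | hpos
  · obtain ⟨x', rfl⟩ : ∃ x' : ℕ, x = -(x' : ℤ) := ⟨(-x).toNat, by omega⟩
    have h3 := key _ (by omega) (exc_pos ν hp (by omega : 1 ≤ x') hνp hx (c := 1) le_rfl)
    have h4 := dvd_sub hpq (dvd_add h3 hb0)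
    push_cast at h4
    ring_nf at h4 ⊢
    exact h4
  · have h3 := key 1 le_rfl (exc_one_pos ν hx)
    have h4 := dvd_add h3 hb0
    push_cast at h4
    ring_nf at h4
    have := Int.le_of_dvd one_pos h4
    omega
  · obtain ⟨x', rfl⟩ : ∃ x' : ℕ, x = (x' : ℤ) := ⟨x.toNat, by omega⟩
    have h3 := key _ (by omega) (exc_pos ν (by omega : 1 ≤ x') hq hx hνq (c := 1) le_rfl)
    have h4 := dvd_add h3 hb0
    push_cast at h4
    ring_nf at h4 ⊢
    exact h4

lemma ae_pathMeasure_of_ae {Q : Measure ℤ} [IsProbabilityMeasure Q] {p : ℤ → Prop}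
    (h : ∀ᵐ y ∂Q, p y) : ∀ᵐ ω ∂pathMeasure Q, ∀ i, p (ω i) := by
  rw [ae_all_iff]
  intro i
  rw [← pathMeasure_map_eval Q i] at h
  have hm : AEMeasurable (fun x : ℕ → ℤ => x i) (pathMeasure Q) :=
    (measurable_pi_apply i).aemeasurable
  exact (ae_map_iff hm MeasurableSet.of_discrete).1 h

lemma strictMono_psum {ω : ℕ → ℤ} (h : ∀ i, 1 ≤ ω i) : StrictMono fun n => psum n ω :=
  strictMono_nat_of_lt_succ fun n => by
    show psum n ω < psum (n + 1) ω
    rw [psum_succ]; linarith [h n]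

/-- The law of the partial sums of the renewal process. -/
lemma prob_psum_renewalLaw [IsProbabilityMeasure (renewalLaw ν lam F)] (hlam : 0 < lam) (j n : ℕ) :
    (pathMeasure (renewalLaw ν lam F)).real {ω | psum j ω = n} =
      lam ^ j * returnProb ν j n * Real.exp (-(n * F)) := by
  set Q := renewalLaw ν lam F with hQ
  have hnonneg : ∀ j n : ℕ, 0 ≤ lam ^ j * returnProb ν j n * Real.exp (-(n * F)) := fun j n => by
    have := returnProb_nonneg ν j n
    positivity
  have hnegv : ∀ (j : ℕ) (y : ℤ), y < 0 → pathMeasure Q {ω | psum j ω = y} = 0 := by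
    intro j y hy
    have h := ae_pathMeasure_of_ae (ae_one_le_renewalLaw (ν := ν) (lam := lam) (F := F))
    rw [← compl_compl {ω | psum j ω = y}, ← mem_ae_iff]
    filter_upwards [h] with ω hω hcon
    have h1 := (strictMono_psum hω).monotone (Nat.zero_le j)
    simp only [psum_zero] at h1
    have h2 : psum j ω = y := hcon
    omega
  suffices H : ∀ j n : ℕ, pathMeasure Q {ω | psum j ω = n} =
      ENNReal.ofReal (lam ^ j * returnProb ν j n * Real.exp (-(n * F))) by
    rw [measureReal_def, H, ENNReal.toReal_ofReal (hnonneg j n)]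
  intro j
  induction j with
  | zero =>
    intro n
    rcases Nat.eq_zero_or_pos n with rfl | hn
    · simp [returnProb_zero_zero]
    · have : {ω : ℕ → ℤ | psum 0 ω = n} = ∅ := by
        refine Set.eq_empty_of_forall_notMem fun ω hω => ?_
        have : psum 0 ω = n := hω
        rw [psum_zero] at this
        omega
      rw [this, returnProb_zero_of_pos ν hn]; simp
  | succ j ih =>
    intro n
    rw [measure_eq_tsum_fiber _ (measurable_psum 1) (finDep_psum_eq (j + 1) n).measurableSet]
    have h1 : ∀ y : ℤ, pathMeasure Q {ω | ω ∈ {ω | psum (j + 1) ω = (n : ℤ)} ∧ psum 1 ω = y} =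
        Q {y} * pathMeasure Q {ω | psum j ω = n - y} := by
      intro y
      have e : {ω | ω ∈ {ω | psum (j + 1) ω = (n : ℤ)} ∧ psum 1 ω = y} =
          {ω | psum 1 ω = y ∧ psum j (shift 1 ω) = n - y} := by
        ext ω
        simp only [Set.mem_ofPred_eq]
        rw [psum_shift, add_comm 1 j]
        constructor
        · rintro ⟨h1, h2⟩; exact ⟨h2, by omega⟩
        · rintro ⟨h1, h2⟩; exact ⟨by omega, h1⟩
      have e2 : {ω | psum 1 ω = y} = (fun x : ℕ → ℤ => x 0) ⁻¹' {y} := by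
        ext ω; simp [psum]
      rw [e, pathMeasure_and_shift Q (finDep_psum_eq 1 y) (finDep_psum_eq j (n - y)), e2,
        ← Measure.map_apply (measurable_pi_apply 0) (measurableSet_singleton y),
        pathMeasure_map_eval]
    simp_rw [h1]
    -- Decomposition at the first renewal `y`. Only `1 ≤ y ≤ n` contributes, because steps are at
    -- least one and the remaining partial sum cannot be negative; the finite sum is then the
    -- renewal equation `returnProb_succ`.
    rw [tsum_eq_sum (s := (Finset.Icc 1 n).map Nat.castEmbedding)]
    · rw [Finset.sum_map, returnProb_succ, Finset.mul_sum, Finset.sum_mul,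
        ENNReal.ofReal_sum_of_nonneg]
      · refine Finset.sum_congr rfl fun i hi => ?_
        rw [Finset.mem_Icc] at hi
        have hc : (n : ℤ) - (i : ℤ) = ((n - i : ℕ) : ℤ) := by omega
        simp only [Nat.castEmbedding_apply]
        rw [hQ, renewalLaw_singleton hi.1, hc, ih,
          ← ENNReal.ofReal_mul (weight_nonneg hlam _)]
        congr 1
        have : Real.exp (-(n * F)) = Real.exp (-(i * F)) * Real.exp (-((n - i : ℕ) * F)) := by
          rw [← Real.exp_add, Nat.cast_sub hi.2]; congr 1; ring
        rw [this]; ring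
      · intro i _
        have := exc_nonneg ν i
        have := returnProb_nonneg ν j (n - i)
        positivity
    · intro y hy
      rcases le_or_gt y 0 with h0 | h0
      · rw [hQ, renewalLaw_singleton_of_nonpos h0, zero_mul]
      · rw [hnegv j _ ?_, mul_zero]
        by_contra hcon
        refine hy (Finset.mem_map.2 ⟨y.toNat, Finset.mem_Icc.2 ⟨by omega, by omega⟩, ?_⟩)
        simp only [Nat.castEmbedding_apply]
        omega

/-! ### Concentration of the number of renewals -/

section Tails

variable {Q : Measure ℤ} [IsProbabilityMeasure Q]

/-- Steps being at least one, the partial sums increase strictly and a value `n` is attained at most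
once. The events are disjoint in `j`, so their total probability is that of a single event `C`
containing them. -/
lemma sum_prob_psum_le (hQ : ∀ᵐ y ∂Q, 1 ≤ y) (B : Finset ℕ) (n : ℤ) {C : Set (ℕ → ℤ)}
    (hC : ∀ ω, (∀ i, 1 ≤ ω i) → ∀ j ∈ B, psum j ω = n → ω ∈ C) :
    ∑ j ∈ B, (pathMeasure Q).real {ω | psum j ω = n} ≤ (pathMeasure Q).real C := by
  have hae := ae_pathMeasure_of_ae hQ
  set E : Set (ℕ → ℤ) := {ω | ∀ i, 1 ≤ ω i} with hE
  have hEm : MeasurableSet E := by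
    rw [hE, Set.ofPred_forall]
    exact MeasurableSet.iInter fun i =>
      ((measurable_pi_apply i : Measurable fun x : ℕ → ℤ => x i)
        (MeasurableSet.of_discrete (s := {y : ℤ | 1 ≤ y})) :)
  have h1 : ∀ j, (pathMeasure Q).real {ω | psum j ω = n} =
      (pathMeasure Q).real ({ω | psum j ω = n} ∩ E) := by
    intro j
    refine measureReal_congr ?_
    filter_upwards [hae] with ω hω
    exact propext ⟨fun h => ⟨h, hω⟩, fun h => h.1⟩
  simp_rw [h1]
  rw [← measureReal_biUnion_finset]
  · exact measureReal_mono (Set.iUnion₂_subset fun j hj ω hω => hC ω hω.2 j hj hω.1)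
  · intro i _ j _ hij
    refine Set.disjoint_left.2 fun ω h h' => hij ?_
    exact (strictMono_psum h.2).injective (h.1.trans h'.1.symm)
  · exact fun j _ => ((finDep_psum_eq j n).measurableSet).inter hEm

lemma sum_prob_psum_le_one (hQ : ∀ᵐ y ∂Q, 1 ≤ y) (B : Finset ℕ) (n : ℤ) :
    ∑ j ∈ B, (pathMeasure Q).real {ω | psum j ω = n} ≤ 1 :=
  (sum_prob_psum_le hQ B n (C := Set.univ) fun _ _ _ _ _ => trivial).trans measureReal_le_one

/-- By monotonicity, attaining `n` at an index beyond `J` forces the `J`-th partial sum to be at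
most `n`, far below its mean. The early case is symmetric. -/
lemma sum_prob_psum_late_le (hQ : ∀ᵐ y ∂Q, 1 ≤ y) (h2 : MemLp (fun y : ℤ => (y : ℝ)) 2 Q)
    {J : ℕ} {n : ℤ} (hJ : (n : ℝ) < J * mean Q) (B : Finset ℕ) (hB : ∀ j ∈ B, J ≤ j) :
    ∑ j ∈ B, (pathMeasure Q).real {ω | psum j ω = n} ≤ J * vari Q / (J * mean Q - n) ^ 2 := by
  refine (sum_prob_psum_le hQ B n (C := {ω | J * mean Q - n ≤ |(psum J ω : ℝ) - J * mean Q|})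
    fun ω hω j hj hn => ?_).trans (prob_abs_psum_sub_le Q h2 J (sub_pos.2 hJ))
  have h3 : psum J ω ≤ n := by
    rw [← hn]; exact (strictMono_psum hω).monotone (hB j hj)
  have h4 : (psum J ω : ℝ) ≤ n := by exact_mod_cast h3
  show J * mean Q - n ≤ |(psum J ω : ℝ) - J * mean Q|
  rw [abs_sub_comm]
  exact (by linarith : _ ≤ J * mean Q - psum J ω).trans (le_abs_self _)

lemma sum_prob_psum_early_le (hQ : ∀ᵐ y ∂Q, 1 ≤ y) (h2 : MemLp (fun y : ℤ => (y : ℝ)) 2 Q)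
    {J : ℕ} {n : ℤ} (hJ : J * mean Q < n) (B : Finset ℕ) (hB : ∀ j ∈ B, j ≤ J) :
    ∑ j ∈ B, (pathMeasure Q).real {ω | psum j ω = n} ≤ J * vari Q / (n - J * mean Q) ^ 2 := by
  refine (sum_prob_psum_le hQ B n (C := {ω | n - J * mean Q ≤ |(psum J ω : ℝ) - J * mean Q|})
    fun ω hω j hj hn => ?_).trans (prob_abs_psum_sub_le Q h2 J (sub_pos.2 hJ))
  have h3 : n ≤ psum J ω := by
    rw [← hn]; exact (strictMono_psum hω).monotone (hB j hj)
  have h4 : (n : ℝ) ≤ psum J ω := by exact_mod_cast h3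
  show n - J * mean Q ≤ |(psum J ω : ℝ) - J * mean Q|
  exact (by linarith : _ ≤ (psum J ω : ℝ) - J * mean Q).trans (le_abs_self _)

end Tails

end

/-! ### Tilting a centered law with exponential moments -/

/-- The inclusion of `ℤ` into `ℝ`. -/
abbrev castZ : ℤ → ℝ := fun y => (y : ℝ)

/-- A centered aperiodic law which satisfies Cramér's condition. -/
structure CenteredCramer (ν : Measure ℤ) : Prop where
  aperiodic : Aperiodic ν
  zero_mem : (0 : ℝ) ∈ interior (integrableExpSet castZ ν)
  mean_zero : mean ν = 0

section

variable {ν : Measure ℤ} [IsProbabilityMeasure ν]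

lemma CenteredCramer.integrable (hν : CenteredCramer ν) : Integrable (fun y : ℤ => (y : ℝ)) ν :=
  integrable_of_mem_interior_integrableExpSet hν.zero_mem

lemma CenteredCramer.memLp (hν : CenteredCramer ν) : MemLp (fun y : ℤ => (y : ℝ)) 2 ν := by
  simpa using memLp_of_mem_interior_integrableExpSet hν.zero_mem 2

/-- The domain of the exponential moments is convex and contains a neighbourhood of zero, hence an
open interval around every point strictly between `0` and `t'`. -/
lemma CenteredCramer.mem_interior (hν : CenteredCramer ν) {t t' : ℝ} (h0 : 0 ≤ t) (h : t < t')
    (ht' : t' ∈ integrableExpSet castZ ν) : t ∈ interior (integrableExpSet castZ ν) := by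
  obtain ⟨ε, hε, hball⟩ := Metric.isOpen_iff.1 isOpen_interior 0 hν.zero_mem
  have hm : -(ε / 2) ∈ integrableExpSet castZ ν := interior_subset (hball (by
    rw [Metric.mem_ball, Real.dist_eq, sub_zero, abs_neg, abs_of_pos (by positivity)]; linarith))
  have hsub : Set.Ioo (-(ε / 2)) t' ⊆ integrableExpSet castZ ν := fun x hx =>
    convex_integrableExpSet.ordConnected.out hm ht' ⟨hx.1.le, hx.2.le⟩
  exact interior_maximal hsub isOpen_Ioo ⟨by linarith, h⟩

/-- Integrating `exp x ≥ 1 + x` gives the weak inequality as the mean vanishes; it is strict because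
the law has a nonzero atom. -/
lemma CenteredCramer.one_lt_mgf (hν : CenteredCramer ν) {t : ℝ} (h0 : t ≠ 0)
    (ht : t ∈ integrableExpSet castZ ν) : 1 < mgf castZ ν t := by
  have hint : Integrable (fun y : ℤ => Real.exp (t * y) - (t * y + 1)) ν :=
    (Integrable.sub ht ((hν.integrable.const_mul t).add (integrable_const 1)) : _)
  have hnn : ∀ y : ℤ, 0 ≤ Real.exp (t * y) - (t * y + 1) := fun y =>
    sub_nonneg.2 (Real.add_one_le_exp _)
  have hval : ∫ y : ℤ, (Real.exp (t * y) - (t * y + 1)) ∂ν = mgf castZ ν t - 1 := by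
    have hi : Integrable (fun y : ℤ => t * (y : ℝ) + 1) ν :=
      (hν.integrable.const_mul t).add (integrable_const 1)
    rw [integral_sub ht hi, integral_add (hν.integrable.const_mul t) (integrable_const 1),
      integral_const_mul]
    have : ∫ y : ℤ, (y : ℝ) ∂ν = 0 := hν.mean_zero
    simp [this, mgf]
  obtain ⟨y, hy, hνy⟩ := hν.aperiodic.exists_ne 0
  have hpos : 0 < ∫ y : ℤ, (Real.exp (t * y) - (t * y + 1)) ∂ν := by
    rw [integral_pos_iff_support_of_nonneg (fun y => hnn y) hint]
    refine lt_of_lt_of_le (pos_iff_ne_zero.2 hνy) (measure_mono ?_)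
    rw [Set.singleton_subset_iff]
    have : t * (y : ℝ) ≠ 0 := mul_ne_zero h0 (by exact_mod_cast hy)
    exact (sub_pos.2 (Real.add_one_lt_exp this)).ne'
  linarith

lemma CenteredCramer.cgf_pos (hν : CenteredCramer ν) {t : ℝ} (h0 : t ≠ 0)
    (ht : t ∈ integrableExpSet castZ ν) : 0 < cgf castZ ν t :=
  Real.log_pos (hν.one_lt_mgf h0 ht)

/-- The exponentially tilted law. -/
def tiltStep (ν : Measure ℤ) (t : ℝ) : Measure ℤ := ν.tilted fun y => t * castZ y

lemma isProbabilityMeasure_tiltStep {t : ℝ} (ht : t ∈ integrableExpSet castZ ν) :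
    IsProbabilityMeasure (tiltStep ν t) :=
  isProbabilityMeasure_tilted ht

lemma tiltStep_singleton {t : ℝ} (ht : t ∈ integrableExpSet castZ ν) (y : ℤ) :
    tiltStep ν t {y} = ENNReal.ofReal (Real.exp (t * y - cgf castZ ν t)) * ν {y} := by
  rw [tiltStep, tilted_mul_apply_cgf _ ht, lintegral_singleton]

lemma mean_tiltStep {t : ℝ} (ht : t ∈ interior (integrableExpSet castZ ν)) :
    mean (tiltStep ν t) = deriv (cgf castZ ν) t :=
  integral_tilted_mul_self ht

lemma vari_tiltStep {t : ℝ} (ht : t ∈ interior (integrableExpSet castZ ν)) :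
    vari (tiltStep ν t) = iteratedDeriv 2 (cgf castZ ν) t :=
  variance_tilted_mul ht

lemma memLp_tiltStep {t : ℝ} (ht : t ∈ interior (integrableExpSet castZ ν)) :
    MemLp (fun y : ℤ => (y : ℝ)) 2 (tiltStep ν t) := by
  have := memLp_tilted_mul ht 2
  exact_mod_cast this

lemma aperiodic_tiltStep (hν : Aperiodic ν) {t : ℝ} (ht : t ∈ integrableExpSet castZ ν) :
    Aperiodic (tiltStep ν t) := fun h hh b hcon =>
  hν h hh b ((absolutelyContinuous_tilted ht).ae_le hcon)

lemma CenteredCramer.iteratedDeriv_two_cgf_pos (hν : CenteredCramer ν) {t : ℝ}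
    (ht : t ∈ interior (integrableExpSet castZ ν)) : 0 < iteratedDeriv 2 (cgf castZ ν) t := by
  have := isProbabilityMeasure_tiltStep (interior_subset ht)
  rw [← vari_tiltStep ht]
  exact (aperiodic_tiltStep hν.aperiodic (interior_subset ht)).vari_pos (memLp_tiltStep ht)

lemma hasDerivAt_cgf {t : ℝ} (ht : t ∈ interior (integrableExpSet castZ ν)) :
    HasDerivAt (cgf castZ ν) (deriv (cgf castZ ν) t) t :=
  (analyticAt_cgf ht).differentiableAt.hasDerivAt

lemma hasStrictDerivAt_deriv_cgf {t : ℝ} (ht : t ∈ interior (integrableExpSet castZ ν)) :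
    HasStrictDerivAt (deriv (cgf castZ ν)) (iteratedDeriv 2 (cgf castZ ν) t) t := by
  have := (analyticAt_cgf ht).deriv.hasStrictDerivAt
  rwa [iteratedDeriv_succ, iteratedDeriv_one]

lemma CenteredCramer.strictMonoOn_deriv_cgf (hν : CenteredCramer ν) :
    StrictMonoOn (deriv (cgf castZ ν)) (interior (integrableExpSet castZ ν)) := by
  refine strictMonoOn_of_deriv_pos (convex_integrableExpSet (X := castZ) (μ := ν)).interior
    (fun t ht => (hasStrictDerivAt_deriv_cgf ht).hasDerivAt.continuousAt.continuousWithinAt)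
    fun t ht => ?_
  rw [interior_interior] at ht
  rw [(hasStrictDerivAt_deriv_cgf ht).hasDerivAt.deriv]
  exact hν.iteratedDeriv_two_cgf_pos ht

lemma CenteredCramer.deriv_cgf_zero (hν : CenteredCramer ν) : deriv (cgf castZ ν) 0 = 0 := by
  rw [ProbabilityTheory.deriv_cgf_zero hν.zero_mem]
  have : ∫ y, castZ y ∂ν = 0 := hν.mean_zero
  simp [this]

lemma CenteredCramer.deriv_cgf_pos (hν : CenteredCramer ν) {t : ℝ} (h0 : 0 < t)
    (ht : t ∈ interior (integrableExpSet castZ ν)) : 0 < deriv (cgf castZ ν) t := by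
  rw [← hν.deriv_cgf_zero]
  exact hν.strictMonoOn_deriv_cgf hν.zero_mem ht h0

lemma CenteredCramer.mem_interior_of_le (hν : CenteredCramer ν) {s t : ℝ} (h0 : 0 ≤ s)
    (h : s ≤ t) (ht : t ∈ interior (integrableExpSet castZ ν)) :
    s ∈ interior (integrableExpSet castZ ν) := by
  rcases h.eq_or_lt with rfl | h
  · exact ht
  · exact hν.mem_interior h0 h (interior_subset ht)

lemma CenteredCramer.cgf_lt_cgf (hν : CenteredCramer ν) {s t : ℝ} (h0 : 0 ≤ s) (h : s < t)
    (ht : t ∈ interior (integrableExpSet castZ ν)) : cgf castZ ν s < cgf castZ ν t := by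
  refine strictMonoOn_of_deriv_pos (convex_Icc 0 t) (fun x hx => (hasDerivAt_cgf
    (hν.mem_interior_of_le hx.1 hx.2 ht)).continuousAt.continuousWithinAt) (fun x hx => ?_)
    ⟨h0, h.le⟩ ⟨h0.trans h.le, le_rfl⟩ h
  rw [interior_Icc] at hx
  exact hν.deriv_cgf_pos hx.1 (hν.mem_interior_of_le hx.1.le hx.2.le ht)

/-- Strict convexity and `Λ(0) = 0`: the chord slope `Λ(t) / t` is a derivative at an earlier point.
This is the inequality behind `u* < v*`. -/
lemma CenteredCramer.cgf_lt_mul_deriv (hν : CenteredCramer ν) {t : ℝ} (h0 : 0 < t)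
    (ht : t ∈ interior (integrableExpSet castZ ν)) :
    cgf castZ ν t < t * deriv (cgf castZ ν) t := by
  have hmem : ∀ x ∈ Set.Icc 0 t, x ∈ interior (integrableExpSet castZ ν) :=
    fun x hx => hν.mem_interior_of_le hx.1 hx.2 ht
  obtain ⟨ξ, hξ, he⟩ := exists_deriv_eq_slope (cgf castZ ν) h0
    (fun x hx => (hasDerivAt_cgf (hmem x hx)).continuousAt.continuousWithinAt)
    (fun x hx => (hasDerivAt_cgf (hmem x ⟨hx.1.le, hx.2.le⟩)).differentiableAt.differentiableWithinAt)
  rw [cgf_zero, sub_zero, sub_zero, eq_div_iff h0.ne'] at he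
  have := hν.strictMonoOn_deriv_cgf (hmem ξ ⟨hξ.1.le, hξ.2.le⟩) ht hξ.2
  nlinarith

/-- A centered law has `Λ'(0) = 0`, so `Λ` lies below every line of positive slope near zero. It
means that descending at a positive speed has a positive exponential cost. -/
lemma CenteredCramer.exists_cgf_lt (hν : CenteredCramer ν) {a : ℝ} (ha : 0 < a) {b : ℝ}
    (hb : 0 < b) :
    ∃ t, 0 < t ∧ t < b ∧ t ∈ interior (integrableExpSet castZ ν) ∧ cgf castZ ν t < a * t := by
  have hd := hasDerivAt_cgf hν.zero_mem
  rw [hν.deriv_cgf_zero, hasDerivAt_iff_isLittleO] at hd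
  have h1 := hd.def (half_pos ha)
  have h2 : ∀ᶠ t in 𝓝 (0 : ℝ), t ∈ interior (integrableExpSet castZ ν) :=
    isOpen_interior.mem_nhds hν.zero_mem
  have h3 : ∀ᶠ t in 𝓝 (0 : ℝ), t < b := gt_mem_nhds hb
  obtain ⟨t, ⟨⟨h1, h2⟩, h3⟩, h4⟩ := (((h1.and h2).and h3).filter_mono nhdsWithin_le_nhds |>.and
    (self_mem_nhdsWithin : ∀ᶠ t in 𝓝[>] (0 : ℝ), t ∈ Set.Ioi (0 : ℝ))).exists
  have h4 : 0 < t := h4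
  refine ⟨t, h4, h3, h2, ?_⟩
  simp only [cgf_zero, sub_zero, smul_zero, Real.norm_eq_abs, abs_of_pos h4] at h1
  have := le_abs_self (cgf castZ ν t)
  nlinarith

/-- The mean of the tilted law is `Λ'(t) > 0`. Under it the exponential moment at `-t` undoes the
tilt and equals `exp(-Λ(t)) < 1`, which supplies the Chernoff bound on the negative side. -/
lemma CenteredCramer.posDrift (hν : CenteredCramer ν) {t : ℝ} (h0 : 0 < t)
    (ht : t ∈ interior (integrableExpSet castZ ν)) : PosDrift (tiltStep ν t) where
  aperiodic := aperiodic_tiltStep hν.aperiodic (interior_subset ht)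
  vari_pos := by rw [vari_tiltStep ht]; exact hν.iteratedDeriv_two_cgf_pos ht
  memLp := memLp_tiltStep ht
  mean_pos := by rw [mean_tiltStep ht]; exact hν.deriv_cgf_pos h0 ht
  exists_mgf_lt := by
    have hmem : t ∈ integrableExpSet castZ ν := interior_subset ht
    refine ⟨t, h0, ?_, ?_⟩
    · rw [tiltStep, integrable_tilted_iff hmem]
      simp only [smul_eq_mul, ← Real.exp_add]
      simp
    · have := integral_tilted_mul_eq_cgf (μ := ν) (X := castZ) (t := t)
        (fun y : ℤ => Real.exp (-t * y)) hmem
      have h2 : mgf (fun y : ℤ => (y : ℝ)) (tiltStep ν t) (-t) =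
          Real.exp (-cgf castZ ν t) := by
        rw [mgf, tiltStep, this]
        have h3 : ∀ y : ℤ, t * castZ y - cgf castZ ν t + -t * (y : ℝ) = -cgf castZ ν t :=
          fun y => by simp only [castZ]; ring
        simp only [smul_eq_mul, ← Real.exp_add, h3]
        simp
      rw [h2, Real.exp_lt_one_iff]
      linarith [hν.cgf_pos h0.ne' (interior_subset ht)]

/-- The tangent inequality for the log-moment generating function. -/
lemma cgf_tangent_le {s t : ℝ} (hs : s ∈ integrableExpSet castZ ν)
    (ht : t ∈ interior (integrableExpSet castZ ν)) :
    cgf castZ ν t + (s - t) * deriv (cgf castZ ν) t ≤ cgf castZ ν s := by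
  have hmem : t ∈ integrableExpSet castZ ν := interior_subset ht
  have := isProbabilityMeasure_tiltStep hmem
  set x := deriv (cgf castZ ν) t with hx
  have hexp : ∫ y, Real.exp ((s - t) * castZ y) ∂(tiltStep ν t) =
      Real.exp (cgf castZ ν s - cgf castZ ν t) := by
    rw [tiltStep, integral_exp_tilted, Real.exp_sub, exp_cgf hs, exp_cgf hmem]
    simp only [mgf, Pi.add_apply]
    congr 2
    ext y
    congr 1; ring
  have hint : Integrable (fun y : ℤ => Real.exp ((s - t) * castZ y)) (tiltStep ν t) := by
    rw [tiltStep, integrable_tilted_iff hmem]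
    simp only [smul_eq_mul, ← Real.exp_add]
    refine Integrable.congr hs (ae_of_all _ fun y => ?_)
    simp only []
    congr 1; ring
  have hi : Integrable (fun y : ℤ => (y : ℝ)) (tiltStep ν t) :=
    (memLp_tiltStep ht).integrable (by norm_num)
  -- Jensen's inequality for the tilted law, whose mean is `x`, obtained by integrating `1 + w ≤ exp
  -- w`.
  have h1 : 1 ≤ ∫ y, Real.exp (-((s - t) * x)) * Real.exp ((s - t) * castZ y) ∂(tiltStep ν t) := by
    have h2 : ∫ y : ℤ, ((s - t) * ((y : ℝ) - x) + 1) ∂(tiltStep ν t) = 1 := by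
      have hi' : Integrable (fun y : ℤ => (s - t) * ((y : ℝ) - x)) (tiltStep ν t) :=
        (hi.sub (integrable_const x)).const_mul _
      rw [integral_add hi' (integrable_const 1),
        integral_const_mul, integral_sub hi (integrable_const x)]
      have : ∫ y : ℤ, (y : ℝ) ∂(tiltStep ν t) = x := mean_tiltStep ht
      simp [this]
    rw [← h2]
    refine integral_mono (((hi.sub (integrable_const x)).const_mul _).add (integrable_const 1))
      (hint.const_mul _) fun y => ?_
    simp only [← Real.exp_add]
    refine (Real.add_one_le_exp _).trans_eq ?_
    congr 1; simp only [castZ]; ring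
  rw [integral_const_mul, hexp, ← Real.exp_add, Real.one_le_exp_iff] at h1
  linarith

end

/-! ### The inverse of the log-moment generating function and the rate function -/

section

variable {ν : Measure ℤ} [IsProbabilityMeasure ν]

lemma logMGF_of_mem {t : ℝ} (ht : t ∈ integrableExpSet castZ ν) :
    logMGF ν castZ t = (cgf castZ ν t : EReal) := if_pos ht

lemma logMGF_lt_top_iff {t : ℝ} : logMGF ν castZ t < ⊤ ↔ t ∈ integrableExpSet castZ ν := by
  unfold logMGF
  split_ifs with h
  · exact ⟨fun _ => h, fun _ => EReal.coe_lt_top _⟩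
  · exact ⟨fun h' => absurd h' (lt_irrefl _), fun h' => absurd h' h⟩

/-- Fatou's lemma. It transfers a bound inside the domain to its endpoint, where finiteness is not
known beforehand. -/
lemma mem_integrableExpSet_of_mgf_le {R M : ℝ} {u : ℕ → ℝ} (hu : Tendsto u atTop (𝓝 R))
    (hi : ∀ n, u n ∈ integrableExpSet castZ ν) (hM : ∀ n, mgf castZ ν (u n) ≤ M) :
    R ∈ integrableExpSet castZ ν ∧ mgf castZ ν R ≤ M := by
  have hlin : ∀ n, ∫⁻ y, ENNReal.ofReal (Real.exp (u n * castZ y)) ∂ν ≤ ENNReal.ofReal M := by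
    intro n
    rw [← ofReal_integral_eq_lintegral_ofReal (hi n) (ae_of_all _ fun y => (Real.exp_pos _).le)]
    exact ENNReal.ofReal_le_ofReal (hM n)
  have hle : ∫⁻ y, ENNReal.ofReal (Real.exp (R * castZ y)) ∂ν ≤ ENNReal.ofReal M := by
    have h1 : ∀ y, ENNReal.ofReal (Real.exp (R * castZ y)) =
        liminf (fun n => ENNReal.ofReal (Real.exp (u n * castZ y))) atTop := fun y =>
      ((ENNReal.continuous_ofReal.tendsto _).comp
        ((Real.continuous_exp.tendsto _).comp (hu.mul_const _))).liminf_eq.symm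
    simp_rw [h1]
    refine (lintegral_liminf_le fun n => Measurable.of_discrete).trans ?_
    refine (liminf_le_liminf (Eventually.of_forall hlin)).trans ?_
    simp
  have hR : R ∈ integrableExpSet castZ ν := by
    refine ⟨Measurable.of_discrete.aestronglyMeasurable, ?_⟩
    rw [hasFiniteIntegral_iff_ofReal (ae_of_all _ fun y => (Real.exp_pos _).le)]
    exact hle.trans_lt ENNReal.ofReal_lt_top
  refine ⟨hR, ?_⟩
  have hM0 : 0 ≤ M := mgf_nonneg.trans (hM 0)
  rw [← ofReal_integral_eq_lintegral_ofReal hR (ae_of_all _ fun y => (Real.exp_pos _).le),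
    ENNReal.ofReal_le_ofReal_iff hM0] at hle
  exact hle

/-- Either the equation `Λ(t) = F` has a positive solution inside the domain, or the log-moment
generating function is finite and at most `F` at a finite radius of convergence. -/
lemma CenteredCramer.exists_root_or (hν : CenteredCramer ν) {F : ℝ} (hF : 0 < F) :
    (∃ t, 0 < t ∧ t ∈ interior (integrableExpSet castZ ν) ∧ cgf castZ ν t = F) ∨
    ∃ R : ℝ, 0 < R ∧ R ∈ integrableExpSet castZ ν ∧ radius ν castZ = (R : EReal) ∧
      0 < cgf castZ ν R ∧ cgf castZ ν R ≤ F := by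
  set D := interior (integrableExpSet castZ ν) with hD
  by_cases hex : ∃ t, 0 ≤ t ∧ t ∈ D ∧ F ≤ cgf castZ ν t
  · left
    obtain ⟨t, h0, ht, hFt⟩ := hex
    have hc : ContinuousOn (cgf castZ ν) (Set.Icc 0 t) := fun x hx =>
      (hasDerivAt_cgf (hν.mem_interior_of_le hx.1 hx.2 ht)).continuousAt.continuousWithinAt
    obtain ⟨s, hs, hsF⟩ := intermediate_value_Icc h0 hc
      (⟨by rw [cgf_zero]; exact hF.le, hFt⟩ : F ∈ Set.Icc (cgf castZ ν 0) (cgf castZ ν t))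
    refine ⟨s, lt_of_le_of_ne hs.1 ?_, hν.mem_interior_of_le hs.1 hs.2 ht, hsF⟩
    rintro rfl
    rw [cgf_zero] at hsF
    exact hF.ne hsF
  · right
    push Not at hex
    obtain ⟨p, hp, hνp⟩ := (hν.aperiodic.exists_pos_neg hν.integrable hν.mean_zero).1
    set S : Set ℝ := {t | 0 ≤ t ∧ t ∈ D} with hS
    have hνp' : 0 < ν.real {(p : ℤ)} :=
      ENNReal.toReal_pos hνp (measure_ne_top _ _)
    have hmgf : ∀ t ∈ S, mgf castZ ν t ≤ Real.exp F := by
      intro t ht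
      rw [← exp_cgf (interior_subset (s := integrableExpSet castZ ν) ht.2)]
      exact Real.exp_le_exp.2 (hex t ht.1 ht.2).le
    -- A positive atom `p` forces the moment generating function to grow at least like `exp(t p)`,
    -- so it cannot stay below `exp F` on an unbounded set.
    have hbdd : BddAbove S := by
      refine ⟨F - Real.log (ν.real {(p : ℤ)}), fun t ht => ?_⟩
      have h1 : Real.exp (t * p) * ν.real {(p : ℤ)} ≤ mgf castZ ν t := by
        have h2 : ∫ y in {(p : ℤ)}, Real.exp (t * castZ y) ∂ν ≤ mgf castZ ν t :=
          setIntegral_le_integral (interior_subset (s := integrableExpSet castZ ν) ht.2)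
            (ae_of_all _ fun y => (Real.exp_pos _).le)
        rw [integral_singleton] at h2
        simpa [mul_comm] using h2
      have h3 := h1.trans (hmgf t ht)
      rw [← Real.exp_log hνp', ← Real.exp_add, Real.exp_le_exp] at h3
      have : (1 : ℝ) ≤ p := by exact_mod_cast hp
      nlinarith [ht.1]
    have hne : S.Nonempty := ⟨0, le_rfl, hν.zero_mem⟩
    set R := sSup S with hR
    obtain ⟨t0, ht0, -, ht0D, -⟩ := hν.exists_cgf_lt one_pos one_pos
    have hR0 : 0 < R := ht0.trans_le (le_csSup hbdd ⟨ht0.le, ht0D⟩)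
    obtain ⟨u, -, hu, huS⟩ := exists_seq_tendsto_sSup hne hbdd
    obtain ⟨hRm, hRM⟩ := mem_integrableExpSet_of_mgf_le hu
      (fun n => interior_subset (huS n).2) (fun n => hmgf _ (huS n))
    refine ⟨R, hR0, hRm, ?_, hν.cgf_pos hR0.ne' hRm, ?_⟩
    -- If an exponential moment were finite at some `t > R`, the midpoint of `R` and `t` would be
    -- interior to the domain and would exceed the supremum `R`.
    · refine le_antisymm (sSup_le ?_) (le_sSup ⟨R, rfl, hR0.le, logMGF_lt_top_iff.2 hRm⟩)
      rintro _ ⟨t, rfl, ht, htt⟩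
      rw [logMGF_lt_top_iff] at htt
      by_contra hcon
      rw [EReal.coe_le_coe_iff, not_le] at hcon
      have h4 : (R + t) / 2 ∈ S :=
        ⟨by linarith, hν.mem_interior (by linarith) (by linarith : (R + t) / 2 < t) htt⟩
      have := le_csSup hbdd h4
      linarith
    · rw [cgf, Real.log_le_iff_le_exp (mgf_pos hRm)]
      exact hRM

lemma CenteredCramer.logMGFInv_eq (hν : CenteredCramer ν) {t : ℝ} (h0 : 0 < t)
    (ht : t ∈ interior (integrableExpSet castZ ν)) : logMGFInv ν castZ (cgf castZ ν t) = t := by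
  refine IsLeast.csInf_eq ⟨⟨h0.le, (logMGF_of_mem (interior_subset ht)).ge⟩, ?_⟩
  rintro s ⟨hs0, hs⟩
  by_contra! hst
  have hsD := hν.mem_interior_of_le hs0 hst.le ht
  rw [logMGF_of_mem (interior_subset hsD), EReal.coe_le_coe_iff] at hs
  exact absurd (hν.cgf_lt_cgf hs0 hst ht) hs.not_gt

lemma CenteredCramer.slope_eq (hν : CenteredCramer ν) {t : ℝ} (h0 : 0 < t)
    (ht : t ∈ interior (integrableExpSet castZ ν)) :
    slope ν castZ (cgf castZ ν t) = deriv (cgf castZ ν) t := by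
  rw [slope, hν.logMGFInv_eq h0 ht]
  refine Filter.EventuallyEq.deriv_eq ?_
  filter_upwards [isOpen_interior.mem_nhds ht] with s hs
  rw [logMGF_of_mem (interior_subset hs), EReal.toReal_coe]

/-- Legendre duality: the tangent inequality at `t` says that the supremum defining the rate
function at the slope `Λ'(t)` is attained at `t`. -/
lemma rateFn_deriv_cgf {t : ℝ} (h0 : 0 < t) (ht : t ∈ interior (integrableExpSet castZ ν)) :
    rateFn ν castZ (deriv (cgf castZ ν) t) =
      ((t * deriv (cgf castZ ν) t - cgf castZ ν t : ℝ) : EReal) := by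
  refine le_antisymm (iSup₂_le fun s _ => ?_) ?_
  · by_cases hs : s ∈ integrableExpSet castZ ν
    · rw [logMGF_of_mem hs, ← EReal.coe_sub, EReal.coe_le_coe_iff]
      have := cgf_tangent_le hs ht
      linarith
    · have : logMGF ν castZ s = ⊤ := if_neg hs
      rw [this]
      simp
  · refine le_iSup₂_of_le t h0.le ?_
    rw [logMGF_of_mem (interior_subset ht), EReal.coe_sub]

/-- Near `x = Λ'(t)` the derivative of the rate function is the local inverse of `Λ'`, since the
terms containing the derivative of the inverse cancel. The inverse function theorem then gives its
derivative. -/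
lemma CenteredCramer.rateFnSecond_eq (hν : CenteredCramer ν) {t : ℝ} (h0 : 0 < t)
    (ht : t ∈ interior (integrableExpSet castZ ν)) :
    rateFnSecond ν castZ (deriv (cgf castZ ν) t) = (iteratedDeriv 2 (cgf castZ ν) t)⁻¹ := by
  set x := deriv (cgf castZ ν) t with hx
  have hne : ∀ s ∈ interior (integrableExpSet castZ ν), iteratedDeriv 2 (cgf castZ ν) s ≠ 0 :=
    fun s hs => (hν.iteratedDeriv_two_cgf_pos hs).ne'
  have hst := (hasStrictDerivAt_deriv_cgf ht).hasStrictFDerivAt_equiv (hne t ht)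
  set e := hst.toOpenPartialHomeomorph (deriv (cgf castZ ν)) with he
  have hcoe : ∀ s, e s = deriv (cgf castZ ν) s := fun s => rfl
  have hxt : x ∈ e.target := hst.image_mem_toOpenPartialHomeomorph_target
  have hsx : e.symm x = t := e.left_inv hst.mem_toOpenPartialHomeomorph_source
  have hev : ∀ᶠ y in 𝓝 x, y ∈ e.target ∧ 0 < e.symm y ∧
      e.symm y ∈ interior (integrableExpSet castZ ν) := by
    have hc : Tendsto e.symm (𝓝 x) (𝓝 t) := by
      have := (e.symm.continuousAt hxt).tendsto
      rwa [hsx] at this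
    filter_upwards [e.open_target.mem_nhds hxt, hc.eventually (lt_mem_nhds h0),
      hc.eventually (isOpen_interior.mem_nhds ht)] with y h1 h2 h3 using ⟨h1, h2, h3⟩
  have hval : ∀ᶠ y in 𝓝 x, (rateFn ν castZ y).toReal =
      e.symm y * y - cgf castZ ν (e.symm y) := by
    filter_upwards [hev] with y hy
    have hy' : deriv (cgf castZ ν) (e.symm y) = y := e.right_inv hy.1
    have := rateFn_deriv_cgf hy.2.1 hy.2.2
    rw [hy'] at this
    rw [this, EReal.toReal_coe]
  have hsymm : ∀ y, y ∈ e.target → e.symm y ∈ interior (integrableExpSet castZ ν) →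
      HasDerivAt e.symm (iteratedDeriv 2 (cgf castZ ν) (e.symm y))⁻¹ y := fun y h1 h2 =>
    e.hasDerivAt_symm h1 (hne _ h2) (hasStrictDerivAt_deriv_cgf h2).hasDerivAt
  have hderiv : ∀ᶠ y in 𝓝 x, deriv (fun y => (rateFn ν castZ y).toReal) y = e.symm y := by
    filter_upwards [hev, hval.eventually_nhds] with y hy hvy
    have hy' : deriv (cgf castZ ν) (e.symm y) = y := e.right_inv hy.1
    rw [Filter.EventuallyEq.deriv_eq hvy]
    have h1 := hsymm y hy.1 hy.2.2
    have h2 := (h1.mul (hasDerivAt_id y)).sub ((hasDerivAt_cgf hy.2.2).comp y h1)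
    rw [hy'] at h2
    refine (HasDerivAt.deriv (f' := e.symm y) (h2.congr_deriv ?_))
    simp only [id]
    ring
  rw [rateFnSecond, Filter.EventuallyEq.deriv_eq hderiv, (hsymm x hxt (hsx ▸ ht)).deriv, hsx]

lemma mgf_neg_law (t : ℝ) : mgf castZ (ν.map Neg.neg) t = mgf castZ ν (-t) := by
  rw [mgf_map Measurable.of_discrete.aemeasurable Measurable.of_discrete.aestronglyMeasurable]
  simp [mgf]

lemma cgf_neg_law (t : ℝ) : cgf castZ (ν.map Neg.neg) t = cgf castZ ν (-t) := by
  rw [cgf, mgf_neg_law, cgf]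

lemma mem_integrableExpSet_neg_law (t : ℝ) :
    t ∈ integrableExpSet castZ (ν.map Neg.neg) ↔ -t ∈ integrableExpSet castZ ν := by
  have : integrableExpSet castZ (ν.map Neg.neg) = {t | Integrable _ _} := rfl
  rw [this, Set.mem_ofPred_eq, integrable_map_measure
    Measurable.of_discrete.aestronglyMeasurable Measurable.of_discrete.aemeasurable]
  have h2 : (fun y => Real.exp (t * castZ y)) ∘ Neg.neg = fun y : ℤ => Real.exp (-t * castZ y) := by
    ext y; simp
  rw [h2]; rfl

lemma CenteredCramer.neg (hν : CenteredCramer ν) : CenteredCramer (ν.map Neg.neg) where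
  aperiodic := by
    intro h hh b hcon
    rw [ae_map_iff Measurable.of_discrete.aemeasurable (MeasurableSet.of_discrete)] at hcon
    refine hν.aperiodic h hh (-b) ?_
    filter_upwards [hcon] with y hy
    have : y - -b = -(-y - b) := by ring
    rw [this, dvd_neg]
    exact hy
  zero_mem := by
    have h1 : integrableExpSet castZ (ν.map Neg.neg) = Neg.neg ⁻¹' integrableExpSet castZ ν := by
      ext t; exact mem_integrableExpSet_neg_law t
    rw [h1]
    refine preimage_interior_subset_interior_preimage continuous_neg ?_
    simpa using hν.zero_mem
  mean_zero := by
    rw [mean, integral_map Measurable.of_discrete.aemeasurable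
      Measurable.of_discrete.aestronglyMeasurable]
    have := hν.mean_zero
    rw [mean] at this
    simp [integral_neg, this]

end

/-! ### Transfer of the constants to the law of the step -/

section

variable {Ω : Type*} [MeasurableSpace Ω] {P : Measure Ω} {X : ℕ → Ω → ℤ}

lemma logMGF_map {f : Ω → ℤ} (hf : Measurable f) :
    logMGF (P.map f) castZ = logMGF P fun ω => (f ω : ℝ) := by
  ext t
  unfold logMGF
  rw [integrable_map_measure Measurable.of_discrete.aestronglyMeasurable hf.aemeasurable]
  congr 2
  rw [cgf, mgf_map hf.aemeasurable Measurable.of_discrete.aestronglyMeasurable]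
  rfl

lemma logMGF_incPos (h : Measurable (X 0)) :
    logMGF P (incPos X) = logMGF (P.map (X 0)) castZ := (logMGF_map h).symm

lemma logMGF_incNeg (h : Measurable (X 0)) :
    logMGF P (incNeg X) = logMGF ((P.map (X 0)).map Neg.neg) castZ := by
  rw [Measure.map_map Measurable.of_discrete h, logMGF_map (Measurable.of_discrete.comp h)]
  congr 1
  ext ω
  simp [incNeg]

/-- Slopes, rate functions and radii depend on the random variable only through its log-moment
generating function, so they may be computed for the law on the integers. -/
lemma slope_congr {Ω' : Type*} [MeasurableSpace Ω'] {P' : Measure Ω'} {Y : Ω → ℝ} {Y' : Ω' → ℝ}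
    (h : logMGF P Y = logMGF P' Y') : slope P Y = slope P' Y' := by
  funext x
  simp only [slope, logMGFInv, h]

lemma rateFnSecond_congr {Ω' : Type*} [MeasurableSpace Ω'] {P' : Measure Ω'} {Y : Ω → ℝ}
    {Y' : Ω' → ℝ} (h : logMGF P Y = logMGF P' Y') : rateFnSecond P Y = rateFnSecond P' Y' := by
  have h1 : rateFn P Y = rateFn P' Y' := by funext x; simp only [rateFn, h]
  funext x
  simp only [rateFnSecond, h1]

lemma radius_congr {Ω' : Type*} [MeasurableSpace Ω'] {P' : Measure Ω'} {Y : Ω → ℝ}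
    {Y' : Ω' → ℝ} (h : logMGF P Y = logMGF P' Y') : radius P Y = radius P' Y' := by
  simp only [radius, h]

end

/-! ### Decomposition of the constrained paths at the first and the last contact -/

/-- The event that the walk is a bridge of length `N` above `-d` which visits `-d` exactly `k`
times, for the first time at `l` and for the last time at `r`. -/
def IsWell (d : ℤ) (N l r k : ℕ) (ω : ℕ → ℤ) : Prop :=
  (∀ i ≤ N, -d ≤ psum i ω) ∧ psum N ω = 0 ∧ (∀ i < l, psum i ω ≠ -d) ∧ psum l ω = -d ∧
    psum r ω = -d ∧ (∀ i, r < i → i ≤ N → psum i ω ≠ -d) ∧ visits (-d) N ω = k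

/-- The event that the walk is a bridge of length `N` which stays above `-d`. -/
def NoVisit (d : ℤ) (N : ℕ) (ω : ℕ → ℤ) : Prop :=
  (∀ i ≤ N, -d ≤ psum i ω) ∧ psum N ω = 0 ∧ ∀ i ≤ N, psum i ω ≠ -d

lemma finDep_isWell {d : ℤ} {N l r k : ℕ} (hl : l ≤ N) (hr : r ≤ N) :
    FinDep N (IsWell d N l r k) :=
  FinDep.of_psum fun a b h ha => ⟨fun i hi => by rw [← h i hi]; exact ha.1 i hi,
    by rw [← h N le_rfl]; exact ha.2.1,
    fun i hi => by rw [← h i (by omega)]; exact ha.2.2.1 i hi,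
    by rw [← h l hl]; exact ha.2.2.2.1, by rw [← h r hr]; exact ha.2.2.2.2.1,
    fun i hi hi' => by rw [← h i hi']; exact ha.2.2.2.2.2.1 i hi hi',
    by rw [← visits_congr h]; exact ha.2.2.2.2.2.2⟩

lemma finDep_noVisit (d : ℤ) (N : ℕ) : FinDep N (NoVisit d N) :=
  FinDep.of_psum fun a b h ha => ⟨fun i hi => by rw [← h i hi]; exact ha.1 i hi,
    by rw [← h N le_rfl]; exact ha.2.1, fun i hi => by rw [← h i hi]; exact ha.2.2 i hi⟩

/-- The probability of a bridge with prescribed first and last contacts and number of contacts. -/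
def wellProb (ν : Measure ℤ) (d : ℤ) (N l r k : ℕ) : ℝ :=
  (pathMeasure ν).real {ω | IsWell d N l r k ω}

/-- The probability of a bridge without contacts. -/
def noVisitProb (ν : Measure ℤ) (d : ℤ) (N : ℕ) : ℝ := (pathMeasure ν).real {ω | NoVisit d N ω}

/-- Since `d ≥ 1`, time zero is not a contact. The first contact thus counts for one visit, the
bridge between `l` and `l + n` for `j` more and the last piece for none, which explains `j + 1`. -/
lemma isWell_iff {d : ℤ} (hd : 1 ≤ d) (l n p j : ℕ) (ω : ℕ → ℤ) :
    IsWell d (l + n + p) l (l + n) (j + 1) ω ↔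
      ((∀ i < l, -d < psum i ω) ∧ psum l ω = -d) ∧
        (IsReturn j n (shift l ω) ∧ ((∀ i, 1 ≤ i → i ≤ p → 0 < psum i (shift n (shift l ω))) ∧
          psum p (shift n (shift l ω)) = d)) := by
  have hvis : psum l ω = -d → (∀ i < l, psum i ω ≠ -d) → psum (l + n) ω = -d →
      (∀ i, l + n < i → i ≤ l + n + p → psum i ω ≠ -d) →
      visits (-d) (l + n + p) ω = 1 + visits 0 n (shift l ω) := by
    intro h1 h2 h3 h4
    have hl : 1 ≤ l := by
      by_contra hl
      obtain rfl : l = 0 := by omega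
      rw [psum_zero] at h1; omega
    rw [add_assoc, visits_add, visits_add, visits_eq_one hl (fun i _ hi => h2 i hi) h1, h1,
      sub_self, visits_eq_zero (n := p), add_zero]
    intro i hi hi'
    rw [psum_shift, psum_shift, psum_shift]
    have := h4 (l + n + i) (by omega) (by omega)
    rw [show l + (n + i) = l + n + i by ring]
    omega
  constructor
  · rintro ⟨h1, h2, h3, h4, h5, h6, h7⟩
    rw [hvis h4 h3 h5 h6] at h7
    refine ⟨⟨fun i hi => lt_of_le_of_ne (h1 i (by omega)) (h3 i hi).symm, h4⟩,
      ⟨fun i hi => ?_, ?_, by omega⟩, fun i hi hi' => ?_, ?_⟩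
    · rw [psum_shift, h4]
      have := h1 (l + i) (by omega)
      omega
    · rw [psum_shift, h4, h5]; ring
    · rw [psum_shift, psum_shift, psum_shift, h4, h5, show l + (n + i) = l + n + i by ring]
      have h8 := h1 (l + n + i) (by omega)
      have h9 := h6 (l + n + i) (by omega) (by omega)
      omega
    · rw [psum_shift, psum_shift, psum_shift, h4, h5, show l + (n + p) = l + n + p by ring, h2]
      ring
  · rintro ⟨⟨h1, h2⟩, ⟨h3, h4, h5⟩, h6, h7⟩
    have e1 : ∀ i, psum i (shift l ω) = psum (l + i) ω + d := fun i => by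
      rw [psum_shift, h2]; ring
    have e2 : psum (l + n) ω = -d := by rw [e1] at h4; omega
    have e3 : ∀ i, psum i (shift n (shift l ω)) = psum (l + n + i) ω + d := fun i => by
      rw [psum_shift, e1, e1, e2, add_assoc]; ring
    have hlast : ∀ i, l + n < i → i ≤ l + n + p → -d < psum i ω := by
      intro i hi hi'
      have := h6 (i - (l + n)) (by omega) (by omega)
      rw [e3, show l + n + (i - (l + n)) = i by omega] at this
      omega
    have hfirst : ∀ i < l, psum i ω ≠ -d := fun i hi => (h1 i hi).ne'
    refine ⟨fun i hi => ?_, ?_, hfirst, h2, e2, fun i hi hi' => (hlast i hi hi').ne', ?_⟩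
    · rcases lt_or_ge i l with hil | hil
      · exact (h1 i hil).le
      · rcases le_or_gt i (l + n) with hin | hin
        · have := h3 (i - l) (by omega)
          rw [e1, show l + (i - l) = i by omega] at this
          omega
        · exact (hlast i hin hi).le
    · rw [e3] at h7; omega
    · rw [hvis h2 hfirst e2 fun i hi hi' => (hlast i hi hi').ne', h5]; ring

section

variable (ν : Measure ℤ) [IsProbabilityMeasure ν]

lemma isProbabilityMeasure_neg_law : IsProbabilityMeasure (ν.map Neg.neg) :=
  Measure.isProbabilityMeasure_map Measurable.of_discrete.aemeasurable

lemma firstHit_neg_law (l : ℕ) (d : ℤ) :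
    firstHit (ν.map Neg.neg) l d =
      (pathMeasure ν).real {ω | (∀ i < l, -d < psum i ω) ∧ psum l ω = -d} := by
  rw [firstHit, pathMeasureReal_neg ν (finDep_firstHit l d)]
  congr 1; ext ω
  simp only [psum_neg, Set.mem_ofPred_eq]
  refine and_congr (forall₂_congr fun i _ => ?_) ?_ <;> omega

lemma finDep_firstHit_neg (l : ℕ) (d : ℤ) :
    FinDep l fun ω => (∀ i < l, -d < psum i ω) ∧ psum l ω = -d :=
  FinDep.and (FinDep.of_psum fun a b h ha i hi => by rw [← h i hi.le]; exact ha i hi)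
    (finDep_psum_eq l (-d))

/-- The decomposition of the constrained paths into three independent pieces. -/
lemma wellProb_eq {d : ℤ} (hd : 1 ≤ d) (l n p j : ℕ) :
    wellProb ν d (l + n + p) l (l + n) (j + 1) =
      firstHit (ν.map Neg.neg) l d * returnProb ν j n * stayPos ν p d := by
  have h : {ω | IsWell d (l + n + p) l (l + n) (j + 1) ω} = {ω | _} :=
    Set.ext fun ω => isWell_iff hd l n p j ω
  rw [wellProb, h, pathMeasureReal_and_shift ν (finDep_firstHit_neg l d)
    ((FinDep.mono (Nat.le_add_right n p) (finDep_isReturn j n)).and ((finDep_stayPos p d).shift n)),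
    pathMeasureReal_and_shift ν (finDep_isReturn j n) (finDep_stayPos p d), firstHit_neg_law,
    returnProb, stayPos, mul_assoc]

/-- Visits are counted from time `1` on; as `d ≥ 1`, a first contact takes place at a positive time
and is counted, whence `1 ≤ k`. -/
lemma wellProb_eq_zero {d : ℤ} (hd : 1 ≤ d) {N l r k : ℕ}
    (h : ¬ (l ≤ r ∧ r ≤ N ∧ 1 ≤ k ∧ k ≤ N)) (hl : l ≤ N) (hr : r ≤ N) :
    wellProb ν d N l r k = 0 := by
  have : {ω | IsWell d N l r k ω} = ∅ := by
    refine Set.eq_empty_of_forall_notMem fun ω hω => h ?_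
    obtain ⟨h1, h2, h3, h4, h5, h6, h7⟩ := hω
    refine ⟨?_, hr, ?_, by rw [← h7]; exact visits_le _ _ _⟩
    · by_contra! hlt
      exact h3 r hlt h5
    · by_contra hk
      obtain rfl : k = 0 := by omega
      rw [visits, Finset.sum_eq_zero_iff] at h7
      have hl1 : 1 ≤ l := by
        by_contra hl
        obtain rfl : l = 0 := by omega
        rw [psum_zero] at h4; omega
      have := h7 (l - 1) (Finset.mem_range.2 (by omega))
      rw [show l - 1 + 1 = l by omega, if_pos h4] at this
      exact one_ne_zero this
  rw [wellProb, this]; simp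

lemma firstHit_tilt {t : ℝ} (ht : t ∈ integrableExpSet castZ ν) (n : ℕ) (d : ℤ) :
    firstHit ν n d = Real.exp (n * cgf castZ ν t - t * d) * firstHit (tiltStep ν t) n d := by
  have := isProbabilityMeasure_tiltStep ht
  exact pathMeasureReal_tilt ν (tiltStep_singleton ht) (finDep_firstHit n d) fun x h => h.2

lemma stayPos_tilt {t : ℝ} (ht : t ∈ integrableExpSet castZ ν) (n : ℕ) (d : ℤ) :
    stayPos ν n d = Real.exp (n * cgf castZ ν t - t * d) * stayPos (tiltStep ν t) n d := by
  have := isProbabilityMeasure_tiltStep ht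
  exact pathMeasureReal_tilt ν (tiltStep_singleton ht) (finDep_stayPos n d) fun x h => h.2

end

/-! ### The Gibbs measure in terms of the canonical path space -/

/-- The event that the first and the last visits of `-d` up to time `N` take place at `l` and `r`,
and that there are `k` visits after time `0`. -/
def IsContact (d : ℤ) (N l r k : ℕ) (ω : ℕ → ℤ) : Prop :=
  (∀ i < l, psum i ω ≠ -d) ∧ psum l ω = -d ∧ psum r ω = -d ∧
    (∀ i, r < i → i ≤ N → psum i ω ≠ -d) ∧ visits (-d) N ω = k

lemma finDep_isContact {d : ℤ} {N l r k : ℕ} (hl : l ≤ N) (hr : r ≤ N) :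
    FinDep N (IsContact d N l r k) :=
  FinDep.of_psum fun a b h ha => ⟨fun i hi => by rw [← h i (by omega)]; exact ha.1 i hi,
    by rw [← h l hl]; exact ha.2.1, by rw [← h r hr]; exact ha.2.2.1,
    fun i hi hi' => by rw [← h i hi']; exact ha.2.2.2.1 i hi hi',
    by rw [← visits_congr h]; exact ha.2.2.2.2⟩

/-- The possible values of the first and the last contacts and of the number of contacts. -/
def triples (N : ℕ) : Finset (ℕ × ℕ × ℕ) :=
  (Finset.range (N + 1) ×ˢ Finset.range (N + 1) ×ˢ Finset.range (N + 1)).filter fun x =>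
    x.1 ≤ x.2.1 ∧ 1 ≤ x.2.2

lemma mem_triples {N : ℕ} {x : ℕ × ℕ × ℕ} :
    x ∈ triples N ↔ x.1 ≤ x.2.1 ∧ x.2.1 ≤ N ∧ 1 ≤ x.2.2 ∧ x.2.2 ≤ N := by
  simp only [triples, Finset.mem_filter, Finset.mem_product, Finset.mem_range]
  omega

/-- The unnormalized Gibbs weight of a value of the contact triple. -/
def tripleWeight (ν : Measure ℤ) (lam : ℝ) (d : ℤ) (N : ℕ) (x : ℕ × ℕ × ℕ) : ℝ :=
  if x ∈ triples N then lam ^ x.2.2 * wellProb ν d N x.1 x.2.1 x.2.2 else 0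

lemma noVisitProb_nonneg (ν : Measure ℤ) (d : ℤ) (N : ℕ) : 0 ≤ noVisitProb ν d N :=
  measureReal_nonneg

lemma tripleWeight_nonneg {lam : ℝ} (hlam : 0 ≤ lam) (ν : Measure ℤ) (d : ℤ) (N : ℕ)
    (x : ℕ × ℕ × ℕ) : 0 ≤ tripleWeight ν lam d N x := by
  unfold tripleWeight
  split_ifs
  · exact mul_nonneg (by positivity) measureReal_nonneg
  · exact le_rfl

lemma tripleWeight_of_not {lam : ℝ} {ν : Measure ℤ} {d : ℤ} {N : ℕ} {x : ℕ × ℕ × ℕ}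
    (h : ¬ (x.1 ≤ x.2.1 ∧ 1 ≤ x.2.2)) : tripleWeight ν lam d N x = 0 :=
  if_neg fun h' => h ⟨(mem_triples.1 h').1, (mem_triples.1 h').2.2.1⟩

section

variable {Ω : Type*} [MeasurableSpace Ω] {P : Measure Ω} {X : ℕ → Ω → ℤ}

/-- The steps of the walk. -/
def steps (X : ℕ → Ω → ℤ) (ω : Ω) : ℕ → ℤ := fun i => X i ω

lemma walk_eq_psum (n : ℕ) (ω : Ω) : walk X n ω = psum n (steps X ω) := rfl

lemma numContacts_eq_visits (a : ℝ) (N : ℕ) (ω : Ω) :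
    numContacts X a N ω = visits (-depth a N) N (steps X ω) := by
  rw [numContacts, Finset.card_filter, visits, Finset.range_eq_Ico,
    Finset.sum_Ico_add' (fun k => if psum k (steps X ω) = -depth a N then 1 else 0) 0 N 1]
  rfl

lemma mem_contactTimes {a : ℝ} {N n : ℕ} {ω : Ω} :
    n ∈ contactTimes X a N ω ↔ n ≤ N ∧ psum n (steps X ω) = -depth a N := by
  rw [contactTimes, Finset.mem_filter, Finset.mem_range, walk_eq_psum]
  omega

lemma leftContact_eq_iff {a : ℝ} {N l : ℕ} {ω : Ω} :
    leftContact X a N ω = (l : ℕ∞) ↔ l ≤ N ∧ psum l (steps X ω) = -depth a N ∧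
      ∀ i < l, psum i (steps X ω) ≠ -depth a N := by
  rw [leftContact]
  constructor
  · intro h
    rcases (contactTimes X a N ω).eq_empty_or_nonempty with he | hne
    · rw [he, Finset.inf_empty] at h
      exact absurd h.symm (ENat.natCast_ne_top l)
    obtain ⟨m, hm, hml⟩ := Finset.exists_mem_eq_inf _ hne fun n : ℕ => (n : ℕ∞)
    rw [h, Nat.cast_inj] at hml
    subst hml
    rw [mem_contactTimes] at hm
    refine ⟨hm.1, hm.2, fun i hi hc => ?_⟩
    have h2 : (contactTimes X a N ω).inf (fun n => (n : ℕ∞)) ≤ (i : ℕ∞) :=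
      Finset.inf_le (mem_contactTimes.2 ⟨by omega, hc⟩)
    rw [h, Nat.cast_le] at h2
    omega
  · rintro ⟨h1, h2, h3⟩
    refine le_antisymm (Finset.inf_le (mem_contactTimes.2 ⟨h1, h2⟩)) (Finset.le_inf fun i hi => ?_)
    rw [mem_contactTimes] at hi
    by_contra hcon
    exact h3 i (by simpa using hcon) hi.2

lemma rightContact_eq_iff {a : ℝ} {N r : ℕ} {ω : Ω} :
    rightContact X a N ω = (r : ℕ∞) ↔ r ≤ N ∧ psum r (steps X ω) = -depth a N ∧
      ∀ i, r < i → i ≤ N → psum i (steps X ω) ≠ -depth a N := by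
  rw [rightContact]
  constructor
  · intro h
    split_ifs at h with hne
    · obtain ⟨m, hm, hml⟩ := Finset.exists_mem_eq_sup _ hne fun n : ℕ => (n : ℕ∞)
      rw [h, Nat.cast_inj] at hml
      subst hml
      rw [mem_contactTimes] at hm
      refine ⟨hm.1, hm.2, fun i hi hi' hc => ?_⟩
      have h2 : (i : ℕ∞) ≤ (contactTimes X a N ω).sup (fun n => (n : ℕ∞)) :=
        Finset.le_sup (f := fun n : ℕ => (n : ℕ∞)) (mem_contactTimes.2 ⟨hi', hc⟩)
      rw [h, Nat.cast_le] at h2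
      omega
    · exact absurd h.symm (ENat.natCast_ne_top r)
  · rintro ⟨h1, h2, h3⟩
    have hmem : r ∈ contactTimes X a N ω := mem_contactTimes.2 ⟨h1, h2⟩
    rw [if_pos ⟨r, hmem⟩]
    refine le_antisymm (Finset.sup_le fun i hi => ?_)
      (Finset.le_sup (f := fun n : ℕ => (n : ℕ∞)) hmem)
    rw [mem_contactTimes] at hi
    by_contra hcon
    exact h3 i (by simpa using hcon) hi.1 hi.2

/-- The event that the contacts have prescribed first and last times and cardinality. -/
def contactEvent (X : ℕ → Ω → ℤ) (a : ℝ) (N : ℕ) (x : ℕ × ℕ × ℕ) : Set Ω :=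
  {ω | leftContact X a N ω = (x.1 : ℕ∞) ∧ rightContact X a N ω = (x.2.1 : ℕ∞) ∧
    numContacts X a N ω = x.2.2}

lemma mem_contactEvent {a : ℝ} {N : ℕ} {x : ℕ × ℕ × ℕ} {ω : Ω} :
    ω ∈ contactEvent X a N x ↔
      x.1 ≤ N ∧ x.2.1 ≤ N ∧ IsContact (depth a N) N x.1 x.2.1 x.2.2 (steps X ω) := by
  rw [contactEvent, Set.mem_ofPred_eq, leftContact_eq_iff, rightContact_eq_iff,
    numContacts_eq_visits, IsContact]
  tauto

lemma contactEvent_eq_empty {a : ℝ} {N : ℕ} {x : ℕ × ℕ × ℕ} (h : ¬ (x.1 ≤ N ∧ x.2.1 ≤ N)) :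
    contactEvent X a N x = ∅ := by
  refine Set.eq_empty_of_forall_notMem fun ω hω => h ?_
  rw [mem_contactEvent] at hω
  exact ⟨hω.1, hω.2.1⟩

lemma pairwiseDisjoint_contactEvent (a : ℝ) (N : ℕ) (s : Set (ℕ × ℕ × ℕ)) :
    s.PairwiseDisjoint (contactEvent X a N) := by
  intro x _ y _ hxy
  refine Set.disjoint_left.2 fun ω h h' => hxy ?_
  refine Prod.ext ?_ (Prod.ext ?_ (h.2.2.symm.trans h'.2.2))
  · exact_mod_cast h.1.symm.trans h'.1
  · exact_mod_cast h.2.1.symm.trans h'.2.1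

lemma compl_noContact (a : ℝ) (N : ℕ) :
    {ω | contactTimes X a N ω = ∅}ᶜ = ⋃ x ∈ Finset.range (N + 1) ×ˢ
      Finset.range (N + 1) ×ˢ Finset.range (N + 1), contactEvent X a N x := by
  ext ω
  simp only [Set.mem_compl_iff, Set.mem_ofPred_eq, Set.mem_iUnion, exists_prop]
  constructor
  · intro h
    have hne := Finset.nonempty_iff_ne_empty.2 h
    obtain ⟨l, hl, hle⟩ := Finset.exists_mem_eq_inf _ hne fun n : ℕ => (n : ℕ∞)
    obtain ⟨r, hr, hre⟩ := Finset.exists_mem_eq_sup _ hne fun n : ℕ => (n : ℕ∞)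
    refine ⟨(l, r, numContacts X a N ω), ?_, hle, ?_, rfl⟩
    · simp only [Finset.mem_product, Finset.mem_range, Nat.lt_succ_iff]
      refine ⟨(mem_contactTimes.1 hl).1, (mem_contactTimes.1 hr).1, ?_⟩
      rw [numContacts_eq_visits]
      exact visits_le _ _ _
    · rw [rightContact, if_pos hne, hre]
  · rintro ⟨x, -, hx⟩ he
    have := hx.1
    rw [leftContact, he, Finset.inf_empty] at this
    exact ENat.natCast_ne_top _ this.symm

variable [IsProbabilityMeasure P]

section

variable (hmeas : ∀ i, Measurable (X i))
include hmeas

lemma measurable_steps : Measurable (steps X) := measurable_pi_lambda _ hmeas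

lemma measurableSet_steps {n : ℕ} {A : (ℕ → ℤ) → Prop} (hA : FinDep n A) :
    MeasurableSet {ω | A (steps X ω)} := measurable_steps hmeas hA.measurableSet

lemma measurableSet_contactEvent (a : ℝ) (N : ℕ) (x : ℕ × ℕ × ℕ) :
    MeasurableSet (contactEvent X a N x) := by
  by_cases h : x.1 ≤ N ∧ x.2.1 ≤ N
  · have : contactEvent X a N x =
        {ω | IsContact (depth a N) N x.1 x.2.1 x.2.2 (steps X ω)} := by
      ext ω
      rw [mem_contactEvent]
      exact ⟨fun h' => h'.2.2, fun h' => ⟨h.1, h.2, h'⟩⟩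
    rw [this]
    exact measurableSet_steps hmeas (finDep_isContact h.1 h.2)
  · rw [contactEvent_eq_empty h]; exact MeasurableSet.empty

lemma measurableSet_noContact (a : ℝ) (N : ℕ) : MeasurableSet {ω | contactTimes X a N ω = ∅} := by
  rw [← MeasurableSet.compl_iff, compl_noContact]
  exact Finset.measurableSet_biUnion _ fun x _ => measurableSet_contactEvent hmeas a N x

variable (hindep : iIndepFun X P) (hident : ∀ i, IdentDistrib (X i) (X 0) P P)
include hindep hident

lemma measure_steps {n : ℕ} {A : (ℕ → ℤ) → Prop} (hA : FinDep n A) :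
    P {ω | A (steps X ω)} = pathMeasure (P.map (X 0)) {x | A x} := by
  have hm : P.map (steps X) = pathMeasure (P.map (X 0)) :=
    map_steps_eq_pathMeasure hmeas hindep hident
  rw [← hm, Measure.map_apply (measurable_steps hmeas) hA.measurableSet]
  rfl

/-- On an event that fixes the number of visits to `k`, the Gibbs weight is `lam ^ k` times the
indicator of the bridge constraint. This passes from the abstract probability space to the path
space. -/
lemma withDensity_apply_of_event {a lam : ℝ} {N : ℕ} (hd : 0 ≤ depth a N) {A B : (ℕ → ℤ) → Prop}
    {n k : ℕ} (hA : FinDep n A) (hB : FinDep n B)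
    (hk : ∀ ω, A ω → visits (-depth a N) N ω = k)
    (hAB : ∀ ω, A ω ∧ (∀ i ≤ N, -depth a N ≤ psum i ω) ∧ psum N ω = 0 ↔ B ω) :
    P.withDensity (weight X a lam N) {ω | A (steps X ω)} =
      ENNReal.ofReal (lam ^ k) * pathMeasure (P.map (X 0)) {x | B x} := by
  rw [withDensity_apply', ← lintegral_indicator (measurableSet_steps hmeas hA),
    ← measure_steps hmeas hindep hident hB, ← lintegral_indicator_const
      (measurableSet_steps hmeas hB)]
  refine lintegral_congr fun ω => ?_
  -- The constraint may include time zero, where it reads `-depth a N ≤ 0`.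
  have hiff : (∀ i ∈ Finset.Icc 1 N, -depth a N ≤ walk X i ω) ↔
      ∀ i ≤ N, -depth a N ≤ psum i (steps X ω) := by
    refine ⟨fun h i hi => ?_, fun h i hi => h i (Finset.mem_Icc.1 hi).2⟩
    rcases Nat.eq_zero_or_pos i with rfl | hi0
    · rw [psum_zero]; omega
    · exact h i (Finset.mem_Icc.2 ⟨hi0, hi⟩)
  by_cases hAω : A (steps X ω)
  · have h' : ω ∈ {ω | A (steps X ω)} := hAω
    rw [Set.indicator_of_mem h', weight, hiff, walk_eq_psum, numContacts_eq_visits, hk _ hAω]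
    by_cases hBω : B (steps X ω)
    · have h2 : ω ∈ {ω | B (steps X ω)} := hBω
      rw [Set.indicator_of_mem h2, if_pos ((hAB _).2 hBω).2]
    · have h2 : ω ∉ {ω | B (steps X ω)} := hBω
      rw [Set.indicator_of_notMem h2, if_neg fun h => hBω ((hAB _).1 ⟨hAω, h⟩)]
  · have h' : ω ∉ {ω | A (steps X ω)} := hAω
    have h2 : ω ∉ {ω | B (steps X ω)} := fun h => hAω ((hAB _).2 h).1
    rw [Set.indicator_of_notMem h', Set.indicator_of_notMem h2]

lemma withDensity_contactEvent {a lam : ℝ} {N : ℕ} (hd : 1 ≤ depth a N) (hlam : 0 ≤ lam)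
    (x : ℕ × ℕ × ℕ) :
    P.withDensity (weight X a lam N) (contactEvent X a N x) = ENNReal.ofReal
      (tripleWeight (P.map (X 0)) lam (depth a N) N x) := by
  unfold tripleWeight
  have hν : IsProbabilityMeasure (P.map (X 0)) :=
    Measure.isProbabilityMeasure_map (hmeas 0).aemeasurable
  by_cases h : x.1 ≤ N ∧ x.2.1 ≤ N
  · have he : contactEvent X a N x =
        {ω | IsContact (depth a N) N x.1 x.2.1 x.2.2 (steps X ω)} := by
      ext ω
      rw [mem_contactEvent]
      exact ⟨fun h' => h'.2.2, fun h' => ⟨h.1, h.2, h'⟩⟩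
    rw [he, withDensity_apply_of_event hmeas hindep hident (by omega) (finDep_isContact h.1 h.2)
      (finDep_isWell (d := depth a N) (k := x.2.2) h.1 h.2) (k := x.2.2) (fun ω hω => hω.2.2.2.2)
      (fun ω => by unfold IsContact IsWell; tauto)]
    split_ifs with hx
    · rw [ENNReal.ofReal_mul (by positivity), wellProb, measureReal_def,
        ENNReal.ofReal_toReal (measure_ne_top _ _)]
    · have h0 := wellProb_eq_zero (P.map (X 0)) hd (k := x.2.2)
        (fun h' => hx (mem_triples.2 h')) h.1 h.2
      rw [wellProb, measureReal_eq_zero_iff] at h0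
      rw [h0]; simp
  · rw [contactEvent_eq_empty h, measure_empty, if_neg, ENNReal.ofReal_zero]
    rw [mem_triples]
    omega

lemma withDensity_noContact {a lam : ℝ} {N : ℕ} (hd : 0 ≤ depth a N) :
    P.withDensity (weight X a lam N) {ω | contactTimes X a N ω = ∅} =
      ENNReal.ofReal (noVisitProb (P.map (X 0)) (depth a N) N) := by
  have hν : IsProbabilityMeasure (P.map (X 0)) :=
    Measure.isProbabilityMeasure_map (hmeas 0).aemeasurable
  have he : {ω | contactTimes X a N ω = ∅} =
      {ω | ∀ i ≤ N, psum i (steps X ω) ≠ -depth a N} := by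
    ext ω
    simp only [Set.mem_ofPred_eq, Finset.eq_empty_iff_forall_notMem, mem_contactTimes]
    exact forall_congr' fun i => by tauto
  rw [he, withDensity_apply_of_event hmeas hindep hident hd (n := N) (k := 0)
    (A := fun ω => ∀ i ≤ N, psum i ω ≠ -depth a N) (B := NoVisit (depth a N) N)
    (FinDep.of_psum fun x y h hx i hi => by rw [← h i hi]; exact hx i hi) (finDep_noVisit _ _)
    (fun ω hω => visits_eq_zero fun i _ hi => hω i hi) (fun ω => by unfold NoVisit; tauto)]
  rw [noVisitProb, measureReal_def, ENNReal.ofReal_toReal (measure_ne_top _ _)]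
  simp

lemma partitionFn_eq_add {a lam : ℝ} {N : ℕ} (hd : 1 ≤ depth a N) (hlam : 0 ≤ lam) :
    partitionFn P X a lam N = ENNReal.ofReal (noVisitProb (P.map (X 0)) (depth a N) N +
      ∑ x ∈ triples N, tripleWeight (P.map (X 0)) lam (depth a N) N x) := by
  have hν : IsProbabilityMeasure (P.map (X 0)) :=
    Measure.isProbabilityMeasure_map (hmeas 0).aemeasurable
  have hnn := tripleWeight_nonneg hlam (P.map (X 0)) (depth a N) N
  have h1 : partitionFn P X a lam N = P.withDensity (weight X a lam N) Set.univ := by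
    rw [withDensity_apply _ MeasurableSet.univ, Measure.restrict_univ]; rfl
  rw [h1, ← measure_add_measure_compl (measurableSet_noContact hmeas a N),
    withDensity_noContact hmeas hindep hident (by omega), compl_noContact,
    measure_biUnion_finset (pairwiseDisjoint_contactEvent a N _)
      fun x _ => measurableSet_contactEvent hmeas a N x,
    ENNReal.ofReal_add (noVisitProb_nonneg _ _ _) (Finset.sum_nonneg fun x _ => hnn x),
    ENNReal.ofReal_sum_of_nonneg fun x _ => hnn x]
  congr 1
  rw [triples, Finset.sum_filter]
  refine Finset.sum_congr rfl fun x hx => ?_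
  rw [withDensity_contactEvent hmeas hindep hident hd hlam]
  split_ifs with h
  · rfl
  · rw [tripleWeight_of_not h, ENNReal.ofReal_zero]

/-- The normalizing constant of the Gibbs measure, on the canonical path space. -/
lemma toReal_partitionFn {a lam : ℝ} {N : ℕ} (hd : 1 ≤ depth a N) (hlam : 0 ≤ lam) :
    (partitionFn P X a lam N).toReal = noVisitProb (P.map (X 0)) (depth a N) N +
      ∑ x ∈ triples N, tripleWeight (P.map (X 0)) lam (depth a N) N x := by
  rw [partitionFn_eq_add hmeas hindep hident hd hlam, ENNReal.toReal_ofReal]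
  exact add_nonneg (noVisitProb_nonneg _ _ _)
    (Finset.sum_nonneg fun x _ => tripleWeight_nonneg hlam _ _ _ x)

omit hmeas hindep hident in
lemma isProbabilityMeasure_gibbs {a lam : ℝ} {N : ℕ}
    (hZ : (partitionFn P X a lam N).toReal ≠ 0) : IsProbabilityMeasure (gibbs P X a lam N) := by
  constructor
  have h1 : partitionFn P X a lam N = P.withDensity (weight X a lam N) Set.univ := by
    rw [withDensity_apply _ MeasurableSet.univ, Measure.restrict_univ]; rfl
  rw [gibbs, Measure.smul_apply, ← h1, smul_eq_mul]
  refine ENNReal.inv_mul_cancel (fun h => hZ (by rw [h]; rfl)) fun h => hZ (by rw [h]; rfl)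

lemma gibbs_real_contactEvent {a lam : ℝ} {N : ℕ} (hd : 1 ≤ depth a N) (hlam : 0 ≤ lam)
    (x : ℕ × ℕ × ℕ) :
    (gibbs P X a lam N).real (contactEvent X a N x) =
      (partitionFn P X a lam N).toReal⁻¹ * tripleWeight (P.map (X 0)) lam (depth a N) N x := by
  rw [gibbs, measureReal_def, Measure.smul_apply, smul_eq_mul, ENNReal.toReal_mul,
    ENNReal.toReal_inv, withDensity_contactEvent hmeas hindep hident hd hlam,
    ENNReal.toReal_ofReal (tripleWeight_nonneg hlam _ _ _ x)]

lemma gibbs_noContact {a lam : ℝ} {N : ℕ} (hd : 1 ≤ depth a N)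
    (hZ : (partitionFn P X a lam N).toReal ≠ 0) :
    gibbs P X a lam N {ω | contactTimes X a N ω = ∅} = ENNReal.ofReal
      ((partitionFn P X a lam N).toReal⁻¹ * noVisitProb (P.map (X 0)) (depth a N) N) := by
  have hpos : 0 < (partitionFn P X a lam N).toReal :=
    lt_of_le_of_ne ENNReal.toReal_nonneg hZ.symm
  rw [gibbs, Measure.smul_apply, smul_eq_mul, withDensity_noContact hmeas hindep hident (by omega),
    ENNReal.ofReal_mul (by positivity), ENNReal.ofReal_inv_of_pos hpos, ENNReal.ofReal_toReal]
  exact fun h => hZ (by rw [h]; rfl)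

/-- The event without contact and the contact events partition the space, and the observable is
constant on each of them. Triples outside `triples N` have zero weight. -/
lemma integral_gibbs {a lam : ℝ} {N : ℕ} (hd : 1 ≤ depth a N) (hlam : 0 ≤ lam)
    {Φ : Ω → ℝ} {g : ℕ × ℕ × ℕ → ℝ} {c : ℝ}
    (hc : ∀ ω, contactTimes X a N ω = ∅ → Φ ω = c)
    (hg : ∀ x, ∀ ω ∈ contactEvent X a N x, Φ ω = g x) :
    ∫ ω, Φ ω ∂(gibbs P X a lam N) = (partitionFn P X a lam N).toReal⁻¹ *
      (noVisitProb (P.map (X 0)) (depth a N) N * c +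
        ∑ x ∈ triples N, tripleWeight (P.map (X 0)) lam (depth a N) N x * g x) := by
  set μ := P.withDensity (weight X a lam N) with hμ
  have h1 : partitionFn P X a lam N = μ Set.univ := by
    rw [hμ, withDensity_apply _ MeasurableSet.univ, Measure.restrict_univ]; rfl
  have hfin : IsFiniteMeasure μ := ⟨by
    rw [← h1, partitionFn_eq_add hmeas hindep hident hd hlam]; exact ENNReal.ofReal_lt_top⟩
  have hs := measurableSet_noContact hmeas a N
  have hE := fun x => measurableSet_contactEvent hmeas a N x
  have i1 : IntegrableOn Φ {ω | contactTimes X a N ω = ∅} μ :=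
    (integrableOn_const (C := c) (measure_ne_top _ _)).congr_fun (fun ω hω => (hc ω hω).symm) hs
  have i2 : ∀ x, IntegrableOn Φ (contactEvent X a N x) μ := fun x =>
    (integrableOn_const (C := g x) (measure_ne_top _ _)).congr_fun
      (fun ω hω => (hg x ω hω).symm) (hE x)
  have i3 : IntegrableOn Φ {ω | contactTimes X a N ω = ∅}ᶜ μ := by
    rw [compl_noContact, integrableOn_finset_iUnion]
    exact fun x _ => i2 x
  have hi : Integrable Φ μ := by
    rw [← integrableOn_univ, ← Set.union_compl_self {ω | contactTimes X a N ω = ∅}]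
    exact i1.union i3
  rw [gibbs, integral_smul_measure, ENNReal.toReal_inv, smul_eq_mul, ← hμ]
  congr 1
  rw [← integral_add_compl hs hi, compl_noContact,
    integral_biUnion_finset _ (fun x _ => hE x) (pairwiseDisjoint_contactEvent a N _)
      fun x _ => i2 x]
  congr 1
  · rw [setIntegral_congr_fun hs (fun ω hω => hc ω hω), setIntegral_const, smul_eq_mul,
      measureReal_def, hμ, withDensity_noContact hmeas hindep hident (by omega),
      ENNReal.toReal_ofReal (noVisitProb_nonneg _ _ _)]
  · rw [triples, Finset.sum_filter]
    refine Finset.sum_congr rfl fun x hx => ?_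
    rw [setIntegral_congr_fun (hE x) (fun ω hω => hg x ω hω), setIntegral_const, smul_eq_mul,
      measureReal_def, hμ, withDensity_contactEvent hmeas hindep hident hd hlam,
      ENNReal.toReal_ofReal (tripleWeight_nonneg hlam _ _ _ x)]
    split_ifs with h
    · rfl
    · rw [tripleWeight_of_not h, zero_mul]

end

end

/-! ### From local limits to convergence in distribution -/

/-- The rescaling of a triple of integers. -/
def resc (u v c : ℝ) (N : ℕ) (x : ℕ × ℕ × ℕ) : ℝ × ℝ × ℝ := rescale u v c N x.1 x.2.1 x.2.2

/-- The family of weights `h` has the local limit `g` along all sequences. -/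
def LocalLimit (u v c : ℝ) (h : ℕ → ℕ × ℕ × ℕ → ℝ) (g : ℝ × ℝ × ℝ → ℝ) : Prop :=
  ∀ (n : ℕ → ℕ) (x : ℕ → ℕ × ℕ × ℕ) (z : ℝ × ℝ × ℝ), Tendsto n atTop atTop →
    Tendsto (fun j => resc u v c (n j) (x j)) atTop (𝓝 z) →
    Tendsto (fun j => Real.sqrt (n j) ^ 3 * h (n j) (x j)) atTop (𝓝 (g z))

section

variable {u v c : ℝ} {h : ℕ → ℕ × ℕ × ℕ → ℝ} {g : ℝ × ℝ × ℝ → ℝ}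

/-- Compactness: bad points along a subsequence of times would have rescaled positions accumulating
at some `z`, contradicting the local limit along that subsequence. This is why `LocalLimit`
quantifies over arbitrary sequences. -/
lemma LocalLimit.uniform (hloc : LocalLimit u v c h g) (hg : Continuous g) (hpos : ∀ z, 0 < g z)
    (A : ℝ) {ε : ℝ} (hε : 0 < ε) :
    ∀ᶠ N : ℕ in atTop, ∀ x, ‖resc u v c N x‖ ≤ A →
      |Real.sqrt N ^ 3 * h N x / g (resc u v c N x) - 1| < ε := by
  by_contra hcon
  rw [not_eventually] at hcon
  obtain ⟨n, hn, hbad⟩ := extraction_of_frequently_atTop hcon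
  push Not at hbad
  choose x hxA hxε using hbad
  obtain ⟨z, -, ψ, hψ, hz⟩ := (isCompact_closedBall (0 : ℝ × ℝ × ℝ) A).tendsto_subseq
    (x := fun j => resc u v c (n j) (x j)) fun j => by simpa using hxA j
  have h1 := hloc (n ∘ ψ) (x ∘ ψ) z (hn.tendsto_atTop.comp hψ.tendsto_atTop) hz
  have h2 := h1.div ((hg.tendsto z).comp hz) (hpos z).ne'
  rw [div_self (hpos z).ne'] at h2
  have h3 := (h2.sub_const 1).abs
  rw [sub_self, abs_zero] at h3
  obtain ⟨j, hj⟩ := (h3.eventually (gt_mem_nhds hε)).exists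
  exact absurd hj (hxε (ψ j)).not_gt

lemma LocalLimit.bounded (hloc : LocalLimit u v c h g) (hg : Continuous g) (hpos : ∀ z, 0 < g z)
    (A : ℝ) : ∃ K, 0 ≤ K ∧ ∀ᶠ N : ℕ in atTop, ∀ x, ‖resc u v c N x‖ ≤ A →
      Real.sqrt N ^ 3 * h N x ≤ K := by
  obtain ⟨B, hB⟩ := (isCompact_closedBall (0 : ℝ × ℝ × ℝ) A).exists_bound_of_continuousOn
    hg.continuousOn
  refine ⟨max (2 * B) 0, le_max_right _ _, ?_⟩
  filter_upwards [hloc.uniform hg hpos A one_pos] with N hN x hx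
  have h1 := (abs_lt.1 (hN x hx)).2
  have h2 := hB (resc u v c N x) (by simpa using hx)
  rw [Real.norm_of_nonneg (hpos _).le] at h2
  have h3 : Real.sqrt N ^ 3 * h N x / g (resc u v c N x) < 2 := by linarith
  rw [div_lt_iff₀ (hpos _)] at h3
  exact le_max_of_le_left (by linarith)

/-- The lattice point of the cell of `z`. -/
def cell (u v c : ℝ) (N : ℕ) (z : ℝ × ℝ × ℝ) : ℕ × ℕ × ℕ :=
  (⌊u * N + z.1 * Real.sqrt N⌋₊, ⌊v * N + z.2.1 * Real.sqrt N⌋₊, ⌊c * N + z.2.2 * Real.sqrt N⌋₊)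

lemma floor_sub_div_bound {w N z : ℝ} (hN : 0 < N) (hk : 0 ≤ w * N + z * Real.sqrt N) :
    |((⌊w * N + z * Real.sqrt N⌋₊ : ℝ) - w * N) / Real.sqrt N - z| ≤ 1 / Real.sqrt N := by
  have hs : 0 < Real.sqrt N := Real.sqrt_pos.2 hN
  have h1 := Nat.floor_le hk
  have h2 := Nat.lt_floor_add_one (w * N + z * Real.sqrt N)
  rw [div_sub' hs.ne', abs_div, abs_of_pos hs, div_le_div_iff_of_pos_right hs, abs_le]
  constructor <;> linarith

lemma tendsto_mul_add_sqrt {w : ℝ} (hw : 0 < w) (z : ℝ) :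
    Tendsto (fun N : ℕ => w * N + z * Real.sqrt N) atTop atTop := by
  have h1 : Tendsto (fun N : ℕ => Real.sqrt N) atTop atTop :=
    Real.tendsto_sqrt_atTop.comp tendsto_natCast_atTop_atTop
  have h2 : Tendsto (fun N : ℕ => Real.sqrt N * (w * Real.sqrt N + z)) atTop atTop :=
    h1.atTop_mul_atTop₀ (tendsto_atTop_add_const_right _ _ (h1.const_mul_atTop hw))
  refine h2.congr fun N => ?_
  have := Real.mul_self_sqrt (Nat.cast_nonneg N : (0 : ℝ) ≤ N)
  linear_combination w * this

lemma tendsto_floor_sub_div {w : ℝ} (hw : 0 < w) (z : ℝ) :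
    Tendsto (fun N : ℕ => ((⌊w * N + z * Real.sqrt N⌋₊ : ℝ) - w * N) / Real.sqrt N) atTop (𝓝 z) := by
  have h1 : Tendsto (fun N : ℕ => 1 / Real.sqrt N) atTop (𝓝 0) :=
    tendsto_const_nhds.div_atTop (Real.tendsto_sqrt_atTop.comp tendsto_natCast_atTop_atTop)
  rw [tendsto_iff_dist_tendsto_zero]
  refine tendsto_of_tendsto_of_tendsto_of_le_of_le' tendsto_const_nhds h1
    (Eventually.of_forall fun _ => dist_nonneg) ?_
  filter_upwards [eventually_gt_atTop 0, (tendsto_mul_add_sqrt hw z).eventually_ge_atTop 0]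
    with N hN hk
  rw [Real.dist_eq]
  exact floor_sub_div_bound (by exact_mod_cast hN) hk

lemma tendsto_resc_cell (hu : 0 < u) (hv : 0 < v) (hc : 0 < c) (z : ℝ × ℝ × ℝ) :
    Tendsto (fun N => resc u v c N (cell u v c N z)) atTop (𝓝 z) :=
  (tendsto_floor_sub_div hu z.1).prodMk_nhds
    ((tendsto_floor_sub_div hv z.2.1).prodMk_nhds (tendsto_floor_sub_div hc z.2.2))

/-- The condition `k ≠ 0` matters: `Nat.floor` sends the whole negative half-line to zero, so the
cell of `0` is unbounded. Within a fixed box the indices are eventually nonzero. -/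
lemma volume_floor_eq {w : ℝ} {N k : ℕ} (hN : 0 < N) (hk : k ≠ 0) :
    volume {z : ℝ | ⌊w * N + z * Real.sqrt N⌋₊ = k} = ENNReal.ofReal (Real.sqrt N)⁻¹ := by
  have hs : 0 < Real.sqrt N := Real.sqrt_pos.2 (by exact_mod_cast hN)
  have : {z : ℝ | ⌊w * N + z * Real.sqrt N⌋₊ = k} =
      Set.Ico ((k - w * N) / Real.sqrt N) ((k + 1 - w * N) / Real.sqrt N) := by
    ext z
    rw [Set.mem_ofPred_eq, Nat.floor_eq_iff' hk, Set.mem_Ico, div_le_iff₀ hs, lt_div_iff₀ hs]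
    constructor <;> rintro ⟨h1, h2⟩ <;> constructor <;> linarith
  rw [this, Real.volume_Ico]
  congr 1
  field_simp
  ring

lemma volume_cell_eq {N : ℕ} (hN : 0 < N) {x : ℕ × ℕ × ℕ} (h1 : x.1 ≠ 0) (h2 : x.2.1 ≠ 0)
    (h3 : x.2.2 ≠ 0) :
    volume {z | cell u v c N z = x} = ENNReal.ofReal ((Real.sqrt N ^ 3)⁻¹) := by
  have : {z | cell u v c N z = x} = {z : ℝ | ⌊u * N + z * Real.sqrt N⌋₊ = x.1} ×ˢ
      ({z : ℝ | ⌊v * N + z * Real.sqrt N⌋₊ = x.2.1} ×ˢ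
        {z : ℝ | ⌊c * N + z * Real.sqrt N⌋₊ = x.2.2}) := by
    ext z
    simp [cell, Prod.ext_iff]
  rw [this, Measure.volume_eq_prod, Measure.prod_prod, Measure.volume_eq_prod, Measure.prod_prod,
    volume_floor_eq hN h1, volume_floor_eq hN h2, volume_floor_eq hN h3,
    ← ENNReal.ofReal_mul (by positivity), ← ENNReal.ofReal_mul (by positivity)]
  congr 1
  rw [pow_succ, pow_two, mul_inv, mul_inv, mul_assoc]

lemma measurable_cell (N : ℕ) : Measurable (cell u v c N) := by
  unfold cell; fun_prop

lemma eventually_ne_zero_of_norm_resc_le (hu : 0 < u) (hv : 0 < v) (hc : 0 < c) (A : ℝ) :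
    ∀ᶠ N : ℕ in atTop, ∀ x, ‖resc u v c N x‖ ≤ A → x.1 ≠ 0 ∧ x.2.1 ≠ 0 ∧ x.2.2 ≠ 0 := by
  filter_upwards [(tendsto_mul_add_sqrt hu (-A)).eventually_gt_atTop 0,
    (tendsto_mul_add_sqrt hv (-A)).eventually_gt_atTop 0,
    (tendsto_mul_add_sqrt hc (-A)).eventually_gt_atTop 0, eventually_gt_atTop 0]
    with N h1 h2 h3 hN x hx
  have hs : 0 < Real.sqrt N := Real.sqrt_pos.2 (by exact_mod_cast hN)
  have key : ∀ {w : ℝ} {k : ℕ}, 0 < w * N + -A * Real.sqrt N →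
      ‖((k : ℝ) - w * N) / Real.sqrt N‖ ≤ A → k ≠ 0 := by
    rintro w k hw hk rfl
    rw [Real.norm_eq_abs, abs_div, abs_of_pos hs, div_le_iff₀ hs] at hk
    have := (abs_le.1 hk).1
    push_cast at this
    linarith
  rw [resc, rescale, Prod.norm_mk, Prod.norm_mk, max_le_iff, max_le_iff] at hx
  exact ⟨key h1 hx.1, key h2 hx.2.1, key h3 hx.2.2⟩

/-- Riemann sums over boxes converge to integrals. -/
lemma LocalLimit.tendsto_sum_box (hloc : LocalLimit u v c h g) (hg : Continuous g)
    (hpos : ∀ z, 0 < g z) (hu : 0 < u) (hv : 0 < v) (hc : 0 < c) (hnn : ∀ N x, 0 ≤ h N x)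
    {S : ℕ → Finset (ℕ × ℕ × ℕ)} (hS : ∀ N x, x ∉ S N → h N x = 0)
    (φ : (ℝ × ℝ × ℝ) →ᵇ ℝ) (A : ℝ) :
    Tendsto (fun N => ∑ x ∈ S N with ‖resc u v c N x‖ ≤ A, h N x * φ (resc u v c N x)) atTop
      (𝓝 (∫ z in Metric.closedBall 0 A, g z * φ z)) := by
  obtain ⟨K, hK0, hK⟩ := hloc.bounded hg hpos A
  -- The sum over the box is the integral of this step function: each cell has volume `(√N)⁻³`,
  -- which the factor `√N ^ 3` compensates.
  set F : ℕ → ℝ × ℝ × ℝ → ℝ := fun N z => ∑ x ∈ S N with ‖resc u v c N x‖ ≤ A,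
    {z | cell u v c N z = x}.indicator
      (fun _ => Real.sqrt N ^ 3 * (h N x * φ (resc u v c N x))) z with hF
  have hFval : ∀ N z, F N z = if ‖resc u v c N (cell u v c N z)‖ ≤ A then
      Real.sqrt N ^ 3 * h N (cell u v c N z) * φ (resc u v c N (cell u v c N z)) else 0 := by
    intro N z
    simp only [hF]
    rw [Finset.sum_filter]
    rw [Finset.sum_eq_single (cell u v c N z)]
    · have : z ∈ {z' | cell u v c N z' = cell u v c N z} := rfl
      rw [Set.indicator_of_mem this, mul_assoc]
    · intro x _ hx
      have : z ∉ {z' | cell u v c N z' = x} := fun h => hx h.symm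
      rw [Set.indicator_of_notMem this, ite_self]
    · intro hx
      have : z ∈ {z' | cell u v c N z' = cell u v c N z} := rfl
      rw [Set.indicator_of_mem this, hS N _ hx]
      simp
  have hmeas : ∀ N (x : ℕ × ℕ × ℕ), MeasurableSet {z | cell u v c N z = x} := fun N x =>
    measurable_cell N (MeasurableSet.singleton x)
  have hint : ∀ᶠ N in atTop, ∫ z, F N z =
      ∑ x ∈ S N with ‖resc u v c N x‖ ≤ A, h N x * φ (resc u v c N x) := by
    filter_upwards [eventually_ne_zero_of_norm_resc_le hu hv hc A, eventually_gt_atTop 0]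
      with N hN hN0
    have hs : 0 < Real.sqrt N := Real.sqrt_pos.2 (by exact_mod_cast hN0)
    have hvol : ∀ x ∈ (S N).filter (fun x => ‖resc u v c N x‖ ≤ A),
        volume {z | cell u v c N z = x} = ENNReal.ofReal ((Real.sqrt N ^ 3)⁻¹) := by
      intro x hx
      obtain ⟨h1, h2, h3⟩ := hN x (Finset.mem_filter.1 hx).2
      exact volume_cell_eq hN0 h1 h2 h3
    simp only [hF]
    rw [integral_finsetSum]
    · refine Finset.sum_congr rfl fun x hx => ?_
      rw [integral_indicator (hmeas N x), setIntegral_const, measureReal_def, hvol x hx,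
        ENNReal.toReal_ofReal (by positivity), smul_eq_mul, ← mul_assoc,
        inv_mul_cancel₀ (by positivity), one_mul]
    · intro x hx
      rw [integrable_indicator_iff (hmeas N x)]
      refine integrableOn_const ?_
      rw [hvol x hx]
      exact ENNReal.ofReal_ne_top
  rw [← integral_indicator Metric.isClosed_closedBall.measurableSet]
  refine Tendsto.congr' hint ?_
  refine tendsto_integral_filter_of_dominated_convergence
    ((Metric.closedBall (0 : ℝ × ℝ × ℝ) (A + 1)).indicator fun _ => K * ‖φ‖)
    (Eventually.of_forall fun N => ?_) ?_ ?_ ?_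
  · refine Measurable.aestronglyMeasurable ?_
    simp only [hF]
    exact Finset.measurable_sum _ fun x _ => measurable_const.indicator (hmeas N x)
  · filter_upwards [hK, eventually_ne_zero_of_norm_resc_le hu hv hc A, eventually_ge_atTop 1]
      with N hN hne hN1
    refine ae_of_all _ fun z => ?_
    rw [hFval]
    split_ifs with hz
    · have hN1' : (1 : ℝ) ≤ N := by exact_mod_cast hN1
      have hs1 : 1 ≤ Real.sqrt N := by rw [Real.one_le_sqrt]; exact hN1'
      -- A point differs from the rescaled lattice point of its cell by at most `1 / √N ≤ 1`, so the
      -- functions vanish outside the ball of radius `A + 1`.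
      have hzmem : z ∈ Metric.closedBall (0 : ℝ × ℝ × ℝ) (A + 1) := by
        obtain ⟨h1, h2, h3⟩ := hne _ hz
        have key : ∀ {w y : ℝ}, ⌊w * N + y * Real.sqrt N⌋₊ ≠ 0 →
            ‖((⌊w * N + y * Real.sqrt N⌋₊ : ℝ) - w * N) / Real.sqrt N‖ ≤ A → ‖y‖ ≤ A + 1 := by
          intro w y hne hle
          have h0 : 0 ≤ w * N + y * Real.sqrt N :=
            zero_le_one.trans (by rwa [← Nat.one_le_floor_iff, Nat.one_le_iff_ne_zero])
          have h4 := floor_sub_div_bound (by linarith : (0 : ℝ) < N) h0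
          have h5 : 1 / Real.sqrt N ≤ 1 := by rw [div_le_one (by linarith)]; exact hs1
          rw [Real.norm_eq_abs] at hle ⊢
          have h6 := abs_sub_abs_le_abs_sub y
            (((⌊w * N + y * Real.sqrt N⌋₊ : ℝ) - w * N) / Real.sqrt N)
          rw [abs_sub_comm y] at h6
          linarith
        rw [resc, rescale, Prod.norm_mk, Prod.norm_mk, max_le_iff, max_le_iff] at hz
        rw [mem_closedBall_zero_iff, Prod.norm_def, Prod.norm_def, max_le_iff, max_le_iff]
        exact ⟨key h1 hz.1, key h2 hz.2.1, key h3 hz.2.2⟩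
      rw [Set.indicator_of_mem hzmem, norm_mul, Real.norm_of_nonneg
        (mul_nonneg (by positivity) (hnn _ _))]
      have h0 := hN _ hz
      exact mul_le_mul h0 (φ.norm_coe_le_norm _) (norm_nonneg _)
        ((mul_nonneg (by positivity) (hnn _ _)).trans h0)
    · rw [norm_zero]
      exact Set.indicator_nonneg (fun _ _ => by positivity) z
  · exact (integrable_indicator_iff Metric.isClosed_closedBall.measurableSet).2
      (integrableOn_const (isCompact_closedBall _ _).measure_ne_top)
  · have i1 : (volume : Measure (ℝ × ℝ)).IsAddHaarMeasure :=
      Measure.prod.instIsAddHaarMeasure volume volume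
    have i2 : (volume : Measure (ℝ × ℝ × ℝ)).IsAddHaarMeasure :=
      Measure.prod.instIsAddHaarMeasure volume volume
    -- The truncation is discontinuous only on the sphere of radius `A`, a null set; elsewhere the
    -- indicator stabilizes.
    have hsph : ∀ᵐ z : ℝ × ℝ × ℝ, ‖z‖ ≠ A := by
      have := Measure.addHaar_sphere (volume : Measure (ℝ × ℝ × ℝ)) 0 A
      rw [ae_iff]
      convert this using 2
      ext z
      simp
    filter_upwards [hsph] with z hz
    have ht := tendsto_resc_cell hu hv hc z
    rcases lt_or_gt_of_ne hz with hlt | hgt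
    · have hmem : z ∈ Metric.closedBall (0 : ℝ × ℝ × ℝ) A := by
        rw [mem_closedBall_zero_iff]; exact hlt.le
      rw [Set.indicator_of_mem hmem]
      have h1 := (hloc id (fun N => cell u v c N z) z tendsto_id ht).mul
        ((φ.continuous.tendsto z).comp ht)
      refine h1.congr' ?_
      filter_upwards [ht.norm.eventually (gt_mem_nhds hlt)] with N hN
      rw [hFval, if_pos hN.le]
      rfl
    · have hmem : z ∉ Metric.closedBall (0 : ℝ × ℝ × ℝ) A := by
        rw [mem_closedBall_zero_iff]; exact hgt.not_ge
      rw [Set.indicator_of_notMem hmem]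
      refine tendsto_const_nhds.congr' ?_
      filter_upwards [ht.norm.eventually (lt_mem_nhds hgt)] with N hN
      rw [hFval, if_neg hN.not_ge]

/-- The family of weights `h` is tight at the scale `√N`. -/
def TightAt (u v c : ℝ) (h : ℕ → ℕ × ℕ × ℕ → ℝ) (S : ℕ → Finset (ℕ × ℕ × ℕ)) : Prop :=
  ∀ ε > 0, ∃ A : ℝ, ∀ᶠ N in atTop, ∑ x ∈ S N with ¬ ‖resc u v c N x‖ ≤ A, h N x ≤ ε

/-- On a large box the Riemann sums converge. Tightness bounds the sum outside the box and
integrability bounds the integral there, so the box can be removed at a cost of `ε / 3` for each. -/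
lemma LocalLimit.tendsto_sum (hloc : LocalLimit u v c h g) (hg : Continuous g)
    (hpos : ∀ z, 0 < g z) (hgi : Integrable g) (hu : 0 < u) (hv : 0 < v) (hc : 0 < c)
    (hnn : ∀ N x, 0 ≤ h N x)
    {S : ℕ → Finset (ℕ × ℕ × ℕ)} (hS : ∀ N x, x ∉ S N → h N x = 0) (ht : TightAt u v c h S)
    (φ : (ℝ × ℝ × ℝ) →ᵇ ℝ) :
    Tendsto (fun N => ∑ x ∈ S N, h N x * φ (resc u v c N x)) atTop (𝓝 (∫ z, g z * φ z)) := by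
  have hgφ : Integrable fun z => g z * φ z :=
    hgi.mul_bdd (c := ‖φ‖) φ.continuous.aestronglyMeasurable (ae_of_all _ φ.norm_coe_le_norm)
  rw [Metric.tendsto_atTop']
  intro ε hε
  have hφ1 : 0 < ‖φ‖ + 1 := by positivity
  obtain ⟨A, hA⟩ := ht (ε / (3 * (‖φ‖ + 1))) (by positivity)
  have hball : Tendsto (fun n : ℕ => ∫ z in Metric.closedBall (0 : ℝ × ℝ × ℝ) n, g z * φ z) atTop
      (𝓝 (∫ z, g z * φ z)) := by
    have h1 := tendsto_setIntegral_of_monotone (μ := volume) (f := fun z => g z * φ z)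
      (s := fun n : ℕ => Metric.closedBall (0 : ℝ × ℝ × ℝ) n)
      (fun n => Metric.isClosed_closedBall.measurableSet)
      (fun m n hmn => Metric.closedBall_subset_closedBall (by exact_mod_cast hmn))
      hgφ.integrableOn
    rwa [Metric.iUnion_closedBall_nat, setIntegral_univ] at h1
  obtain ⟨n, hn1, hn2⟩ := ((hball.eventually (Metric.ball_mem_nhds _ (ε := ε / 3) (by positivity))).and
    (eventually_ge_atTop (max ⌈A⌉₊ 1))).exists
  have hnA : A ≤ n := (Nat.le_ceil A).trans (by exact_mod_cast (le_max_left _ _).trans hn2)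
  have hn0 : (0 : ℝ) < n := by exact_mod_cast (le_max_right _ _).trans hn2
  have hbox := hloc.tendsto_sum_box hg hpos hu hv hc hnn hS φ n
  obtain ⟨N₀, hN₀⟩ := eventually_atTop.1 ((hbox.eventually (Metric.ball_mem_nhds _ (ε := ε / 3)
    (by positivity))).and hA)
  refine ⟨N₀, fun N hN => ?_⟩
  obtain ⟨h1, h2⟩ := hN₀ N hN.le
  have hsplit := Finset.sum_filter_add_sum_filter_not (S N) (fun x => ‖resc u v c N x‖ ≤ n)
    fun x => h N x * φ (resc u v c N x)
  have hrest : |∑ x ∈ S N with ¬ ‖resc u v c N x‖ ≤ n, h N x * φ (resc u v c N x)| < ε / 3 := by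
    calc _ ≤ ∑ x ∈ S N with ¬ ‖resc u v c N x‖ ≤ n, |h N x * φ (resc u v c N x)| :=
          Finset.abs_sum_le_sum_abs _ _
      _ ≤ ∑ x ∈ S N with ¬ ‖resc u v c N x‖ ≤ n, h N x * ‖φ‖ := by
          refine Finset.sum_le_sum fun x _ => ?_
          rw [abs_mul, abs_of_nonneg (hnn N x)]
          exact mul_le_mul_of_nonneg_left (φ.norm_coe_le_norm _) (hnn N x)
      _ ≤ ∑ x ∈ S N with ¬ ‖resc u v c N x‖ ≤ A, h N x * ‖φ‖ := by
          refine Finset.sum_le_sum_of_subset_of_nonneg ?_ fun x _ _ =>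
            mul_nonneg (hnn N x) (norm_nonneg _)
          intro x hx
          rw [Finset.mem_filter] at hx ⊢
          exact ⟨hx.1, fun h => hx.2 (h.trans hnA)⟩
      _ ≤ ε / (3 * (‖φ‖ + 1)) * ‖φ‖ := by
          rw [← Finset.sum_mul]
          exact mul_le_mul_of_nonneg_right h2 (norm_nonneg _)
      _ < ε / 3 := by
          rw [div_mul_eq_mul_div, div_lt_div_iff₀ (by positivity) (by positivity)]
          nlinarith [norm_nonneg φ]
  rw [Real.dist_eq] at *
  rw [abs_lt] at *
  rw [← hsplit]
  constructor <;> linarith [h1.1, h1.2, hn1.1, hn1.2]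

end

/-! ### The local limit of the tilted weights -/

lemma gaussDens_neg (V z : ℝ) : gaussDens V (-z) = gaussDens V z := by
  simp [gaussDens]

/-- The local limit theorem measures a fluctuation of the position around its mean. Dividing by the
speed `μ` converts it into a fluctuation of the time needed to reach a given distance, of variance
`w V / μ²`. -/
lemma gaussDens_scale {V w μ : ℝ} (hV : 0 < V) (hw : 0 < w) (hμ : 0 < μ) (z : ℝ) :
    gaussDens V (μ * z / Real.sqrt w) / Real.sqrt w = μ⁻¹ * gaussDens (w * V / μ ^ 2) z := by
  have hsw := Real.sqrt_pos.2 hw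
  have hsq : Real.sqrt w ^ 2 = w := Real.sq_sqrt hw.le
  unfold gaussDens
  have h1 : Real.sqrt (2 * Real.pi * (w * V / μ ^ 2)) =
      Real.sqrt w * Real.sqrt (2 * Real.pi * V) / μ := by
    rw [show 2 * Real.pi * (w * V / μ ^ 2) = w * (2 * Real.pi * V) / μ ^ 2 by ring,
      Real.sqrt_div (by positivity), Real.sqrt_sq hμ.le, Real.sqrt_mul hw.le]
  have h2 : -(μ * z / Real.sqrt w) ^ 2 / (2 * V) = -z ^ 2 / (2 * (w * V / μ ^ 2)) := by
    rw [div_pow, hsq]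
    field_simp
  rw [h1, h2]
  have : 0 < Real.sqrt (2 * Real.pi * V) := Real.sqrt_pos.2 (by positivity)
  field_simp

section

variable {N n : ℕ → ℕ} {w y : ℝ}

lemma tendsto_div_of_rescaled {x : ℕ → ℝ} (hN : Tendsto N atTop atTop)
    (h : Tendsto (fun j => (x j - w * N j) / Real.sqrt (N j)) atTop (𝓝 y)) :
    Tendsto (fun j => x j / N j) atTop (𝓝 w) := by
  have hs : Tendsto (fun j => Real.sqrt (N j)) atTop atTop :=
    Real.tendsto_sqrt_atTop.comp (tendsto_natCast_atTop_atTop.comp hN)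
  have h1 := (h.div_atTop hs).const_add w
  rw [add_zero] at h1
  refine h1.congr' ?_
  filter_upwards [hN.eventually_gt_atTop 0] with j hj
  have hj' : (0 : ℝ) < N j := by exact_mod_cast hj
  rw [div_div, Real.mul_self_sqrt hj'.le]
  field_simp
  ring

lemma tendsto_atTop_of_rescaled (hw : 0 < w) (hN : Tendsto N atTop atTop)
    (h : Tendsto (fun j => (n j - w * N j) / Real.sqrt (N j)) atTop (𝓝 y)) :
    Tendsto n atTop atTop := by
  have h1 := (tendsto_natCast_atTop_atTop (R := ℝ)).comp hN |>.atTop_mul_pos hw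
    (tendsto_div_of_rescaled hN h)
  refine tendsto_natCast_atTop_iff.1 (h1.congr' ?_)
  filter_upwards [hN.eventually_gt_atTop 0] with j hj
  have hj' : (N j : ℝ) ≠ 0 := by positivity
  simp only [Function.comp]
  field_simp

lemma tendsto_sqrt_div_sqrt (hN : Tendsto N atTop atTop)
    (h : Tendsto (fun j => (n j - w * N j) / Real.sqrt (N j)) atTop (𝓝 y)) (hw : 0 < w) :
    Tendsto (fun j => Real.sqrt (N j) / Real.sqrt (n j)) atTop (𝓝 (Real.sqrt w)⁻¹) := by
  have h1 := ((Real.continuous_sqrt.tendsto w).comp (tendsto_div_of_rescaled hN h)).inv₀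
    (Real.sqrt_pos.2 hw).ne'
  refine h1.congr fun j => ?_
  simp only [Function.comp]
  rw [Real.sqrt_div (Nat.cast_nonneg _), inv_div]

/-- When the length `n` itself fluctuates around `w N`, its fluctuation `y` moves the mean of the
walk by `μ y`; the factor `√w` accounts for normalizing by `√n` instead of `√N`. -/
lemma tendsto_recenter {μ y' : ℝ} {x : ℕ → ℤ} (hN : Tendsto N atTop atTop)
    (h : Tendsto (fun j => (n j - w * N j) / Real.sqrt (N j)) atTop (𝓝 y)) (hw : 0 < w)
    (hx : Tendsto (fun j => (x j - w * μ * N j) / Real.sqrt (N j)) atTop (𝓝 y')) :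
    Tendsto (fun j => ((x j : ℝ) - n j * μ) / Real.sqrt (n j)) atTop
      (𝓝 ((y' - μ * y) / Real.sqrt w)) := by
  have h1 := (hx.sub (h.const_mul μ)).mul (tendsto_sqrt_div_sqrt hN h hw)
  refine h1.congr' ?_
  filter_upwards [hN.eventually_gt_atTop 0,
    (tendsto_atTop_of_rescaled hw hN h).eventually_gt_atTop 0] with j hj hj'
  have h2 : (0 : ℝ) < Real.sqrt (N j) := Real.sqrt_pos.2 (by exact_mod_cast hj)
  have h3 : (0 : ℝ) < Real.sqrt (n j) := Real.sqrt_pos.2 (by exact_mod_cast hj')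
  field_simp
  ring

lemma tendsto_sqrt_mul_of_rescaled {p : ℕ → ℝ} {L : ℝ} (hN : Tendsto N atTop atTop)
    (h : Tendsto (fun j => (n j - w * N j) / Real.sqrt (N j)) atTop (𝓝 y)) (hw : 0 < w)
    (hp : Tendsto (fun j => Real.sqrt (n j) * p j) atTop (𝓝 L)) :
    Tendsto (fun j => Real.sqrt (N j) * p j) atTop (𝓝 (L / Real.sqrt w)) := by
  have h1 := hp.mul (tendsto_sqrt_div_sqrt hN h hw)
  rw [← div_eq_mul_inv] at h1
  refine h1.congr' ?_
  filter_upwards [(tendsto_atTop_of_rescaled hw hN h).eventually_gt_atTop 0] with j hj'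
  have h3 : (0 : ℝ) < Real.sqrt (n j) := Real.sqrt_pos.2 (by exact_mod_cast hj')
  field_simp

lemma tendsto_depth (a : ℝ) (hN : Tendsto N atTop atTop) :
    Tendsto (fun j => ((depth a (N j) : ℝ) - a * N j) / Real.sqrt (N j)) atTop (𝓝 0) := by
  have hs : Tendsto (fun j => 1 / Real.sqrt (N j)) atTop (𝓝 0) :=
    tendsto_const_nhds.div_atTop
      (Real.tendsto_sqrt_atTop.comp (tendsto_natCast_atTop_atTop.comp hN))
  refine squeeze_zero_norm (fun j => ?_) hs
  rw [Real.norm_eq_abs, abs_div, abs_of_nonneg (Real.sqrt_nonneg _)]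
  refine div_le_div_of_nonneg_right ?_ (Real.sqrt_nonneg _)
  rw [depth, abs_le]
  have h1 := Int.floor_le (a * N j)
  have h2 := Int.lt_floor_add_one (a * N j)
  constructor <;> linarith

end

/-- The product of the probabilities of the three pieces of a constrained path. -/
def pieceWeight (ν₁ Q ν₂ : Measure ℤ) (d : ℤ) (N : ℕ) (x : ℕ × ℕ × ℕ) : ℝ :=
  if x ∈ triples N then firstHit ν₁ x.1 d *
    (pathMeasure Q).real {ω | psum (x.2.2 - 1) ω = (x.2.1 : ℤ) - x.1} * stayPos ν₂ (N - x.2.1) d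
  else 0

lemma pieceWeight_nonneg (ν₁ Q ν₂ : Measure ℤ) (d : ℤ) (N : ℕ) (x : ℕ × ℕ × ℕ) :
    0 ≤ pieceWeight ν₁ Q ν₂ d N x := by
  unfold pieceWeight
  split_ifs
  · exact mul_nonneg (mul_nonneg measureReal_nonneg measureReal_nonneg) measureReal_nonneg
  · exact le_rfl

/-- The standing assumptions on the three step laws. -/
structure Pieces (ν₁ Q ν₂ : Measure ℤ) (a : ℝ) : Prop where
  left : PosDrift ν₁
  right : PosDrift ν₂
  aperiodic : Aperiodic Q
  memLp : MemLp (fun y : ℤ => (y : ℝ)) 2 Q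
  vari_pos : 0 < vari Q
  one_le : ∀ᵐ y : ℤ ∂Q, 1 ≤ y
  pos : 0 < a
  lt : a / mean ν₁ < 1 - a / mean ν₂

/-- The unnormalized local limit. -/
def pieceLimit (ν₁ Q ν₂ : Measure ℤ) (a : ℝ) (z : ℝ × ℝ × ℝ) : ℝ :=
  escape ν₁ * escape ν₂ * (mean ν₁ * mean ν₂ * mean Q)⁻¹ *
    (gaussDens (a / mean ν₁ * vari ν₁ / mean ν₁ ^ 2) z.1 *
    gaussDens (a / mean ν₂ * vari ν₂ / mean ν₂ ^ 2) z.2.1 *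
    gaussDens ((mean Q)⁻¹ * (1 - a / mean ν₂ - a / mean ν₁) * vari Q / mean Q ^ 2)
      (z.2.2 - (mean Q)⁻¹ * (z.2.1 - z.1)))

section

variable {ν₁ Q ν₂ : Measure ℤ} [IsProbabilityMeasure ν₁] [IsProbabilityMeasure ν₂]
  [IsProbabilityMeasure Q] {a : ℝ}

lemma Pieces.one_le_mean (hp : Pieces ν₁ Q ν₂ a) : 1 ≤ mean Q := by
  have h1 : ∫ _ : ℤ, (1 : ℝ) ∂Q ≤ mean Q := by
    refine integral_mono_ae (integrable_const _) (hp.memLp.integrable (by norm_num)) ?_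
    filter_upwards [hp.one_le] with y hy
    exact_mod_cast hy
  simpa using h1

/-- Each of the three probabilities is of order `1 / √N` with a Gaussian profile, and the factors `1
/ μ` come from rewriting positions as times. The profile of the first piece depends on `z.1`, that
of the last on `z.2.1`, and that of the renewal piece on the excess of `z.2.2` over `(z.2.1 - z.1) /
mean Q`. -/
lemma Pieces.localLimit (hp : Pieces ν₁ Q ν₂ a) :
    LocalLimit (a / mean ν₁) (1 - a / mean ν₂) ((mean Q)⁻¹ * (1 - a / mean ν₂ - a / mean ν₁))
      (fun N x => pieceWeight ν₁ Q ν₂ (depth a N) N x) (pieceLimit ν₁ Q ν₂ a) := by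
  intro N x z hN hz
  have hμ₁ := hp.left.mean_pos
  have hμ₂ := hp.right.mean_pos
  have hm1 := hp.one_le_mean
  have hm : 0 < mean Q := by linarith
  have ha := hp.pos
  set u := a / mean ν₁ with hu
  set w₂ := a / mean ν₂ with hw₂
  have hu0 : 0 < u := by positivity
  have hw0 : 0 < w₂ := by positivity
  have hlt : u < 1 - w₂ := hp.lt
  have hc0 : 0 < (mean Q)⁻¹ * (1 - w₂ - u) := mul_pos (inv_pos.2 hm) (by linarith)
  -- The mean step of the renewal process is at least one, so the typical number of contacts is
  -- below `N`; eventually the triple satisfies all the constraints of `triples`.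
  have hc1 : (mean Q)⁻¹ * (1 - w₂ - u) < 1 := by
    rw [inv_mul_lt_iff₀ hm]; linarith
  have hz1 : Tendsto (fun j => (((x j).1 : ℝ) - u * N j) / Real.sqrt (N j)) atTop (𝓝 z.1) :=
    (continuous_fst.tendsto z).comp hz
  have hz2 : Tendsto (fun j => (((x j).2.1 : ℝ) - (1 - w₂) * N j) / Real.sqrt (N j)) atTop
      (𝓝 z.2.1) := ((continuous_fst.comp continuous_snd).tendsto z).comp hz
  have hz3 : Tendsto (fun j => (((x j).2.2 : ℝ) - (mean Q)⁻¹ * (1 - w₂ - u) * N j) /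
      Real.sqrt (N j)) atTop (𝓝 z.2.2) := ((continuous_snd.comp continuous_snd).tendsto z).comp hz
  have r1 := tendsto_div_of_rescaled hN hz1
  have r2 := tendsto_div_of_rescaled hN hz2
  have r3 := tendsto_div_of_rescaled hN hz3
  have hmem : ∀ᶠ j in atTop, (x j).1 ≤ (x j).2.1 ∧ (x j).2.1 ≤ N j ∧ 1 ≤ (x j).2.2 ∧
      (x j).2.2 ≤ N j := by
    filter_upwards [hN.eventually_gt_atTop 0, r1.eventually_lt r2 hlt,
      r2.eventually (gt_mem_nhds (by linarith : 1 - w₂ < 1)), r3.eventually (lt_mem_nhds hc0),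
      r3.eventually (gt_mem_nhds hc1)] with j hj e1 e2 e3 e4
    have hj' : (0 : ℝ) < N j := by exact_mod_cast hj
    rw [div_lt_div_iff_of_pos_right hj'] at e1
    rw [div_lt_one hj'] at e2 e4
    have e5 : (0 : ℝ) < (x j).2.2 := by
      by_contra hcon
      exact absurd e3 (not_lt.2 (div_nonpos_of_nonpos_of_nonneg (not_lt.1 hcon) hj'.le))
    norm_cast at e1 e2 e4 e5
    omega
  have hd := tendsto_depth a hN
  -- the first piece
  have p1 : Tendsto (fun j => Real.sqrt (N j) * firstHit ν₁ (x j).1 (depth a (N j))) atTop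
      (𝓝 (escape ν₁ * ((mean ν₁)⁻¹ * gaussDens (u * vari ν₁ / mean ν₁ ^ 2) z.1))) := by
    have h0 : Tendsto (fun j => ((depth a (N j) : ℝ) - u * mean ν₁ * N j) / Real.sqrt (N j)) atTop
        (𝓝 0) := by
      rw [hu, div_mul_cancel₀ _ hμ₁.ne']; exact hd
    have h1 := tendsto_recenter hN hz1 hu0 h0
    have h2 := hp.left.tendsto_sqrt_mul_stayPos (tendsto_atTop_of_rescaled hu0 hN hz1) h1
    have h3 := tendsto_sqrt_mul_of_rescaled hN hz1 hu0 h2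
    rw [zero_sub, neg_div, gaussDens_neg, mul_div_assoc,
      gaussDens_scale hp.left.vari_pos hu0 hμ₁] at h3
    simpa only [firstHit_eq_stayPos] using h3
  -- the last piece
  have p3 : Tendsto (fun j => Real.sqrt (N j) * stayPos ν₂ (N j - (x j).2.1) (depth a (N j))) atTop
      (𝓝 (escape ν₂ * ((mean ν₂)⁻¹ * gaussDens (w₂ * vari ν₂ / mean ν₂ ^ 2) z.2.1))) := by
    have hn : Tendsto (fun j => (((N j - (x j).2.1 : ℕ) : ℝ) - w₂ * N j) / Real.sqrt (N j)) atTop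
        (𝓝 (-z.2.1)) := by
      refine hz2.neg.congr' ?_
      filter_upwards [hmem] with j hj
      rw [Nat.cast_sub hj.2.1]
      ring
    have h0 : Tendsto (fun j => ((depth a (N j) : ℝ) - w₂ * mean ν₂ * N j) / Real.sqrt (N j)) atTop
        (𝓝 0) := by
      rw [hw₂, div_mul_cancel₀ _ hμ₂.ne']; exact hd
    have h1 := tendsto_recenter hN hn hw0 h0
    have h2 := hp.right.tendsto_sqrt_mul_stayPos (tendsto_atTop_of_rescaled hw0 hN hn) h1
    have h3 := tendsto_sqrt_mul_of_rescaled hN hn hw0 h2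
    rwa [zero_sub, mul_neg, neg_neg, mul_div_assoc,
      gaussDens_scale hp.right.vari_pos hw0 hμ₂] at h3
  -- the renewal piece
  have p2 : Tendsto (fun j => Real.sqrt (N j) *
      (pathMeasure Q).real {ω | psum ((x j).2.2 - 1) ω = ((x j).2.1 : ℤ) - (x j).1}) atTop
      (𝓝 ((mean Q)⁻¹ * gaussDens ((mean Q)⁻¹ * (1 - w₂ - u) * vari Q / mean Q ^ 2)
        (z.2.2 - (mean Q)⁻¹ * (z.2.1 - z.1)))) := by
    have hs : Tendsto (fun j => 1 / Real.sqrt (N j)) atTop (𝓝 0) :=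
      tendsto_const_nhds.div_atTop
        (Real.tendsto_sqrt_atTop.comp (tendsto_natCast_atTop_atTop.comp hN))
    -- With `k` contacts there are `k - 1` renewals; the shift by one disappears at scale `√N`.
    have hn : Tendsto (fun j => ((((x j).2.2 - 1 : ℕ) : ℝ) - (mean Q)⁻¹ * (1 - w₂ - u) * N j) /
        Real.sqrt (N j)) atTop (𝓝 z.2.2) := by
      have := hz3.sub hs
      rw [sub_zero] at this
      refine this.congr' ?_
      filter_upwards [hmem] with j hj
      rw [Nat.cast_sub hj.2.2.1]
      push_cast
      ring
    have h0 : Tendsto (fun j => ((((x j).2.1 : ℤ) - (x j).1 : ℤ) -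
        (mean Q)⁻¹ * (1 - w₂ - u) * mean Q * N j) / Real.sqrt (N j)) atTop (𝓝 (z.2.1 - z.1)) := by
      refine (hz2.sub hz1).congr fun j => ?_
      have e : (mean Q)⁻¹ * (1 - w₂ - u) * mean Q = 1 - w₂ - u := by field_simp
      rw [e]
      push_cast
      ring
    have h1 := tendsto_recenter hN hn hc0 h0
    have h2 := tendsto_sqrt_mul_prob hp.aperiodic hp.vari_pos hp.memLp
      (A := fun _ => True) (M := 0) (fun _ _ _ h => h) (tendsto_atTop_of_rescaled hc0 hN hn) h1
    have h3 := tendsto_sqrt_mul_of_rescaled hN hn hc0 h2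
    have h4 : z.2.1 - z.1 - mean Q * z.2.2 =
        -(mean Q * (z.2.2 - (mean Q)⁻¹ * (z.2.1 - z.1))) := by
      field_simp
      ring
    rw [h4, neg_div, gaussDens_neg, mul_div_assoc, gaussDens_scale hp.vari_pos hc0 hm] at h3
    simpa using h3
  refine (((p1.mul p2).mul p3).congr' ?_).trans (le_of_eq ?_)
  · filter_upwards [hmem] with j hj
    rw [pieceWeight, if_pos (mem_triples.2 hj)]
    ring
  · congr 1
    rw [pieceLimit, mul_inv, mul_inv]
    ring

end

/-! ### Tightness of the tilted weights -/

lemma exists_forall_le_mul_sq (C : ℝ) {e : ℝ} (he : 0 < e) :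
    ∃ A₀ : ℝ, 0 < A₀ ∧ ∀ A, A₀ ≤ A → C ≤ e * A ^ 2 := by
  refine ⟨max 1 (C / e), lt_max_of_lt_left one_pos, fun A hA => ?_⟩
  have h1 : 1 ≤ A := (le_max_left _ _).trans hA
  have h2 : C / e ≤ A := (le_max_right _ _).trans hA
  rw [div_le_iff₀ he] at h2
  nlinarith [mul_nonneg (mul_nonneg he.le (zero_le_one.trans h1)) (sub_nonneg.2 h1)]

/-- The form in which Chebyshev's inequality is used: a deviation of order `A √N` over a time of
order `N` has probability of order `1 / A²`. -/
lemma mul_div_sq_le {J D V w A b N ε : ℝ} (hV : 0 ≤ V) (hN : 0 < N) (hJ : J ≤ (w + 1) * N)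
    (hA : 0 < A) (hb : 0 < b) (hD : A * b * Real.sqrt N ≤ D)
    (h : (w + 1) * V / b ^ 2 ≤ ε * A ^ 2) (hε : 0 ≤ ε) : J * V / D ^ 2 ≤ ε := by
  have hs : 0 < Real.sqrt N := Real.sqrt_pos.2 hN
  have hD0 : 0 < D := lt_of_lt_of_le (by positivity) hD
  rw [div_le_iff₀ (by positivity)] at h ⊢
  have h1 : (A * b) ^ 2 * N ≤ D ^ 2 := by
    have := pow_le_pow_left₀ (by positivity) hD 2
    rwa [mul_pow, Real.sq_sqrt hN.le] at this
  calc J * V ≤ (w + 1) * N * V := mul_le_mul_of_nonneg_right hJ hV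
    _ = ((w + 1) * V) * N := by ring
    _ ≤ ε * A ^ 2 * b ^ 2 * N := mul_le_mul_of_nonneg_right h hN.le
    _ = ε * ((A * b) ^ 2 * N) := by ring
    _ ≤ ε * D ^ 2 := mul_le_mul_of_nonneg_left h1 hε

lemma eventually_scale {w A : ℝ} (hw : 0 < w) (hA : 0 < A) (B : ℝ) :
    ∀ᶠ N : ℕ in atTop, (0 : ℝ) < N ∧ B ≤ A * Real.sqrt N ∧ A * Real.sqrt N ≤ N ∧
      0 ≤ w * N - A * Real.sqrt N := by
  have h1 : Tendsto (fun N : ℕ => Real.sqrt N) atTop atTop :=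
    Real.tendsto_sqrt_atTop.comp tendsto_natCast_atTop_atTop
  filter_upwards [(h1.const_mul_atTop hA).eventually_ge_atTop B, h1.eventually_ge_atTop A,
    eventually_gt_atTop 0, (tendsto_mul_add_sqrt hw (-A)).eventually_ge_atTop 0] with N e1 e2 e3 e4
  have hN : (0 : ℝ) < N := by exact_mod_cast e3
  refine ⟨hN, e1, ?_, by linarith⟩
  nlinarith [Real.mul_self_sqrt hN.le, Real.sqrt_nonneg N]

section

variable {ν : Measure ℤ} [IsProbabilityMeasure ν]

/-- A passage off by more than `A √N` from `(a / μ) N` requires, at the nearby deterministic time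
`(a / μ) N ± A √N`, a deviation of the walk of order `μ A √N`. Late and early passages each receive
`ε / 2`. -/
lemma PosDrift.tight_firstHit (h : PosDrift ν) {a : ℝ} (ha : 0 < a) {ε : ℝ} (hε : 0 < ε) :
    ∃ A₀ : ℝ, 0 < A₀ ∧ ∀ A, A₀ ≤ A → ∀ᶠ N : ℕ in atTop, ∀ B : Finset ℕ,
      (∀ l ∈ B, A * Real.sqrt N < |(l : ℝ) - a / mean ν * N|) →
      ∑ l ∈ B, firstHit ν l (depth a N) ≤ ε := by
  have hμ := h.mean_pos
  have hρ := h.escape_pos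
  have hw : 0 < a / mean ν := by positivity
  have hwμ : a / mean ν * mean ν = a := div_mul_cancel₀ _ hμ.ne'
  set w := a / mean ν with hwdef
  obtain ⟨A₁, hA₁, hB₁⟩ := exists_forall_le_mul_sq ((w + 1) * vari ν / (mean ν / 2) ^ 2)
    (half_pos hε)
  -- The early estimate carries the factor `escape ν` on its left side, so a smaller tolerance is
  -- required.
  obtain ⟨A₂, hA₂, hB₂⟩ := exists_forall_le_mul_sq ((w + 1) * vari ν / (mean ν / 2) ^ 2)
    (mul_pos hρ (half_pos hε))
  refine ⟨max A₁ A₂, lt_max_of_lt_left hA₁, fun A hA => ?_⟩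
  have hA0 : 0 < A := hA₁.trans_le ((le_max_left _ _).trans hA)
  have hb₁ := hB₁ A ((le_max_left _ _).trans hA)
  have hb₂ := hB₂ A ((le_max_right _ _).trans hA)
  -- With this threshold half of `μ A √N` exceeds `μ + 1`, which absorbs the rounding of the time
  -- `n` and of the depth; the other half is the deviation used.
  filter_upwards [eventually_scale hw hA0 (2 * (1 + 1 / mean ν))] with N ⟨hN, h2, hle, hnn⟩ B hB
  have hinv : 1 / mean ν * mean ν = 1 := by field_simp
  have hbig : 2 * mean ν + 2 ≤ A * Real.sqrt N * mean ν := by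
    have := mul_le_mul_of_nonneg_right h2 hμ.le
    nlinarith
  have hd1 : (depth a N : ℝ) ≤ a * N := Int.floor_le _
  have hd2 : a * N < depth a N + 1 := Int.lt_floor_add_one _
  have hsplit := Finset.sum_filter_add_sum_filter_not B (fun l : ℕ => w * N < l)
    fun l => firstHit ν l (depth a N)
  have hlate : ∑ l ∈ B with w * N < ((l : ℕ) : ℝ), firstHit ν l (depth a N) ≤ ε / 2 := by
    set n := ⌊w * N + A * Real.sqrt N⌋₊ with hn
    have hpos : 0 ≤ w * N + A * Real.sqrt N := by positivity
    have hn1 : (n : ℝ) ≤ w * N + A * Real.sqrt N := Nat.floor_le hpos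
    have hn2 : w * N + A * Real.sqrt N < n + 1 := Nat.lt_floor_add_one _
    have hgap : A * (mean ν / 2) * Real.sqrt N ≤ n * mean ν - depth a N := by
      have h3 : (w * N + A * Real.sqrt N - 1) * mean ν ≤ n * mean ν :=
        mul_le_mul_of_nonneg_right (by linarith) hμ.le
      have h4 : w * N * mean ν = a * N := by rw [← hwμ]; ring
      nlinarith
    have hgap0 : 0 < A * (mean ν / 2) * Real.sqrt N := by
      have := Real.sqrt_pos.2 hN
      positivity
    refine (sum_firstHit_late_le ν h.memLp (n := n) (by linarith) _ fun l hl => ?_).trans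
      (mul_div_sq_le h.vari_pos.le hN (by linarith) hA0 (half_pos hμ) hgap hb₁ (half_pos hε).le)
    rw [Finset.mem_filter] at hl
    have h5 := hB l hl.1
    rw [abs_of_pos (by linarith [hl.2])] at h5
    have : (n : ℝ) < l := by linarith
    exact_mod_cast this
  have hearly : ∑ l ∈ B with ¬ w * N < ((l : ℕ) : ℝ), firstHit ν l (depth a N) ≤ ε / 2 := by
    set n := ⌊w * N - A * Real.sqrt N⌋₊ with hn
    have hn1 : (n : ℝ) ≤ w * N - A * Real.sqrt N := Nat.floor_le hnn
    have hgap : A * (mean ν / 2) * Real.sqrt N ≤ depth a N - n * mean ν := by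
      have h3 : n * mean ν ≤ (w * N - A * Real.sqrt N) * mean ν :=
        mul_le_mul_of_nonneg_right (by linarith) hμ.le
      have h4 : w * N * mean ν = a * N := by rw [← hwμ]; ring
      nlinarith
    have hgap0 : 0 < A * (mean ν / 2) * Real.sqrt N := by
      have := Real.sqrt_pos.2 hN
      positivity
    have h6 := (sum_firstHit_early_le ν h.memLp (n := n) (d := depth a N) (by linarith)
      (B.filter fun l : ℕ => ¬ w * N < (l : ℝ)) fun l hl => ?_).trans
      (mul_div_sq_le h.vari_pos.le hN (J := n) (w := w) (by nlinarith) hA0 (half_pos hμ) hgap hb₂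
        (mul_pos hρ (half_pos hε)).le)
    · exact le_of_mul_le_mul_left h6 hρ
    · rw [Finset.mem_filter] at hl
      have h5 := hB l hl.1
      rw [abs_of_nonpos (by linarith [not_lt.1 hl.2])] at h5
      exact Nat.le_floor (by linarith)
  linarith

end

section

variable {Q : Measure ℤ} [IsProbabilityMeasure Q]

/-- The bound is uniform over all targets `n` in a window of width `2 A √N` on either side of `mean
Q * w * N`, as needed when both endpoints `l` and `r` move by up to `A √N`. -/
lemma tight_renewal (hQ : ∀ᵐ y : ℤ ∂Q, 1 ≤ y) (h2 : MemLp (fun y : ℤ => (y : ℝ)) 2 Q)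
    (hm : 1 ≤ mean Q) {w : ℝ} (hw : 0 < w) (A : ℝ) {ε : ℝ} (hε : 0 < ε) :
    ∃ A₀ : ℝ, 0 < A₀ ∧ ∀ᶠ N : ℕ in atTop, ∀ n : ℤ,
      |(n : ℝ) - mean Q * w * N| ≤ 2 * A * Real.sqrt N → ∀ B : Finset ℕ,
      (∀ j ∈ B, A₀ * Real.sqrt N < |(j : ℝ) + 1 - w * N|) →
      ∑ j ∈ B, (pathMeasure Q).real {ω | psum j ω = n} ≤ ε := by
  have hm0 : 0 < mean Q := by linarith
  have hV : 0 ≤ vari Q := variance_nonneg _ _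
  obtain ⟨A₁, hA₁, hB₁⟩ := exists_forall_le_mul_sq ((w + 1) * vari Q / (mean Q / 2) ^ 2)
    (half_pos hε)
  -- The factor `8` makes the displacement `2 A √N` of the target at most a quarter of `A₀ √N`.
  -- Another quarter absorbs the rounding of `J`, so half of the deviation is left.
  set A₀ := max A₁ (8 * A) with hA₀
  have hA0 : 0 < A₀ := lt_max_of_lt_left hA₁
  have hA8 : 8 * A ≤ A₀ := le_max_right _ _
  have hb := hB₁ A₀ (le_max_left _ _)
  refine ⟨A₀, hA0, ?_⟩
  filter_upwards [eventually_scale hw hA0 4] with N ⟨hN, h4, hle, hnn⟩ n hn B hB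
  have hs := Real.sqrt_pos.2 hN
  have hgap0 : 0 < A₀ * (mean Q / 2) * Real.sqrt N := by positivity
  have hA8' : 8 * A * Real.sqrt N ≤ A₀ * Real.sqrt N := mul_le_mul_of_nonneg_right hA8 hs.le
  have hmA : A₀ * Real.sqrt N ≤ mean Q * (A₀ * Real.sqrt N) := by
    nlinarith [mul_pos hA0 hs]
  have h4m : mean Q * 4 ≤ mean Q * (A₀ * Real.sqrt N) := mul_le_mul_of_nonneg_left h4 hm0.le
  rw [abs_le] at hn
  have hsplit := Finset.sum_filter_add_sum_filter_not B (fun j : ℕ => w * N < (j : ℝ) + 1)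
    fun j => (pathMeasure Q).real {ω | psum j ω = n}
  have hlate : ∑ j ∈ B with w * N < ((j : ℕ) : ℝ) + 1, (pathMeasure Q).real {ω | psum j ω = n} ≤
      ε / 2 := by
    set J := ⌊w * N + A₀ * Real.sqrt N⌋₊ with hJ
    have hJ1 : (J : ℝ) ≤ w * N + A₀ * Real.sqrt N := Nat.floor_le (by positivity)
    have hJ2 : w * N + A₀ * Real.sqrt N < J + 1 := Nat.lt_floor_add_one _
    have hgap : A₀ * (mean Q / 2) * Real.sqrt N ≤ J * mean Q - n := by
      have h3 : (w * N + A₀ * Real.sqrt N - 1) * mean Q ≤ J * mean Q :=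
        mul_le_mul_of_nonneg_right (by linarith) hm0.le
      nlinarith
    refine (sum_prob_psum_late_le hQ h2 (J := J) (by linarith) _ fun j hj => ?_).trans
      (mul_div_sq_le hV hN (by linarith) hA0 (half_pos hm0) hgap hb (half_pos hε).le)
    rw [Finset.mem_filter] at hj
    have h5 := hB j hj.1
    rw [abs_of_pos (by linarith [hj.2])] at h5
    have : (J : ℝ) < j + 1 := by linarith
    have : J < j + 1 := by exact_mod_cast this
    omega
  have hearly : ∑ j ∈ B with ¬ w * N < ((j : ℕ) : ℝ) + 1, (pathMeasure Q).real {ω | psum j ω = n} ≤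
      ε / 2 := by
    set J := ⌊w * N - A₀ * Real.sqrt N⌋₊ with hJ
    have hJ1 : (J : ℝ) ≤ w * N - A₀ * Real.sqrt N := Nat.floor_le hnn
    have hgap : A₀ * (mean Q / 2) * Real.sqrt N ≤ n - J * mean Q := by
      have h3 : J * mean Q ≤ (w * N - A₀ * Real.sqrt N) * mean Q :=
        mul_le_mul_of_nonneg_right (by linarith) hm0.le
      nlinarith
    refine (sum_prob_psum_early_le hQ h2 (J := J) (by linarith) _ fun j hj => ?_).trans
      (mul_div_sq_le hV hN (w := w) (by nlinarith) hA0 (half_pos hm0) hgap hb (half_pos hε).le)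
    rw [Finset.mem_filter] at hj
    have h5 := hB j hj.1
    rw [abs_of_nonpos (by linarith [not_lt.1 hj.2])] at h5
    exact Nat.le_floor (by linarith)
  linarith

end

-- The product structure lets one sum over `k` at fixed endpoints, where a uniform bound is
-- available, and afterwards over `r` and `l` separately.
open Classical in
lemma sum_triple_le {f s : ℕ → ℝ} {W : ℕ → ℕ → ℕ → ℝ} (hf : ∀ l, 0 ≤ f l) (hs : ∀ r, 0 ≤ s r)
    (hW : ∀ l r k, 0 ≤ W l r k) {R R₁ R₂ : Finset ℕ} {T : ℕ → ℕ → ℕ → Prop} {α β γ : ℝ}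
    (hα : ∑ l ∈ R₁, f l ≤ α) (hβ : ∑ r ∈ R₂, s r ≤ β) (hγ0 : 0 ≤ γ)
    (hγ : ∀ l ∈ R₁, ∀ r ∈ R₂, ∑ k ∈ R with T l r k, W l r k ≤ γ)
    {D : Finset (ℕ × ℕ × ℕ)}
    (hD : ∀ x ∈ D, x.1 ∈ R₁ ∧ x.2.1 ∈ R₂ ∧ x.2.2 ∈ R ∧ T x.1 x.2.1 x.2.2) :
    ∑ x ∈ D, f x.1 * W x.1 x.2.1 x.2.2 * s x.2.1 ≤ α * β * γ := by
  have hα0 : 0 ≤ ∑ l ∈ R₁, f l := Finset.sum_nonneg fun l _ => hf l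
  have hβ0 : 0 ≤ ∑ r ∈ R₂, s r := Finset.sum_nonneg fun r _ => hs r
  calc ∑ x ∈ D, f x.1 * W x.1 x.2.1 x.2.2 * s x.2.1
      ≤ ∑ x ∈ (R₁ ×ˢ R₂ ×ˢ R) with T x.1 x.2.1 x.2.2, f x.1 * W x.1 x.2.1 x.2.2 * s x.2.1 := by
        refine Finset.sum_le_sum_of_subset_of_nonneg (fun x hx => ?_) fun x _ _ =>
          mul_nonneg (mul_nonneg (hf _) (hW _ _ _)) (hs _)
        obtain ⟨h1, h2, h3, h4⟩ := hD x hx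
        exact Finset.mem_filter.2 ⟨Finset.mem_product.2 ⟨h1, Finset.mem_product.2 ⟨h2, h3⟩⟩, h4⟩
    _ = ∑ l ∈ R₁, f l * ∑ r ∈ R₂, s r * ∑ k ∈ R with T l r k, W l r k := by
        rw [Finset.sum_filter, Finset.sum_product]
        refine Finset.sum_congr rfl fun l _ => ?_
        rw [Finset.sum_product, Finset.mul_sum]
        refine Finset.sum_congr rfl fun r _ => ?_
        rw [Finset.sum_filter, Finset.mul_sum, Finset.mul_sum]
        refine Finset.sum_congr rfl fun k _ => ?_
        dsimp only
        split_ifs <;> ring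
    _ ≤ ∑ l ∈ R₁, f l * ∑ r ∈ R₂, s r * γ := by
        refine Finset.sum_le_sum fun l hl => mul_le_mul_of_nonneg_left ?_ (hf l)
        exact Finset.sum_le_sum fun r hr => mul_le_mul_of_nonneg_left (hγ l hl r hr) (hs r)
    _ = (∑ l ∈ R₁, f l) * (∑ r ∈ R₂, s r) * γ := by
        rw [← Finset.sum_mul, ← Finset.sum_mul, mul_assoc]
    _ ≤ α * β * γ := mul_le_mul_of_nonneg_right
        (mul_le_mul hα hβ hβ0 (hα0.trans hα)) hγ0

lemma sum_stayPos_reflect_le {ν : Measure ℤ} [IsProbabilityMeasure ν] {d : ℤ} {N : ℕ} {ε : ℝ}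
    {B : Finset ℕ} (hB : ∀ r ∈ B, r ≤ N)
    (h : ∑ l ∈ B.image (fun r => N - r), firstHit ν l d ≤ ε) :
    ∑ r ∈ B, stayPos ν (N - r) d ≤ ε := by
  rw [Finset.sum_image (fun r hr r' hr' (he : N - r = N - r') => by
    have := hB r hr; have := hB r' hr'; omega)] at h
  simpa only [firstHit_eq_stayPos] using h

section

variable {ν₁ Q ν₂ : Measure ℤ} [IsProbabilityMeasure ν₁] [IsProbabilityMeasure ν₂]
  [IsProbabilityMeasure Q] {a : ℝ}

-- If the rescaled triple is large, then `l` is far from its center, or `r` is, or both are close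
-- and `k` is far from its center. In each case one factor contributes at most `ε / 3`, and the
-- other two sum to at most one.
open Classical in
lemma Pieces.tight (hp : Pieces ν₁ Q ν₂ a) :
    TightAt (a / mean ν₁) (1 - a / mean ν₂) ((mean Q)⁻¹ * (1 - a / mean ν₂ - a / mean ν₁))
      (fun N x => pieceWeight ν₁ Q ν₂ (depth a N) N x) triples := by
  intro ε hε
  have hm1 := hp.one_le_mean
  have hm : 0 < mean Q := by linarith
  have hlt := hp.lt
  have hc0 : 0 < (mean Q)⁻¹ * (1 - a / mean ν₂ - a / mean ν₁) :=
    mul_pos (inv_pos.2 hm) (by linarith)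
  obtain ⟨A₁, hA₁, hB₁⟩ := hp.left.tight_firstHit hp.pos (div_pos hε three_pos)
  obtain ⟨A₂, hA₂, hB₂⟩ := hp.right.tight_firstHit hp.pos (div_pos hε three_pos)
  set A := max A₁ A₂ with hA
  obtain ⟨A₃, hA₃, hB₃⟩ := tight_renewal hp.one_le hp.memLp hm1 hc0 A (div_pos hε three_pos)
  refine ⟨max A A₃, ?_⟩
  filter_upwards [hB₁ A (le_max_left _ _), hB₂ A (le_max_right _ _), hB₃, eventually_gt_atTop 0]
    with N h1 h2 h3 hN
  have hs : 0 < Real.sqrt N := Real.sqrt_pos.2 (by exact_mod_cast hN)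
  set u := a / mean ν₁ with hu
  set w₂ := a / mean ν₂ with hw₂
  set c := (mean Q)⁻¹ * (1 - w₂ - u) with hc
  set d := depth a N with hd
  set R := Finset.range (N + 1) with hR
  set W : ℕ → ℕ → ℕ → ℝ := fun l r k =>
    (pathMeasure Q).real {ω | psum (k - 1) ω = (r : ℤ) - l} with hW
  have hW0 : ∀ l r k, 0 ≤ W l r k := fun _ _ _ => measureReal_nonneg
  have hf0 : ∀ l, 0 ≤ firstHit ν₁ l d := fun _ => measureReal_nonneg
  have hs0 : ∀ r, 0 ≤ stayPos ν₂ (N - r) d := fun _ => measureReal_nonneg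
  have hWk : ∀ (p : ℕ → Prop) (l r : ℕ) (γ : ℝ),
      (∀ B : Finset ℕ, (∀ j ∈ B, p (j + 1)) →
        ∑ j ∈ B, (pathMeasure Q).real {ω | psum j ω = (r : ℤ) - l} ≤ γ) →
      ∑ k ∈ R with 1 ≤ k ∧ p k, W l r k ≤ γ := by
    intro p l r γ hγ
    have hinj : Set.InjOn (fun k : ℕ => k - 1) (R.filter fun k => 1 ≤ k ∧ p k) := by
      intro k hk k' hk' he
      have := (Finset.mem_filter.1 hk).2.1
      have := (Finset.mem_filter.1 hk').2.1
      have he' : k - 1 = k' - 1 := he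
      omega
    have h := hγ ((R.filter fun k => 1 ≤ k ∧ p k).image fun k => k - 1) fun j hj => by
      obtain ⟨k, hk, rfl⟩ := Finset.mem_image.1 hj
      obtain ⟨-, hk1, hpk⟩ := Finset.mem_filter.1 hk
      rwa [Nat.sub_add_cancel hk1]
    rwa [Finset.sum_image hinj] at h
  have hW1 : ∀ l r, ∑ k ∈ R with 1 ≤ k ∧ True, W l r k ≤ 1 := fun l r => by
    convert hWk (fun _ => True) l r 1 fun B _ => sum_prob_psum_le_one hp.one_le B _
  set L := R.filter fun l : ℕ => A * Real.sqrt N < |(l : ℝ) - u * N| with hL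
  set L' := R.filter fun r : ℕ => A * Real.sqrt N < |(r : ℝ) - (1 - w₂) * N| with hL'
  set D := (triples N).filter fun x => ¬ ‖resc u (1 - w₂) c N x‖ ≤ max A A₃ with hD
  have hmem : ∀ x ∈ triples N, x.1 ∈ R ∧ x.2.1 ∈ R ∧ x.2.2 ∈ R ∧ 1 ≤ x.2.2 := by
    intro x hx
    rw [mem_triples] at hx
    simp only [hR, Finset.mem_range]
    omega
  have hval : ∀ x ∈ triples N, pieceWeight ν₁ Q ν₂ d N x =
      firstHit ν₁ x.1 d * W x.1 x.2.1 x.2.2 * stayPos ν₂ (N - x.2.1) d := fun x hx => by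
    rw [pieceWeight, if_pos hx]
  have hS1 : ∑ l ∈ L, firstHit ν₁ l d ≤ ε / 3 := h1 L fun l hl => (Finset.mem_filter.1 hl).2
  have hS2 : ∑ r ∈ L', stayPos ν₂ (N - r) d ≤ ε / 3 := by
    have hle : ∀ r ∈ L', r ≤ N := fun r hr => by
      have := (Finset.mem_filter.1 hr).1
      rw [hR, Finset.mem_range] at this; omega
    refine sum_stayPos_reflect_le hle (h2 _ fun l hl => ?_)
    obtain ⟨r, hr, rfl⟩ := Finset.mem_image.1 hl
    have h5 := (Finset.mem_filter.1 hr).2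
    rw [Nat.cast_sub (hle r hr), ← abs_neg]
    rwa [show -((N : ℝ) - r - w₂ * N) = r - (1 - w₂) * N by ring]
  have hT1 : ∑ l ∈ R, firstHit ν₁ l d ≤ 1 := sum_firstHit_le_one ν₁ _ _
  have hT2 : ∑ r ∈ R, stayPos ν₂ (N - r) d ≤ 1 :=
    sum_stayPos_reflect_le (fun r hr => by rw [hR, Finset.mem_range] at hr; omega)
      (sum_firstHit_le_one ν₂ _ _)
  set D₁ := D.filter fun x => x.1 ∈ L with hD₁
  set D₂ := D.filter fun x => x.2.1 ∈ L' with hD₂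
  set D₃ := D.filter fun x => x.1 ∉ L ∧ x.2.1 ∉ L' with hD₃
  have hDt : ∀ x ∈ D, x ∈ triples N := fun x hx => (Finset.mem_filter.1 hx).1
  have e1 : ∑ x ∈ D₁, pieceWeight ν₁ Q ν₂ d N x ≤ ε / 3 := by
    rw [Finset.sum_congr rfl fun x hx => hval x (hDt x (Finset.mem_filter.1 hx).1)]
    refine (sum_triple_le hf0 hs0 hW0 (R := R) (T := fun _ _ k => 1 ≤ k ∧ True) hS1 hT2
      zero_le_one (fun l _ r _ => by convert hW1 l r) fun x hx => ?_).trans_eq (by ring)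
    obtain ⟨hx1, hx2⟩ := Finset.mem_filter.1 hx
    obtain ⟨m1, m2, m3, m4⟩ := hmem x (hDt x hx1)
    exact ⟨hx2, m2, m3, m4, trivial⟩
  have e2 : ∑ x ∈ D₂, pieceWeight ν₁ Q ν₂ d N x ≤ ε / 3 := by
    rw [Finset.sum_congr rfl fun x hx => hval x (hDt x (Finset.mem_filter.1 hx).1)]
    refine (sum_triple_le hf0 hs0 hW0 (R := R) (T := fun _ _ k => 1 ≤ k ∧ True) hT1 hS2
      zero_le_one (fun l _ r _ => by convert hW1 l r) fun x hx => ?_).trans_eq (by ring)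
    obtain ⟨hx1, hx2⟩ := Finset.mem_filter.1 hx
    obtain ⟨m1, m2, m3, m4⟩ := hmem x (hDt x hx1)
    exact ⟨m1, hx2, m3, m4, trivial⟩
  have e3 : ∑ x ∈ D₃, pieceWeight ν₁ Q ν₂ d N x ≤ ε / 3 := by
    rw [Finset.sum_congr rfl fun x hx => hval x (hDt x (Finset.mem_filter.1 hx).1)]
    refine (sum_triple_le hf0 hs0 hW0 (R := R) (R₁ := R.filter (· ∉ L)) (R₂ := R.filter (· ∉ L'))
      (T := fun _ _ k => 1 ≤ k ∧ A₃ * Real.sqrt N < |(k : ℝ) - c * N|) (γ := ε / 3)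
      ((Finset.sum_le_sum_of_subset_of_nonneg (Finset.filter_subset _ _)
        fun l _ _ => hf0 l).trans hT1)
      ((Finset.sum_le_sum_of_subset_of_nonneg (Finset.filter_subset _ _)
        fun r _ _ => hs0 r).trans hT2) (by positivity) (fun l hl r hr => ?_)
      fun x hx => ?_).trans_eq (by ring)
    · obtain ⟨hl1, hl2⟩ := Finset.mem_filter.1 hl
      obtain ⟨hr1, hr2⟩ := Finset.mem_filter.1 hr
      have hl3 : |(l : ℝ) - u * N| ≤ A * Real.sqrt N := by
        by_contra hcon
        exact hl2 (Finset.mem_filter.2 ⟨hl1, not_le.1 hcon⟩)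
      have hr3 : |(r : ℝ) - (1 - w₂) * N| ≤ A * Real.sqrt N := by
        by_contra hcon
        exact hr2 (Finset.mem_filter.2 ⟨hr1, not_le.1 hcon⟩)
      have hk := hWk (fun k => A₃ * Real.sqrt N < |(k : ℝ) - c * N|) l r (ε / 3) fun B hB => ?_
      · convert hk
      refine h3 ((r : ℤ) - l) ?_ B fun j hj => by simpa using hB j hj
      have e : mean Q * c = 1 - w₂ - u := by rw [hc]; field_simp
      rw [e]
      push_cast
      rw [abs_le] at hl3 hr3 ⊢
      constructor <;> linarith [hl3.1, hl3.2, hr3.1, hr3.2]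
    · obtain ⟨hxD, hxl, hxr⟩ := Finset.mem_filter.1 hx
      obtain ⟨m1, m2, m3, m4⟩ := hmem x (hDt x hxD)
      refine ⟨Finset.mem_filter.2 ⟨m1, hxl⟩, Finset.mem_filter.2 ⟨m2, hxr⟩, m3, m4, ?_⟩
      have hl3 : |(x.1 : ℝ) - u * N| ≤ A * Real.sqrt N := by
        by_contra hcon
        exact hxl (Finset.mem_filter.2 ⟨m1, not_le.1 hcon⟩)
      have hr3 : |(x.2.1 : ℝ) - (1 - w₂) * N| ≤ A * Real.sqrt N := by
        by_contra hcon
        exact hxr (Finset.mem_filter.2 ⟨m2, not_le.1 hcon⟩)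
      by_contra! hk
      refine (Finset.mem_filter.1 hxD).2 ?_
      rw [resc, rescale, Prod.norm_mk, Prod.norm_mk, max_le_iff, max_le_iff]
      simp only [Real.norm_eq_abs, abs_div, abs_of_pos hs]
      rw [div_le_iff₀ hs, div_le_iff₀ hs, div_le_iff₀ hs]
      exact ⟨hl3.trans (mul_le_mul_of_nonneg_right (le_max_left _ _) hs.le),
        hr3.trans (mul_le_mul_of_nonneg_right (le_max_left _ _) hs.le),
        hk.trans (mul_le_mul_of_nonneg_right (le_max_right _ _) hs.le)⟩
  have hcover : D ⊆ D₁ ∪ (D₂ ∪ D₃) := by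
    intro x hx
    simp only [hD₁, hD₂, hD₃, Finset.mem_union, Finset.mem_filter]
    tauto
  have hnn := pieceWeight_nonneg ν₁ Q ν₂ d N
  calc _ ≤ ∑ x ∈ D₁ ∪ (D₂ ∪ D₃), pieceWeight ν₁ Q ν₂ d N x :=
        Finset.sum_le_sum_of_subset_of_nonneg (by convert hcover) fun x _ _ => hnn x
    _ ≤ ∑ x ∈ D₁, pieceWeight ν₁ Q ν₂ d N x + ∑ x ∈ D₂ ∪ D₃, pieceWeight ν₁ Q ν₂ d N x :=
        (Finset.sum_union_inter (s₁ := D₁) (s₂ := D₂ ∪ D₃) (f := pieceWeight ν₁ Q ν₂ d N)) ▸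
          le_add_of_nonneg_right (Finset.sum_nonneg fun x _ => hnn x)
    _ ≤ ∑ x ∈ D₁, pieceWeight ν₁ Q ν₂ d N x + (∑ x ∈ D₂, pieceWeight ν₁ Q ν₂ d N x +
        ∑ x ∈ D₃, pieceWeight ν₁ Q ν₂ d N x) := by
        gcongr
        exact (Finset.sum_union_inter (s₁ := D₂) (s₂ := D₃) (f := pieceWeight ν₁ Q ν₂ d N)) ▸
          le_add_of_nonneg_right (Finset.sum_nonneg fun x _ => hnn x)
    _ ≤ ε := by linarith

end

/-! ### The limit law -/

/-- The shear which maps the product of three centered Gaussian laws to the limit law. -/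
def shear (m : ℝ) : (ℝ × ℝ × ℝ) →L[ℝ] (ℝ × ℝ × ℝ) :=
  (ContinuousLinearMap.fst ℝ ℝ (ℝ × ℝ)).prod
    (((ContinuousLinearMap.fst ℝ ℝ ℝ).comp (ContinuousLinearMap.snd ℝ ℝ (ℝ × ℝ))).prod
      ((ContinuousLinearMap.snd ℝ ℝ ℝ).comp (ContinuousLinearMap.snd ℝ ℝ (ℝ × ℝ)) +
        m⁻¹ • ((ContinuousLinearMap.fst ℝ ℝ ℝ).comp (ContinuousLinearMap.snd ℝ ℝ (ℝ × ℝ)) -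
          ContinuousLinearMap.fst ℝ ℝ (ℝ × ℝ))))

lemma shear_apply (m : ℝ) (z : ℝ × ℝ × ℝ) :
    shear m z = (z.1, z.2.1, z.2.2 + m⁻¹ * (z.2.1 - z.1)) := rfl

/-- For fixed first two coordinates the shear is a translation of the third one, so Lebesgue measure
is preserved as in a skew product. -/
lemma measurePreserving_shear (m : ℝ) :
    MeasurePreserving (shear m) (volume : Measure (ℝ × ℝ × ℝ)) volume := by
  have h : ∀ x : ℝ, MeasurePreserving (fun p : ℝ × ℝ => (p.1, p.2 + m⁻¹ * (p.1 - x))) volume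
      volume := by
    intro x
    exact (MeasurePreserving.id volume).skew_product (μa := (volume : Measure ℝ))
      (μc := (volume : Measure ℝ)) (g := fun y w => w + m⁻¹ * (y - x))
      (by unfold Function.uncurry; fun_prop) (ae_of_all _ fun y => map_add_right_eq_self volume _)
  exact (MeasurePreserving.id volume).skew_product (μa := (volume : Measure ℝ))
    (μc := (volume : Measure (ℝ × ℝ))) (g := fun x p => (p.1, p.2 + m⁻¹ * (p.1 - x)))
    (by unfold Function.uncurry; fun_prop) (ae_of_all _ fun x => (h x).map_eq)

/-- The product of three centered Gaussian laws. -/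
def gauss3 (s₁ s₂ s₃ : ℝ) : Measure (ℝ × ℝ × ℝ) :=
  (gaussianReal 0 (s₁ ^ 2).toNNReal).prod
    ((gaussianReal 0 (s₂ ^ 2).toNNReal).prod (gaussianReal 0 (s₃ ^ 2).toNNReal))

instance (s₁ s₂ s₃ : ℝ) : IsGaussian (gauss3 s₁ s₂ s₃) := by
  unfold gauss3; infer_instance

section

variable {s₁ s₂ s₃ : ℝ} (h₁ : 0 < s₁) (h₂ : 0 < s₂) (h₃ : 0 < s₃) (m : ℝ)

lemma gaussianReal_eq_withDensity {s : ℝ} (h : 0 < s) :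
    gaussianReal 0 (s ^ 2).toNNReal = volume.withDensity fun z =>
      ENNReal.ofReal (gaussDens (s ^ 2) z) := by
  rw [gaussianReal_of_var_ne_zero _ (by simpa using h.ne')]
  congr 1; ext z
  rw [gaussianPDF, gaussianPDFReal, gaussDens, Real.coe_toNNReal _ (by positivity), sub_zero]

lemma gaussDens_pos {V : ℝ} (hV : 0 < V) (z : ℝ) : 0 < gaussDens V z := by
  unfold gaussDens
  have := Real.pi_pos
  positivity

lemma continuous_gaussDens (V : ℝ) : Continuous (gaussDens V) := by
  unfold gaussDens; fun_prop

include h₁ h₂ h₃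

lemma limit_density_eq (z : ℝ × ℝ × ℝ) :
    1 / ((2 * Real.pi) ^ (3 / 2 : ℝ) * s₁ * s₂ * s₃) *
      Real.exp (-(1 / 2) * quadForm s₁ s₂ s₃ m z) =
    gaussDens (s₁ ^ 2) z.1 * gaussDens (s₂ ^ 2) z.2.1 *
      gaussDens (s₃ ^ 2) (z.2.2 - m⁻¹ * (z.2.1 - z.1)) := by
  have hp := Real.pi_pos
  have hsq : ∀ {s : ℝ}, 0 < s → Real.sqrt (2 * Real.pi * s ^ 2) = Real.sqrt (2 * Real.pi) * s :=
    fun hs => by rw [Real.sqrt_mul (by positivity), Real.sqrt_sq hs.le]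
  have hpow : (2 * Real.pi) ^ (3 / 2 : ℝ) = Real.sqrt (2 * Real.pi) ^ 3 := by
    rw [Real.sqrt_eq_rpow, ← Real.rpow_natCast, ← Real.rpow_mul (by positivity)]
    norm_num
  have hexp : Real.exp (-(1 / 2) * quadForm s₁ s₂ s₃ m z) =
      Real.exp (-z.1 ^ 2 / (2 * s₁ ^ 2)) * Real.exp (-z.2.1 ^ 2 / (2 * s₂ ^ 2)) *
        Real.exp (-(z.2.2 - m⁻¹ * (z.2.1 - z.1)) ^ 2 / (2 * s₃ ^ 2)) := by
    rw [← Real.exp_add, ← Real.exp_add, quadForm]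
    congr 1
    field_simp
    ring
  rw [hexp, hpow]
  unfold gaussDens
  rw [hsq h₁, hsq h₂, hsq h₃]
  have : 0 < Real.sqrt (2 * Real.pi) := Real.sqrt_pos.2 (by positivity)
  field_simp

/-- The shear removes the cross terms of `Q`, so the limit is a linear image of three independent
centered Gaussian variables. Its Gaussianity and its total mass follow without computing an
integral. -/
lemma limitLaw_eq_map : limitLaw s₁ s₂ s₃ m = (gauss3 s₁ s₂ s₃).map (shear m) := by
  have hg : ∀ V, Measurable fun z => ENNReal.ofReal (gaussDens V z) := fun V =>
    (continuous_gaussDens V).measurable.ennreal_ofReal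
  have hg₂ : Measurable fun z : ℝ × ℝ => ENNReal.ofReal (gaussDens (s₂ ^ 2) z.1) *
      ENNReal.ofReal (gaussDens (s₃ ^ 2) z.2) :=
    ((hg (s₂ ^ 2)).comp measurable_fst).mul ((hg (s₃ ^ 2)).comp measurable_snd)
  have hpi : gauss3 s₁ s₂ s₃ = volume.withDensity fun z : ℝ × ℝ × ℝ =>
      ENNReal.ofReal (gaussDens (s₁ ^ 2) z.1 * gaussDens (s₂ ^ 2) z.2.1 *
        gaussDens (s₃ ^ 2) z.2.2) := by
    rw [gauss3, gaussianReal_eq_withDensity h₁, gaussianReal_eq_withDensity h₂,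
      gaussianReal_eq_withDensity h₃, prod_withDensity (hg _) (hg _), prod_withDensity (hg _) hg₂]
    rw [← Measure.volume_eq_prod, ← Measure.volume_eq_prod]
    congr 1; ext z
    rw [mul_assoc, ENNReal.ofReal_mul (gaussDens_pos (by positivity) _).le,
      ENNReal.ofReal_mul (gaussDens_pos (by positivity) _).le]
  have hmd : Measurable fun z : ℝ × ℝ × ℝ => ENNReal.ofReal
      (gaussDens (s₁ ^ 2) z.1 * gaussDens (s₂ ^ 2) z.2.1 *
        gaussDens (s₃ ^ 2) (z.2.2 - m⁻¹ * (z.2.1 - z.1))) := by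
    have := continuous_gaussDens (s₁ ^ 2)
    have := continuous_gaussDens (s₂ ^ 2)
    have := continuous_gaussDens (s₃ ^ 2)
    refine Measurable.ennreal_ofReal (Continuous.measurable ?_)
    fun_prop
  have hlim : limitLaw s₁ s₂ s₃ m = volume.withDensity fun z : ℝ × ℝ × ℝ => ENNReal.ofReal
      (gaussDens (s₁ ^ 2) z.1 * gaussDens (s₂ ^ 2) z.2.1 *
        gaussDens (s₃ ^ 2) (z.2.2 - m⁻¹ * (z.2.1 - z.1))) := by
    unfold limitLaw
    congr 1; ext z
    rw [limit_density_eq h₁ h₂ h₃]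
  ext A hA
  rw [Measure.map_apply (shear m).continuous.measurable hA, hlim, hpi, withDensity_apply _ hA,
    withDensity_apply _ ((shear m).continuous.measurable hA), ← lintegral_indicator hA,
    ← lintegral_indicator ((shear m).continuous.measurable hA),
    ← (measurePreserving_shear m).lintegral_comp (hmd.indicator hA)]
  refine lintegral_congr fun z => ?_
  by_cases hz : shear m z ∈ A
  · have hz' : z ∈ shear m ⁻¹' A := hz
    rw [Set.indicator_of_mem hz, Set.indicator_of_mem hz', shear_apply]
    simp
  · have hz' : z ∉ shear m ⁻¹' A := hz
    rw [Set.indicator_of_notMem hz, Set.indicator_of_notMem hz']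

lemma isGaussian_limitLaw : IsGaussian (limitLaw s₁ s₂ s₃ m) := by
  rw [limitLaw_eq_map h₁ h₂ h₃]; infer_instance

-- The sheared third coordinate is a function of the last two independent coordinates minus `m⁻¹`
-- times the first. Only the latter term is correlated with the first coordinate, and it alone
-- already gives a positive variance.
omit h₂ h₃ in
lemma covariance_shear :
    cov[fun z => (shear m z).2.2, fun z => z.1; gauss3 s₁ s₂ s₃] = -(m⁻¹ * s₁ ^ 2) ∧
      (m⁻¹) ^ 2 * s₁ ^ 2 ≤ Var[fun z => (shear m z).2.2; gauss3 s₁ s₂ s₃] := by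
  set π := gauss3 s₁ s₂ s₃ with hπ
  have hm1 : MemLp (fun z : ℝ × ℝ × ℝ => z.1) 2 π :=
    IsGaussian.memLp_dual π (ContinuousLinearMap.fst ℝ ℝ (ℝ × ℝ)) 2 (by norm_num)
  set f : ℝ × ℝ → ℝ := fun p => p.2 + m⁻¹ * p.1 with hf
  have hm2 : MemLp (fun z : ℝ × ℝ × ℝ => f z.2) 2 π :=
    IsGaussian.memLp_dual π ((ContinuousLinearMap.snd ℝ ℝ ℝ + m⁻¹ • ContinuousLinearMap.fst ℝ ℝ ℝ).comp
      (ContinuousLinearMap.snd ℝ ℝ (ℝ × ℝ))) 2 (by norm_num)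
  have hind : IndepFun (fun z : ℝ × ℝ × ℝ => f z.2) (fun z : ℝ × ℝ × ℝ => z.1) π :=
    (indepFun_prod (X := fun x : ℝ => x) (Y := f) measurable_id (by fun_prop)).symm
  have hdec : (fun z : ℝ × ℝ × ℝ => (shear m z).2.2) =
      (fun z => f z.2) + fun z => -m⁻¹ * z.1 := by
    ext z
    simp only [shear_apply, hf, Pi.add_apply]
    ring
  have hvar : Var[fun z : ℝ × ℝ × ℝ => z.1; π] = s₁ ^ 2 := by
    have h1 := variance_map (μ := π) (Y := fun z : ℝ × ℝ × ℝ => z.1) (X := id) (by fun_prop)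
      (by fun_prop)
    have h2 : π.map (fun z : ℝ × ℝ × ℝ => z.1) = gaussianReal 0 (s₁ ^ 2).toNNReal := by
      rw [hπ, gauss3]
      exact Measure.fst_prod
    rw [h2, variance_id_gaussianReal, Real.coe_toNNReal _ (by positivity)] at h1
    exact h1.symm
  constructor
  · rw [hdec, covariance_add_left hm2 (hm1.const_mul _) hm1, hind.covariance_eq_zero hm2 hm1,
      covariance_const_mul_left, covariance_self hm1.aestronglyMeasurable.aemeasurable, hvar]
    ring
  · have hind' : IndepFun (fun z : ℝ × ℝ × ℝ => f z.2) (fun z => -m⁻¹ * z.1) π :=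
      hind.comp measurable_id (measurable_const_mul _)
    rw [hdec, hind'.variance_add hm2 (hm1.const_mul _), variance_const_mul, hvar]
    have := variance_nonneg (fun z : ℝ × ℝ × ℝ => f z.2) π
    nlinarith

lemma not_indepFun_limitLaw (hm : 0 < m) :
    ¬ IndepFun (fun z : ℝ × ℝ × ℝ => z.2.2) (fun z : ℝ × ℝ × ℝ => (z.1, z.2.1))
      (limitLaw s₁ s₂ s₃ m) := by
  intro hind
  have hG := isGaussian_limitLaw h₁ h₂ h₃ m
  set μ := limitLaw s₁ s₂ s₃ m with hμ
  have hm1 : MemLp (fun z : ℝ × ℝ × ℝ => z.1) 2 μ :=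
    IsGaussian.memLp_dual μ (ContinuousLinearMap.fst ℝ ℝ (ℝ × ℝ)) 2 (by norm_num)
  have hm2 : MemLp (fun z : ℝ × ℝ × ℝ => z.2.2) 2 μ :=
    IsGaussian.memLp_dual μ ((ContinuousLinearMap.snd ℝ ℝ ℝ).comp
      (ContinuousLinearMap.snd ℝ ℝ (ℝ × ℝ))) 2 (by norm_num)
  have hind2 : IndepFun (fun z : ℝ × ℝ × ℝ => z.2.2) (fun z : ℝ × ℝ × ℝ => z.1) μ :=
    hind.comp measurable_id measurable_fst
  have h0 := hind2.covariance_eq_zero hm2 hm1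
  rw [hμ, limitLaw_eq_map h₁ h₂ h₃, covariance_map (by fun_prop) (by fun_prop)
    (shear m).continuous.aemeasurable] at h0
  have h1 := (covariance_shear (s₂ := s₂) (s₃ := s₃) h₁ m).1
  have h2 : cov[(fun z : ℝ × ℝ × ℝ => z.2.2) ∘ shear m, (fun z : ℝ × ℝ × ℝ => z.1) ∘ shear m;
      gauss3 s₁ s₂ s₃] = cov[fun z => (shear m z).2.2, fun z => z.1; gauss3 s₁ s₂ s₃] := rfl
  rw [h2, h1] at h0
  have : 0 < m⁻¹ * s₁ ^ 2 := by positivity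
  linarith

lemma exists_map_limitLaw_eq (hm : 0 < m) :
    ∃ w : ℝ≥0, 0 < w ∧ (limitLaw s₁ s₂ s₃ m).map (fun z => z.2.2) = gaussianReal 0 w := by
  set L : (ℝ × ℝ × ℝ) →L[ℝ] ℝ := ((ContinuousLinearMap.snd ℝ ℝ ℝ).comp
    (ContinuousLinearMap.snd ℝ ℝ (ℝ × ℝ))).comp (shear m) with hL
  have hmap : (limitLaw s₁ s₂ s₃ m).map (fun z => z.2.2) = (gauss3 s₁ s₂ s₃).map L := by
    rw [limitLaw_eq_map h₁ h₂ h₃, Measure.map_map (by fun_prop) (shear m).continuous.measurable]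
    rfl
  refine ⟨Var[L; gauss3 s₁ s₂ s₃].toNNReal, ?_, ?_⟩
  · rw [Real.toNNReal_pos]
    exact lt_of_lt_of_le (by positivity) (covariance_shear (s₂ := s₂) (s₃ := s₃) h₁ m).2
  · rw [hmap, IsGaussian.map_eq_gaussianReal]
    congr 1
    have i1 : Integrable (fun z : ℝ × ℝ × ℝ => z.1) (gauss3 s₁ s₂ s₃) :=
      (IsGaussian.memLp_dual _ (ContinuousLinearMap.fst ℝ ℝ (ℝ × ℝ)) 1 (by norm_num)).integrable
        le_rfl
    have i2 : Integrable (fun z : ℝ × ℝ × ℝ => z.2.1) (gauss3 s₁ s₂ s₃) :=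
      (IsGaussian.memLp_dual _ ((ContinuousLinearMap.fst ℝ ℝ ℝ).comp
        (ContinuousLinearMap.snd ℝ ℝ (ℝ × ℝ))) 1 (by norm_num)).integrable le_rfl
    have i3 : Integrable (fun z : ℝ × ℝ × ℝ => z.2.2) (gauss3 s₁ s₂ s₃) :=
      (IsGaussian.memLp_dual _ ((ContinuousLinearMap.snd ℝ ℝ ℝ).comp
        (ContinuousLinearMap.snd ℝ ℝ (ℝ × ℝ))) 1 (by norm_num)).integrable le_rfl
    have e1 : ∫ z : ℝ × ℝ × ℝ, z.1 ∂(gauss3 s₁ s₂ s₃) = 0 := by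
      rw [gauss3, integral_fun_fst (fun x : ℝ => x)]; simp
    have e2 : ∫ z : ℝ × ℝ × ℝ, z.2.1 ∂(gauss3 s₁ s₂ s₃) = 0 := by
      rw [gauss3, integral_fun_snd (fun p : ℝ × ℝ => p.1), integral_fun_fst (fun x : ℝ => x)]; simp
    have e3 : ∫ z : ℝ × ℝ × ℝ, z.2.2 ∂(gauss3 s₁ s₂ s₃) = 0 := by
      rw [gauss3, integral_fun_snd (fun p : ℝ × ℝ => p.2), integral_fun_snd (fun x : ℝ => x)]; simp
    have e4 : ∀ z, L z = z.2.2 + m⁻¹ * (z.2.1 - z.1) := fun z => rfl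
    simp_rw [e4]
    have i4 : Integrable (fun z : ℝ × ℝ × ℝ => m⁻¹ * (z.2.1 - z.1)) (gauss3 s₁ s₂ s₃) :=
      (i2.sub i1).const_mul _
    rw [integral_add i3 i4, integral_const_mul]
    have e5 : ∫ z : ℝ × ℝ × ℝ, (z.2.1 - z.1) ∂(gauss3 s₁ s₂ s₃) = 0 := by
      rw [integral_sub i2 i1, e1, e2, sub_zero]
    rw [e3, e5, mul_zero, add_zero]

end

/-! ### The limit of the Gibbs measures -/

section

variable {ν₁ Q ν₂ : Measure ℤ} [IsProbabilityMeasure ν₁] [IsProbabilityMeasure ν₂]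
  [IsProbabilityMeasure Q] {a : ℝ}

/-- The limit law of the rescaled contact triple of three independent pieces. -/
def pieceLaw (ν₁ Q ν₂ : Measure ℤ) (a : ℝ) : Measure (ℝ × ℝ × ℝ) :=
  limitLaw (Real.sqrt (a / mean ν₁ * vari ν₁ / mean ν₁ ^ 2))
    (Real.sqrt (a / mean ν₂ * vari ν₂ / mean ν₂ ^ 2))
    (Real.sqrt ((mean Q)⁻¹ * (1 - a / mean ν₂ - a / mean ν₁) * vari Q / mean Q ^ 2)) (mean Q)

lemma Pieces.sigma_pos (hp : Pieces ν₁ Q ν₂ a) :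
    0 < a / mean ν₁ * vari ν₁ / mean ν₁ ^ 2 ∧ 0 < a / mean ν₂ * vari ν₂ / mean ν₂ ^ 2 ∧
      0 < (mean Q)⁻¹ * (1 - a / mean ν₂ - a / mean ν₁) * vari Q / mean Q ^ 2 := by
  have h1 := hp.left.mean_pos
  have h2 := hp.right.mean_pos
  have h3 : 0 < mean Q := by linarith [hp.one_le_mean]
  have h4 := hp.left.vari_pos
  have h5 := hp.right.vari_pos
  have h6 := hp.vari_pos
  have h7 := hp.pos
  have h8 : 0 < 1 - a / mean ν₂ - a / mean ν₁ := by linarith [hp.lt]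
  exact ⟨by positivity, by positivity, by positivity⟩

/-- The limit of the total weight. -/
def pieceConst (ν₁ Q ν₂ : Measure ℤ) : ℝ :=
  escape ν₁ * escape ν₂ * (mean ν₁ * mean ν₂ * mean Q)⁻¹

lemma Pieces.const_pos (hp : Pieces ν₁ Q ν₂ a) : 0 < pieceConst ν₁ Q ν₂ := by
  have h1 := hp.left.mean_pos
  have h2 := hp.right.mean_pos
  have h3 : 0 < mean Q := by linarith [hp.one_le_mean]
  have h4 := hp.left.escape_pos
  have h5 := hp.right.escape_pos
  unfold pieceConst
  positivity

lemma Pieces.limit_pos (hp : Pieces ν₁ Q ν₂ a) (z : ℝ × ℝ × ℝ) : 0 < pieceLimit ν₁ Q ν₂ a z := by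
  obtain ⟨h1, h2, h3⟩ := hp.sigma_pos
  exact mul_pos hp.const_pos (mul_pos (mul_pos (gaussDens_pos h1 _) (gaussDens_pos h2 _))
    (gaussDens_pos h3 _))

lemma continuous_pieceLimit : Continuous (pieceLimit ν₁ Q ν₂ a) := by
  unfold pieceLimit gaussDens
  fun_prop

lemma Pieces.limit_eq (hp : Pieces ν₁ Q ν₂ a) (z : ℝ × ℝ × ℝ) :
    pieceLimit ν₁ Q ν₂ a z = pieceConst ν₁ Q ν₂ *
      (1 / ((2 * Real.pi) ^ (3 / 2 : ℝ) * (Real.sqrt (a / mean ν₁ * vari ν₁ / mean ν₁ ^ 2)) *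
    (Real.sqrt (a / mean ν₂ * vari ν₂ / mean ν₂ ^ 2)) *
    (Real.sqrt ((mean Q)⁻¹ * (1 - a / mean ν₂ - a / mean ν₁) * vari Q / mean Q ^ 2))) *
      Real.exp (-(1 / 2) * quadForm (Real.sqrt (a / mean ν₁ * vari ν₁ / mean ν₁ ^ 2))
    (Real.sqrt (a / mean ν₂ * vari ν₂ / mean ν₂ ^ 2))
    (Real.sqrt ((mean Q)⁻¹ * (1 - a / mean ν₂ - a / mean ν₁) * vari Q / mean Q ^ 2))
      (mean Q) z)) := by
  obtain ⟨h1, h2, h3⟩ := hp.sigma_pos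
  rw [limit_density_eq (Real.sqrt_pos.2 h1) (Real.sqrt_pos.2 h2) (Real.sqrt_pos.2 h3),
    Real.sq_sqrt h1.le, Real.sq_sqrt h2.le, Real.sq_sqrt h3.le, pieceLimit, pieceConst]

lemma Pieces.isGaussian (hp : Pieces ν₁ Q ν₂ a) : IsGaussian (pieceLaw ν₁ Q ν₂ a) := by
  obtain ⟨h1, h2, h3⟩ := hp.sigma_pos
  exact isGaussian_limitLaw (Real.sqrt_pos.2 h1) (Real.sqrt_pos.2 h2) (Real.sqrt_pos.2 h3) _

lemma Pieces.integral_limit (hp : Pieces ν₁ Q ν₂ a) (φ : ℝ × ℝ × ℝ → ℝ) :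
    ∫ z, pieceLimit ν₁ Q ν₂ a z * φ z = pieceConst ν₁ Q ν₂ * ∫ z, φ z ∂(pieceLaw ν₁ Q ν₂ a) := by
  have hC := hp.const_pos
  have hd : ∀ z, pieceLimit ν₁ Q ν₂ a z / pieceConst ν₁ Q ν₂ = _ := fun z => by
    rw [hp.limit_eq z, mul_div_cancel_left₀ _ hC.ne']
  have h1 : pieceLaw ν₁ Q ν₂ a = volume.withDensity fun z =>
      ENNReal.ofReal (pieceLimit ν₁ Q ν₂ a z / pieceConst ν₁ Q ν₂) := by
    simp_rw [hd]
    rfl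
  rw [h1, integral_withDensity_eq_integral_toReal_smul
    (continuous_pieceLimit.div_const _).measurable.ennreal_ofReal
    (ae_of_all _ fun z => ENNReal.ofReal_lt_top), ← integral_const_mul]
  refine integral_congr_ae (ae_of_all _ fun z => ?_)
  simp only [smul_eq_mul]
  rw [ENNReal.toReal_ofReal (div_nonneg (hp.limit_pos z).le hC.le)]
  field_simp

/-- The integral of a non-integrable function is zero by convention, whereas `integral_limit` with
`φ = 1` gives the positive constant, the limit law being a probability measure. -/
lemma Pieces.integrable_limit (hp : Pieces ν₁ Q ν₂ a) : Integrable (pieceLimit ν₁ Q ν₂ a) := by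
  by_contra hcon
  have := hp.isGaussian
  have h1 := hp.integral_limit fun _ => 1
  simp only [mul_one, integral_const, probReal_univ, smul_eq_mul] at h1
  rw [integral_undef hcon] at h1
  exact hp.const_pos.ne h1

lemma Pieces.tendsto_sum (hp : Pieces ν₁ Q ν₂ a) (φ : (ℝ × ℝ × ℝ) →ᵇ ℝ) :
    Tendsto (fun N => ∑ x ∈ triples N, pieceWeight ν₁ Q ν₂ (depth a N) N x *
      φ (resc (a / mean ν₁) (1 - a / mean ν₂) ((mean Q)⁻¹ * (1 - a / mean ν₂ - a / mean ν₁)) N x))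
      atTop (𝓝 (pieceConst ν₁ Q ν₂ * ∫ z, φ z ∂(pieceLaw ν₁ Q ν₂ a))) := by
  rw [← hp.integral_limit]
  have h1 := hp.left.mean_pos
  have h2 := hp.right.mean_pos
  have h3 : 0 < mean Q := by linarith [hp.one_le_mean]
  have h7 := hp.pos
  have hu : 0 < a / mean ν₁ := by positivity
  have h8 := hp.lt
  exact hp.localLimit.tendsto_sum continuous_pieceLimit hp.limit_pos hp.integrable_limit hu
    (by linarith) (mul_pos (inv_pos.2 h3) (by linarith)) (fun N x => pieceWeight_nonneg _ _ _ _ _ _)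
    (fun N x hx => if_neg hx) hp.tight φ

lemma Pieces.tendsto_total (hp : Pieces ν₁ Q ν₂ a) :
    Tendsto (fun N => ∑ x ∈ triples N, pieceWeight ν₁ Q ν₂ (depth a N) N x) atTop
      (𝓝 (pieceConst ν₁ Q ν₂)) := by
  have := hp.isGaussian
  have h := hp.tendsto_sum (BoundedContinuousFunction.const _ 1)
  simpa using h

end

/-- `F` is the positive free energy of the standard wetting model at `lam`. -/
structure Localized (ν : Measure ℤ) (lam F : ℝ) : Prop where
  cramer : CenteredCramer ν
  lam_pos : 0 < lam
  F_pos : 0 < F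
  hasSum : HasSum (fun n : ℕ => lam * exc ν (n + 1) * Real.exp (-((n + 1 : ℕ) * F))) 1

/-- The tilting parameters of the two unconstrained pieces. -/
structure WellTilt (ν : Measure ℤ) (F tm tp : ℝ) : Prop where
  tm_pos : 0 < tm
  tp_pos : 0 < tp
  tm_mem : tm ∈ interior (integrableExpSet castZ (ν.map Neg.neg))
  tp_mem : tp ∈ interior (integrableExpSet castZ ν)
  tm_eq : cgf castZ (ν.map Neg.neg) tm = F
  tp_eq : cgf castZ ν tp = F

section

variable {ν : Measure ℤ} [IsProbabilityMeasure ν] {lam F tm tp a : ℝ}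

/-- The tilts `tm` and `tp` need not be roots of `Λ = F` here. The general identity also serves
below the critical point, where only `Λ ≤ F` is available and `tp = 0` is a useful choice. -/
lemma Localized.tripleWeight_eq (h : Localized ν lam F)
    (hm : tm ∈ integrableExpSet castZ (ν.map Neg.neg)) (hp : tp ∈ integrableExpSet castZ ν)
    {d : ℤ} (hd : 1 ≤ d) {N l r k : ℕ} (hx : (l, r, k) ∈ triples N) :
    lam ^ k * wellProb ν d N l r k =
      lam * Real.exp (l * cgf castZ (ν.map Neg.neg) tm + (r - l) * F + (N - r) * cgf castZ ν tp -
        (tm + tp) * d) *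
        pieceWeight (tiltStep (ν.map Neg.neg) tm) (renewalLaw ν lam F) (tiltStep ν tp) d N
          (l, r, k) := by
  have hν' := isProbabilityMeasure_neg_law ν
  have hQ := isProbabilityMeasure_renewalLaw h.lam_pos h.hasSum
  rw [pieceWeight, if_pos hx]
  rw [mem_triples] at hx
  simp only at hx ⊢
  obtain ⟨n, rfl⟩ : ∃ n, r = l + n := ⟨r - l, by omega⟩
  obtain ⟨p, rfl⟩ : ∃ p, N = l + n + p := ⟨N - (l + n), by omega⟩
  obtain ⟨j, rfl⟩ : ∃ j, k = j + 1 := ⟨k - 1, by omega⟩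
  rw [wellProb_eq ν hd, firstHit_tilt (ν.map Neg.neg) hm, stayPos_tilt ν hp,
    Nat.add_sub_cancel_left, Nat.add_sub_cancel,
    show ((l + n : ℕ) : ℤ) - (l : ℤ) = (n : ℤ) by push_cast; ring,
    prob_psum_renewalLaw h.lam_pos j n]
  have e : Real.exp (l * cgf castZ (ν.map Neg.neg) tm + (((l + n : ℕ) : ℝ) - l) * F +
      (((l + n + p : ℕ) : ℝ) - (l + n : ℕ)) * cgf castZ ν tp - (tm + tp) * d) =
      Real.exp (l * cgf castZ (ν.map Neg.neg) tm - tm * d) * Real.exp (n * F) *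
        Real.exp (p * cgf castZ ν tp - tp * d) := by
    rw [← Real.exp_add, ← Real.exp_add]
    congr 1
    push_cast
    ring
  have e2 : Real.exp (n * F) * Real.exp (-(n * F)) = 1 := by rw [← Real.exp_add]; simp
  rw [e, pow_succ]
  linear_combination (-(lam ^ (j + 1) * Real.exp (l * cgf castZ (ν.map Neg.neg) tm - tm * d) *
    Real.exp (p * cgf castZ ν tp - tp * d) * firstHit (tiltStep (ν.map Neg.neg) tm) l d *
    returnProb ν j n * stayPos (tiltStep ν tp) p d)) * e2

/-- When both log-moment generating functions equal `F`, the exponents `l F`, `(r - l) F` and `(N -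
r) F` add up to `N F`. The prefactor then does not depend on the triple and cancels in the Gibbs
measure. -/
lemma WellTilt.tripleWeight_eq (hw : WellTilt ν F tm tp) (h : Localized ν lam F)
    {d : ℤ} (hd : 1 ≤ d) (N : ℕ) (x : ℕ × ℕ × ℕ) :
    tripleWeight ν lam d N x = lam * Real.exp (N * F - (tm + tp) * d) *
      pieceWeight (tiltStep (ν.map Neg.neg) tm) (renewalLaw ν lam F) (tiltStep ν tp) d N x := by
  by_cases hx : x ∈ triples N
  · obtain ⟨l, r, k⟩ := x
    rw [tripleWeight, if_pos hx]
    simp only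
    rw [h.tripleWeight_eq (interior_subset hw.tm_mem) (interior_subset hw.tp_mem) hd hx, hw.tm_eq,
      hw.tp_eq]
    congr 3
    ring
  · rw [tripleWeight, if_neg hx, pieceWeight, if_neg hx, mul_zero]

lemma WellTilt.pieces (hw : WellTilt ν F tm tp) (h : Localized ν lam F) (ha : 0 < a)
    (hlt : a / deriv (cgf castZ (ν.map Neg.neg)) tm < 1 - a / deriv (cgf castZ ν) tp) :
    Pieces (tiltStep (ν.map Neg.neg) tm) (renewalLaw ν lam F) (tiltStep ν tp) a := by
  have hν' := isProbabilityMeasure_neg_law ν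
  have hQ := isProbabilityMeasure_renewalLaw h.lam_pos h.hasSum
  have hap := aperiodic_renewalLaw (F := F) h.lam_pos h.cramer.aperiodic h.cramer.integrable
    h.cramer.mean_zero
  have h2 := memLp_renewalLaw h.lam_pos h.hasSum h.F_pos
  exact ⟨h.cramer.neg.posDrift hw.tm_pos hw.tm_mem, h.cramer.posDrift hw.tp_pos hw.tp_mem, hap, h2,
    hap.vari_pos h2, ae_one_le_renewalLaw, ha, by
      rwa [mean_tiltStep hw.tm_mem, mean_tiltStep hw.tp_mem]⟩

lemma noVisitProb_le (d : ℤ) (N : ℕ) :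
    noVisitProb ν d N ≤ (pathMeasure ν).real {ω | psum N ω = 0} :=
  measureReal_mono fun _ h => h.2.1

lemma CenteredCramer.tendsto_noVisitProb (hν : CenteredCramer ν) (d : ℕ → ℤ) :
    Tendsto (fun N => noVisitProb ν (d N) N) atTop (𝓝 0) := by
  obtain ⟨K, hK, hKb⟩ := exists_sqrt_mul_prob_le hν.aperiodic (hν.aperiodic.vari_pos hν.memLp)
    hν.memLp
  have hs : Tendsto (fun N : ℕ => K / Real.sqrt N) atTop (𝓝 0) :=
    tendsto_const_nhds.div_atTop (Real.tendsto_sqrt_atTop.comp tendsto_natCast_atTop_atTop)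
  refine tendsto_of_tendsto_of_tendsto_of_le_of_le' tendsto_const_nhds hs
    (Eventually.of_forall fun N => noVisitProb_nonneg _ _ _) ?_
  filter_upwards [eventually_gt_atTop 0] with N hN
  have hs0 : 0 < Real.sqrt N := Real.sqrt_pos.2 (by exact_mod_cast hN)
  rw [le_div_iff₀ hs0, mul_comm]
  exact (mul_le_mul_of_nonneg_left (noVisitProb_le _ _) hs0.le).trans (hKb N 0)

end

/-! ### The Gibbs measures of a three-piece model -/

/-- Up to the prefactor `E N`, the weights of the contact triples are those of three independent
pieces, and the weight of the paths without contact is negligible. -/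
structure GibbsPieces (ν ν₁ Q ν₂ : Measure ℤ) [IsProbabilityMeasure ν₁] [IsProbabilityMeasure ν₂]
    [IsProbabilityMeasure Q] (a lam : ℝ) (E : ℕ → ℝ) : Prop where
  pieces : Pieces ν₁ Q ν₂ a
  lam_nonneg : 0 ≤ lam
  pos : ∀ N, 0 < E N
  depth_pos : ∀ᶠ N : ℕ in atTop, 1 ≤ depth a N
  eq : ∀ᶠ N : ℕ in atTop, ∀ x, tripleWeight ν lam (depth a N) N x =
    E N * pieceWeight ν₁ Q ν₂ (depth a N) N x
  noVisit : Tendsto (fun N => noVisitProb ν (depth a N) N / E N) atTop (𝓝 0)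

section

variable {Ω : Type*} [MeasurableSpace Ω] {P : Measure Ω} {X : ℕ → Ω → ℤ} {ν₁ Q ν₂ : Measure ℤ}
  [IsProbabilityMeasure ν₁] [IsProbabilityMeasure ν₂] [IsProbabilityMeasure Q] {a lam : ℝ}
  {E : ℕ → ℝ} [IsProbabilityMeasure P] (hmeas : ∀ i, Measurable (X i)) (hindep : iIndepFun X P)
  (hident : ∀ i, IdentDistrib (X i) (X 0) P P)
  (h : GibbsPieces (P.map (X 0)) ν₁ Q ν₂ a lam E)
include hmeas hindep hident h

lemma GibbsPieces.tendsto_partitionFn :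
    Tendsto (fun N => (partitionFn P X a lam N).toReal / E N) atTop (𝓝 (pieceConst ν₁ Q ν₂)) := by
  have h1 := h.noVisit.add h.pieces.tendsto_total
  rw [zero_add] at h1
  refine h1.congr' ?_
  filter_upwards [h.depth_pos, h.eq] with N hd he
  rw [toReal_partitionFn hmeas hindep hident hd h.lam_nonneg, add_div]
  simp_rw [he]
  rw [← Finset.mul_sum, mul_div_cancel_left₀ _ (h.pos N).ne']

lemma GibbsPieces.eventually_pos : ∀ᶠ N in atTop, 0 < (partitionFn P X a lam N).toReal := by
  filter_upwards [(h.tendsto_partitionFn hmeas hindep hident).eventually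
    (lt_mem_nhds h.pieces.const_pos)] with N hN
  have := mul_pos hN (h.pos N)
  rwa [div_mul_cancel₀ _ (h.pos N).ne'] at this

lemma GibbsPieces.isProbabilityMeasure :
    ∀ᶠ N in atTop, IsProbabilityMeasure (gibbs P X a lam N) := by
  filter_upwards [h.eventually_pos hmeas hindep hident] with N hN
  exact isProbabilityMeasure_gibbs hN.ne'

lemma GibbsPieces.tendsto_noContact :
    Tendsto (fun N => gibbs P X a lam N {ω | contactTimes X a N ω = ∅}) atTop (𝓝 0) := by
  have h1 := h.noVisit.div (h.tendsto_partitionFn hmeas hindep hident) h.pieces.const_pos.ne'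
  rw [zero_div] at h1
  have h2 := (ENNReal.continuous_ofReal.tendsto _).comp h1
  rw [ENNReal.ofReal_zero] at h2
  refine h2.congr' ?_
  filter_upwards [h.eventually_pos hmeas hindep hident, h.depth_pos] with N hN hd
  rw [gibbs_noContact hmeas hindep hident hd hN.ne', Function.comp_apply, Pi.div_apply]
  congr 1
  have := h.pos N
  field_simp

lemma GibbsPieces.tendsto_integral (φ : (ℝ × ℝ × ℝ) →ᵇ ℝ) :
    Tendsto (fun N => ∫ ω, φ (rescaledVector X a (a / mean ν₁) (1 - a / mean ν₂)
        ((mean Q)⁻¹ * (1 - a / mean ν₂ - a / mean ν₁)) N ω) ∂(gibbs P X a lam N)) atTop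
      (𝓝 (∫ z, φ z ∂(pieceLaw ν₁ Q ν₂ a))) := by
  set u := a / mean ν₁
  set v := 1 - a / mean ν₂
  set c := (mean Q)⁻¹ * (v - u)
  have hC := h.pieces.const_pos
  -- On paths without contact all three coordinates take the default value `0`. The observable is
  -- bounded and the weight of these paths is negligible with respect to the prefactor.
  have h0 : Tendsto (fun N => noVisitProb (P.map (X 0)) (depth a N) N / E N *
      φ (rescale u v c N 0 0 0)) atTop (𝓝 0) := by
    refine squeeze_zero_norm (a := fun N => ‖noVisitProb (P.map (X 0)) (depth a N) N / E N‖ * ‖φ‖)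
      (fun N => ?_) ?_
    · rw [norm_mul]
      exact mul_le_mul_of_nonneg_left (φ.norm_coe_le_norm _) (norm_nonneg _)
    · simpa using h.noVisit.norm.mul_const ‖φ‖
  have hS : Tendsto (fun N => ∑ x ∈ triples N, pieceWeight ν₁ Q ν₂ (depth a N) N x *
      φ (resc u v c N x)) atTop (𝓝 (pieceConst ν₁ Q ν₂ * ∫ z, φ z ∂(pieceLaw ν₁ Q ν₂ a))) :=
    h.pieces.tendsto_sum φ
  have h1 := (h0.add hS).div (h.tendsto_partitionFn hmeas hindep hident)
    hC.ne'
  rw [zero_add, mul_div_cancel_left₀ _ hC.ne'] at h1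
  refine h1.congr' ?_
  filter_upwards [h.eventually_pos hmeas hindep hident, h.depth_pos, h.eq] with N hN hd he
  rw [integral_gibbs hmeas hindep hident hd h.lam_nonneg (c := φ (rescale u v c N 0 0 0))
    (g := fun x => φ (resc u v c N x))]
  · simp_rw [he, mul_assoc]
    rw [← Finset.mul_sum]
    have := h.pos N
    simp only [Pi.div_apply]
    field_simp
  · intro ω hω
    have hn : numContacts X a N ω = 0 := by
      rw [numContacts_eq_visits]
      refine visits_eq_zero fun i _ hi hc => ?_
      have : i ∈ contactTimes X a N ω := mem_contactTimes.2 ⟨hi, hc⟩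
      rw [hω] at this
      exact absurd this (Finset.notMem_empty _)
    rw [rescaledVector, hn, leftContact, rightContact, hω]
    simp
  · rintro ⟨l, r, k⟩ ω ⟨h1, h2, h3⟩
    simp only at h1 h2 h3
    rw [rescaledVector, h1, h2, h3]
    rfl

lemma GibbsPieces.local_limit (A ε : ℝ) (hε : 0 < ε) : ∀ᶠ N in atTop, ∀ x,
    ‖resc (a / mean ν₁) (1 - a / mean ν₂) ((mean Q)⁻¹ * (1 - a / mean ν₂ - a / mean ν₁)) N x‖ ≤ A →
    |(gibbs P X a lam N).real (contactEvent X a N x) / (pieceLimit ν₁ Q ν₂ a (resc (a / mean ν₁)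
      (1 - a / mean ν₂) ((mean Q)⁻¹ * (1 - a / mean ν₂ - a / mean ν₁)) N x) /
        pieceConst ν₁ Q ν₂ / Real.sqrt N ^ 3) - 1| ≤ ε := by
  have hC := h.pieces.const_pos
  have h1 := (tendsto_const_nhds (x := pieceConst ν₁ Q ν₂)).div
    (h.tendsto_partitionFn hmeas hindep hident) hC.ne'
  rw [div_self hC.ne'] at h1
  -- The ratio is a product `α β` of the errors from the partition function and from the local
  -- limit; its distance to one is at most `1 · δ + δ + δ ≤ ε`.
  set δ := min (ε / 4) 1 with hδ
  have hδ0 : 0 < δ := lt_min (by linarith) one_pos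
  have hδε : δ ≤ ε / 4 := min_le_left _ _
  have hδ1 : δ ≤ 1 := min_le_right _ _
  have h2 := h.pieces.localLimit.uniform continuous_pieceLimit h.pieces.limit_pos A hδ0
  filter_upwards [h.eventually_pos hmeas hindep hident, h.depth_pos, h.eq, h2,
    Metric.tendsto_nhds.1 h1 δ hδ0, eventually_gt_atTop 0] with N hN hd he hu hα hN0 x hx
  have hu' := hu x hx
  have hE := h.pos N
  have hg := h.pieces.limit_pos (resc (a / mean ν₁) (1 - a / mean ν₂)
    ((mean Q)⁻¹ * (1 - a / mean ν₂ - a / mean ν₁)) N x)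
  have hs : 0 < Real.sqrt N := Real.sqrt_pos.2 (by exact_mod_cast hN0)
  rw [gibbs_real_contactEvent hmeas hindep hident hd h.lam_nonneg, he]
  set G := pieceLimit ν₁ Q ν₂ a (resc (a / mean ν₁) (1 - a / mean ν₂)
    ((mean Q)⁻¹ * (1 - a / mean ν₂ - a / mean ν₁)) N x)
  set w := pieceWeight ν₁ Q ν₂ (depth a N) N x
  set Z := (partitionFn P X a lam N).toReal
  set β := Real.sqrt N ^ 3 * w / G with hβ
  rw [Real.dist_eq] at hα
  simp only [Pi.div_apply] at hα
  set α := pieceConst ν₁ Q ν₂ / (Z / E N) with hαd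
  have e : Z⁻¹ * (E N * w) / (G / pieceConst ν₁ Q ν₂ / Real.sqrt N ^ 3) = α * β := by
    rw [hαd, hβ]
    field_simp
  rw [e, show α * β - 1 = (α - 1) * (β - 1) + (α - 1) + (β - 1) by ring]
  calc |(α - 1) * (β - 1) + (α - 1) + (β - 1)|
      ≤ |α - 1| * |β - 1| + |α - 1| + |β - 1| := by
        rw [← abs_mul]; exact (abs_add_le _ _).trans (by gcongr; exact abs_add_le _ _)
    _ ≤ 1 * δ + δ + δ := by
        gcongr
        exact hα.le.trans hδ1
    _ ≤ ε := by linarith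

end

/-- The assumption `a (tm + tp) ≤ F` keeps the prefactor above `lam`. This suffices also in the case
of equality, as bridges without contact have probability of order at most `N ^ (-1 / 2)`. -/
lemma WellTilt.gibbsPieces {ν : Measure ℤ} [IsProbabilityMeasure ν] {lam F tm tp a : ℝ}
    (hw : WellTilt ν F tm tp) (h : Localized ν lam F) (ha : 0 < a)
    (hlt : a / deriv (cgf castZ (ν.map Neg.neg)) tm < 1 - a / deriv (cgf castZ ν) tp)
    (hF : a * (tm + tp) ≤ F)
    [IsProbabilityMeasure (ν.map Neg.neg)]
    [IsProbabilityMeasure (renewalLaw ν lam F)]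
    [IsProbabilityMeasure (tiltStep (ν.map Neg.neg) tm)] [IsProbabilityMeasure (tiltStep ν tp)] :
    GibbsPieces ν (tiltStep (ν.map Neg.neg) tm) (renewalLaw ν lam F) (tiltStep ν tp) a lam
      fun N => lam * Real.exp (N * F - (tm + tp) * depth a N) := by
  have hl := h.lam_pos
  have hd : ∀ᶠ N : ℕ in atTop, 1 ≤ depth a N := by
    filter_upwards [(tendsto_natCast_atTop_atTop.const_mul_atTop ha).eventually_ge_atTop 1]
      with N hN
    rw [depth, Int.le_floor]
    exact_mod_cast hN
  refine ⟨hw.pieces h ha hlt, hl.le, fun N => by positivity, hd, ?_, ?_⟩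
  · filter_upwards [hd] with N hN x
    exact hw.tripleWeight_eq h hN N x
  · have h0 := (h.cramer.tendsto_noVisitProb (depth a ·)).div_const lam
    rw [zero_div] at h0
    refine tendsto_of_tendsto_of_tendsto_of_le_of_le tendsto_const_nhds h0 (fun N => ?_)
      fun N => ?_
    · exact div_nonneg (noVisitProb_nonneg _ _ _) (by positivity)
    · refine div_le_div_of_nonneg_left (noVisitProb_nonneg _ _ _) hl
        (le_mul_of_one_le_right hl.le (Real.one_le_exp ?_))
      have h1 : (depth a N : ℝ) ≤ a * N := Int.floor_le _
      have h2 := mul_le_mul_of_nonneg_left h1 (add_pos hw.tm_pos hw.tp_pos).le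
      have h3 := mul_le_mul_of_nonneg_right hF (Nat.cast_nonneg (α := ℝ) N)
      linarith

/-! ### The free energy of the standard wetting model -/

section

variable (ν : Measure ℤ) [IsProbabilityMeasure ν]

lemma sum_exc_le_one (n : ℕ) : ∑ i ∈ Finset.range n, exc ν (i + 1) ≤ 1 := by
  unfold exc
  rw [← measureReal_biUnion_finset]
  · exact measureReal_le_one
  · intro i _ j _ hij
    refine Set.disjoint_left.2 fun ω h h' => ?_
    rcases lt_or_gt_of_ne hij with hlt | hlt
    · exact (h'.1 (i + 1) (by omega) (by omega)).ne' h.2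
    · exact (h.1 (j + 1) (by omega) (by omega)).ne' h'.2
  · exact fun i _ => (finDep_isExcursion (i + 1)).measurableSet

lemma summable_exc : Summable fun n : ℕ => exc ν (n + 1) :=
  summable_of_sum_range_le (fun _ => exc_nonneg ν _) (sum_exc_le_one ν)

/-- The Laplace transform of the excursion lengths. -/
def excLaplace (s : ℝ) : ℝ := ∑' n : ℕ, exc ν (n + 1) * Real.exp (-((n + 1 : ℕ) * s))

lemma exc_mul_exp_le {s : ℝ} (hs : 0 ≤ s) (n : ℕ) :
    exc ν (n + 1) * Real.exp (-((n + 1 : ℕ) * s)) ≤ exc ν (n + 1) :=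
  mul_le_of_le_one_right (exc_nonneg ν _) (Real.exp_le_one_iff.2 (by
    have : (0 : ℝ) ≤ (n + 1 : ℕ) * s := by positivity
    linarith))

lemma summable_excLaplace {s : ℝ} (hs : 0 ≤ s) :
    Summable fun n : ℕ => exc ν (n + 1) * Real.exp (-((n + 1 : ℕ) * s)) :=
  (summable_exc ν).of_nonneg_of_le (fun _ => mul_nonneg (exc_nonneg ν _) (Real.exp_pos _).le)
    (exc_mul_exp_le ν hs)

lemma continuousOn_excLaplace : ContinuousOn (excLaplace ν) (Set.Ici 0) := by
  refine continuousOn_tsum (fun n => by fun_prop) (summable_exc ν) fun n s hs => ?_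
  rw [Real.norm_of_nonneg (mul_nonneg (exc_nonneg ν _) (Real.exp_pos _).le)]
  exact exc_mul_exp_le ν hs n

lemma excLaplace_zero : excLaplace ν 0 = ∑' n : ℕ, exc ν (n + 1) := by
  simp [excLaplace]

lemma excLaplace_le {s : ℝ} (hs : 0 ≤ s) :
    excLaplace ν s ≤ Real.exp (-s) := by
  calc excLaplace ν s ≤ ∑' n : ℕ, exc ν (n + 1) * Real.exp (-s) := by
        refine (summable_excLaplace ν hs).tsum_le_tsum (fun n => ?_)
          ((summable_exc ν).mul_right _)
        refine mul_le_mul_of_nonneg_left (Real.exp_le_exp.2 ?_) (exc_nonneg ν _)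
        push_cast
        nlinarith [mul_nonneg (Nat.cast_nonneg (α := ℝ) n) hs]
    _ = (∑' n : ℕ, exc ν (n + 1)) * Real.exp (-s) := tsum_mul_right
    _ ≤ 1 * Real.exp (-s) := by
        gcongr
        exact (summable_exc ν).tsum_le_of_sum_range_le (sum_exc_le_one ν)
    _ = Real.exp (-s) := one_mul _

variable {ν}

lemma CenteredCramer.exists_exc_pos (hν : CenteredCramer ν) : ∃ n, 0 < exc ν (n + 1) := by
  obtain ⟨⟨p, hp, hνp⟩, q, hq, hνq⟩ := hν.aperiodic.exists_pos_neg hν.integrable hν.mean_zero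
  have := exc_pos ν hp hq hνp hνq le_rfl
  exact ⟨1 * (p + q) - 1, by rwa [Nat.sub_add_cancel (by omega)]⟩

lemma CenteredCramer.excLaplace_pos (hν : CenteredCramer ν) {s : ℝ} (hs : 0 ≤ s) :
    0 < excLaplace ν s := by
  obtain ⟨n, hn⟩ := hν.exists_exc_pos
  exact (summable_excLaplace ν hs).tsum_pos
    (fun n => mul_nonneg (exc_nonneg ν _) (Real.exp_pos _).le) n (mul_pos hn (Real.exp_pos _))

lemma CenteredCramer.strictAntiOn_excLaplace (hν : CenteredCramer ν) :
    StrictAntiOn (excLaplace ν) (Set.Ici 0) := by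
  intro s hs t ht hst
  obtain ⟨n, hn⟩ := hν.exists_exc_pos
  refine Summable.tsum_lt_tsum (i := n) (fun k => ?_) ?_ (summable_excLaplace ν ht)
    (summable_excLaplace ν hs)
  · exact mul_le_mul_of_nonneg_left (Real.exp_le_exp.2 (by gcongr)) (exc_nonneg ν _)
  · exact mul_lt_mul_of_pos_left (Real.exp_lt_exp.2 (by gcongr)) hn

/-- Every `F > 0` is the free energy at the explicit parameter `1 / excLaplace ν F`. Comparisons
between values of `lam` thus become comparisons between values of the strictly decreasing function
`excLaplace`. -/
lemma CenteredCramer.localized (hν : CenteredCramer ν) {F : ℝ} (hF : 0 < F) :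
    Localized ν (excLaplace ν F)⁻¹ F := by
  have hp := hν.excLaplace_pos hF.le
  refine ⟨hν, inv_pos.2 hp, hF, ?_⟩
  have h := (summable_excLaplace ν hF.le).hasSum.mul_left (excLaplace ν F)⁻¹
  rw [show ∑' n : ℕ, exc ν (n + 1) * Real.exp (-((n + 1 : ℕ) * F)) = excLaplace ν F from rfl,
    inv_mul_cancel₀ hp.ne'] at h
  simpa only [mul_assoc] using h

lemma Localized.mul_excLaplace {lam F : ℝ} (h : Localized ν lam F) : lam * excLaplace ν F = 1 := by
  rw [excLaplace, ← tsum_mul_left, ← h.hasSum.tsum_eq]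
  simp only [mul_assoc]

/-- Intermediate value theorem between `0` and a point `S`; the bound `excLaplace ν S ≤ exp(-S)`
with `S > log lam` puts the function below one there. -/
lemma CenteredCramer.exists_localized (hν : CenteredCramer ν) {lam : ℝ} (hl : 0 < lam)
    (h : 1 < lam * excLaplace ν 0) : ∃ F, Localized ν lam F := by
  obtain ⟨S, hS, hS'⟩ : ∃ S : ℝ, 0 < S ∧ lam * excLaplace ν S < 1 := by
    refine ⟨max 1 (Real.log lam + 1), lt_max_of_lt_left one_pos, ?_⟩
    have h1 := excLaplace_le ν (s := max 1 (Real.log lam + 1)) (le_max_of_le_left zero_le_one)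
    calc lam * _ ≤ lam * Real.exp (-max 1 (Real.log lam + 1)) := by gcongr
      _ ≤ lam * Real.exp (-(Real.log lam + 1)) := by
        gcongr
        exact le_max_right _ _
      _ = Real.exp (-1) := by
        nth_rw 1 [← Real.exp_log hl]
        rw [← Real.exp_add]
        congr 1
        ring
      _ < 1 := Real.exp_lt_one_iff.2 (by norm_num)
  have hc : ContinuousOn (fun s => lam * excLaplace ν s) (Set.Icc 0 S) :=
    (continuousOn_const.mul (continuousOn_excLaplace ν)).mono Set.Icc_subset_Ici_self
  obtain ⟨F, hF, hF'⟩ := intermediate_value_Ioo' hS.le hc ⟨hS', h⟩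
  refine ⟨F, ?_⟩
  have h2 := hν.localized hF.1
  have h3 : lam = (excLaplace ν F)⁻¹ := eq_inv_of_mul_eq_one_left hF'
  rwa [← h3] at h2

end

lemma tendsto_log_div {Z : ℕ → ℝ} {F c C : ℝ} (hc : 0 < c) (hC : 0 < C) (p : ℕ)
    (h1 : ∀ᶠ N : ℕ in atTop, c * Real.exp (N * F) / N ≤ Z N)
    (h2 : ∀ᶠ N : ℕ in atTop, Z N ≤ C * (N : ℝ) ^ p * Real.exp (N * F)) :
    Tendsto (fun N : ℕ => 1 / (N : ℝ) * Real.log (Z N)) atTop (𝓝 F) := by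
  have hlog : Tendsto (fun N : ℕ => Real.log N / N) atTop (𝓝 0) :=
    (Real.isLittleO_log_id_atTop.tendsto_div_nhds_zero).comp tendsto_natCast_atTop_atTop
  have hdiv : ∀ b : ℝ, Tendsto (fun N : ℕ => b / N) atTop (𝓝 0) := fun b =>
    tendsto_const_nhds.div_atTop tendsto_natCast_atTop_atTop
  have hl := ((hdiv (Real.log c)).add_const F).sub hlog
  have hu := ((hdiv (Real.log C)).add_const F).add (hlog.const_mul (p : ℝ))
  rw [zero_add, sub_zero] at hl
  rw [zero_add, mul_zero, add_zero] at hu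
  refine tendsto_of_tendsto_of_tendsto_of_le_of_le' hl hu ?_ ?_
  · filter_upwards [h1, eventually_gt_atTop 0] with N hN hN0
    have hN0' : (0 : ℝ) < N := by exact_mod_cast hN0
    have hpos : 0 < c * Real.exp (N * F) / N := by positivity
    have h3 := Real.log_le_log hpos hN
    rw [Real.log_div (by positivity) hN0'.ne', Real.log_mul hc.ne' (Real.exp_pos _).ne',
      Real.log_exp] at h3
    calc _ = 1 / (N : ℝ) * (Real.log c + N * F - Real.log N) := by field_simp
      _ ≤ _ := by gcongr
  · filter_upwards [h1, h2, eventually_gt_atTop 0] with N hN hN' hN0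
    have hN0' : (0 : ℝ) < N := by exact_mod_cast hN0
    have hpos : 0 < c * Real.exp (N * F) / N := by positivity
    have h3 := Real.log_le_log (hpos.trans_le hN) hN'
    rw [Real.log_mul (by positivity) (Real.exp_pos _).ne', Real.log_mul hC.ne' (by positivity),
      Real.log_exp, Real.log_pow] at h3
    calc _ ≤ 1 / (N : ℝ) * (Real.log C + p * Real.log N + N * F) := by gcongr
      _ = _ := by field_simp; ring

section

variable {Ω : Type*} [MeasurableSpace Ω] {P : Measure Ω} {X : ℕ → Ω → ℤ} [IsProbabilityMeasure P]
  (hmeas : ∀ i, Measurable (X i)) (hindep : iIndepFun X P)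
  (hident : ∀ i, IdentDistrib (X i) (X 0) P P)
include hmeas hindep hident

lemma toReal_partitionFn_zero {lam : ℝ} (hlam : 0 ≤ lam) (N : ℕ) :
    (partitionFn P X 0 lam N).toReal =
      ∑ k ∈ Finset.range (N + 1), lam ^ k * returnProb (P.map (X 0)) k N := by
  have hν : IsProbabilityMeasure (P.map (X 0)) :=
    Measure.isProbabilityMeasure_map (hmeas 0).aemeasurable
  have hd : depth 0 N = 0 := by simp [depth]
  have hfd : ∀ k, FinDep N fun ω => visits 0 N ω = k := fun k =>
    FinDep.of_psum fun x y h hx => by rw [← visits_congr h]; exact hx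
  have h1 : partitionFn P X 0 lam N = P.withDensity (weight X 0 lam N) Set.univ := by
    rw [withDensity_apply _ MeasurableSet.univ, Measure.restrict_univ]; rfl
  have h2 : (Set.univ : Set Ω) =
      ⋃ k ∈ Finset.range (N + 1), {ω | visits 0 N (steps X ω) = k} := by
    ext ω
    simp only [Set.mem_univ, Set.mem_iUnion, Set.mem_ofPred_eq, exists_prop, true_iff]
    exact ⟨_, Finset.mem_range.2 (Nat.lt_succ_of_le (visits_le _ _ _)), rfl⟩
  have h3 : ∀ k, P.withDensity (weight X 0 lam N) {ω | visits 0 N (steps X ω) = k} =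
      ENNReal.ofReal (lam ^ k * returnProb (P.map (X 0)) k N) := by
    intro k
    rw [withDensity_apply_of_event hmeas hindep hident (a := 0) (by rw [hd]) (hfd k)
      (finDep_isReturn k N) (k := k) (fun ω h => by rw [hd, neg_zero]; exact h)
      (fun ω => by rw [hd, neg_zero]; unfold IsReturn; tauto),
      ENNReal.ofReal_mul (by positivity), returnProb, measureReal_def,
        ENNReal.ofReal_toReal (measure_ne_top _ _)]
  have hnn : ∀ k, 0 ≤ lam ^ k * returnProb (P.map (X 0)) k N := fun k =>
    mul_nonneg (by positivity) (returnProb_nonneg _ _ _)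
  rw [h1, h2, measure_biUnion_finset _ fun k _ => measurableSet_steps hmeas (hfd k)]
  · simp_rw [h3]
    rw [← ENNReal.ofReal_sum_of_nonneg fun k _ => hnn k,
      ENNReal.toReal_ofReal (Finset.sum_nonneg fun k _ => hnn k)]
  · intro i _ j _ hij
    exact Set.disjoint_left.2 fun ω h h' => hij (h.symm.trans h')

/-- The free energy of the standard wetting model. -/
lemma Localized.freeEnergy_eq {lam F : ℝ} (h : Localized (P.map (X 0)) lam F) :
    freeEnergy P X 0 lam = F := by
  have hν : IsProbabilityMeasure (P.map (X 0)) :=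
    Measure.isProbabilityMeasure_map (hmeas 0).aemeasurable
  have hl := h.lam_pos
  set ν := P.map (X 0)
  have hQ := isProbabilityMeasure_renewalLaw hl h.hasSum
  set Q := renewalLaw ν lam F with hQd
  have hap : Aperiodic Q := aperiodic_renewalLaw hl h.cramer.aperiodic h.cramer.integrable
    h.cramer.mean_zero
  have h2 : MemLp (fun y : ℤ => (y : ℝ)) 2 Q := memLp_renewalLaw hl h.hasSum h.F_pos
  have hvar := hap.vari_pos h2
  have hm1 : 1 ≤ mean Q := by
    have := integral_mono_ae (integrable_const (1 : ℝ)) (h2.integrable one_le_two)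
      (ae_one_le_renewalLaw.mono fun y hy => (by exact_mod_cast hy : (1 : ℝ) ≤ (y : ℝ)))
    rw [mean]
    simpa using this
  set m := mean Q
  have hm0 : 0 < m := by linarith
  refine Tendsto.limUnder_eq ?_
  have hterm : ∀ k N, lam ^ k * returnProb ν k N * Real.exp (-(N * F)) =
      (pathMeasure Q).real {ω | psum k ω = N} := fun k N => (prob_psum_renewalLaw hl k N).symm
  have hexp : ∀ N : ℕ, Real.exp (N * F) * Real.exp (-(N * F)) = 1 := fun N => by
    rw [← Real.exp_add]; simp
  -- The lower bound keeps a single term, the typical number `⌊N / m⌋` of renewals, to which the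
  -- local limit theorem applies at `z = 0`. The upper bound is the renewal mass estimate
  -- `sum_returnProb_le_one`.
  set k : ℕ → ℕ := fun N => ⌊(N : ℝ) / m⌋₊
  have hk1 : ∀ N : ℕ, (k N : ℝ) ≤ N / m := fun N => Nat.floor_le (by positivity)
  have hk2 : ∀ N : ℕ, (N : ℝ) / m < k N + 1 := fun N => Nat.lt_floor_add_one _
  have hkN : ∀ N : ℕ, k N ≤ N := fun N => by
    have : (k N : ℝ) ≤ N := (hk1 N).trans (div_le_self (by positivity) hm1)
    exact_mod_cast this
  have hkt : Tendsto k atTop atTop :=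
    tendsto_nat_floor_atTop.comp (tendsto_natCast_atTop_atTop.atTop_div_const hm0)
  have hs : Tendsto (fun N => m / Real.sqrt (k N)) atTop (𝓝 0) := tendsto_const_nhds.div_atTop
    (Real.tendsto_sqrt_atTop.comp (tendsto_natCast_atTop_atTop.comp hkt))
  have hx : Tendsto (fun N : ℕ => (((N : ℤ) : ℝ) - k N * mean Q) / Real.sqrt (k N)) atTop
      (𝓝 0) := by
    refine squeeze_zero_norm (fun N => ?_) hs
    have e1 := hk1 N
    have e2 := hk2 N
    rw [le_div_iff₀ hm0] at e1
    rw [div_lt_iff₀ hm0] at e2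
    rw [Real.norm_eq_abs, abs_div, abs_of_nonneg (Real.sqrt_nonneg _)]
    gcongr
    rw [Int.cast_natCast, abs_le]
    constructor <;> linarith
  have hA : FinDep 0 fun _ : ℕ → ℤ => True := FinDep.of_psum fun _ _ _ _ => trivial
  have hllt := tendsto_sqrt_mul_prob hap hvar h2 hA hkt hx
  simp only [true_and, Set.ofPred_true, probReal_univ, one_mul] at hllt
  have hg := gaussDens_pos hvar 0
  set c := gaussDens (vari Q) 0 / 2
  have hc : 0 < c := half_pos hg
  refine tendsto_log_div hc one_pos 0 ?_ (Eventually.of_forall fun N => ?_)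
  · filter_upwards [hllt.eventually (lt_mem_nhds (half_lt_self hg)), eventually_ge_atTop 1]
      with N hN hN1
    rw [toReal_partitionFn_zero hmeas hindep hident hl.le]
    have hNR : (1 : ℝ) ≤ N := by exact_mod_cast hN1
    have e0 : Real.sqrt (k N) ≤ N := by
      refine (Real.sqrt_le_sqrt (Nat.cast_le.2 (hkN N))).trans ?_
      rw [Real.sqrt_le_left (by linarith)]
      nlinarith
    have e1 : c ≤ N * (lam ^ k N * returnProb ν (k N) N * Real.exp (-(N * F))) := by
      rw [hterm]
      exact hN.le.trans (mul_le_mul_of_nonneg_right e0 measureReal_nonneg)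
    have e2 : lam ^ k N * returnProb ν (k N) N ≤
        ∑ j ∈ Finset.range (N + 1), lam ^ j * returnProb ν j N :=
      Finset.single_le_sum (f := fun j => lam ^ j * returnProb ν j N)
        (fun j _ => mul_nonneg (by positivity) (returnProb_nonneg _ _ _))
        (Finset.mem_range.2 (Nat.lt_succ_of_le (hkN N)))
    refine le_trans ?_ e2
    rw [div_le_iff₀ (by linarith)]
    calc c * Real.exp (N * F) ≤ N * (lam ^ k N * returnProb ν (k N) N * Real.exp (-(N * F))) *
          Real.exp (N * F) := by gcongr
      _ = lam ^ k N * returnProb ν (k N) N * N := by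
        linear_combination (lam ^ k N * returnProb ν (k N) N * N) * hexp N
  · rw [toReal_partitionFn_zero hmeas hindep hident hl.le, pow_zero, one_mul, one_mul]
    have hq : ∀ n, ∑ i ∈ Finset.Icc 1 n, lam * exc ν i * Real.exp (-(i * F)) ≤ 1 := fun n => by
      rw [← h.hasSum.tsum_eq]
      have e : ∑ i ∈ Finset.Icc 1 n, lam * exc ν i * Real.exp (-(i * F)) =
          ∑ i ∈ Finset.range n, lam * exc ν (i + 1) * Real.exp (-((i + 1 : ℕ) * F)) := by
        rw [Finset.range_eq_Ico, Finset.sum_Ico_add'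
          (fun i : ℕ => lam * exc ν i * Real.exp (-(i * F))) 0 n 1]
        rfl
      rw [e]
      exact h.hasSum.summable.sum_le_tsum _ fun i _ => weight_nonneg hl _
    have e3 := sum_returnProb_le_one ν hl.le hq N
    rw [← Finset.sum_mul] at e3
    calc _ = (∑ j ∈ Finset.range (N + 1), lam ^ j * returnProb ν j N) * Real.exp (-(N * F)) *
          Real.exp (N * F) := by
            linear_combination (-(∑ j ∈ Finset.range (N + 1), lam ^ j * returnProb ν j N)) * hexp N
      _ ≤ 1 * Real.exp (N * F) := by gcongr
      _ = _ := one_mul _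

end

/-! ### The free energy in a well and the critical point -/

section

variable {ν : Measure ℤ} [IsProbabilityMeasure ν]

lemma prob_psum_le_neg_le {t : ℝ} (h0 : 0 ≤ t) (ht : t ∈ integrableExpSet castZ (ν.map Neg.neg))
    (n : ℕ) (d : ℝ) : (pathMeasure ν).real {ω | (psum n ω : ℝ) ≤ -d} ≤
      Real.exp (n * cgf castZ (ν.map Neg.neg) t - t * d) := by
  have hi : Integrable (fun y : ℤ => Real.exp (-t * y)) ν := (mem_integrableExpSet_neg_law t).1 ht
  refine (prob_psum_le_le ν h0 hi n (-d)).trans_eq ?_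
  have hpos : 0 < mgf castZ ν (-t) := mgf_pos hi
  have e : mgf (fun y : ℤ => (y : ℝ)) ν (-t) = Real.exp (cgf castZ (ν.map Neg.neg) t) := by
    rw [cgf_neg_law, cgf, Real.exp_log hpos]
  rw [e, ← Real.exp_nat_mul, ← Real.exp_add]
  congr 1
  ring

lemma prob_psum_eq_zero_le (d : ℤ) (N : ℕ) :
    (pathMeasure ν).real {ω | psum N ω = 0} ≤ noVisitProb ν d N +
      ∑ i ∈ Finset.range (N + 1), (pathMeasure ν).real {ω | (psum i ω : ℝ) ≤ -(d : ℝ)} := by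
  calc (pathMeasure ν).real {ω | psum N ω = 0}
      ≤ (pathMeasure ν).real ({ω | NoVisit d N ω} ∪
          ⋃ i ∈ Finset.range (N + 1), {ω | (psum i ω : ℝ) ≤ -(d : ℝ)}) := by
        refine measureReal_mono fun ω (hω : psum N ω = 0) => ?_
        by_cases h : ∃ i ≤ N, psum i ω ≤ -d
        · obtain ⟨i, hi, h⟩ := h
          refine Or.inr (Set.mem_biUnion (Finset.mem_coe.2 (Finset.mem_range.2 (by omega)) :
            i ∈ (Finset.range (N + 1) : Set ℕ)) ?_)
          show (psum i ω : ℝ) ≤ -(d : ℝ)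
          exact_mod_cast h
        · push Not at h
          exact Or.inl ⟨fun i hi => (h i hi).le, hω, fun i hi => (h i hi).ne'⟩
    _ ≤ _ := (measureReal_union_le _ _).trans
        (add_le_add le_rfl (measureReal_biUnion_finset_le _ _))

/-- Bridges of length `N` avoid the bottom of a well of depth `a N` with probability at least of
order `N ^ (-1 / 2)`. -/
lemma CenteredCramer.exists_le_noVisitProb (hν : CenteredCramer ν) {a : ℝ} (ha : 0 < a) :
    ∃ c, 0 < c ∧ ∀ᶠ N : ℕ in atTop, c / Real.sqrt N ≤ noVisitProb ν (depth a N) N := by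
  have hνn := isProbabilityMeasure_neg_law ν
  have hvar := hν.aperiodic.vari_pos hν.memLp
  have hA : FinDep 0 fun _ : ℕ → ℤ => True := FinDep.of_psum fun _ _ _ _ => trivial
  have hllt := tendsto_sqrt_mul_prob hν.aperiodic hvar hν.memLp hA tendsto_id
    (x := fun _ => 0) (z := 0) (by simp [hν.mean_zero])
  simp only [true_and, Set.ofPred_true, probReal_univ, one_mul, id] at hllt
  have hg := gaussDens_pos hvar 0
  -- With `Λ_-(t) < (a / 2) t`, reaching depth `aN` at a given time costs `exp(-a t N / 2)` up to a
  -- constant. Even summed over all times this is negligible against the probability `N ^ (-1 / 2)`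
  -- of a bridge.
  obtain ⟨t, ht, -, htm, hlt⟩ := hν.neg.exists_cgf_lt (half_pos ha) one_pos
  have hb : 0 < a * t / 2 := by positivity
  have hdecay : Tendsto (fun N : ℕ => Real.exp t * (Real.sqrt N * ((N + 1 : ℕ) *
      Real.exp (-(a * t / 2) * N)))) atTop (𝓝 0) := by
    have h1 := ((tendsto_rpow_mul_exp_neg_mul_atTop_nhds_zero 2 _ hb).comp
      tendsto_natCast_atTop_atTop).const_mul (Real.exp t * 2)
    rw [mul_zero] at h1
    refine tendsto_of_tendsto_of_tendsto_of_le_of_le' tendsto_const_nhds h1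
      (Eventually.of_forall fun N => by positivity) ?_
    filter_upwards [eventually_ge_atTop 1] with N hN
    have hN' : (1 : ℝ) ≤ N := by exact_mod_cast hN
    simp only [Function.comp_apply, Real.rpow_two]
    have e1 : Real.sqrt N ≤ N := by
      rw [Real.sqrt_le_left (by linarith)]
      nlinarith
    have e2 : ((N + 1 : ℕ) : ℝ) ≤ 2 * N := by push_cast; linarith
    calc _ ≤ Real.exp t * (N * (2 * N * Real.exp (-(a * t / 2) * N))) := by gcongr
      _ = _ := by ring
  refine ⟨gaussDens (vari ν) 0 / 4, by positivity, ?_⟩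
  filter_upwards [hllt.eventually (lt_mem_nhds (half_lt_self hg)),
    hdecay.eventually (gt_mem_nhds (by positivity : 0 < gaussDens (vari ν) 0 / 4)),
    eventually_gt_atTop 0] with N h1 h2 hN
  have hs : 0 < Real.sqrt N := Real.sqrt_pos.2 (by exact_mod_cast hN)
  have h3 := prob_psum_eq_zero_le (ν := ν) (depth a N) N
  have h4 : ∑ i ∈ Finset.range (N + 1),
      (pathMeasure ν).real {ω | (psum i ω : ℝ) ≤ -(depth a N : ℝ)} ≤
      (N + 1 : ℕ) * (Real.exp t * Real.exp (-(a * t / 2) * N)) := by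
    have h5 : ∀ i ∈ Finset.range (N + 1),
        (pathMeasure ν).real {ω | (psum i ω : ℝ) ≤ -(depth a N : ℝ)} ≤
        Real.exp t * Real.exp (-(a * t / 2) * N) := by
      intro i hi
      refine (prob_psum_le_neg_le ht.le (interior_subset htm) i _).trans ?_
      rw [← Real.exp_add]
      refine Real.exp_le_exp.2 ?_
      have e1 : a * N - 1 < depth a N := Int.sub_one_lt_floor _
      have e2 : (i : ℝ) ≤ N := by
        have := Finset.mem_range.1 hi
        exact_mod_cast Nat.lt_succ_iff.1 this
      have e3 := hν.neg.cgf_pos ht.ne' (interior_subset htm)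
      have e4 := mul_le_mul e2 hlt.le e3.le (Nat.cast_nonneg N)
      have e5 := mul_le_mul_of_nonneg_left e1.le ht.le
      linarith
    refine (Finset.sum_le_sum h5).trans_eq ?_
    simp
  rw [div_le_iff₀ hs]
  have h6 := mul_le_mul_of_nonneg_left (h3.trans (add_le_add le_rfl h4)) hs.le
  linarith

lemma pieceWeight_le_one (ν₁ Q ν₂ : Measure ℤ) [IsProbabilityMeasure ν₁] [IsProbabilityMeasure Q]
    [IsProbabilityMeasure ν₂] (d : ℤ) (N : ℕ) (x : ℕ × ℕ × ℕ) :
    pieceWeight ν₁ Q ν₂ d N x ≤ 1 := by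
  unfold pieceWeight
  split_ifs
  · exact mul_le_one₀ (mul_le_one₀ measureReal_le_one measureReal_nonneg measureReal_le_one)
      measureReal_nonneg measureReal_le_one
  · exact zero_le_one

lemma tripleWeight_mono {lam lam' : ℝ} (h0 : 0 ≤ lam) (h : lam ≤ lam') (d : ℤ) (N : ℕ)
    (x : ℕ × ℕ × ℕ) : tripleWeight ν lam d N x ≤ tripleWeight ν lam' d N x := by
  unfold tripleWeight
  split_ifs
  · exact mul_le_mul_of_nonneg_right (pow_le_pow_left₀ h0 h _) measureReal_nonneg
  · exact le_rfl

lemma card_triples_le (N : ℕ) : (triples N).card ≤ (N + 1) ^ 3 := by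
  refine (Finset.card_filter_le _ _).trans_eq ?_
  rw [Finset.card_product, Finset.card_product, Finset.card_range]
  ring

/-- The weights of the contact triples are bounded if the cost of reaching the bottom of the well
exceeds the free energy of the standard wetting model. -/
lemma Localized.tripleWeight_le {lam F tm tp a : ℝ} (h : Localized ν lam F)
    (h0m : 0 ≤ tm) (h0p : 0 ≤ tp) (hm : tm ∈ integrableExpSet castZ (ν.map Neg.neg))
    (hp : tp ∈ integrableExpSet castZ ν) (hmF : cgf castZ (ν.map Neg.neg) tm ≤ F)
    (hpF : cgf castZ ν tp ≤ F) (hF : F ≤ a * (tm + tp)) {N : ℕ} (hd : 1 ≤ depth a N)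
    (x : ℕ × ℕ × ℕ) :
    tripleWeight ν lam (depth a N) N x ≤ lam * Real.exp (tm + tp) := by
  have hl := h.lam_pos
  unfold tripleWeight
  split_ifs with hx
  · have hνn := isProbabilityMeasure_neg_law ν
    have hQ := isProbabilityMeasure_renewalLaw hl h.hasSum
    have h1 := isProbabilityMeasure_tiltStep hm
    have h2 := isProbabilityMeasure_tiltStep hp
    obtain ⟨l, r, k⟩ := x
    simp only
    rw [h.tripleWeight_eq hm hp hd hx]
    refine (mul_le_of_le_one_right (by positivity) (pieceWeight_le_one _ _ _ _ _ _)).trans ?_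
    rw [mem_triples] at hx
    simp only at hx
    have e1 : a * N - 1 < depth a N := Int.sub_one_lt_floor _
    have e2 := mul_le_mul_of_nonneg_left e1.le (add_nonneg h0m h0p)
    have e3 : ((N - r : ℕ) : ℝ) = N - r := Nat.cast_sub hx.2.1
    have e4 := mul_le_mul_of_nonneg_left hmF (Nat.cast_nonneg (α := ℝ) l)
    have e5 := mul_le_mul_of_nonneg_left hpF (Nat.cast_nonneg (α := ℝ) (N - r))
    have e6 := mul_le_mul_of_nonneg_left hF (Nat.cast_nonneg (α := ℝ) N)
    rw [e3] at e5
    gcongr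
    linarith
  · positivity

end

section

variable {Ω : Type*} [MeasurableSpace Ω] {P : Measure Ω} {X : ℕ → Ω → ℤ} [IsProbabilityMeasure P]
  (hmeas : ∀ i, Measurable (X i)) (hindep : iIndepFun X P)
  (hident : ∀ i, IdentDistrib (X i) (X 0) P P)
include hmeas hindep hident

/-- The partition function lies between the weight of bridges without contact, of order at least `N
^ (-1 / 2)`, and a polynomial number of bounded terms. Monotonicity in the pinning parameter extends
the upper bound to all `lam' ≤ lam`. -/
lemma Localized.freeEnergy_eq_zero {lam lam' F tm tp a : ℝ} (h : Localized (P.map (X 0)) lam F)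
    (h0m : 0 ≤ tm) (h0p : 0 ≤ tp)
    (hm : tm ∈ integrableExpSet castZ ((P.map (X 0)).map Neg.neg))
    (hp : tp ∈ integrableExpSet castZ (P.map (X 0)))
    (hmF : cgf castZ ((P.map (X 0)).map Neg.neg) tm ≤ F)
    (hpF : cgf castZ (P.map (X 0)) tp ≤ F) (hF : F ≤ a * (tm + tp)) (ha : 0 < a)
    (h0 : 0 ≤ lam') (hle : lam' ≤ lam) : freeEnergy P X a lam' = 0 := by
  have hν : IsProbabilityMeasure (P.map (X 0)) :=
    Measure.isProbabilityMeasure_map (hmeas 0).aemeasurable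
  have hl := h.lam_pos
  refine Tendsto.limUnder_eq ?_
  obtain ⟨c, hc, hlow⟩ := h.cramer.exists_le_noVisitProb ha
  have hd : ∀ᶠ N : ℕ in atTop, 1 ≤ depth a N := by
    filter_upwards [(tendsto_natCast_atTop_atTop.const_mul_atTop ha).eventually_ge_atTop 1]
      with N hN
    rw [depth, Int.le_floor]
    exact_mod_cast hN
  refine tendsto_log_div hc (C := 1 + 8 * (lam * Real.exp (tm + tp))) (by positivity) 3 ?_ ?_
  · filter_upwards [hlow, hd, eventually_ge_atTop 1] with N hN hdN hN1
    rw [toReal_partitionFn hmeas hindep hident hdN h0, mul_zero, Real.exp_zero, mul_one]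
    have hNR : (1 : ℝ) ≤ N := by exact_mod_cast hN1
    have hs : 0 < Real.sqrt N := Real.sqrt_pos.2 (by linarith)
    have e0 : Real.sqrt N ≤ N := by
      rw [Real.sqrt_le_left (by linarith)]
      nlinarith
    calc c / N ≤ c / Real.sqrt N := by gcongr
      _ ≤ _ := hN
      _ ≤ _ := le_add_of_nonneg_right (Finset.sum_nonneg fun x _ => tripleWeight_nonneg h0 _ _ _ _)
  · filter_upwards [hd, eventually_ge_atTop 1] with N hdN hN1
    rw [toReal_partitionFn hmeas hindep hident hdN h0, mul_zero, Real.exp_zero, mul_one]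
    have hNR : (1 : ℝ) ≤ N := by exact_mod_cast hN1
    have e1 : ∑ x ∈ triples N, tripleWeight (P.map (X 0)) lam' (depth a N) N x ≤
        (N + 1) ^ 3 * (lam * Real.exp (tm + tp)) := by
      calc _ ≤ ∑ x ∈ triples N, lam * Real.exp (tm + tp) := Finset.sum_le_sum fun x _ =>
            (tripleWeight_mono h0 hle _ _ _).trans
              (h.tripleWeight_le h0m h0p hm hp hmF hpF hF hdN x)
        _ = (triples N).card * (lam * Real.exp (tm + tp)) := by
            rw [Finset.sum_const, nsmul_eq_mul]
        _ ≤ _ := by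
            gcongr
            exact_mod_cast card_triples_le N
    have e2 : ((N : ℝ) + 1) ^ 3 ≤ 8 * N ^ 3 := by
      calc ((N : ℝ) + 1) ^ 3 ≤ (2 * N) ^ 3 := by gcongr; linarith
        _ = _ := by ring
    have e3 : noVisitProb (P.map (X 0)) (depth a N) N ≤ 1 := measureReal_le_one
    have e4 : (1 : ℝ) ≤ (N : ℝ) ^ 3 := one_le_pow₀ hNR
    have e5 := mul_le_mul_of_nonneg_right e2
      (by positivity : 0 ≤ lam * Real.exp (tm + tp))
    calc _ ≤ 1 + 8 * (N : ℝ) ^ 3 * (lam * Real.exp (tm + tp)) := by linarith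
      _ ≤ _ := by linarith

lemma Localized.le_criticalPoint {lam F tm tp a : ℝ} (h : Localized (P.map (X 0)) lam F)
    (h0m : 0 ≤ tm) (h0p : 0 ≤ tp)
    (hm : tm ∈ integrableExpSet castZ ((P.map (X 0)).map Neg.neg))
    (hp : tp ∈ integrableExpSet castZ (P.map (X 0)))
    (hmF : cgf castZ ((P.map (X 0)).map Neg.neg) tm ≤ F)
    (hpF : cgf castZ (P.map (X 0)) tp ≤ F) (hF : F ≤ a * (tm + tp)) (ha : 0 < a) :
    (lam : EReal) ≤ criticalPoint P X a := by
  refine le_sInf ?_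
  rintro _ ⟨lam', rfl, h0, hpos⟩
  by_contra! hcon
  rw [EReal.coe_lt_coe_iff] at hcon
  rw [h.freeEnergy_eq_zero hmeas hindep hident h0m h0p hm hp hmF hpF hF ha h0.le hcon.le] at hpos
  exact lt_irrefl _ hpos

/-- Above the critical point of the well, the standard wetting model is localized. -/
lemma exists_localized_of_criticalPoint_le (hν : CenteredCramer (P.map (X 0))) {lam a : ℝ}
    (ha : 0 < a) (hlam : 0 < lam) (hcrit : criticalPoint P X a ≤ lam) :
    ∃ F, Localized (P.map (X 0)) lam F := by
  have hνP : IsProbabilityMeasure (P.map (X 0)) :=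
    Measure.isProbabilityMeasure_map (hmeas 0).aemeasurable
  refine hν.exists_localized hlam ?_
  by_contra! hcon
  have hνn := isProbabilityMeasure_neg_law (P.map (X 0))
  -- If the standard model were not localized, the value `Λ_-(t) < a t` would be a free energy at a
  -- parameter larger than `lam`. Its cost condition holds with the right tilt equal to zero, so the
  -- critical point would exceed `lam`.
  obtain ⟨t, ht, -, htm, hlt⟩ := hν.neg.exists_cgf_lt ha one_pos
  have hF := hν.neg.cgf_pos ht.ne' (interior_subset htm)
  have h := hν.localized hF
  have h1 := h.le_criticalPoint hmeas hindep hident ht.le le_rfl (interior_subset htm)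
    (interior_subset hν.zero_mem) le_rfl (by rw [cgf_zero]; exact hF.le)
    (by rw [add_zero]; exact hlt.le) ha
  have h2 := h1.trans hcrit
  rw [EReal.coe_le_coe_iff] at h2
  have h3 := hν.strictAntiOn_excLaplace Set.self_mem_Ici (Set.mem_Ici.2 hF.le) hF
  have h4 := h.mul_excLaplace
  have h5 := mul_le_mul_of_nonneg_right h2 (hν.excLaplace_pos hF.le).le
  have h6 := mul_lt_mul_of_pos_left h3 hlam
  linarith

/-- Above the critical point, the free energy exceeds the cost of reaching the bottom of the
well. -/
lemma WellTilt.mul_le_of_criticalPoint_le {lam F tm tp a : ℝ}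
    (hw : WellTilt (P.map (X 0)) F tm tp) (h : Localized (P.map (X 0)) lam F) (ha : 0 < a)
    (hcrit : criticalPoint P X a ≤ lam) : a * (tm + tp) ≤ F := by
  have hνP : IsProbabilityMeasure (P.map (X 0)) :=
    Measure.isProbabilityMeasure_map (hmeas 0).aemeasurable
  by_contra! hcon
  have hν := h.cramer
  -- The parameter whose free energy is exactly `a (tm + tp)` is larger than `lam`, and the well is
  -- still delocalized there, which contradicts `hcrit`.
  have hF' : 0 < a * (tm + tp) := h.F_pos.trans hcon
  have h' := hν.localized hF'
  have h1 := h'.le_criticalPoint hmeas hindep hident hw.tm_pos.le hw.tp_pos.le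
    (interior_subset hw.tm_mem) (interior_subset hw.tp_mem) (hw.tm_eq.trans_le hcon.le)
    (hw.tp_eq.trans_le hcon.le) le_rfl ha
  have h2 := h1.trans hcrit
  rw [EReal.coe_le_coe_iff] at h2
  have h3 := hν.strictAntiOn_excLaplace (Set.mem_Ici.2 h.F_pos.le) (Set.mem_Ici.2 hF'.le) hcon
  have h4 := h'.mul_excLaplace
  have h5 := mul_le_mul_of_nonneg_right h2 (hν.excLaplace_pos hF'.le).le
  have h6 := mul_lt_mul_of_pos_left h3 h.lam_pos
  have h7 := h.mul_excLaplace
  linarith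

/-- Below the saturation point, the free energy is attained by the log-moment generating
function. -/
lemma Localized.exists_cgf_eq {lam F : ℝ} (h : Localized (P.map (X 0)) lam F) {Y : Ω → ℝ}
    {ν' : Measure ℤ} [IsProbabilityMeasure ν'] (hν' : CenteredCramer ν')
    (hY : logMGF P Y = logMGF ν' castZ) (hsat : (lam : EReal) < saturationPoint P X Y) :
    ∃ t, 0 < t ∧ t ∈ interior (integrableExpSet castZ ν') ∧ cgf castZ ν' t = F := by
  have hνP : IsProbabilityMeasure (P.map (X 0)) :=
    Measure.isProbabilityMeasure_map (hmeas 0).aemeasurable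
  rcases hν'.exists_root_or h.F_pos with hroot | ⟨R, hR, hRm, hrad, hpos, hle⟩
  · exact hroot
  · exfalso
    -- The parameter with free energy `Λ(R)` belongs to the set defining the saturation point, and
    -- it is at most `lam` because `Λ(R) ≤ F`.
    have h' := h.cramer.localized hpos
    have hmem : saturationPoint P X Y ≤
        ((excLaplace (P.map (X 0)) (cgf castZ ν' R))⁻¹ : ℝ) := by
      refine sInf_le ⟨_, rfl, h'.lam_pos, ?_, ?_, ?_⟩
      · rw [radius_congr hY, hrad]; exact_mod_cast hR
      · rw [radius_congr hY, hrad]; exact EReal.coe_lt_top _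
      · rw [h'.freeEnergy_eq hmeas hindep hident, radius_congr hY, hrad, hY, EReal.toReal_coe,
          logMGF_of_mem hRm]
    have h2 := hsat.trans_le hmem
    rw [EReal.coe_lt_coe_iff] at h2
    have h3 := h.cramer.strictAntiOn_excLaplace.antitoneOn (Set.mem_Ici.2 hpos.le)
      (Set.mem_Ici.2 h.F_pos.le) hle
    have h4 := h'.mul_excLaplace
    have h5 := mul_lt_mul_of_pos_right h2 (h.cramer.excLaplace_pos hpos.le)
    have h6 := mul_le_mul_of_nonneg_left h3 h.lam_pos.le
    have h7 := h.mul_excLaplace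
    linarith

end

/-- The two unconstrained pieces do not fill the whole time interval. -/
lemma WellTilt.lt {ν : Measure ℤ} [IsProbabilityMeasure ν] {F tm tp a : ℝ}
    (hw : WellTilt ν F tm tp) (hν : CenteredCramer ν) (ha : 0 < a) (hF : a * (tm + tp) ≤ F) :
    a / deriv (cgf castZ (ν.map Neg.neg)) tm < 1 - a / deriv (cgf castZ ν) tp := by
  have hνn := isProbabilityMeasure_neg_law ν
  have h1 := hν.neg.cgf_lt_mul_deriv hw.tm_pos hw.tm_mem
  have h2 := hν.cgf_lt_mul_deriv hw.tp_pos hw.tp_mem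
  have h3 := hν.neg.deriv_cgf_pos hw.tm_pos hw.tm_mem
  have h4 := hν.deriv_cgf_pos hw.tp_pos hw.tp_mem
  have hm := hw.tm_pos
  have hp := hw.tp_pos
  rw [hw.tm_eq] at h1
  rw [hw.tp_eq] at h2
  have hF0 : 0 < F := lt_of_lt_of_le (by positivity) hF
  -- From `F < t Λ'(t)` one gets `a / Λ'(t) < a t / F`; the two fractions on the right add up to at
  -- most one because `a (tm + tp) ≤ F`.
  have e1 : a / deriv (cgf castZ (ν.map Neg.neg)) tm < a * tm / F := by
    rw [div_lt_div_iff₀ h3 hF0]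
    nlinarith
  have e2 : a / deriv (cgf castZ ν) tp < a * tp / F := by
    rw [div_lt_div_iff₀ h4 hF0]
    nlinarith
  have e3 : a * tm / F + a * tp / F ≤ 1 := by
    rw [← add_div, div_le_one hF0]; linarith
  linarith

/-! ### The constants of the limit theorem -/

section

variable {Ω : Type*} [MeasurableSpace Ω] {P : Measure Ω} {X : ℕ → Ω → ℤ} [IsProbabilityMeasure P]

lemma centeredCramer_map (hX : Measurable (X 0))
    (hcramer : ∃ t₀ : ℝ, 0 < t₀ ∧ ∀ t : ℝ, |t| < t₀ →
      Integrable (fun ω => Real.exp (t * (X 0 ω : ℝ))) P)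
    (hmean : ∫ ω, (X 0 ω : ℝ) ∂P = 0)
    (haper : ∀ h : ℕ, 2 ≤ h → ∀ b : ℤ, ¬ ∀ᵐ ω ∂P, (h : ℤ) ∣ X 0 ω - b) :
    CenteredCramer (P.map (X 0)) where
  aperiodic := by
    intro h hh b hcon
    rw [ae_map_iff hX.aemeasurable MeasurableSet.of_discrete] at hcon
    exact haper h hh b hcon
  zero_mem := by
    obtain ⟨t₀, ht₀, hi⟩ := hcramer
    refine mem_interior.2 ⟨Set.Ioo (-t₀) t₀, fun t ht => ?_, isOpen_Ioo, by simpa using ht₀⟩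
    show Integrable _ _
    rw [integrable_map_measure Measurable.of_discrete.aestronglyMeasurable hX.aemeasurable]
    exact hi t (abs_lt.2 ht)
  mean_zero := by
    rw [mean, integral_map hX.aemeasurable Measurable.of_discrete.aestronglyMeasurable]
    exact hmean

section

variable {lam F tm tp a : ℝ} (hmeas : ∀ i, Measurable (X i)) (hindep : iIndepFun X P)
  (hident : ∀ i, IdentDistrib (X i) (X 0) P P) (h : Localized (P.map (X 0)) lam F)
include hmeas hindep hident h

/-- The constant `κ` cancels against the normalization of `K`, its positivity making the division
legitimate. -/
lemma Localized.tiltedLaw_eq (n : ℕ) :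
    tiltedLaw P X lam (n + 1) =
      lam * exc (P.map (X 0)) (n + 1) * Real.exp (-((n + 1 : ℕ) * F)) := by
  have hνP : IsProbabilityMeasure (P.map (X 0)) :=
    Measure.isProbabilityMeasure_map (hmeas 0).aemeasurable
  have h1 : ∀ n, excursionProb P X n = exc (P.map (X 0)) n := fun n => by
    rw [excursionProb, exc, measureReal_def, measureReal_def,
      ← measure_steps hmeas hindep hident (finDep_isExcursion n)]
    congr 2
    ext ω
    simp only [Set.mem_ofPred_eq, Finset.mem_Ico, IsExcursion, walk_eq_psum, and_imp]
  have h2 : kappa P X = excLaplace (P.map (X 0)) 0 := by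
    rw [excLaplace_zero, kappa]
    simp_rw [h1]
  have h3 := h.cramer.excLaplace_pos le_rfl
  rw [tiltedLaw, interArrival, h1, h2, h.freeEnergy_eq hmeas hindep hident, neg_mul]
  field_simp

lemma Localized.tiltedMean_eq :
    tiltedMean P X lam = mean (renewalLaw (P.map (X 0)) lam F) := by
  have hνP : IsProbabilityMeasure (P.map (X 0)) :=
    Measure.isProbabilityMeasure_map (hmeas 0).aemeasurable
  have hQ := isProbabilityMeasure_renewalLaw h.lam_pos h.hasSum
  rw [mean, integral_renewalLaw h.lam_pos
    ((memLp_renewalLaw h.lam_pos h.hasSum h.F_pos).integrable one_le_two), tiltedMean]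
  simp_rw [h.tiltedLaw_eq hmeas hindep hident, Int.cast_natCast]

lemma Localized.tiltedVar_eq :
    tiltedVar P X lam = vari (renewalLaw (P.map (X 0)) lam F) := by
  have hνP : IsProbabilityMeasure (P.map (X 0)) :=
    Measure.isProbabilityMeasure_map (hmeas 0).aemeasurable
  have hQ := isProbabilityMeasure_renewalLaw h.lam_pos h.hasSum
  have h2 := memLp_renewalLaw h.lam_pos h.hasSum h.F_pos
  rw [vari, variance_eq_integral Measurable.of_discrete.aemeasurable]
  have hi := (h2.sub (memLp_const (mean (renewalLaw (P.map (X 0)) lam F)))).integrable_sq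
  have h3 := integral_renewalLaw h.lam_pos hi
  refine Eq.trans ?_ h3.symm
  rw [tiltedVar, h.tiltedMean_eq hmeas hindep hident]
  simp_rw [h.tiltedLaw_eq hmeas hindep hident]
  simp

lemma Localized.slope_eq {Y : Ω → ℝ} {ν' : Measure ℤ} [IsProbabilityMeasure ν']
    (hν' : CenteredCramer ν') (hY : logMGF P Y = logMGF ν' castZ) {t : ℝ} (h0 : 0 < t)
    (ht : t ∈ interior (integrableExpSet castZ ν')) (hF : cgf castZ ν' t = F) :
    slope P Y (freeEnergy P X 0 lam) = mean (tiltStep ν' t) := by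
  rw [h.freeEnergy_eq hmeas hindep hident, slope_congr hY, ← hF, hν'.slope_eq h0 ht,
    mean_tiltStep ht]

omit hmeas hindep hident h in
lemma rateFnSecond_mean_tiltStep {Y : Ω → ℝ} {ν' : Measure ℤ} [IsProbabilityMeasure ν']
    (hν' : CenteredCramer ν') (hY : logMGF P Y = logMGF ν' castZ) {t : ℝ} (h0 : 0 < t)
    (ht : t ∈ interior (integrableExpSet castZ ν')) :
    rateFnSecond P Y (mean (tiltStep ν' t)) = (vari (tiltStep ν' t))⁻¹ := by
  rw [rateFnSecond_congr hY, mean_tiltStep ht, hν'.rateFnSecond_eq h0 ht, vari_tiltStep ht]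

end

end

/-- Here `μ = Λ'(t)`, `s = Λ''(t)` and `s⁻¹ = I''(μ)`, so that `u³ / (a² I''(a / u))` with `u = a /
μ` is the variance produced by `gaussDens_scale`. -/
lemma sqrt_sigma_eq {a μ s : ℝ} (ha : 0 < a) (hμ : 0 < μ) :
    Real.sqrt ((a / μ) ^ 3 / (a ^ 2 * s⁻¹)) = Real.sqrt (a / μ * s / μ ^ 2) := by
  congr 1
  rw [div_mul_eq_div_div, div_inv_eq_mul]
  field_simp

lemma two_pi_mul_rpow (N : ℕ) : (2 * Real.pi * N) ^ (3 / 2 : ℝ) =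
    (2 * Real.pi) ^ (3 / 2 : ℝ) * Real.sqrt N ^ 3 := by
  rw [Real.mul_rpow (by positivity) (by positivity), Real.sqrt_eq_rpow, ← Real.rpow_natCast,
    ← Real.rpow_mul (by positivity)]
  norm_num

end WettingWell

end

theorem corollary3p13 {Ω : Type*} [MeasurableSpace Ω] (P : Measure Ω) [IsProbabilityMeasure P]
    (X : ℕ → Ω → ℤ) (hmeas : ∀ i, Measurable (X i)) (hindep : iIndepFun X P)
    (hident : ∀ i, IdentDistrib (X i) (X 0) P P)
    -- Cramér's condition
    (hcramer : ∃ t₀ : ℝ, 0 < t₀ ∧ ∀ t : ℝ, |t| < t₀ →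
      Integrable (fun ω => Real.exp (t * (X 0 ω : ℝ))) P)
    -- the walk is centered
    (hmean : ∫ ω, (X 0 ω : ℝ) ∂P = 0)
    -- the walk is aperiodic: no coset of a proper subgroup of `ℤ` carries the law of `X_1`
    (haper : ∀ h : ℕ, 2 ≤ h → ∀ b : ℤ, ¬ ∀ᵐ ω ∂P, (h : ℤ) ∣ X 0 ω - b)
    (a lam : ℝ) (ha : 0 < a) (hlam : 0 < lam)
    (hcrit : WettingWell.criticalPoint P X a ≤ (lam : EReal))
    (hsat : (lam : EReal) < min (WettingWell.saturationPoint P X (WettingWell.incPos X))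
      (WettingWell.saturationPoint P X (WettingWell.incNeg X))) :
    let u := WettingWell.uStar P X a lam
    let v := WettingWell.vStar P X a lam
    let m := WettingWell.tiltedMean P X lam
    let s₁ := WettingWell.sigma1 P X a lam
    let s₂ := WettingWell.sigma2 P X a lam
    let s₃ := WettingWell.sigma3 P X a lam
    let c := m⁻¹ * (v - u)
    let G := WettingWell.gibbs P X a lam
    let μ := WettingWell.limitLaw s₁ s₂ s₃ m
    -- the constants are well defined and nondegenerate
    (0 < u ∧ u < v ∧ v < 1 ∧ 0 < m ∧ 0 < s₁ ∧ 0 < s₂ ∧ 0 < s₃) ∧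
    -- the limit is a Gaussian vector, and `Z_3` is Gaussian but not independent of `(Z_1, Z_2)`
    IsGaussian μ ∧
    (∃ w : ℝ≥0, 0 < w ∧ μ.map (fun z => z.2.2) = gaussianReal 0 w) ∧
    (¬ IndepFun (fun z : ℝ × ℝ × ℝ => z.2.2) (fun z : ℝ × ℝ × ℝ => (z.1, z.2.1)) μ) ∧
    -- joint convergence in distribution under the Gibbs measures
    (∀ᶠ N : ℕ in atTop, IsProbabilityMeasure (G N)) ∧
    Tendsto (fun N : ℕ => G N {ω | WettingWell.contactTimes X a N ω = ∅}) atTop (𝓝 0) ∧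
    (∀ φ : (ℝ × ℝ × ℝ) →ᵇ ℝ,
      Tendsto (fun N : ℕ => ∫ ω, φ (WettingWell.rescaledVector X a u v c N ω) ∂(G N)) atTop
        (𝓝 (∫ z, φ z ∂μ))) ∧
    -- local version, uniformly over windows of size `A √N`
    (∀ A : ℝ, 0 < A → ∀ ε : ℝ, 0 < ε → ∀ᶠ N : ℕ in atTop, ∀ l r k : ℕ,
      |(l : ℝ) - u * N| ≤ A * Real.sqrt N → |(r : ℝ) - v * N| ≤ A * Real.sqrt N →
      |(k : ℝ) - c * N| ≤ A * Real.sqrt N →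
      |(G N).real {ω | WettingWell.leftContact X a N ω = (l : ℕ∞) ∧
            WettingWell.rightContact X a N ω = (r : ℕ∞) ∧ WettingWell.numContacts X a N ω = k} /
          (1 / ((2 * Real.pi * N) ^ (3 / 2 : ℝ) * s₁ * s₂ * s₃) *
            Real.exp (-(1 / 2) * WettingWell.quadForm s₁ s₂ s₃ m
              (WettingWell.rescale u v c N l r k))) - 1| ≤ ε) := by
  have hνP : IsProbabilityMeasure (P.map (X 0)) :=
    Measure.isProbabilityMeasure_map (hmeas 0).aemeasurable
  have hν := WettingWell.centeredCramer_map (hmeas 0) hcramer hmean haper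
  have hνn := WettingWell.isProbabilityMeasure_neg_law (P.map (X 0))
  have hYp := WettingWell.logMGF_incPos (P := P) (hmeas 0)
  have hYm := WettingWell.logMGF_incNeg (P := P) (hmeas 0)
  obtain ⟨F, h⟩ := WettingWell.exists_localized_of_criticalPoint_le hmeas hindep hident hν ha hlam
    hcrit
  obtain ⟨tp, htp, htpm, htpF⟩ := h.exists_cgf_eq hmeas hindep hident hν hYp
    (hsat.trans_le (min_le_left _ _))
  obtain ⟨tm, htm, htmm, htmF⟩ := h.exists_cgf_eq hmeas hindep hident hν.neg hYm
    (hsat.trans_le (min_le_right _ _))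
  have hw : WettingWell.WellTilt (P.map (X 0)) F tm tp := ⟨htm, htp, htmm, htpm, htmF, htpF⟩
  have hF := hw.mul_le_of_criticalPoint_le hmeas hindep hident h ha hcrit
  have hlt := hw.lt hν ha hF
  have hQ := WettingWell.isProbabilityMeasure_renewalLaw h.lam_pos h.hasSum
  have hν₁ := WettingWell.isProbabilityMeasure_tiltStep (interior_subset htmm)
  have hν₂ := WettingWell.isProbabilityMeasure_tiltStep (interior_subset htpm)
  have hG := hw.gibbsPieces h ha hlt hF
  have hp := hG.pieces
  set Q := WettingWell.renewalLaw (P.map (X 0)) lam F with hQd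
  set ν₁ := WettingWell.tiltStep ((P.map (X 0)).map Neg.neg) tm with hν₁d
  set ν₂ := WettingWell.tiltStep (P.map (X 0)) tp with hν₂d
  have hμ₁ := hp.left.mean_pos
  have hμ₂ := hp.right.mean_pos
  have hm := hp.one_le_mean
  obtain ⟨hσ₁, hσ₂, hσ₃⟩ := hp.sigma_pos
  intro u v m s₁ s₂ s₃ c G μ
  have hu : u = a / WettingWell.mean ν₁ :=
    congrArg (a / ·) (h.slope_eq hmeas hindep hident hν.neg hYm htm htmm htmF)
  have hv : v = 1 - a / WettingWell.mean ν₂ :=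
    congrArg (1 - a / ·) (h.slope_eq hmeas hindep hident hν hYp htp htpm htpF)
  have hmQ : m = WettingWell.mean Q := h.tiltedMean_eq hmeas hindep hident
  have hs₁ : s₁ = Real.sqrt (a / WettingWell.mean ν₁ * WettingWell.vari ν₁ /
      WettingWell.mean ν₁ ^ 2) := by
    -- The point `a / u` is the tilted mean `Λ_-'(tm)`, exactly where duality evaluates the second
    -- derivative of the rate function.
    show Real.sqrt (u ^ 3 / (a ^ 2 * WettingWell.rateFnSecond P (WettingWell.incNeg X) (a / u))) = _
    rw [hu, div_div_cancel₀ ha.ne', WettingWell.rateFnSecond_mean_tiltStep hν.neg hYm htm htmm,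
      WettingWell.sqrt_sigma_eq ha hμ₁]
  have hs₂ : s₂ = Real.sqrt (a / WettingWell.mean ν₂ * WettingWell.vari ν₂ /
      WettingWell.mean ν₂ ^ 2) := by
    show Real.sqrt ((1 - v) ^ 3 /
      (a ^ 2 * WettingWell.rateFnSecond P (WettingWell.incPos X) (a / (1 - v)))) = _
    rw [hv, sub_sub_cancel, div_div_cancel₀ ha.ne',
      WettingWell.rateFnSecond_mean_tiltStep hν hYp htp htpm, WettingWell.sqrt_sigma_eq ha hμ₂]
  have hs₃ : s₃ = Real.sqrt ((WettingWell.mean Q)⁻¹ *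
      (1 - a / WettingWell.mean ν₂ - a / WettingWell.mean ν₁) * WettingWell.vari Q /
      WettingWell.mean Q ^ 2) := by
    show Real.sqrt ((v - u) * WettingWell.tiltedVar P X lam / m ^ 3) = _
    rw [hv, hu, hmQ, h.tiltedVar_eq hmeas hindep hident, ← hQd]
    congr 1
    field_simp
  have hc : c = (WettingWell.mean Q)⁻¹ *
      (1 - a / WettingWell.mean ν₂ - a / WettingWell.mean ν₁) := by
    show m⁻¹ * (v - u) = _
    rw [hmQ, hv, hu]
  have hμ : μ = WettingWell.pieceLaw ν₁ Q ν₂ a := by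
    show WettingWell.limitLaw s₁ s₂ s₃ m = _
    rw [hs₁, hs₂, hs₃, hmQ, WettingWell.pieceLaw]
  rw [hμ, hc, hs₁, hs₂, hs₃, hmQ, hu, hv]
  have hr₁ := Real.sqrt_pos.2 hσ₁
  have hr₂ := Real.sqrt_pos.2 hσ₂
  have hr₃ := Real.sqrt_pos.2 hσ₃
  have hm0 : 0 < WettingWell.mean Q := by linarith
  refine ⟨⟨by positivity, hp.lt, sub_lt_self _ (by positivity), hm0, hr₁, hr₂, hr₃⟩,
    hp.isGaussian, WettingWell.exists_map_limitLaw_eq hr₁ hr₂ hr₃ _ hm0,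
    WettingWell.not_indepFun_limitLaw hr₁ hr₂ hr₃ _ hm0,
    hG.isProbabilityMeasure hmeas hindep hident, hG.tendsto_noContact hmeas hindep hident,
    hG.tendsto_integral hmeas hindep hident, fun A hA ε hε => ?_⟩
  filter_upwards [hG.local_limit hmeas hindep hident A ε hε, eventually_gt_atTop 0]
    with N hN hN0 l r k hl hr hk
  have hs : 0 < Real.sqrt N := Real.sqrt_pos.2 (by exact_mod_cast hN0)
  have hnorm : ∀ x : ℝ, |x| ≤ A * Real.sqrt N → ‖x / Real.sqrt N‖ ≤ A := fun x hx => by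
    rwa [Real.norm_eq_abs, abs_div, abs_of_pos hs, div_le_iff₀ hs]
  have hmain := hN (l, r, k) (max_le (hnorm _ hl) (max_le (hnorm _ hr) (hnorm _ hk)))
  -- Dividing by the limiting total mass leaves the normalized Gaussian density; only the factor `√N
  -- ^ 3` has to be moved into `(2 π N) ^ (3 / 2)`.
  rw [hp.limit_eq, mul_div_cancel_left₀ _ hp.const_pos.ne'] at hmain
  convert hmain using 4
  · rfl
  · have hdens : ∀ p q x y z e : ℝ, 1 / (p * q * x * y * z) * e = 1 / (p * x * y * z) * e / q := by
      intros
      ring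
    rw [WettingWell.two_pi_mul_rpow]
    exact hdens _ _ _ _ _ _
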